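/- A \emph{polyomino} is a finite non-empty set $P\subset\mathbb Z^2$ of $N$ grid points (\emph{tiles}: unit squares centred at these points) whose induced grid graph $G_P$ is connected; it is \emph{simple} (hole-free) if the grid graph induced by $\mathbb Z^2\setminus P$ is connected. It is \emph{$x$-monotone} (\emph{$y$-monotone}) if its intersection with every vertical (horizontal) line is connected, \emph{monotone} if it is $x$-monotone or $y$-monotone, and \emph{convex} if it is both. A tile $t\in P$ is \emph{locally reflex} if some $2\times2$ square of cells contains exactly $t$ and its two neighbours in that square, and not the fourth cell. A \emph{cut} of $P$ is a simple orthogonal lattice curve running along sides of tiles, with both ends not in the interior of $P$. A \emph{2-cut} is a cut that splits $P$ into exactly two subpolyominoes, and it is \emph{valid} if these two can be moved infinitely far apart, one in direction $v$ and the other in direction $-v$ for some $v\in\{(\pm1,0),(0,\pm1)\}$, without blocking each other, that is, without ever overlapping. $P$ is \emph{2-cuttable} if it can be subdivided into monotone polyominoes by successive valid 2-cuts. \textbf{Theorem.} There is an algorithm (a program for a word RAM) and a constant $C$ such that, for every simple, non-convex, 2-cuttable polyomino $P$ with $N$ tiles, $r$ of which are locally reflex, given as a list of its tiles in arbitrary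 order, the algorithm outputs a valid (not necessarily straight) 2-cut of $P$, as the list of the lattice points it visits, after at most $C\,r^2N\log N$ steps. Here a word holds $O(\log(N+M))$ bits, where $M$ bounds the absolute values of the coordinates of the tiles, and each register or memory access, arithmetic operation, comparison, assignment and test costs one step. -/

import Mathlib

/-! ### Polyominoes -/

namespace Polyomino

/-- The grid graph on `ℤ²`: two points are adjacent iff they are at unit distance. -/
def gridGraph : SimpleGraph (ℤ × ℤ) where
  Adj p q := |p.1 - q.1| + |p.2 - q.2| = 1
  symm := ⟨fun p q h => by rw [abs_sub_comm q.1, abs_sub_comm q.2]; exact h⟩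
  loopless := ⟨fun p h => by simp at h⟩

/-- A finite set of grid points (tiles, i.e. unit squares centred at these points) is a polyomino
if its induced grid graph is connected (in particular it is non-empty). -/
def IsPolyomino (P : Finset (ℤ × ℤ)) : Prop :=
  (gridGraph.induce (P : Set (ℤ × ℤ))).Connected

/-- Hole-free: the grid graph induced by the complement is connected. -/
def IsSimple (P : Finset (ℤ × ℤ)) : Prop :=
  (gridGraph.induce (P : Set (ℤ × ℤ))ᶜ).Connected

/-- Column convex, i.e. `x`-monotone. -/
def ColumnConvex (P : Finset (ℤ × ℤ)) : Prop :=
  ∀ x y₁ y y₂ : ℤ, (x, y₁) ∈ P → (x, y₂) ∈ P → y₁ ≤ y → y ≤ y₂ → (x, y) ∈ P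

/-- Row convex, i.e. `y`-monotone. -/
def RowConvex (P : Finset (ℤ × ℤ)) : Prop :=
  ∀ y x₁ x x₂ : ℤ, (x₁, y) ∈ P → (x₂, y) ∈ P → x₁ ≤ x → x ≤ x₂ → (x, y) ∈ P

/-- Monotone: `x`-monotone or `y`-monotone. -/
def IsMonotone (P : Finset (ℤ × ℤ)) : Prop :=
  ColumnConvex P ∨ RowConvex P

/-- Orthogonally convex: column convex and row convex. -/
def IsConvex (P : Finset (ℤ × ℤ)) : Prop :=
  ColumnConvex P ∧ RowConvex P

/-- The tile `t` of `P` is locally reflex: some `2 × 2` square of cells contains, of `P`,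
exactly `t` and its two neighbours in that square. -/
def LocallyReflex (P : Finset (ℤ × ℤ)) (t : ℤ × ℤ) : Prop :=
  t ∈ P ∧ ∃ dx dy : ℤ, (dx = 1 ∨ dx = -1) ∧ (dy = 1 ∨ dy = -1) ∧
    (t.1 + dx, t.2) ∈ P ∧ (t.1, t.2 + dy) ∈ P ∧ (t.1 + dx, t.2 + dy) ∉ P

open Classical in
/-- The number `r` of locally reflex tiles of `P`. -/
noncomputable def numReflex (P : Finset (ℤ × ℤ)) : ℕ :=
  (P.filter (LocallyReflex P)).card

/-! ### Cuts

Cuts run between the grid points, along the sides of the tiles. A tile corner is written with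
integer coordinates: `(i, j)` stands for the lower left corner of the tile `(i, j)`, that is, for
the point `(i - 1/2, j - 1/2)` of the plane. -/

/-- `u` is one of the four corners of the tile `p`. -/
def TileCorner (u p : ℤ × ℤ) : Prop :=
  (u.1 = p.1 ∨ u.1 = p.1 + 1) ∧ (u.2 = p.2 ∨ u.2 = p.2 + 1)

/-- A cut of `P`: a simple orthogonal lattice curve, given by the list of the tile corners it
visits, consecutive ones at unit distance, which neither starts nor ends in the interior of `P`
(a corner is in the interior of `P` iff its four incident tiles all belong to `P`). -/
structure IsCut (P : Finset (ℤ × ℤ)) (c : List (ℤ × ℤ)) : Prop where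
  chain : c.IsChain gridGraph.Adj
  nodup : c.Nodup
  start_not_interior : ∀ u ∈ c.head?, ∃ p ∉ P, TileCorner u p
  end_not_interior : ∀ u ∈ c.getLast?, ∃ p ∉ P, TileCorner u p

/-- The curve `c` runs along a common side of the (adjacent) tiles `p` and `q`. -/
def Separates (c : List (ℤ × ℤ)) (p q : ℤ × ℤ) : Prop :=
  ∃ u w : ℤ × ℤ, [u, w] <:+: c ∧
    TileCorner u p ∧ TileCorner u q ∧ TileCorner w p ∧ TileCorner w q

/-- What is left of the dual graph of `P` after cutting along `c`. -/
def cutGraph (P : Finset (ℤ × ℤ)) (c : List (ℤ × ℤ)) : SimpleGraph (ℤ × ℤ) where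
  Adj p q := p ∈ P ∧ q ∈ P ∧ gridGraph.Adj p q ∧ ¬ Separates c p q
  symm := ⟨fun _ _ h => ⟨h.2.1, h.1, h.2.2.1.symm,
    fun ⟨u, w, hc, h1, h2, h3, h4⟩ => h.2.2.2 ⟨u, w, hc, h2, h1, h4, h3⟩⟩⟩
  loopless := ⟨fun p h => gridGraph.loopless.irrefl p h.2.2.1⟩

/-- `c` is a 2-cut of `P`: it splits `P` into exactly two pieces, namely `A` and `B`. -/
structure IsTwoCut (P : Finset (ℤ × ℤ)) (c : List (ℤ × ℤ)) (A B : Finset (ℤ × ℤ)) : Prop where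
  isCut : IsCut P c
  nonempty_left : A.Nonempty
  nonempty_right : B.Nonempty
  disjoint : Disjoint A B
  union : A ∪ B = P
  piece_left : ∀ p ∈ A, ∀ q : ℤ × ℤ, q ∈ A ↔ (cutGraph P c).Reachable p q
  piece_right : ∀ p ∈ B, ∀ q : ℤ × ℤ, q ∈ B ↔ (cutGraph P c).Reachable p q

/-- `A` can be moved to infinity in direction `v` and `B` in direction `-v` without ever
blocking each other. -/
def PullApart (A B : Finset (ℤ × ℤ)) (v : ℤ × ℤ) : Prop :=
  ∀ m n : ℕ, ∀ a ∈ A, ∀ b ∈ B, a + m • v ≠ b - n • v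

/-- `c` is a valid 2-cut of `P`, with pieces `A` and `B`: the pieces can be pulled apart into
opposite horizontal or opposite vertical directions. -/
def IsValidTwoCut (P : Finset (ℤ × ℤ)) (c : List (ℤ × ℤ)) (A B : Finset (ℤ × ℤ)) : Prop :=
  IsTwoCut P c A B ∧
    ∃ v : ℤ × ℤ, (v = (1, 0) ∨ v = (-1, 0) ∨ v = (0, 1) ∨ v = (0, -1)) ∧ PullApart A B v

/-- `P` is 2-cuttable: successive valid 2-cuts subdivide it into monotone pieces. -/
inductive TwoCuttable : Finset (ℤ × ℤ) → Prop
  | monotone (P : Finset (ℤ × ℤ)) : IsMonotone P → TwoCuttable P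
  | cut (P : Finset (ℤ × ℤ)) (c : List (ℤ × ℤ)) (A B : Finset (ℤ × ℤ)) :
      IsValidTwoCut P c A B → TwoCuttable A → TwoCuttable B → TwoCuttable P

end Polyomino

/-! ### A word RAM with step count

Programs are structured programs over integer registers and a random-access memory of integers.
Every register access, memory access, arithmetic operation, comparison, assignment and test costs
one step. All integers that are computed (including addresses) must fit into a machine word, that
is, have absolute value at most `W`; otherwise the execution is stuck. -/

namespace WordRAM

/-- Registers and memory cells, all holding integers. -/
structure Store where
  reg : ℕ → ℤ
  mem : ℤ → ℤ

/-- Expressions; `le` yields `1` if the first argument is at most the second, and `0` otherwise. -/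
inductive Term where
  | const (z : ℤ)
  | reg (i : ℕ)
  | load (a : Term)
  | add (a b : Term)
  | sub (a b : Term)
  | mul (a b : Term)
  | div (a b : Term)
  | le (a b : Term)

/-- `z`, provided that it fits into a machine word. -/
def word (W : ℕ) (z : ℤ) : Option ℤ :=
  if |z| ≤ (W : ℤ) then some z else none

/-- The value of an expression; `none` if some intermediate result does not fit into a word. -/
def Term.value (W : ℕ) (s : Store) : Term → Option ℤ
  | .const z => word W z
  | .reg i => word W (s.reg i)
  | .load a => (a.value W s).bind fun x => word W (s.mem x)
  | .add a b => (a.value W s).bind fun x => (b.value W s).bind fun y => word W (x + y)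
  | .sub a b => (a.value W s).bind fun x => (b.value W s).bind fun y => word W (x - y)
  | .mul a b => (a.value W s).bind fun x => (b.value W s).bind fun y => word W (x * y)
  | .div a b => (a.value W s).bind fun x => (b.value W s).bind fun y => word W (x / y)
  | .le a b => (a.value W s).bind fun x => (b.value W s).bind fun y =>
      word W (if x ≤ y then 1 else 0)

/-- The number of elementary operations in an expression. -/
def Term.cost : Term → ℕ
  | .const _ => 1
  | .reg _ => 1
  | .load a => a.cost + 1
  | .add a b => a.cost + b.cost + 1
  | .sub a b => a.cost + b.cost + 1
  | .mul a b => a.cost + b.cost + 1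
  | .div a b => a.cost + b.cost + 1
  | .le a b => a.cost + b.cost + 1

/-- Programs. -/
inductive Prog where
  /-- register `i` := `e` -/
  | assign (i : ℕ) (e : Term)
  /-- memory cell with address `a` := `e` -/
  | store (a e : Term)
  | seq (c d : Prog)
  /-- if `e ≠ 0` then `c` else `d` -/
  | cond (e : Term) (c d : Prog)
  /-- while `e ≠ 0` do `c` -/
  | loop (e : Term) (c : Prog)

/-- `Exec W c s t s'`: with word bound `W`, the program `c` started in `s` halts in `s'` after
exactly `t` steps. -/
inductive Exec (W : ℕ) : Prog → Store → ℕ → Store → Prop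
  | assign {i : ℕ} {e : Term} {s : Store} {z : ℤ} :
      e.value W s = some z →
      Exec W (.assign i e) s (e.cost + 1) ⟨Function.update s.reg i z, s.mem⟩
  | store {a e : Term} {s : Store} {x z : ℤ} :
      a.value W s = some x → e.value W s = some z →
      Exec W (.store a e) s (a.cost + e.cost + 1) ⟨s.reg, Function.update s.mem x z⟩
  | seq {c d : Prog} {s s₁ s₂ : Store} {t₁ t₂ : ℕ} :
      Exec W c s t₁ s₁ → Exec W d s₁ t₂ s₂ → Exec W (.seq c d) s (t₁ + t₂) s₂
  | cond_true {e : Term} {c d : Prog} {s s' : Store} {t : ℕ} {z : ℤ} :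
      e.value W s = some z → z ≠ 0 → Exec W c s t s' →
      Exec W (.cond e c d) s (e.cost + 1 + t) s'
  | cond_false {e : Term} {c d : Prog} {s s' : Store} {t : ℕ} :
      e.value W s = some 0 → Exec W d s t s' →
      Exec W (.cond e c d) s (e.cost + 1 + t) s'
  | loop_true {e : Term} {c : Prog} {s s₁ s₂ : Store} {t₁ t₂ : ℕ} {z : ℤ} :
      e.value W s = some z → z ≠ 0 → Exec W c s t₁ s₁ → Exec W (.loop e c) s₁ t₂ s₂ →
      Exec W (.loop e c) s (e.cost + 1 + t₁ + t₂) s₂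
  | loop_false {e : Term} {c : Prog} {s : Store} :
      e.value W s = some 0 → Exec W (.loop e c) s (e.cost + 1) s

/-- The initial store for a list of `N` points: register `0` holds `N`, the cells `2 i` and
`2 i + 1` (for `i < N`) hold the coordinates of the `i`-th point, all else is `0`. -/
def input (L : List (ℤ × ℤ)) : Store where
  reg i := if i = 0 then (L.length : ℤ) else 0
  mem a := if 0 ≤ a then
      (let p := L.getD (a.toNat / 2) (0, 0)
       if a.toNat % 2 = 0 then p.1 else p.2)
    else 0

/-- The final store holds the list `l` of points: register `0` holds its length, register `1` a
base address `b`, and the cells `b + 2 i` and `b + 2 i + 1` the coordinates of the `i`-th point. -/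
def Outputs (s : Store) (l : List (ℤ × ℤ)) : Prop :=
  s.reg 0 = (l.length : ℤ) ∧
    ∀ (i : ℕ) (p : ℤ × ℤ), l[i]? = some p →
      s.mem (s.reg 1 + 2 * (i : ℤ)) = p.1 ∧ s.mem (s.reg 1 + 2 * (i : ℤ) + 1) = p.2

end WordRAM

/-! ### Walks in the grid and winding numbers around tile corners. -/

namespace Polyomino

/-! After a rotation by a multiple of a quarter turn, a valid 2-cut is a partition of `P` into
connected sets `L` and `R` with `L` left of `R` in every row (`HCut`). The algorithm looks for such
a partition in each of the four rotations.

Fix a tile `l` to be put on the left and a tile `r` to be put on the right. Join the tiles of `P` by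
all horizontal adjacencies, but for each contact between two maximal row segments keep only the
leftmost vertical adjacency. For hole-free `P` this graph (`hug P (-1)`) has no cycles
(`hug_isAcyclic`), since winding numbers of closed walks around boundary corners vanish and the
missing verticals propagate this to interior corners. A connected `L` that is closed under going
left is still connected in this graph, because vertical steps can be slid to the left
(`hugOn_reachable`). So `L` contains the parent of each of its tiles in the tree rooted at `l`.
Symmetrically `R` is closed under parents in the tree of rightmost contacts rooted at `r`; hence `L`
contains the children, in that tree, of each of its tiles. Conversely, the smallest set that
contains `l` and is closed under left neighbours in the row, left parents and right children is the
left side of a cut as soon as it omits `r` (`HCut.forces`, `hcut_of_forces`). Three breadth first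
searches therefore decide a pair `(l, r)` in linear time.

Only pairs of locally reflex tiles need be tried, which gives the factor `r ^ 2`. If one side of a
cut has no locally reflex tile, then a single tile can be cut off in this direction or the opposite
one, and such a `Bite` is recognised locally (`HCut.exists_bite`, `Bite.hcut`). A first cut exists
for 2-cuttable non-convex `P`, also if `P` is already monotone (`exists_rot_hcut`); together this is
`exists_not_noCut`.

A partition still has to be turned into a curve. The boundary of `L` is followed from one
non-interior corner to the next. A closed walk that crossed from `L` to `R` elsewhere and came back
through the first traced side would have different winding numbers around the two ends, so the
traced curve contains every contact of `L` and `R` (`trace_separates`).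

On the word RAM, arrays live at negative addresses and the input and the output at nonnegative ones.
Memory starts at zero and its size is free, so tiles are looked up in a table indexed by
coordinates, and each direction uses a fresh part of it. Predecessors in rows come from a sweep over
the columns; connectedness bounds the number of columns by `N`. No sorting is needed: the running
time is `O((r ^ 2 + 1) N)`, and `r ≥ 1`, `N ≥ 2` absorb it into the stated bound. Correctness and
time are proved in a small Hoare logic (`Run`) over unbounded integers and transferred to machine
words by `HExec.exec`. -/

theorem gridGraph_adj_iff (p q : ℤ × ℤ) : gridGraph.Adj p q ↔
    q = (p.1 + 1, p.2) ∨ q = (p.1 - 1, p.2) ∨ q = (p.1, p.2 + 1) ∨ q = (p.1, p.2 - 1) := by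
  obtain ⟨a, b⟩ := p
  obtain ⟨c, d⟩ := q
  simp only [gridGraph, Prod.mk.injEq]
  rcases abs_cases (a - c) with h | h <;> rcases abs_cases (b - d) with h' | h' <;> omega

/-- The grid graph on the tiles of `P`. -/
def pg (P : Finset (ℤ × ℤ)) : SimpleGraph (ℤ × ℤ) where
  Adj p q := p ∈ P ∧ q ∈ P ∧ gridGraph.Adj p q
  symm := ⟨fun _ _ h => ⟨h.2.1, h.1, h.2.2.symm⟩⟩
  loopless := ⟨fun p h => gridGraph.loopless.irrefl p h.2.2⟩

theorem pg_mono {P Q : Finset (ℤ × ℤ)} (h : P ⊆ Q) : pg P ≤ pg Q :=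
  fun _ _ ⟨h1, h2, h3⟩ => ⟨h h1, h h2, h3⟩

/-- The tiles of `P` are connected to each other within `P`. -/
def Conn (P : Finset (ℤ × ℤ)) : Prop := ∀ p ∈ P, ∀ q ∈ P, (pg P).Reachable p q

/-- Passes from an induced graph on a subtype to `pg P` on all of `ℤ × ℤ`, where graphs of subsets
compare by `≤` and walks in different subsets can be concatenated. -/
theorem isPolyomino_iff {P : Finset (ℤ × ℤ)} : IsPolyomino P ↔ P.Nonempty ∧ Conn P := by
  constructor
  · intro h
    refine ⟨?_, ?_⟩
    · obtain ⟨⟨p, hp⟩⟩ := h.nonempty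
      exact ⟨p, hp⟩
    · intro p hp q hq
      let f : gridGraph.induce (P : Set (ℤ × ℤ)) →g pg P :=
        ⟨fun x => x.1, fun {a b} hab => ⟨a.2, b.2, hab⟩⟩
      exact (h.preconnected ⟨p, hp⟩ ⟨q, hq⟩).map f
  · rintro ⟨⟨p, hp⟩, h⟩
    have key : ∀ a b : ℤ × ℤ, (pg P).Walk a b → ∀ (ha : a ∈ P) (hb : b ∈ P),
        (gridGraph.induce (P : Set (ℤ × ℤ))).Reachable ⟨a, ha⟩ ⟨b, hb⟩ := by
      intro a b w
      induction w with
      | nil => intro ha hb; exact SimpleGraph.Reachable.refl _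
      | @cons u v w h p ih =>
        intro ha hb
        refine SimpleGraph.Reachable.trans (SimpleGraph.Adj.reachable ?_) (ih h.2.1 hb)
        exact h.2.2
    exact
      { preconnected := fun a b => by
          obtain ⟨w⟩ := h a.1 a.2 b.1 b.2
          exact key a.1 b.1 w a.2 b.2
        nonempty := ⟨⟨p, hp⟩⟩ }

/-- The sum of `f` over the steps of a walk. -/
def flux {G : SimpleGraph (ℤ × ℤ)} (f : ℤ × ℤ → ℤ × ℤ → ℤ) : ∀ {u v : ℤ × ℤ}, G.Walk u v → ℤ
  | _, _, .nil => 0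
  | _, _, .cons (u := u) (v := v) _ p => f u v + flux f p

section flux
variable {G : SimpleGraph (ℤ × ℤ)} {u v w : ℤ × ℤ}

theorem flux_append (f : ℤ × ℤ → ℤ × ℤ → ℤ) (p : G.Walk u v) (q : G.Walk v w) :
    flux f (p.append q) = flux f p + flux f q := by
  induction p with
  | nil => simp [flux]
  | cons h p ih => simp [flux, ih, add_assoc]

theorem flux_congr {f g : ℤ × ℤ → ℤ × ℤ → ℤ} (h : ∀ a b, G.Adj a b → f a b = g a b)
    (p : G.Walk u v) : flux f p = flux g p := by
  induction p with
  | nil => rfl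
  | cons h' p ih => simp [flux, ih, h _ _ h']

theorem flux_add (f g : ℤ × ℤ → ℤ × ℤ → ℤ) (p : G.Walk u v) :
    flux (fun a b => f a b + g a b) p = flux f p + flux g p := by
  induction p with
  | nil => rfl
  | cons h' p ih => simp only [flux, ih]; ring

theorem flux_zero {f : ℤ × ℤ → ℤ × ℤ → ℤ} (h : ∀ a b, G.Adj a b → f a b = 0)
    (p : G.Walk u v) : flux f p = 0 := by
  induction p with
  | nil => rfl
  | cons h' p ih => simp [flux, ih, h _ _ h']

theorem flux_potential (g : ℤ × ℤ → ℤ) (p : G.Walk u v) :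
    flux (fun a b => g b - g a) p = g v - g u := by
  induction p with
  | nil => simp [flux]
  | cons h' p ih => simp only [flux, ih]; ring

theorem flux_mapLe {G' : SimpleGraph (ℤ × ℤ)} (hG : G ≤ G') (f : ℤ × ℤ → ℤ × ℤ → ℤ)
    (p : G.Walk u v) : flux f (p.mapLe hG) = flux f p := by
  induction p with
  | nil => rfl
  | cons h' p ih => simpa [flux] using ih
end flux

/-- Signed passage through the step from `a` to `b`. -/
def through (a b p q : ℤ × ℤ) : ℤ :=
  (if p = a ∧ q = b then 1 else 0) - (if p = b ∧ q = a then 1 else 0)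

/-- Signed passage of the ray running to the right from the corner `(i, j)`. -/
def cross (i j : ℤ) (p q : ℤ × ℤ) : ℤ :=
  (if p.2 = j - 1 ∧ q.2 = j ∧ i ≤ p.1 then 1 else 0) -
    (if p.2 = j ∧ q.2 = j - 1 ∧ i ≤ p.1 then 1 else 0)

/-- The rays from the corners `(i, j)` and `(i + 1, j)` differ in one unit segment, the common side
of the tiles `(i, j - 1)` and `(i, j)`. -/
theorem cross_right (i j : ℤ) {p q : ℤ × ℤ} (h : gridGraph.Adj p q) :
    cross i j p q = cross (i + 1) j p q + through (i, j - 1) (i, j) p q := by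
  obtain ⟨a, b⟩ := p
  rw [gridGraph_adj_iff] at h
  rcases h with rfl | rfl | rfl | rfl <;>
    simp only [cross, through, Prod.mk.injEq] <;> split_ifs <;> omega

/-- Between the rays from `(i, j)` and `(i, j + 1)` lies the half row of tiles `(x, j)` with `i ≤
x`. A step that enters or leaves it crosses one of the rays or its left end; the indicator
difference on the left telescopes, so it vanishes on closed walks. -/
theorem cross_up (i j : ℤ) {p q : ℤ × ℤ} (h : gridGraph.Adj p q) :
    cross i (j + 1) p q + ((if i ≤ q.1 ∧ q.2 = j then 1 else 0) -
      (if i ≤ p.1 ∧ p.2 = j then 1 else 0)) =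
      cross i j p q + through (i - 1, j) (i, j) p q := by
  obtain ⟨a, b⟩ := p
  rw [gridGraph_adj_iff] at h
  rcases h with rfl | rfl | rfl | rfl <;>
    simp only [cross, through, Prod.mk.injEq] <;> split_ifs <;> omega

/-- The winding number of a walk around a corner. -/
def winding {G : SimpleGraph (ℤ × ℤ)} {u v : ℤ × ℤ} (w : G.Walk u v) (c : ℤ × ℤ) : ℤ :=
  flux (cross c.1 c.2) w

section winding
variable {G : SimpleGraph (ℤ × ℤ)} (hG : G ≤ gridGraph) {u : ℤ × ℤ} (w : G.Walk u u)
include hG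

theorem winding_right (i j : ℤ) :
    winding w (i, j) = winding w (i + 1, j) + flux (through (i, j - 1) (i, j)) w := by
  unfold winding
  rw [← flux_add]
  exact flux_congr (fun a b h => cross_right i j (hG h)) w

theorem winding_up (i j : ℤ) :
    winding w (i, j + 1) = winding w (i, j) + flux (through (i - 1, j) (i, j)) w := by
  unfold winding
  have h := flux_potential (fun p : ℤ × ℤ => if i ≤ p.1 ∧ p.2 = j then (1 : ℤ) else 0) w
  rw [sub_self] at h
  rw [← flux_add, ← add_zero (flux (cross (i, j + 1).1 (i, j + 1).2) w), ← h, ← flux_add]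
  exact flux_congr (fun a b h => cross_up i j (hG h)) w
end winding

/-- A corner is on the boundary or outside of `P`. -/
def NonInterior (P : Finset (ℤ × ℤ)) (c : ℤ × ℤ) : Prop := ∃ p ∉ P, TileCorner c p

theorem nonInterior_iff {P : Finset (ℤ × ℤ)} {i j : ℤ} : NonInterior P (i, j) ↔
    (i, j) ∉ P ∨ (i - 1, j) ∉ P ∨ (i, j - 1) ∉ P ∨ (i - 1, j - 1) ∉ P := by
  constructor
  · rintro ⟨⟨a, b⟩, hp, h1, h2⟩
    dsimp only at h1 h2
    rcases h1 with h1 | h1 <;> rcases h2 with h2 | h2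
    · subst h1 h2; exact .inl hp
    · obtain rfl : b = j - 1 := by omega
      subst h1; exact .inr (.inr (.inl hp))
    · obtain rfl : a = i - 1 := by omega
      subst h2; exact .inr (.inl hp)
    · obtain rfl : a = i - 1 := by omega
      obtain rfl : b = j - 1 := by omega
      exact .inr (.inr (.inr hp))
  · rintro (h | h | h | h)
    · exact ⟨_, h, by simp [TileCorner]⟩
    · exact ⟨_, h, by simp [TileCorner]⟩
    · exact ⟨_, h, by simp [TileCorner]⟩
    · exact ⟨_, h, by simp [TileCorner]⟩

theorem flux_through_of_notMem {P : Finset (ℤ × ℤ)} {G : SimpleGraph (ℤ × ℤ)} (hG : G ≤ pg P)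
    {u v : ℤ × ℤ} (w : G.Walk u v) {a b : ℤ × ℤ} (h : a ∉ P ∨ b ∉ P) :
    flux (through a b) w = 0 := by
  refine flux_zero (fun p q hpq => ?_) w
  have := hG hpq
  unfold through
  rw [if_neg, if_neg]
  · rfl
  · rintro ⟨rfl, rfl⟩; exact h.elim (fun h => h this.2.1) (fun h => h this.1)
  · rintro ⟨rfl, rfl⟩; exact h.elim (fun h => h this.1) (fun h => h this.2.1)

/-- A closed walk in a hole-free polyomino does not wind around any boundary corner. -/
theorem winding_eq_zero {P : Finset (ℤ × ℤ)} (hP : IsSimple P) {G : SimpleGraph (ℤ × ℤ)}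
    (hG : G ≤ pg P) {u : ℤ × ℤ} (w : G.Walk u u) {c : ℤ × ℤ} (hc : NonInterior P c) :
    winding w c = 0 := by
  have hG' : G ≤ gridGraph := fun a b h => (hG h).2.2
  -- The walk never uses a side of a tile outside `P`, so the winding number is the same at all four
  -- corners of such a tile, and hence along walks in the complement.
  have hr : ∀ x y : ℤ, (x, y) ∉ P → winding w (x + 1, y) = winding w (x, y) := by
    intro x y h
    rw [winding_right hG' w x y, flux_through_of_notMem hG w (.inr h), add_zero]
  have hu : ∀ x y : ℤ, (x, y) ∉ P → winding w (x, y + 1) = winding w (x, y) := by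
    intro x y h
    rw [winding_up hG' w x y, flux_through_of_notMem hG w (.inr h), add_zero]
  have hru : ∀ x y : ℤ, (x, y) ∉ P → winding w (x + 1, y + 1) = winding w (x, y) := by
    intro x y h
    rw [winding_up hG' w (x + 1) y, hr x y h, flux_through_of_notMem hG w (.inl _), add_zero]
    rwa [add_sub_cancel_right]
  have hconst : ∀ p q : ((P : Set (ℤ × ℤ))ᶜ : Set (ℤ × ℤ)),
      (gridGraph.induce (P : Set (ℤ × ℤ))ᶜ).Walk p q → winding w p.1 = winding w q.1 := by
    intro p q k
    induction k with
    | nil => rfl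
    | @cons a b c h k ih =>
      rw [← ih]
      obtain ⟨⟨x, y⟩, ha⟩ := a
      obtain ⟨⟨x', y'⟩, hb⟩ := b
      have h' : gridGraph.Adj (x, y) (x', y') := h
      rw [gridGraph_adj_iff] at h'
      simp only [Prod.mk.injEq] at h'
      have ha' : (x, y) ∉ P := ha
      have hb' : (x', y') ∉ P := hb
      rcases h' with ⟨rfl, rfl⟩ | ⟨rfl, rfl⟩ | ⟨rfl, rfl⟩ | ⟨rfl, rfl⟩
      · exact (hr _ _ ha').symm
      · have := hr _ _ hb'; simpa using this
      · exact (hu _ _ ha').symm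
      · have := hu _ _ hb'; simpa using this
  -- A cell to the right of all tiles: the ray from it meets no step of the walk.
  obtain ⟨B, hB⟩ : ∃ B : ℤ, ∀ p ∈ P, p.1 < B := by
    obtain ⟨B, hB⟩ := (P.image Prod.fst).exists_le
    exact ⟨B + 1, fun p hp => by have := hB p.1 (Finset.mem_image_of_mem _ hp); omega⟩
  have hfar : (B, (0 : ℤ)) ∉ P := fun h => by simpa using hB _ h
  have hfar0 : winding w (B, 0) = 0 := by
    refine flux_zero (fun a b h => ?_) w
    have := hB a (hG h).1
    unfold cross
    rw [if_neg, if_neg]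
    · rfl
    · rintro ⟨_, _, h⟩; dsimp only at h; omega
    · rintro ⟨_, _, h⟩; dsimp only at h; omega
  obtain ⟨⟨x, y⟩, hp, h1, h2⟩ := hc
  obtain ⟨i, j⟩ := c
  have h0 : winding w (x, y) = 0 := by
    obtain ⟨k⟩ := hP.preconnected ⟨(x, y), hp⟩ ⟨(B, 0), hfar⟩
    rw [← hfar0]
    exact hconst _ _ k
  dsimp only at h1 h2
  rcases h1 with rfl | rfl <;> rcases h2 with rfl | rfl
  · exact h0
  · rw [hu _ _ hp, h0]
  · rw [hr _ _ hp, h0]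
  · rw [hru _ _ hp, h0]

end Polyomino


/-! ### The acyclic graph of extreme contacts between row segments. -/

namespace Polyomino

/-- The adjacent tiles `p` and `q` of `P` are in the same row, or are the extreme tiles (in
direction `e`) of a contact between two maximal horizontal segments of `P`. -/
def HugAdj (P : Finset (ℤ × ℤ)) (e : ℤ) (p q : ℤ × ℤ) : Prop :=
  p ∈ P ∧ q ∈ P ∧ gridGraph.Adj p q ∧
    (p.2 = q.2 ∨ ¬ ((p.1 + e, p.2) ∈ P ∧ (q.1 + e, q.2) ∈ P))

/-- The graph of `HugAdj`. -/
def hug (P : Finset (ℤ × ℤ)) (e : ℤ) : SimpleGraph (ℤ × ℤ) where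
  Adj := HugAdj P e
  symm := ⟨fun _ _ h => ⟨h.2.1, h.1, h.2.2.1.symm, h.2.2.2.imp Eq.symm fun h k => h k.symm⟩⟩
  loopless := ⟨fun p h => gridGraph.loopless.irrefl p h.2.2.1⟩

theorem hug_le (P : Finset (ℤ × ℤ)) (e : ℤ) : hug P e ≤ pg P :=
  fun _ _ h => ⟨h.1, h.2.1, h.2.2.1⟩

theorem flux_eq_zero_of_not_adj {G : SimpleGraph (ℤ × ℤ)} {u v : ℤ × ℤ} (w : G.Walk u v)
    {a b : ℤ × ℤ} (h : ¬ G.Adj a b) : flux (through a b) w = 0 := by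
  refine flux_zero (fun p q hpq => ?_) w
  unfold through
  rw [if_neg, if_neg]
  · rfl
  · rintro ⟨rfl, rfl⟩; exact h hpq.symm
  · rintro ⟨rfl, rfl⟩; exact h hpq

theorem nonInterior_far (P : Finset (ℤ × ℤ)) : ∃ B : ℤ, 0 ≤ B ∧
    ∀ i j : ℤ, B ≤ |i| → NonInterior P (i, j) := by
  obtain ⟨B, hB⟩ := (P.image fun p => |p.1|).exists_le
  refine ⟨|B| + 2, by positivity, fun i j h => ?_⟩
  rw [nonInterior_iff]
  by_contra hcon
  push Not at hcon
  have h1 := hB |i| (Finset.mem_image.2 ⟨_, hcon.1, rfl⟩)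
  have := le_abs_self B
  omega

/-- At non-interior corners this is `winding_eq_zero`. At an interior corner, the vertical adjacency
next to it on the side opposite to `e` is not extreme, as its two `e`-neighbours are in `P`. So it
is not an edge, and the winding number equals that at the next corner on that side; the induction
starts far away on that side. -/
theorem hug_winding {P : Finset (ℤ × ℤ)} (hP : IsSimple P) {e : ℤ} (he : e = 1 ∨ e = -1)
    {u : ℤ × ℤ} (w : (hug P e).Walk u u) (c : ℤ × ℤ) : winding w c = 0 := by
  have hG : hug P e ≤ gridGraph := fun a b h => h.2.2.1
  obtain ⟨B, hB0, hB⟩ := nonInterior_far P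
  obtain ⟨i, j⟩ := c
  rcases he with rfl | rfl
  · have key : ∀ n : ℕ, ∀ i : ℤ, i ≤ n - B → winding w (i, j) = 0 := by
      intro n
      induction n with
      | zero =>
        intro i hi
        refine winding_eq_zero hP (hug_le P 1) w (hB i j ?_)
        rw [abs_of_nonpos] <;> push_cast at hi <;> omega
      | succ n ih =>
        intro i hi
        by_cases h : NonInterior P (i, j)
        · exact winding_eq_zero hP (hug_le P 1) w h
        · have h1 := ih (i - 1) (by push_cast at hi; omega)
          rw [winding_right hG, sub_add_cancel, flux_eq_zero_of_not_adj, add_zero] at h1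
          · exact h1
          · rw [nonInterior_iff] at h
            push Not at h
            rintro ⟨_, _, _, h5⟩
            rcases h5 with h5 | h5
            · dsimp only at h5; omega
            · apply h5
              simp [h]
    exact key (i + B).toNat i (by have := Int.self_le_toNat (i + B); omega)
  · have key : ∀ n : ℕ, ∀ i : ℤ, B - n ≤ i → winding w (i, j) = 0 := by
      intro n
      induction n with
      | zero =>
        intro i hi
        refine winding_eq_zero hP (hug_le P _) w (hB i j ?_)
        rw [abs_of_nonneg] <;> push_cast at hi <;> omega
      | succ n ih =>
        intro i hi
        by_cases h : NonInterior P (i, j)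
        · exact winding_eq_zero hP (hug_le P _) w h
        · rw [winding_right hG, ih (i + 1) (by push_cast at hi; omega), zero_add]
          apply flux_eq_zero_of_not_adj
          rw [nonInterior_iff] at h
          push Not at h
          rintro ⟨_, _, _, h5⟩
          rcases h5 with h5 | h5
          · dsimp only at h5; omega
          · apply h5
            simp only [← sub_eq_add_neg]
            exact ⟨h.2.2.2, h.2.1⟩
    exact key (B - i).toNat i (by have := Int.self_le_toNat (B - i); omega)

/-- The net number of passages through a side is, up to sign, the difference of the winding numbers
around its two ends, and both vanish. -/
theorem hug_flux {P : Finset (ℤ × ℤ)} (hP : IsSimple P) {e : ℤ} (he : e = 1 ∨ e = -1)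
    {u : ℤ × ℤ} (w : (hug P e).Walk u u) {a b : ℤ × ℤ} (hab : gridGraph.Adj a b) :
    flux (through a b) w = 0 := by
  have hG : hug P e ≤ gridGraph := fun a b h => h.2.2.1
  have h1 : ∀ i j : ℤ, flux (through (i, j - 1) (i, j)) w = 0 := fun i j => by
    have := winding_right hG w i j
    simpa [hug_winding hP he] using this.symm
  have h2 : ∀ i j : ℤ, flux (through (i - 1, j) (i, j)) w = 0 := fun i j => by
    have := winding_up hG w i j
    simpa [hug_winding hP he] using this.symm
  have hs : ∀ a b, flux (through a b) w = 0 → flux (through b a) w = 0 := by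
    intro a b h
    have h3 := flux_add (through a b) (through b a) w
    rw [h, zero_add] at h3
    rw [← h3]
    exact flux_zero (fun p q _ => by simp [through]) w
  obtain ⟨x, y⟩ := a
  rw [gridGraph_adj_iff] at hab
  rcases hab with rfl | rfl | rfl | rfl
  · have := h2 (x + 1) y
    rwa [add_sub_cancel_right] at this
  · exact hs _ _ (h2 x y)
  · have := h1 x (y + 1)
    rwa [add_sub_cancel_right] at this
  · exact hs _ _ (h1 x y)

/-- An edge that is not a bridge closes up to a closed walk that uses it just once, so with flux
`-1` through it, contrary to `hug_flux`. -/
theorem hug_isAcyclic {P : Finset (ℤ × ℤ)} (hP : IsSimple P) {e : ℤ} (he : e = 1 ∨ e = -1) :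
    (hug P e).IsAcyclic := by
  rw [SimpleGraph.isAcyclic_iff_forall_adj_isBridge]
  intro a b hab
  rw [SimpleGraph.isBridge_iff]
  rintro ⟨w⟩
  have hle : (hug P e).deleteEdges {s(a, b)} ≤ hug P e := SimpleGraph.deleteEdges_le _
  have h := hug_flux hP he (SimpleGraph.Walk.cons hab.symm (w.mapLe hle)) hab.2.2.1
  rw [flux, flux_mapLe, flux_eq_zero_of_not_adj w (by simp), add_zero] at h
  have hne : a ≠ b := hab.ne
  simp [through, hne] at h

/-- In an acyclic graph, a connected set that contains the root is closed under taking parents. -/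
theorem parent_mem_of_acyclic {V : Type*} {G H : SimpleGraph V} (hG : G.IsAcyclic)
    {D : Set V} (hHG : H ≤ G) (hHD : ∀ a b, H.Adj a b → b ∈ D) {root : V}
    {U : Set V} {par : V → V} {rank : V → ℕ}
    (hpar : ∀ v ∈ U, v ≠ root → par v ∈ U ∧ G.Adj (par v) v ∧ rank (par v) < rank v)
    {v : V} (hv : v ∈ U) (hne : v ≠ root) (hr : H.Reachable v root) : par v ∈ D := by
  classical
  -- Following parents leads to the root along vertices of no larger rank. Hence the walk from `par
  -- v` avoids `v`, and prefixing `v` gives a path.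
  have key : ∀ n : ℕ, ∀ x ∈ U, rank x ≤ n →
      ∃ w : G.Walk x root, ∀ y ∈ w.support, rank y ≤ rank x := by
    intro n
    induction n with
    | zero =>
      intro x hx h
      by_cases hxr : x = root
      · subst hxr; exact ⟨.nil, by simp⟩
      · have := (hpar x hx hxr).2.2; omega
    | succ n ih =>
      intro x hx h
      by_cases hxr : x = root
      · subst hxr; exact ⟨.nil, by simp⟩
      · obtain ⟨h1, h2, h3⟩ := hpar x hx hxr
        obtain ⟨w, hw⟩ := ih (par x) h1 (by omega)
        refine ⟨.cons h2.symm w, fun y hy => ?_⟩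
        rw [SimpleGraph.Walk.support_cons, List.mem_cons] at hy
        rcases hy with rfl | hy
        · rfl
        · exact (hw y hy).trans h3.le
  obtain ⟨h1, h2, h3⟩ := hpar v hv hne
  obtain ⟨w, hw⟩ := key _ (par v) h1 le_rfl
  have hvn : v ∉ w.bypass.support := fun h => by
    have := hw v (w.support_bypass_subset_support h)
    omega
  obtain ⟨w'⟩ := hr
  have hp : (SimpleGraph.Walk.cons h2.symm w.bypass).IsPath :=
    (w.bypass_isPath).cons hvn
  have hq := (w'.mapLe hHG).bypass_isPath
  -- The path from `v` to the root is unique, so the one inside `H` also passes through `par v`; all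
  -- vertices of that one after the first lie in `D`.
  have huniq := congrArg Subtype.val
    ((hG.subsingleton_path _ _).elim (⟨_, hp⟩ : G.Path v root) ⟨_, hq⟩)
  dsimp only at huniq
  have hs : par v ∈ (w'.mapLe hHG).bypass.support := by
    rw [← huniq]
    simp
  have hs' : par v ∈ w'.support := by
    have := (w'.mapLe hHG).support_bypass_subset_support hs
    simpa using this
  have hD : ∀ x y : V, ∀ k : H.Walk x y, ∀ z ∈ k.support, z = x ∨ z ∈ D := by
    intro x y k
    induction k with
    | nil => intro z hz; left; simpa using hz
    | cons h k ih =>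
      intro z hz
      rw [SimpleGraph.Walk.support_cons, List.mem_cons] at hz
      rcases hz with rfl | hz
      · exact .inl rfl
      · rcases ih z hz with rfl | h'
        · exact .inr (hHD _ _ h)
        · exact .inr h'
  rcases hD _ _ w' _ hs' with h | h
  · exact absurd h h2.ne
  · exact h

/-- The part of `hug P e` on the tiles of `D`. -/
def hugOn (P D : Finset (ℤ × ℤ)) (e : ℤ) : SimpleGraph (ℤ × ℤ) where
  Adj p q := p ∈ D ∧ q ∈ D ∧ HugAdj P e p q
  symm := ⟨fun _ _ h => ⟨h.2.1, h.1, (hug P e).symm.symm _ _ h.2.2⟩⟩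
  loopless := ⟨fun p h => (hug P e).loopless.irrefl p h.2.2⟩

/-- A connected set of tiles of `P` that contains with each tile all tiles of its row on the
`e`-side of it remains connected in `hug P e`. -/
theorem hugOn_reachable {P D : Finset (ℤ × ℤ)} (hDP : D ⊆ P) {e : ℤ} (he : e = 1 ∨ e = -1)
    (hclosed : ∀ p ∈ D, (p.1 + e, p.2) ∈ P → (p.1 + e, p.2) ∈ D) (hD : Conn D)
    {p q : ℤ × ℤ} (hp : p ∈ D) (hq : q ∈ D) : (hugOn P D e).Reachable p q := by
  obtain ⟨B, hB⟩ := (P.image fun p => e * p.1).exists_le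
  have hB' : ∀ p ∈ P, e * p.1 ≤ B := fun p hp => hB _ (Finset.mem_image_of_mem _ hp)
  have hor : ∀ x y : ℤ, (x, y) ∈ D → (x + e, y) ∈ D → (hugOn P D e).Adj (x, y) (x + e, y) := by
    intro x y h1 h2
    refine ⟨h1, h2, hDP h1, hDP h2, ?_, .inl rfl⟩
    rw [gridGraph_adj_iff]
    rcases he with rfl | rfl
    · exact .inl rfl
    · exact .inr (.inl rfl)
  -- A vertical step is slid in direction `e` until one of the next tiles is missing; there it is an
  -- extreme contact. By `hclosed` the detour stays in `D`, and it ends before `e * x` exceeds `B`.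
  have ver : ∀ n : ℕ, ∀ x y y' : ℤ, gridGraph.Adj (x, y) (x, y') → (x, y) ∈ D → (x, y') ∈ D →
      B - e * x ≤ n → (hugOn P D e).Reachable (x, y) (x, y') := by
    intro n
    induction n with
    | zero =>
      intro x y y' ha h1 h2 hn
      refine SimpleGraph.Adj.reachable ⟨h1, h2, hDP h1, hDP h2, ha, .inr fun h => ?_⟩
      have h3 := hB' _ h.1
      have h4 : e * e = 1 := by rcases he with rfl | rfl <;> rfl
      dsimp only at h3
      rw [mul_add, h4] at h3
      push_cast at hn
      omega
    | succ n ih =>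
      intro x y y' ha h1 h2 hn
      by_cases h : (x + e, y) ∈ P ∧ (x + e, y') ∈ P
      · have h3 := hclosed _ h1 h.1
        have h4 := hclosed _ h2 h.2
        have ha' : gridGraph.Adj (x + e, y) (x + e, y') := by
          simp only [gridGraph, sub_self] at ha ⊢
          exact ha
        refine ((hor x y h1 h3).reachable.trans (ih _ _ _ ha' h3 h4 ?_)).trans
          (hor x y' h2 h4).symm.reachable
        have h4 : e * e = 1 := by rcases he with rfl | rfl <;> rfl
        rw [mul_add, h4]
        push_cast at hn
        omega
      · exact SimpleGraph.Adj.reachable ⟨h1, h2, hDP h1, hDP h2, ha, .inr h⟩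
  obtain ⟨w⟩ := hD p hp q hq
  clear hp hq
  induction w with
  | nil => exact SimpleGraph.Reachable.refl _
  | @cons a b c h w ih =>
    refine SimpleGraph.Reachable.trans ?_ ih
    obtain ⟨h1, h2, h3⟩ := h
    by_cases hrow : a.2 = b.2
    · exact SimpleGraph.Adj.reachable ⟨h1, h2, hDP h1, hDP h2, h3, .inl hrow⟩
    · obtain ⟨x, y⟩ := a
      obtain ⟨x', y'⟩ := b
      obtain rfl : x' = x := by
        rw [gridGraph_adj_iff] at h3
        simp only [Prod.mk.injEq] at h3 hrow
        omega
      exact ver (B - e * x').toNat _ _ _ h3 h1 h2 (Int.self_le_toNat _)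

/-- The parent of a tile of `D` in a spanning tree of `hug P e` with root in `D` is in `D`. -/
theorem hug_parent_mem {P D : Finset (ℤ × ℤ)} (hP : IsSimple P) (hDP : D ⊆ P) {e : ℤ}
    (he : e = 1 ∨ e = -1)
    (hclosed : ∀ p ∈ D, (p.1 + e, p.2) ∈ P → (p.1 + e, p.2) ∈ D) (hD : Conn D)
    {root : ℤ × ℤ} (hroot : root ∈ D) {par : ℤ × ℤ → ℤ × ℤ} {rank : ℤ × ℤ → ℕ}
    (hpar : ∀ v ∈ P, v ≠ root → HugAdj P e (par v) v ∧ rank (par v) < rank v)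
    {v : ℤ × ℤ} (hv : v ∈ D) (hne : v ≠ root) : par v ∈ D := by
  refine parent_mem_of_acyclic (D := D) (par := par) (rank := rank) (H := hugOn P D e) (U := P)
      (hug_isAcyclic hP he)
    (fun a b h => h.2.2) (fun a b h => h.2.1) (fun v hv hne => ?_) (hDP hv) hne
    (hugOn_reachable hDP he hclosed hD hv hroot)
  obtain ⟨h1, h2⟩ := hpar v hv hne
  exact ⟨h1.1, h1, h2⟩

end Polyomino


/-! ### Partitions of a polyomino into a left and a right part. -/

namespace Polyomino

/-- `P` is split into two connected parts, with `L` left of `R` in every row. -/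
structure HCut (P L R : Finset (ℤ × ℤ)) : Prop where
  nonempty_left : L.Nonempty
  nonempty_right : R.Nonempty
  disjoint : Disjoint L R
  union : L ∪ R = P
  order : ∀ p ∈ L, ∀ q ∈ R, p.2 = q.2 → p.1 < q.1
  conn_left : Conn L
  conn_right : Conn R

namespace HCut
variable {P L R : Finset (ℤ × ℤ)} (h : HCut P L R)
include h

theorem left_subset : L ⊆ P := h.union ▸ Finset.subset_union_left
theorem right_subset : R ⊆ P := h.union ▸ Finset.subset_union_right

theorem mem_or {p : ℤ × ℤ} (hp : p ∈ P) : p ∈ L ∨ p ∈ R := by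
  rwa [← h.union, Finset.mem_union] at hp

theorem not_mem_right {p : ℤ × ℤ} (hp : p ∈ L) : p ∉ R := Finset.disjoint_left.1 h.disjoint hp
theorem not_mem_left {p : ℤ × ℤ} (hp : p ∈ R) : p ∉ L := Finset.disjoint_right.1 h.disjoint hp

theorem left_closed {p q : ℤ × ℤ} (hp : p ∈ L) (hq : q ∈ P) (h2 : q.2 = p.2) (h1 : q.1 ≤ p.1) :
    q ∈ L := by
  rcases h.mem_or hq with h' | h'
  · exact h'
  · have := h.order p hp q h' h2.symm; omega

theorem right_closed {p q : ℤ × ℤ} (hp : p ∈ R) (hq : q ∈ P) (h2 : q.2 = p.2) (h1 : p.1 ≤ q.1) :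
    q ∈ R := by
  rcases h.mem_or hq with h' | h'
  · have := h.order q h' p hp h2; omega
  · exact h'
end HCut

/-- `q` is the next tile of `P` to the left of `p`, in the same row. -/
def IsPrev (P : Finset (ℤ × ℤ)) (q p : ℤ × ℤ) : Prop :=
  q ∈ P ∧ q.2 = p.2 ∧ q.1 < p.1 ∧ ∀ z ∈ P, z.2 = p.2 → z.1 < p.1 → z.1 ≤ q.1

/-- `par` is the parent function of a spanning tree of `hug P e` with root `root`. -/
def IsHugTree (P : Finset (ℤ × ℤ)) (e : ℤ) (root : ℤ × ℤ) (par : ℤ × ℤ → ℤ × ℤ) : Prop :=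
  par root = root ∧ ∃ rank : ℤ × ℤ → ℕ, ∀ v ∈ P, v ≠ root →
    HugAdj P e (par v) v ∧ rank (par v) < rank v

/-- If `u` is on the left of a cut, then so is `v`. -/
def Forces (P : Finset (ℤ × ℤ)) (pa pb : ℤ × ℤ → ℤ × ℤ) (u v : ℤ × ℤ) : Prop :=
  v ∈ P ∧ (IsPrev P v u ∨ v = pa u ∨ (gridGraph.Adj u v ∧ pb v = u))

/-- Both sides are closed under parents in the tree that hugs their own outer direction, by
`hug_parent_mem`. For `R` this is used in contrapositive form: a tile whose right parent is in `L`
cannot be in `R`. -/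
theorem HCut.forces {P L R : Finset (ℤ × ℤ)} (h : HCut P L R) (hP : IsSimple P)
    {l r : ℤ × ℤ} (hl : l ∈ L) (hr : r ∈ R) {pa pb : ℤ × ℤ → ℤ × ℤ}
    (ha : IsHugTree P (-1) l pa) (hb : IsHugTree P 1 r pb) {v : ℤ × ℤ}
    (hv : Relation.ReflTransGen (Forces P pa pb) l v) : v ∈ L := by
  induction hv with
  | refl => exact hl
  | @tail u v _ huv hu =>
    obtain ⟨hvP, h1 | rfl | ⟨h1, h2⟩⟩ := huv
    · exact h.left_closed hu hvP h1.2.1 h1.2.2.1.le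
    · obtain ⟨h0, rank, hrank⟩ := ha
      by_cases hul : u = l
      · rw [hul, h0]; exact hl
      · exact hug_parent_mem hP h.left_subset (.inr rfl)
          (fun p hp hpP => h.left_closed hp hpP rfl (by dsimp only; omega)) h.conn_left hl hrank
            hu hul
    · obtain ⟨h0, rank, hrank⟩ := hb
      rcases h.mem_or hvP with h' | h'
      · exact h'
      · exfalso
        -- The root `r` is its own parent; the adjacency required in `Forces` excludes this loop.
        by_cases hvr : v = r
        · subst hvr
          rw [h0] at h2
          exact h1.ne h2.symm
        · refine h.not_mem_right hu (h2 ▸ ?_)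
          exact hug_parent_mem hP h.right_subset (.inl rfl)
            (fun p hp hpP => h.right_closed hp hpP rfl (by dsimp only; omega)) h.conn_right hr hrank
            h' hvr

theorem conn_of_parent {P D : Finset (ℤ × ℤ)} (hDP : D ⊆ P) {e : ℤ} {root : ℤ × ℤ}
    {par : ℤ × ℤ → ℤ × ℤ} (hpar : IsHugTree P e root par)
    (h : ∀ v ∈ D, v ≠ root → par v ∈ D) : Conn D := by
  obtain ⟨_, rank, hrank⟩ := hpar
  have key : ∀ n : ℕ, ∀ v ∈ D, rank v ≤ n → (pg D).Reachable v root := by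
    intro n
    induction n with
    | zero =>
      intro v hv hn
      by_cases hvr : v = root
      · rw [hvr]
      · have := (hrank v (hDP hv) hvr).2; omega
    | succ n ih =>
      intro v hv hn
      by_cases hvr : v = root
      · rw [hvr]
      · obtain ⟨h1, h2⟩ := hrank v (hDP hv) hvr
        have h3 := h v hv hvr
        exact SimpleGraph.Reachable.trans (SimpleGraph.Adj.reachable ⟨hv, h3, h1.2.2.1.symm⟩)
          (ih _ h3 (by omega))
  intro p hp q hq
  exact (key _ p hp le_rfl).trans (key _ q hq le_rfl).symm

theorem left_closed_of_prev {P L : Finset (ℤ × ℤ)} (h : ∀ p ∈ L, ∀ q, IsPrev P q p → q ∈ L)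
    {p q : ℤ × ℤ} (hp : p ∈ L) (hq : q ∈ P) (h2 : q.2 = p.2) (h1 : q.1 ≤ p.1) :
    q ∈ L := by
  obtain ⟨n, hn⟩ : ∃ n : ℕ, p.1 - q.1 ≤ n := ⟨_, Int.self_le_toNat _⟩
  induction n generalizing p with
  | zero =>
    have : q = p := Prod.ext (by push_cast at hn; omega) h2
    exact this ▸ hp
  | succ n ih =>
    by_cases hqp : q.1 = p.1
    · have : q = p := Prod.ext hqp h2
      exact this ▸ hp
    obtain ⟨z, hz, hmax⟩ := (P.filter fun z => z.2 = p.2 ∧ z.1 < p.1).exists_max_image Prod.fst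
      ⟨q, by simp only [Finset.mem_filter]; exact ⟨hq, h2, by omega⟩⟩
    simp only [Finset.mem_filter] at hz hmax
    have hprev : IsPrev P z p :=
      ⟨hz.1, hz.2.1, hz.2.2, fun z' h1 h2 h3 => hmax z' ⟨h1, h2, h3⟩⟩
    refine ih (h p hp z hprev) (h2.trans hz.2.1.symm) (hmax q ⟨hq, h2, by omega⟩) ?_
    push_cast at hn
    omega

/-- The three kinds of closure give the three properties of a cut: previous tiles give the order in
the rows, left parents connect `L` to `l`, and closure of `L` under right children is closure of `P
\ L` under right parents, which connects it to `r`. -/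
theorem hcut_of_forces {P L : Finset (ℤ × ℤ)} {l r : ℤ × ℤ} (hlP : l ∈ P) (hrP : r ∈ P)
    {pa pb : ℤ × ℤ → ℤ × ℤ}
    (ha : IsHugTree P (-1) l pa) (hb : IsHugTree P 1 r pb)
    (hL : ∀ v, v ∈ L ↔ v ∈ P ∧ Relation.ReflTransGen (Forces P pa pb) l v) (hr : r ∉ L) :
    HCut P L (P \ L) := by
  have hLP : L ⊆ P := fun v hv => ((hL v).1 hv).1
  have hl : l ∈ L := (hL l).2 ⟨hlP, .refl⟩
  have hclosed : ∀ u ∈ L, ∀ v, Forces P pa pb u v → v ∈ L := fun u hu v huv =>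
    (hL v).2 ⟨huv.1, ((hL u).1 hu).2.tail huv⟩
  refine ⟨⟨l, hl⟩, ⟨r, Finset.mem_sdiff.2 ⟨hrP, hr⟩⟩, Finset.disjoint_sdiff,
    Finset.union_sdiff_of_subset hLP, ?_, ?_, ?_⟩
  · intro p hp q hq h2
    rw [Finset.mem_sdiff] at hq
    by_contra hcon
    exact hq.2 (left_closed_of_prev (fun p hp q hq => hclosed p hp q ⟨hq.1, .inl hq⟩) hp hq.1
      h2.symm (by omega))
  · refine conn_of_parent hLP ha fun v hv hne => hclosed v hv _ ⟨?_, .inr (.inl rfl)⟩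
    obtain ⟨_, rank, hrank⟩ := ha
    exact (hrank v (hLP hv) hne).1.1
  · refine conn_of_parent Finset.sdiff_subset hb fun v hv hne => ?_
    obtain ⟨_, rank, hrank⟩ := hb
    rw [Finset.mem_sdiff] at hv ⊢
    have h1 := (hrank v hv.1 hne).1
    refine ⟨h1.1, fun h => hv.2 (hclosed _ h v ⟨hv.1, .inr (.inr ⟨h1.2.2.1, rfl⟩)⟩)⟩

/-! ### Cutting off a single tile -/

/-- A single tile that is cut off by a valid cut. -/
def Bite (P : Finset (ℤ × ℤ)) (t : ℤ × ℤ) : Prop :=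
  t ∈ P ∧ (∀ q ∈ P, q.2 = t.2 → t.1 ≤ q.1) ∧ ¬ LocallyReflex P t ∧
    ¬ ((t.1, t.2 + 1) ∈ P ∧ (t.1, t.2 - 1) ∈ P ∧ (t.1 + 1, t.2) ∉ P)

theorem diag_mem {P : Finset (ℤ × ℤ)} {x y dx dy : ℤ} (h : ¬ LocallyReflex P (x, y))
    (hx : dx = 1 ∨ dx = -1) (hy : dy = 1 ∨ dy = -1) (h0 : (x, y) ∈ P) (h1 : (x + dx, y) ∈ P)
    (h2 : (x, y + dy) ∈ P) : (x + dx, y + dy) ∈ P := by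
  by_contra h3
  exact h ⟨h0, dx, dy, hx, hy, h1, h2, h3⟩

theorem eq_right_of_adj {p q : ℤ × ℤ} (h : gridGraph.Adj p q) (hlt : p.1 < q.1) :
    q = (p.1 + 1, p.2) := by
  rw [gridGraph_adj_iff] at h
  rcases h with rfl | rfl | rfl | rfl
  · rfl
  all_goals dsimp only at hlt; omega

theorem reachable_of_adj {P : Finset (ℤ × ℤ)} {p q : ℤ × ℤ} (hp : p ∈ P) (hq : q ∈ P)
    (h : gridGraph.Adj p q) : (pg P).Reachable p q :=
  SimpleGraph.Adj.reachable (G := pg P) ⟨hp, hq, h⟩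

/-- Removing `t` keeps its neighbours connected: there is none on the left, the right one is joined
to the upper and to the lower one through a diagonal tile since `t` is not locally reflex, and the
upper and lower ones are joined via the right one. So walks can be rerouted around `t`. -/
theorem Bite.hcut {P : Finset (ℤ × ℤ)} (hP : Conn P) (hcard : 2 ≤ P.card) {t : ℤ × ℤ}
    (ht : Bite P t) : HCut P {t} (P.erase t) := by
  obtain ⟨htP, hleft, hreflex, hud⟩ := ht
  obtain ⟨x, y⟩ := t
  refine ⟨by simp, ?_, by simp, ?_, ?_, ?_, ?_⟩
  · rw [← Finset.card_pos, Finset.card_erase_of_mem htP]; omega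
  · rw [← Finset.insert_eq, Finset.insert_erase htP]
  · intro p hp q hq h2
    rw [Finset.mem_singleton] at hp
    subst hp
    rw [Finset.mem_erase] at hq
    have := hleft q hq.2 h2.symm
    refine lt_of_le_of_ne this fun h => hq.1 (Prod.ext h.symm h2.symm)
  · intro p hp q hq
    rw [Finset.mem_singleton] at hp hq
    rw [hp, hq]
  · have hnl : (x - 1, y) ∉ P := fun h => by have := hleft _ h rfl; dsimp only at this; omega
    have hadj : ∀ a b c d : ℤ, (a, b) ∈ P → (c, d) ∈ P → (a, b) ≠ (x, y) → (c, d) ≠ (x, y) →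
        gridGraph.Adj (a, b) (c, d) → (pg (P.erase (x, y))).Reachable (a, b) (c, d) :=
      fun a b c d h1 h2 h3 h4 h5 => reachable_of_adj (Finset.mem_erase.2 ⟨h3, h1⟩)
        (Finset.mem_erase.2 ⟨h4, h2⟩) h5
    have hr : ∀ d : ℤ, d = 1 ∨ d = -1 → (x + 1, y) ∈ P → (x, y + d) ∈ P →
        (pg (P.erase (x, y))).Reachable (x + 1, y) (x, y + d) := by
      intro d hd h1 h2
      have h3 := diag_mem hreflex (.inl rfl) hd htP h1 h2
      have hd0 : d ≠ 0 := by rintro rfl; omega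
      refine (hadj _ _ (x + 1) (y + d) h1 h3 (by simp) (by simp) ?_).trans
        (hadj _ _ _ _ h3 h2 (by simp) (by simp [hd0]) ?_)
      · rw [gridGraph_adj_iff]; rcases hd with rfl | rfl <;> simp [sub_eq_add_neg]
      · rw [gridGraph_adj_iff]; simp
    have nbr : ∀ a ∈ P, ∀ b ∈ P, gridGraph.Adj (x, y) a → gridGraph.Adj (x, y) b →
        (pg (P.erase (x, y))).Reachable a b := by
      intro a ha b hb h1 h2
      rw [gridGraph_adj_iff] at h1 h2
      have hu := hr 1 (.inl rfl)
      have hd := hr (-1) (.inr rfl)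
      rw [← sub_eq_add_neg] at hd
      dsimp only at h1 h2 hud
      rcases h1 with rfl | rfl | rfl | rfl <;> rcases h2 with rfl | rfl | rfl | rfl <;>
        first
        | exact SimpleGraph.Reachable.refl _
        | exact absurd ha hnl
        | exact absurd hb hnl
        | exact hu ha hb
        | exact hd ha hb
        | exact (hu hb ha).symm
        | exact (hd hb ha).symm
        | skip
      · by_cases h : (x + 1, y) ∈ P
        · exact (hu h ha).symm.trans (hd h hb)
        · exact absurd ⟨ha, hb, h⟩ hud
      · by_cases h : (x + 1, y) ∈ P
        · exact (hd h ha).symm.trans (hu h hb)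
        · exact absurd ⟨hb, ha, h⟩ hud
    -- Rerouting by induction on the walk: when the walk stands at the removed tile, every neighbour
    -- of that tile in `P` can already reach the end.
    have key : ∀ p q : ℤ × ℤ, (pg P).Walk p q → q ≠ (x, y) →
        (p ≠ (x, y) → (pg (P.erase (x, y))).Reachable p q) ∧
        (p = (x, y) → ∀ a ∈ P, gridGraph.Adj (x, y) a →
          (pg (P.erase (x, y))).Reachable a q) := by
      intro p q w
      induction w with
      | nil => exact fun hq => ⟨fun _ => SimpleGraph.Reachable.refl _, fun h => absurd h hq⟩
      | @cons a b c h w ih =>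
        intro hq
        obtain ⟨ih1, ih2⟩ := ih hq
        obtain ⟨haP, hbP, hab⟩ := h
        refine ⟨fun ha => ?_, ?_⟩
        · by_cases hb : b = (x, y)
          · subst hb
            exact ih2 rfl a haP hab.symm
          · exact (reachable_of_adj (Finset.mem_erase.2 ⟨ha, haP⟩)
              (Finset.mem_erase.2 ⟨hb, hbP⟩) hab).trans (ih1 hb)
        · rintro rfl a' ha' h'
          exact (nbr a' ha' b hbP h' hab).trans (ih1 hab.ne')
    intro p hp q hq
    rw [Finset.mem_erase] at hp hq
    obtain ⟨w⟩ := hP p hp.2 q hq.2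
    exact (key p q w hq.1).1 hp.1

/-- Without a bite, the leftmost tile of a row that meets `L` has tiles above and below it and none
on its right. As `L` has no locally reflex tiles, this propagates: `L` is a piece of one column
without horizontal neighbours in `P`, continued by tiles of `R` at both ends. Since `R` is
connected, the column closes up to a ring, and a ring in a hole-free polyomino is impossible. -/
theorem HCut.exists_bite {P L R : Finset (ℤ × ℤ)} (h : HCut P L R) (hP : IsSimple P)
    (hL : ∀ t ∈ L, ¬ LocallyReflex P t) : ∃ t, Bite P t := by
  by_contra hcon
  push Not at hcon
  have hmin : ∀ p ∈ L, (∀ q ∈ P, q.2 = p.2 → p.1 ≤ q.1) →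
      (p.1, p.2 + 1) ∈ P ∧ (p.1, p.2 - 1) ∈ P ∧ (p.1 + 1, p.2) ∉ P := by
    intro p hp h1
    by_contra h2
    exact hcon p ⟨h.left_subset hp, h1, hL p hp, h2⟩
  obtain ⟨p, hp⟩ := h.nonempty_left
  obtain ⟨t, ht, htmin⟩ := (P.filter fun z => z.2 = p.2).exists_min_image Prod.fst
    ⟨p, by simp [h.left_subset hp]⟩
  simp only [Finset.mem_filter] at ht htmin
  have htL : t ∈ L := h.left_closed hp ht.1 ht.2 (htmin p ⟨h.left_subset hp, rfl⟩)
  have htmin' : ∀ q ∈ P, q.2 = t.2 → t.1 ≤ q.1 := fun q hq h2 => htmin q ⟨hq, h2.trans ht.2⟩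
  -- all of `L` lies in one column and has no horizontal neighbours
  have hcol : ∀ a b : ℤ × ℤ, (pg L).Walk a b → a.1 = t.1 → (a.1 - 1, a.2) ∉ P →
      (a.1 + 1, a.2) ∉ P → b.1 = t.1 ∧ (b.1 - 1, b.2) ∉ P ∧ (b.1 + 1, b.2) ∉ P := by
    intro a b w
    induction w with
    | nil => exact fun h1 h2 h3 => ⟨h1, h2, h3⟩
    | @cons a b c hab w ih =>
      intro h1 h2 h3
      obtain ⟨haL, hbL, hab⟩ := hab
      have haP := h.left_subset haL
      have hbP := h.left_subset hbL
      have hb := hL b hbL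
      obtain ⟨x, y⟩ := a
      rw [gridGraph_adj_iff] at hab
      dsimp only at h1 h2 h3 hab
      rcases hab with rfl | rfl | rfl | rfl
      · exact absurd hbP h3
      · exact absurd hbP h2
      · refine ih h1 (fun h5 => h2 ?_) (fun h5 => h3 ?_)
        · have := diag_mem hb (.inr rfl) (.inr rfl) hbP h5 (by simpa using haP)
          simpa [sub_eq_add_neg] using this
        · have := diag_mem hb (.inl rfl) (.inr rfl) hbP h5 (by simpa using haP)
          simpa using this
      · refine ih h1 (fun h5 => h2 ?_) (fun h5 => h3 ?_)
        · have := diag_mem hb (.inr rfl) (.inl rfl) hbP h5 (by simpa using haP)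
          simpa [sub_eq_add_neg] using this
        · have := diag_mem hb (.inl rfl) (.inl rfl) hbP h5 (by simpa using haP)
          simpa using this
  have hcol' : ∀ b ∈ L, b.1 = t.1 ∧ (b.1 - 1, b.2) ∉ P ∧ (b.1 + 1, b.2) ∉ P := by
    intro b hb
    obtain ⟨w⟩ := h.conn_left t htL b hb
    refine hcol t b w rfl (fun h1 => ?_) (hmin t htL htmin').2.2
    have := htmin' _ h1 rfl
    dsimp only at this
    omega
  have hud : ∀ b ∈ L, (b.1, b.2 + 1) ∈ P ∧ (b.1, b.2 - 1) ∈ P := by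
    intro b hb
    have := hmin b hb fun q hq h2 => by
      by_contra h3
      have := (hcol' q (h.left_closed hb hq h2 (by omega))).1
      have := (hcol' b hb).1
      omega
    exact ⟨this.1, this.2.1⟩
  obtain ⟨a, ha, hamax⟩ := L.exists_max_image Prod.snd h.nonempty_left
  obtain ⟨b, hb, hbmin⟩ := L.exists_min_image Prod.snd h.nonempty_left
  have haR : (a.1, a.2 + 1) ∈ R := (h.mem_or (hud a ha).1).resolve_left fun h1 => by
    have := hamax _ h1; dsimp only at this; omega
  have hbR : (b.1, b.2 - 1) ∈ R := (h.mem_or (hud b hb).2).resolve_left fun h1 => by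
    have := hbmin _ h1; dsimp only at this; omega
  obtain ⟨w1⟩ := h.conn_left a ha b hb
  obtain ⟨w2⟩ := h.conn_right _ hbR _ haR
  obtain ⟨x, y⟩ := a
  have hab : (pg P).Adj b (b.1, b.2 - 1) :=
    ⟨h.left_subset hb, (hud b hb).2, by rw [gridGraph_adj_iff]; simp⟩
  have hba : (pg P).Adj (x, y + 1) (x, y) :=
    ⟨(hud _ ha).1, h.left_subset ha, by rw [gridGraph_adj_iff]; simp⟩
  -- The ring: down the column and back through `R`. It passes once through the upper side of `(x,
  -- y)`, whose two ends are both non-interior, so their winding numbers should agree.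
  let w : (pg P).Walk (x, y + 1) (x, y + 1) := .cons hba
    ((w1.mapLe (pg_mono h.left_subset)).append (.cons hab (w2.mapLe (pg_mono h.right_subset))))
  have hw1 : winding w (x, y + 1) = 0 :=
    winding_eq_zero hP le_rfl w (nonInterior_iff.2 (.inr (.inr (.inr (by
      have := (hcol' _ ha).2.1; simpa using this)))))
  have hw2 : winding w (x + 1, y + 1) = 0 :=
    winding_eq_zero hP le_rfl w (nonInterior_iff.2 (.inr (.inr (.inl (by
      have := (hcol' _ ha).2.2; simpa using this)))))
  have hw := winding_right (G := pg P) (fun a b h => h.2.2) w x (y + 1)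
  have haR' := h.not_mem_right ha
  have haL' := h.not_mem_left haR
  rw [hw1, hw2, zero_add, add_sub_cancel_right] at hw
  simp only [w, flux, flux_append, flux_mapLe] at hw
  rw [flux_through_of_notMem le_rfl w1 (.inr haL'), flux_through_of_notMem le_rfl w2 (.inl haR')]
    at hw
  have hby : (b.1, b.2 - 1) ≠ (x, y + 1) := fun h1 => by
    have := hbmin _ ha
    simp only [Prod.mk.injEq] at h1
    dsimp only at this; omega
  have hbne : b ≠ (x, y + 1) := fun h1 => haL' (h1 ▸ hb)
  simp [through, hby, hbne] at hw

/-- Column convex polyominoes can be cut along a column. -/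
theorem exists_hcut_of_columnConvex {P : Finset (ℤ × ℤ)} (hP : Conn P) (hc : ColumnConvex P)
    (hr : ¬ RowConvex P) : ∃ L R, HCut P L R := by
  unfold RowConvex at hr
  push Not at hr
  obtain ⟨y, x₁, x, x₂, h1, h2, h3, h4, h5⟩ := hr
  -- The leftmost column is cut off. A gap in a row forces two different columns, so something
  -- remains on the right.
  obtain ⟨m, hm, hmin⟩ := P.exists_min_image Prod.fst ⟨_, h1⟩
  have hcolumn : ∀ D : Finset (ℤ × ℤ), ColumnConvex D → ∀ n : ℕ, ∀ x y y' : ℤ, (x, y) ∈ D →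
      (x, y') ∈ D → y' - y = n → (pg D).Reachable (x, y) (x, y') := by
    intro D hD n
    induction n with
    | zero => intro x y y' h1 h2 h3; obtain rfl : y' = y := by push_cast at h3; omega
              exact SimpleGraph.Reachable.refl _
    | succ n ih =>
      intro x y y' h1 h2 h3
      push_cast at h3
      have h4 := hD x y (y + 1) y' h1 h2 (by omega) (by omega)
      exact (reachable_of_adj h1 h4 (by rw [gridGraph_adj_iff]; simp)).trans
        (ih x (y + 1) y' h4 h2 (by omega))
  have hcolumn' : ∀ D : Finset (ℤ × ℤ), ColumnConvex D → ∀ x y y' : ℤ, (x, y) ∈ D →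
      (x, y') ∈ D → (pg D).Reachable (x, y) (x, y') := by
    intro D hD x y y' h1 h2
    rcases le_total y y' with h | h
    · exact hcolumn D hD (y' - y).toNat x y y' h1 h2 (by omega)
    · exact (hcolumn D hD (y - y').toNat x y' y h2 h1 (by omega)).symm
  have hcL : ColumnConvex (P.filter fun p => p.1 = m.1) := by
    intro x y₁ y y₂ h1 h2 h3 h4
    simp only [Finset.mem_filter] at h1 h2 ⊢
    exact ⟨hc x y₁ y y₂ h1.1 h2.1 h3 h4, h1.2⟩
  have hcR : ColumnConvex (P.filter fun p => ¬ p.1 = m.1) := by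
    intro x y₁ y y₂ h1 h2 h3 h4
    simp only [Finset.mem_filter] at h1 h2 ⊢
    exact ⟨hc x y₁ y y₂ h1.1 h2.1 h3 h4, h1.2⟩
  have h12 : x₁ ≠ x₂ := by
    rintro rfl
    obtain rfl : x = x₁ := by omega
    exact h5 h1
  refine ⟨P.filter fun p => p.1 = m.1, P.filter fun p => ¬ p.1 = m.1, ⟨m, by simp [hm]⟩, ?_,
    Finset.disjoint_filter_filter_not _ _ _, Finset.filter_union_filter_not_eq _ _, ?_, ?_, ?_⟩
  · by_cases h : x₁ = m.1
    · exact ⟨(x₂, y), by simp only [Finset.mem_filter]; exact ⟨h2, by omega⟩⟩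
    · exact ⟨(x₁, y), by simp only [Finset.mem_filter]; exact ⟨h1, h⟩⟩
  · intro p hp q hq h
    simp only [Finset.mem_filter] at hp hq
    have := hmin q hq.1
    omega
  · rintro ⟨a, b⟩ hp ⟨c, d⟩ hq
    obtain rfl : a = c := by
      simp only [Finset.mem_filter] at hp hq; omega
    exact hcolumn' _ hcL _ _ _ hp hq
  -- An excursion into the leftmost column leaves from and returns to the second column, which is
  -- connected by column convexity; it is replaced by a vertical move there.
  · have key : ∀ p q : ℤ × ℤ, (pg P).Walk p q → q.1 ≠ m.1 →
        (p.1 ≠ m.1 → (pg (P.filter fun p => ¬ p.1 = m.1)).Reachable p q) ∧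
        (p.1 = m.1 → ∀ y, (m.1 + 1, y) ∈ P →
          (pg (P.filter fun p => ¬ p.1 = m.1)).Reachable (m.1 + 1, y) q) := by
      intro p q w
      induction w with
      | nil => exact fun hq => ⟨fun _ => SimpleGraph.Reachable.refl _, fun h => absurd h hq⟩
      | @cons a b c h w ih =>
        intro hq
        obtain ⟨ih1, ih2⟩ := ih hq
        obtain ⟨haP, hbP, hab⟩ := h
        have ham := hmin a haP
        have hbm := hmin b hbP
        refine ⟨fun ha => ?_, fun ha y hy => ?_⟩
        · by_cases hb : b.1 = m.1
          · have h1 := eq_right_of_adj hab.symm (by omega)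
            rw [hb] at h1
            rw [h1]
            exact ih2 hb _ (h1 ▸ haP)
          · exact (reachable_of_adj (Finset.mem_filter.2 ⟨haP, ha⟩)
              (Finset.mem_filter.2 ⟨hbP, hb⟩) hab).trans (ih1 hb)
        · by_cases hb : b.1 = m.1
          · exact ih2 hb y hy
          · have h1 := eq_right_of_adj hab (by omega)
            rw [ha] at h1
            have h2 := ih1 hb
            rw [h1] at h2 hbP
            exact (hcolumn' _ hcR _ _ _ (Finset.mem_filter.2 ⟨hy, by simp⟩)
              (Finset.mem_filter.2 ⟨hbP, by simp⟩)).trans h2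
    intro p hp q hq
    simp only [Finset.mem_filter] at hp hq
    obtain ⟨w⟩ := hP p hp.1 q hq.1
    exact (key p q w hq.2).1 hp.2

end Polyomino


/-! ### The curve between the two sides of a cut. -/

namespace Polyomino

theorem HCut.exists_threshold {P L R : Finset (ℤ × ℤ)} (h : HCut P L R) :
    ∃ s : ℤ → ℤ, ∀ x y : ℤ, (x, y) ∈ P → ((x, y) ∈ L ↔ x < s y) := by
  have key : ∀ y : ℤ, ∃ s : ℤ, ∀ x : ℤ, (x, y) ∈ P → ((x, y) ∈ L ↔ x < s) := by
    intro y
    rcases (L.filter fun p => p.2 = y).eq_empty_or_nonempty with h0 | h0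
    · have h0' : ∀ x, (x, y) ∉ L := fun x hx => by
        have : (x, y) ∈ L.filter fun p => p.2 = y := by simp [hx]
        simp [h0] at this
      obtain ⟨B, hB⟩ := (P.image fun p => -p.1).exists_le
      -- In a row without tiles of `L`, any threshold that is not to the right of a tile of `P` will
      -- do.
      refine ⟨-B, fun x hx => ⟨fun h1 => absurd h1 (h0' x), fun h1 => ?_⟩⟩
      have := hB (-x) (Finset.mem_image.2 ⟨_, hx, rfl⟩)
      omega
    · obtain ⟨m, hm, hmax⟩ := Finset.exists_max_image _ Prod.fst h0
      simp only [Finset.mem_filter] at hm hmax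
      refine ⟨m.1 + 1, fun x hx => ⟨fun h1 => ?_, fun h1 => ?_⟩⟩
      · have := hmax _ ⟨h1, rfl⟩; dsimp only at this; omega
      · exact h.left_closed hm.1 hx hm.2.symm (by dsimp only; omega)
  choose s hs using key
  exact ⟨s, fun x y => hs y x⟩

/-- The corner after `c` on the curve that crosses the row `y` at `x = s y`. -/
def next (s : ℤ → ℤ) (c : ℤ × ℤ) : ℤ × ℤ :=
  if c.1 < s c.2 then (c.1 + 1, c.2) else if s c.2 < c.1 then (c.1 - 1, c.2) else (c.1, c.2 + 1)

/-- The tile on the left of the step from `c` to the next corner. -/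
def leftTile (s : ℤ → ℤ) (c : ℤ × ℤ) : ℤ × ℤ :=
  if c.1 < s c.2 then c else if s c.2 < c.1 then (c.1 - 1, c.2 - 1) else (c.1 - 1, c.2)

/-- The tile on the right of the step from `c` to the next corner. -/
def rightTile (s : ℤ → ℤ) (c : ℤ × ℤ) : ℤ × ℤ :=
  if c.1 < s c.2 then (c.1, c.2 - 1) else if s c.2 < c.1 then (c.1 - 1, c.2) else c

/-- `c` is on the curve that crosses the row `y` at `x = s y`. -/
def OnCurve (s : ℤ → ℤ) (c : ℤ × ℤ) : Prop :=
  (s (c.2 - 1) ≤ c.1 ∧ c.1 ≤ s c.2) ∨ (s c.2 ≤ c.1 ∧ c.1 ≤ s (c.2 - 1))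

theorem OnCurve.next {s : ℤ → ℤ} {c : ℤ × ℤ} (h : OnCurve s c) : OnCurve s (next s c) := by
  obtain ⟨i, j⟩ := c
  simp only [OnCurve, Polyomino.next] at h ⊢
  split_ifs with h1 h2
  · dsimp only at h1 ⊢; omega
  · dsimp only at h2 ⊢; omega
  · simp only [add_sub_cancel_right]
    omega

theorem next_adj (s : ℤ → ℤ) (c : ℤ × ℤ) : gridGraph.Adj c (next s c) := by
  rw [gridGraph_adj_iff, next]
  split_ifs <;> simp

/-- The order in which the curve visits the corners. -/
def Before (s : ℤ → ℤ) (a b : ℤ × ℤ) : Prop :=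
  a.2 < b.2 ∨ (a.2 = b.2 ∧ |b.1 - s b.2| < |a.1 - s a.2|)

theorem before_next (s : ℤ → ℤ) (c : ℤ × ℤ) : Before s c (next s c) := by
  obtain ⟨i, j⟩ := c
  simp only [Before, next]
  split_ifs with h1 h2
  · refine .inr ⟨rfl, ?_⟩
    dsimp only at h1 ⊢
    rw [abs_of_nonpos (by omega), abs_of_neg (by omega)]; omega
  · refine .inr ⟨rfl, ?_⟩
    dsimp only at h2 ⊢
    rw [abs_of_nonneg (by omega), abs_of_pos (by omega)]; omega
  · left; dsimp only; omega

theorem Before.trans {s : ℤ → ℤ} {a b c : ℤ × ℤ} (h1 : Before s a b) (h2 : Before s b c) :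
    Before s a c := by
  rcases h1 with h1 | ⟨h1, h1'⟩ <;> rcases h2 with h2 | ⟨h2, h2'⟩
  · exact .inl (h1.trans h2)
  · exact .inl (h2 ▸ h1)
  · exact .inl (h1 ▸ h2)
  · exact .inr ⟨h1.trans h2, h2'.trans h1'⟩

theorem before_iterate (s : ℤ → ℤ) (c : ℤ × ℤ) {i j : ℕ} (h : i < j) :
    Before s ((next s)^[i] c) ((next s)^[j] c) := by
  induction j with
  | zero => omega
  | succ j ih =>
    rw [Function.iterate_succ_apply']
    rcases Nat.lt_succ_iff_lt_or_eq.1 h with h | rfl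
    · exact (ih h).trans (before_next s _)
    · exact before_next s _

/-- The curve is simple: it climbs from row to row, and within a height it approaches `s`, so
`Before` strictly increases along it. -/
theorem iterate_next_injective (s : ℤ → ℤ) (c : ℤ × ℤ) :
    Function.Injective fun k : ℕ => (next s)^[k] c := by
  intro i j hij
  dsimp only at hij
  by_contra hne
  have irr : ∀ a, ¬ Before s a a := fun a h => by
    rcases h with h | h
    · exact lt_irrefl _ h
    · exact lt_irrefl _ h.2
  rcases Nat.lt_or_gt_of_ne hne with h | h
  · have := before_iterate s c h; rw [hij] at this; exact irr _ this
  · have := before_iterate s c h; rw [hij] at this; exact irr _ this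

/-- The corners visited in `m` steps from `c`. -/
def trace (s : ℤ → ℤ) (c : ℤ × ℤ) (m : ℕ) : List (ℤ × ℤ) :=
  (List.range (m + 1)).map fun k => (next s)^[k] c

theorem trace_getElem? (s : ℤ → ℤ) (c : ℤ × ℤ) (m k : ℕ) :
    (trace s c m)[k]? = if k < m + 1 then some ((next s)^[k] c) else none := by
  rw [trace, List.getElem?_map]
  split_ifs with h
  · rw [List.getElem?_range h]; rfl
  · rw [List.getElem?_eq_none (by simpa using h)]; rfl

theorem pair_infix_iff {α : Type*} {l : List α} {u w : α} :
    [u, w] <:+: l ↔ ∃ k, l[k]? = some u ∧ l[k + 1]? = some w := by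
  constructor
  · rintro ⟨a, b, rfl⟩
    refine ⟨a.length, ?_, ?_⟩
    · simp
    · rw [List.append_assoc, List.getElem?_append_right (by omega)]; simp
  · rintro ⟨k, h1, h2⟩
    refine ⟨l.take k, l.drop (k + 2), ?_⟩
    apply List.ext_getElem?
    intro i
    obtain ⟨hk, -⟩ := List.getElem?_eq_some_iff.1 h2
    rcases lt_trichotomy i k with h | rfl | h
    · rw [List.append_assoc, List.getElem?_append_left (by rw [List.length_take]; omega),
        List.getElem?_take_of_lt h]
    · rw [h1, List.append_assoc, List.getElem?_append_right (by rw [List.length_take]; omega),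
        List.length_take, min_eq_left (by omega)]
      simp
    · rw [List.append_assoc, List.getElem?_append_right (by rw [List.length_take]; omega),
        List.length_take, min_eq_left (by omega)]
      obtain ⟨d, rfl⟩ : ∃ d, i = k + 1 + d := ⟨i - (k + 1), by omega⟩
      rw [show k + 1 + d - k = d + 1 by omega]
      rcases d with _ | d
      · simp [h2]
      · simp only [List.cons_append, List.nil_append, List.getElem?_cons_succ, List.getElem?_drop]
        congr 1; omega

/-- A step that starts the boundary between the two sides of the curve. -/
structure IsStart (P : Finset (ℤ × ℤ)) (s : ℤ → ℤ) (c : ℤ × ℤ) : Prop where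
  onCurve : OnCurve s c
  left_mem : leftTile s c ∈ P
  right_mem : rightTile s c ∈ P

section trace
variable {P L R : Finset (ℤ × ℤ)} {s : ℤ → ℤ}

theorem tiles_adj (s : ℤ → ℤ) (c : ℤ × ℤ) : gridGraph.Adj (leftTile s c) (rightTile s c) := by
  rw [gridGraph_adj_iff, leftTile, rightTile]
  split_ifs <;> simp

/-- Along the curve, the winding number changes by the net number of passages from its left side to
its right side, whichever way the step points. -/
theorem winding_next {G : SimpleGraph (ℤ × ℤ)} (hG : G ≤ gridGraph) {u : ℤ × ℤ} (w : G.Walk u u)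
    (s : ℤ → ℤ) (c : ℤ × ℤ) :
    winding w (next s c) = winding w c + flux (through (leftTile s c) (rightTile s c)) w := by
  obtain ⟨i, j⟩ := c
  simp only [next, leftTile, rightTile]
  split_ifs with h1 h2
  · rw [winding_right hG w i j, add_assoc, ← flux_add, flux_zero, add_zero]
    intro a b _
    simp only [through]; ring
  · have := winding_right hG w (i - 1) j
    rwa [sub_add_cancel] at this
  · exact winding_up hG w i j

theorem mem_of_interior {c : ℤ × ℤ} (h : ¬ NonInterior P c) (s : ℤ → ℤ) :
    leftTile s c ∈ P ∧ rightTile s c ∈ P := by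
  obtain ⟨i, j⟩ := c
  rw [nonInterior_iff] at h
  push Not at h
  simp only [leftTile, rightTile]
  split_ifs
  · exact ⟨h.1, h.2.2.1⟩
  · exact ⟨h.2.2.2, h.2.1⟩
  · exact ⟨h.2.1, h.1⟩

variable (h : HCut P L R) (hs : ∀ x y : ℤ, (x, y) ∈ P → ((x, y) ∈ L ↔ x < s y))
include h hs

omit h in
theorem IsStart.left {c : ℤ × ℤ} (hc : IsStart P s c) : leftTile s c ∈ L := by
  obtain ⟨h1, h2, h3⟩ := hc
  obtain ⟨i, j⟩ := c
  simp only [OnCurve, leftTile, rightTile] at h1 h2 h3 ⊢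
  split_ifs at h2 ⊢ with h4 h5
  · exact (hs _ _ h2).2 h4
  · exact (hs _ _ h2).2 (by omega)
  · exact (hs _ _ h2).2 (by omega)

theorem IsStart.right {c : ℤ × ℤ} (hc : IsStart P s c) : rightTile s c ∈ R := by
  obtain ⟨h1, h2, h3⟩ := hc
  obtain ⟨i, j⟩ := c
  refine (h.mem_or h3).resolve_left fun h6 => ?_
  simp only [OnCurve, leftTile, rightTile] at h1 h2 h3 h6
  split_ifs at h3 h6 with h4 h5
  · have := (hs _ _ h3).1 h6; omega
  · have := (hs _ _ h3).1 h6; omega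
  · have := (hs _ _ h3).1 h6; omega

omit h hs in
-- At an interior corner all four cells belong to `P`, so the next step again runs between two
-- tiles.
theorem isStart_iterate {c : ℤ × ℤ} (hc : IsStart P s c) {m : ℕ}
    (hint : ∀ k, 0 < k → k < m → ¬ NonInterior P ((next s)^[k] c)) {k : ℕ} (hk : k < m) :
    IsStart P s ((next s)^[k] c) := by
  have hon : ∀ k, OnCurve s ((next s)^[k] c) := by
    intro k
    induction k with
    | zero => exact hc.onCurve
    | succ k ih => rw [Function.iterate_succ_apply']; exact ih.next
  rcases Nat.eq_zero_or_pos k with rfl | hk0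
  · exact hc
  · have := mem_of_interior (hint k hk0 hk) s
    exact ⟨hon k, this.1, this.2⟩

/-- Otherwise cross from `p` to `q`, go within `R` to the right tile of the first step, cross to its
left tile, and go back within `L` to `p`. This closed walk meets the traced curve only from right to
left, and at least at the first step, so the winding number drops between the two ends of the curve.
Both ends are non-interior, where it is zero. -/
theorem trace_separates {c : ℤ × ℤ} (hP : IsSimple P) (hc : IsStart P s c) {m : ℕ} (hm : 0 < m)
    (h0 : NonInterior P c) (h1 : NonInterior P ((next s)^[m] c))
    (hint : ∀ k, 0 < k → k < m → ¬ NonInterior P ((next s)^[k] c)) {p q : ℤ × ℤ} (hp : p ∈ L)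
    (hq : q ∈ R) (hpq : gridGraph.Adj p q) :
    ∃ k < m, p = leftTile s ((next s)^[k] c) ∧ q = rightTile s ((next s)^[k] c) := by
  by_contra hcon
  push Not at hcon
  obtain ⟨w1⟩ := h.conn_right q hq _ (hc.right h hs)
  obtain ⟨w2⟩ := h.conn_left _ (hc.left hs) p hp
  have hpq' : (pg P).Adj p q := ⟨h.left_subset hp, h.right_subset hq, hpq⟩
  have hrl : (pg P).Adj (rightTile s c) (leftTile s c) :=
    ⟨hc.right_mem, hc.left_mem, (tiles_adj s c).symm⟩
  let w : (pg P).Walk p p := .cons hpq' ((w1.mapLe (pg_mono h.right_subset)).append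
    (.cons hrl (w2.mapLe (pg_mono h.left_subset))))
  -- The parts of the walk inside `L` and inside `R` contribute nothing, and the crossing from `p`
  -- to `q` contributes nothing by assumption.
  have hle : ∀ k < m, flux (through (leftTile s ((next s)^[k] c)) (rightTile s ((next s)^[k] c))) w
      ≤ (if k = 0 then -1 else 0) := by
    intro k hk
    have hst := isStart_iterate hc hint hk
    have hl := hst.left hs
    have hr := hst.right h hs
    simp only [w, flux, flux_append, flux_mapLe]
    rw [flux_through_of_notMem le_rfl w1 (.inl (h.not_mem_right hl)),
      flux_through_of_notMem le_rfl w2 (.inr (h.not_mem_left hr))]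
    have e1 : ¬ (p = leftTile s ((next s)^[k] c) ∧ q = rightTile s ((next s)^[k] c)) :=
      fun h => hcon k hk h.1 h.2
    have e2 : ¬ (p = rightTile s ((next s)^[k] c) ∧ q = leftTile s ((next s)^[k] c)) :=
      fun h' => h.not_mem_right hp (h'.1 ▸ hr)
    have e3 : ¬ (rightTile s c = leftTile s ((next s)^[k] c) ∧
        leftTile s c = rightTile s ((next s)^[k] c)) :=
      fun h' => h.not_mem_right hl (h'.1 ▸ hc.right h hs)
    unfold through
    rw [if_neg e1, if_neg e2, if_neg e3]
    rcases Nat.eq_zero_or_pos k with rfl | hk0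
    · simp
    · rw [if_neg (by omega : ¬ k = 0)]
      split_ifs <;> simp
  have hsum : ∀ n ≤ m, 0 < n → winding w ((next s)^[n] c) ≤ winding w c - 1 := by
    intro n
    induction n with
    | zero => intro _ h; omega
    | succ n ih =>
      intro hn _
      rw [Function.iterate_succ_apply', winding_next (G := pg P) (fun a b h => h.2.2) w s]
      have := hle n (by omega)
      rcases Nat.eq_zero_or_pos n with rfl | hn0
      · simp only [Function.iterate_zero, id_eq, if_true] at this ⊢
        omega
      · rw [if_neg (by omega)] at this
        have := ih (by omega) hn0
        omega
  have := hsum m le_rfl hm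
  rw [winding_eq_zero hP le_rfl w h0, winding_eq_zero hP le_rfl w h1] at this
  omega

omit h hs in
theorem eq_tiles_of_separates {c : ℤ × ℤ} {p q : ℤ × ℤ} (hpq : gridGraph.Adj p q)
    (h1 : TileCorner c p) (h2 : TileCorner c q) (h3 : TileCorner (next s c) p)
    (h4 : TileCorner (next s c) q) :
    (p = leftTile s c ∧ q = rightTile s c) ∨ (q = leftTile s c ∧ p = rightTile s c) := by
  obtain ⟨i, j⟩ := c
  obtain ⟨a, b⟩ := p
  rw [gridGraph_adj_iff] at hpq
  simp only [TileCorner, next, leftTile, rightTile] at h1 h2 h3 h4 ⊢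
  rcases hpq with rfl | rfl | rfl | rfl <;> split_ifs at h3 h4 ⊢ <;>
    simp only [Prod.mk.injEq] at * <;> omega

/-- Each traced step separates a tile of `L` from one of `R`, so it cuts no contact inside a side;
by `trace_separates` all contacts between the sides are cut. The pieces are then `L` and `R`, as
both are connected. -/
theorem isTwoCut_trace {c : ℤ × ℤ} (hP : IsSimple P) (hc : IsStart P s c) {m : ℕ} (hm : 0 < m)
    (h0 : NonInterior P c) (h1 : NonInterior P ((next s)^[m] c))
    (hint : ∀ k, 0 < k → k < m → ¬ NonInterior P ((next s)^[k] c)) :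
    IsTwoCut P (trace s c m) L R := by
  have hsep : ∀ p q, gridGraph.Adj p q → Separates (trace s c m) p q →
      (p ∈ L ∧ q ∈ R) ∨ (q ∈ L ∧ p ∈ R) := by
    rintro p q hpq ⟨u, w, hi, h1, h2, h3, h4⟩
    rw [pair_infix_iff] at hi
    obtain ⟨k, hu, hw⟩ := hi
    rw [trace_getElem?] at hu hw
    split_ifs at hu hw with hk1 hk2
    simp only [Option.some.injEq] at hu hw
    subst hu hw
    rw [Function.iterate_succ_apply'] at h3 h4
    have hst := isStart_iterate hc hint (k := k) (by omega)
    rcases eq_tiles_of_separates hpq h1 h2 h3 h4 with ⟨rfl, rfl⟩ | ⟨rfl, rfl⟩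
    · exact .inl ⟨hst.left hs, hst.right h hs⟩
    · exact .inr ⟨hst.left hs, hst.right h hs⟩
  have hcut : ∀ p ∈ L, ∀ q ∈ R, gridGraph.Adj p q → Separates (trace s c m) p q := by
    intro p hp q hq hpq
    obtain ⟨k, hk, rfl, rfl⟩ := trace_separates h hs hP hc hm h0 h1 hint hp hq hpq
    refine ⟨(next s)^[k] c, (next s)^[k + 1] c, ?_, ?_⟩
    · rw [pair_infix_iff]
      exact ⟨k, by rw [trace_getElem?, if_pos (by omega)], by rw [trace_getElem?,
          if_pos (by omega)]⟩
    · rw [Function.iterate_succ_apply']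
      generalize (next s)^[k] c = z
      obtain ⟨i, j⟩ := z
      simp only [TileCorner, next, leftTile, rightTile]
      split_ifs <;> simp
  have sep_symm : ∀ p q, Separates (trace s c m) p q → Separates (trace s c m) q p :=
    fun p q ⟨u, w, hc, h1, h2, h3, h4⟩ => ⟨u, w, hc, h2, h1, h4, h3⟩
  have piece : ∀ D E : Finset (ℤ × ℤ), D ⊆ P → Conn D → (∀ p ∈ P, p ∈ D ∨ p ∈ E) →
      (∀ p ∈ D, ∀ q ∈ E, gridGraph.Adj p q → Separates (trace s c m) p q) →
      (∀ p ∈ D, ∀ q ∈ D, gridGraph.Adj p q → ¬ Separates (trace s c m) p q) →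
      ∀ p ∈ D, ∀ q, q ∈ D ↔ (cutGraph P (trace s c m)).Reachable p q := by
    intro D E hDP hD hor h1 h2 p hp q
    constructor
    · intro hq
      obtain ⟨w⟩ := hD p hp q hq
      clear hp hq
      induction w with
      | nil => exact SimpleGraph.Reachable.refl _
      | @cons a b d hab w ih =>
        refine SimpleGraph.Reachable.trans (SimpleGraph.Adj.reachable ?_) ih
        exact ⟨hDP hab.1, hDP hab.2.1, hab.2.2, h2 a hab.1 b hab.2.1 hab.2.2⟩
    · rintro ⟨w⟩
      induction w with
      | nil => exact hp
      | @cons a b d hab w ih =>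
        refine ih ((hor b hab.2.1).resolve_right fun hb => hab.2.2.2 (h1 a hp b hb hab.2.2.1))
  refine
    { isCut := ⟨?_, ?_, ?_, ?_⟩
      nonempty_left := h.nonempty_left
      nonempty_right := h.nonempty_right
      disjoint := h.disjoint
      union := h.union
      piece_left := piece L R h.left_subset h.conn_left (fun p hp => h.mem_or hp) hcut ?_
      piece_right := piece R L h.right_subset h.conn_right (fun p hp => (h.mem_or hp).symm)
        (fun p hp q hq hpq => sep_symm _ _ (hcut q hq p hp hpq.symm)) ?_ }
  · rw [List.isChain_iff_getElem]
    intro i hi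
    simp only [trace, List.getElem_map, List.getElem_range, Function.iterate_succ_apply']
    exact next_adj s _
  · exact List.nodup_range.map (iterate_next_injective s c)
  · intro u hu
    rw [List.head?_eq_getElem?, trace_getElem?, if_pos (by omega)] at hu
    simp only [Function.iterate_zero, id_eq, Option.mem_def, Option.some.injEq] at hu
    exact hu ▸ h0
  · intro u hu
    rw [List.getLast?_eq_getElem?, trace_getElem?] at hu
    simp only [trace, List.length_map, List.length_range, add_tsub_cancel_right,
        lt_add_iff_pos_right,
      zero_lt_one, if_true, Option.mem_def, Option.some.injEq] at hu
    exact hu ▸ h1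
  · intro p hp q hq hpq hsp
    rcases hsep p q hpq hsp with ⟨_, h2⟩ | ⟨_, h2⟩
    · exact h.not_mem_right hq h2
    · exact h.not_mem_right hp h2
  · intro p hp q hq hpq hsp
    rcases hsep p q hpq hsp with ⟨h2, _⟩ | ⟨h2, _⟩
    · exact h.not_mem_left hp h2
    · exact h.not_mem_left hq h2

omit h hs in
theorem pullApart_of_hcut (h : HCut P L R) : PullApart L R (-1, 0) := by
  intro m n a ha b hb hab
  have := congrArg Prod.fst hab
  have h2 := congrArg Prod.snd hab
  simp at this h2
  have := h.order a ha b hb h2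
  omega

/-- The tile `p` of `L` is on the left of the step from `u` to `u'`, with a tile of `P` that is
not in `L` on the right. -/
def IsSide (P L : Finset (ℤ × ℤ)) (p u u' : ℤ × ℤ) : Prop :=
  p ∈ L ∧
  (((p.1 + 1, p.2) ∈ P ∧ (p.1 + 1, p.2) ∉ L ∧ u = (p.1 + 1, p.2) ∧ u' = (p.1 + 1, p.2 + 1)) ∨
   ((p.1, p.2 - 1) ∈ P ∧ (p.1, p.2 - 1) ∉ L ∧ u = p ∧ u' = (p.1 + 1, p.2)) ∨
   ((p.1, p.2 + 1) ∈ P ∧ (p.1, p.2 + 1) ∉ L ∧ u = (p.1 + 1, p.2 + 1) ∧ u' = (p.1, p.2 + 1)))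

/-- `IsSide` refers only to membership in `P` and `L`, which the program can test; the thresholds
`s` occur only in the proof. With `IsStart.isSide` the two descriptions match. -/
theorem IsSide.isStart {p u u' : ℤ × ℤ} (hu : IsSide P L p u u') :
    IsStart P s u ∧ next s u = u' := by
  obtain ⟨hp, hu⟩ := hu
  obtain ⟨x, y⟩ := p
  have hpP := h.left_subset hp
  have hx := (hs x y hpP).1 hp
  rcases hu with ⟨h1, h2, rfl, rfl⟩ | ⟨h1, h2, rfl, rfl⟩ | ⟨h1, h2, rfl, rfl⟩
  · have := mt (hs _ _ h1).2 h2
    dsimp only at this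
    have e : s y = x + 1 := by omega
    refine ⟨⟨?_, ?_, ?_⟩, ?_⟩
    · simp only [OnCurve]; omega
    · simpa [leftTile, e] using hpP
    · simpa [rightTile, e] using h1
    · simp [next, e]
  · have := mt (hs _ _ h1).2 h2
    dsimp only at this
    refine ⟨⟨?_, ?_, ?_⟩, ?_⟩
    · simp only [OnCurve]; omega
    · simpa [leftTile, hx] using hpP
    · simpa [rightTile, hx] using h1
    · simp [next, hx]
  · have := mt (hs _ _ h1).2 h2
    dsimp only at this h1 h2
    have e1 : ¬ x + 1 < s (y + 1) := by omega
    have e2 : s (y + 1) < x + 1 := by omega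
    refine ⟨⟨?_, ?_, ?_⟩, ?_⟩
    · simp only [OnCurve, add_sub_cancel_right]; omega
    · simpa [leftTile, e1, e2] using hpP
    · simpa [rightTile, e1, e2] using h1
    · simp [next, e1, e2]

theorem IsStart.isSide {u : ℤ × ℤ} (hu : IsStart P s u) :
    IsSide P L (leftTile s u) u (next s u) := by
  have hl := hu.left hs
  have hr := h.not_mem_left (hu.right h hs)
  obtain ⟨h1, h2, h3⟩ := hu
  refine ⟨hl, ?_⟩
  obtain ⟨i, j⟩ := u
  simp only [leftTile, rightTile, next] at *
  split_ifs at * with h4 h5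
  · exact .inr (.inl ⟨h3, hr, rfl, rfl⟩)
  · refine .inr (.inr ⟨?_, ?_, ?_, ?_⟩) <;> simp_all
  · refine .inl ⟨?_, ?_, ?_, ?_⟩ <;> simp_all

/-- The boundary between the sides of a cut has a first step. -/
theorem exists_first_side (hP : Conn P) : ∃ p u u', IsSide P L p u u' ∧ NonInterior P u := by
  have hadj : ∃ p ∈ L, ∃ q ∈ R, gridGraph.Adj p q := by
    by_contra hcon
    push Not at hcon
    obtain ⟨a, ha⟩ := h.nonempty_left
    obtain ⟨b, hb⟩ := h.nonempty_right
    obtain ⟨w⟩ := hP a (h.left_subset ha) b (h.right_subset hb)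
    have key : ∀ a b : ℤ × ℤ, (pg P).Walk a b → a ∈ L → b ∈ L := by
      intro a b w
      induction w with
      | nil => exact id
      | @cons a b c hab w ih =>
        exact fun ha => ih ((h.mem_or hab.2.1).resolve_right fun hb => hcon a ha b hb hab.2.2)
    exact h.not_mem_left hb (key a b w ha)
  obtain ⟨u, hu⟩ : ∃ u, IsStart P s u := by
    obtain ⟨p, hp, q, hq, hpq⟩ := hadj
    have hqP := h.right_subset hq
    have hqL := h.not_mem_left hq
    rw [gridGraph_adj_iff] at hpq
    rcases hpq with rfl | rfl | rfl | rfl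
    · exact ⟨_, (IsSide.isStart h hs ⟨hp, .inl ⟨hqP, hqL, rfl, rfl⟩⟩).1⟩
    · have := h.order _ hp _ hq rfl
      dsimp only at this; omega
    · exact ⟨_, (IsSide.isStart h hs ⟨hp, .inr (.inr ⟨hqP, hqL, rfl, rfl⟩)⟩).1⟩
    · exact ⟨_, (IsSide.isStart h hs ⟨hp, .inr (.inl ⟨hqP, hqL, rfl, rfl⟩)⟩).1⟩
  by_contra hcon
  push Not at hcon
  have hint : ∀ u, IsStart P s u → ¬ NonInterior P u := fun u hu => hcon _ _ _ (hu.isSide h hs)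
  obtain ⟨B, hB⟩ := (P.image fun p => -p.2).exists_le
  have hB' : ∀ p ∈ P, -B ≤ p.2 := fun p hp => by
    have := hB _ (Finset.mem_image_of_mem _ hp); omega
  -- If no step started at a non-interior corner, the curve could be followed backwards forever.
  -- Going back, the corner moves horizontally towards `s (j - 1)` and then down a row; `n` bounds
  -- the height above the lowest tiles and `k` the horizontal distance.
  have key : ∀ n k : ℕ, ∀ i j : ℤ, IsStart P s (i, j) → j + B + 1 ≤ n →
      |i - s (j - 1)| ≤ k → False := by
    intro n
    induction n with
    | zero =>
      intro k i j hst hn _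
      have h2 := hB' _ hst.left_mem
      simp only [leftTile] at h2
      push_cast at hn
      split_ifs at h2 <;> dsimp only at h2 <;> omega
    | succ n ihn =>
      have hdown : ∀ i j : ℤ, IsStart P s (i, j) → j + B + 1 ≤ (n + 1 : ℕ) → i = s (j - 1) →
          False := by
        intro i j hst hn hi
        have h3 := hint _ hst
        rw [nonInterior_iff] at h3
        push Not at h3
        refine ihn _ i (j - 1) ⟨?_, ?_, ?_⟩ (by push_cast at hn ⊢; omega) (Int.self_le_toNat _)
        · simp only [OnCurve]; omega
        · simpa [leftTile, ← hi] using h3.2.2.2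
        · simpa [rightTile, ← hi] using h3.2.2.1
      intro k
      induction k with
      | zero =>
        intro i j hst hn hk
        refine hdown i j hst hn ?_
        push_cast at hk
        have := abs_nonpos_iff.1 hk
        omega
      | succ k ihk =>
        intro i j hst hn hk
        have h3 := hint _ hst
        have h4 := hst.onCurve
        rw [nonInterior_iff] at h3
        push Not at h3
        simp only [OnCurve] at h4
        push_cast at hk
        rw [abs_le] at hk
        rcases lt_trichotomy i (s (j - 1)) with hi | hi | hi
        · have e1 : ¬ i + 1 < s j := by omega
          have e2 : s j < i + 1 := by omega
          refine ihk (i + 1) j ⟨?_, ?_, ?_⟩ hn ?_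
          · simp only [OnCurve]; omega
          · simpa [leftTile, e1, e2] using h3.2.2.1
          · simpa [rightTile, e1, e2] using h3.1
          · rw [abs_le]; omega
        · exact hdown i j hst hn hi
        · have e1 : i - 1 < s j := by omega
          refine ihk (i - 1) j ⟨?_, ?_, ?_⟩ hn ?_
          · simp only [OnCurve]; omega
          · simpa [leftTile, e1] using h3.2.1
          · simpa [rightTile, e1] using h3.2.2.2
          · rw [abs_le]; omega
  obtain ⟨i, j⟩ := u
  exact key (j + B + 1).toNat _ i j hu (Int.self_le_toNat _) (Int.self_le_toNat _)

end trace
end Polyomino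


namespace Polyomino

/-! ### Symmetries of the grid -/

/-- `f` is a linear symmetry of the grid, acting on the tile corners as `g`. -/
structure IsSymmetry (f : (ℤ × ℤ) ≃+ (ℤ × ℤ)) (g : (ℤ × ℤ) ≃ (ℤ × ℤ)) : Prop where
  adj : ∀ p q, gridGraph.Adj (f p) (f q) ↔ gridGraph.Adj p q
  adj_corner : ∀ p q, gridGraph.Adj (g p) (g q) ↔ gridGraph.Adj p q
  corner : ∀ u p, TileCorner (g u) (f p) ↔ TileCorner u p

/-- The image of a set of tiles under a symmetry. -/
def timage (f : (ℤ × ℤ) ≃+ (ℤ × ℤ)) (P : Finset (ℤ × ℤ)) : Finset (ℤ × ℤ) :=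
  P.map f.toEquiv.toEmbedding

theorem mem_timage {f : (ℤ × ℤ) ≃+ (ℤ × ℤ)} {P : Finset (ℤ × ℤ)} {p : ℤ × ℤ} :
    p ∈ timage f P ↔ f.symm p ∈ P := by
  simp only [timage, Finset.mem_map_equiv]
  rfl

theorem apply_mem_timage {f : (ℤ × ℤ) ≃+ (ℤ × ℤ)} {P : Finset (ℤ × ℤ)} {p : ℤ × ℤ} :
    f p ∈ timage f P ↔ p ∈ P := by
  rw [mem_timage, AddEquiv.symm_apply_apply]

theorem forall_mem_timage {f : (ℤ × ℤ) ≃+ (ℤ × ℤ)} {P : Finset (ℤ × ℤ)} {C : ℤ × ℤ → Prop} :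
    (∀ p ∈ timage f P, C p) ↔ ∀ p ∈ P, C (f p) := by
  constructor
  · exact fun h p hp => h _ (apply_mem_timage.2 hp)
  · intro h p hp
    have := h _ (mem_timage.1 hp)
    rwa [AddEquiv.apply_symm_apply] at this

theorem timage_symm (f : (ℤ × ℤ) ≃+ (ℤ × ℤ)) (P : Finset (ℤ × ℤ)) :
    timage f.symm (timage f P) = P := by
  ext p
  simp [mem_timage]

section symmetry
variable {f : (ℤ × ℤ) ≃+ (ℤ × ℤ)} {g : (ℤ × ℤ) ≃ (ℤ × ℤ)} (hf : IsSymmetry f g)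
  {P A B : Finset (ℤ × ℤ)}
include hf

theorem IsSymmetry.separates {c : List (ℤ × ℤ)} {p q : ℤ × ℤ} :
    Separates (c.map g) (f p) (f q) ↔ Separates c p q := by
  constructor
  · rintro ⟨u, w, hi, h⟩
    rw [pair_infix_iff] at hi
    obtain ⟨k, h1, h2⟩ := hi
    rw [List.getElem?_map, Option.map_eq_some_iff] at h1 h2
    obtain ⟨u', h1, rfl⟩ := h1
    obtain ⟨w', h2, rfl⟩ := h2
    rw [hf.corner, hf.corner, hf.corner, hf.corner] at h
    exact ⟨u', w', pair_infix_iff.2 ⟨k, h1, h2⟩, h⟩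
  · rintro ⟨u, w, hi, h⟩
    rw [pair_infix_iff] at hi
    obtain ⟨k, h1, h2⟩ := hi
    refine ⟨g u, g w, pair_infix_iff.2 ⟨k, ?_, ?_⟩, ?_⟩
    · rw [List.getElem?_map, h1]; rfl
    · rw [List.getElem?_map, h2]; rfl
    · rwa [hf.corner, hf.corner, hf.corner, hf.corner]

theorem IsSymmetry.conn (hP : Conn P) : Conn (timage f P) := by
  refine forall_mem_timage.2 fun p hp => forall_mem_timage.2 fun q hq => ?_
  let φ : pg P →g pg (timage f P) :=
    ⟨f, fun {a b} h => ⟨apply_mem_timage.2 h.1, apply_mem_timage.2 h.2.1, (hf.adj a b).2 h.2.2⟩⟩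
  exact (hP p hp q hq).map φ

theorem IsSymmetry.cutGraph_reachable {c : List (ℤ × ℤ)} {p q : ℤ × ℤ} :
    (cutGraph (timage f P) (c.map g)).Reachable (f p) (f q) ↔ (cutGraph P c).Reachable p q := by
  let φ : cutGraph P c ≃g cutGraph (timage f P) (c.map g) :=
    ⟨f.toEquiv, fun {a b} => by
      change (f a ∈ timage f P ∧ f b ∈ timage f P ∧ gridGraph.Adj (f a) (f b) ∧
        ¬ Separates (c.map g) (f a) (f b)) ↔ _
      rw [apply_mem_timage, apply_mem_timage, hf.adj, hf.separates]
      rfl⟩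
  exact φ.reachable_iff

theorem IsSymmetry.nonInterior {u : ℤ × ℤ} (h : NonInterior P u) :
    NonInterior (timage f P) (g u) := by
  obtain ⟨p, hp, hu⟩ := h
  exact ⟨f p, fun h => hp (apply_mem_timage.1 h), (hf.corner _ _).2 hu⟩

theorem IsSymmetry.isTwoCut {c : List (ℤ × ℤ)} (h : IsTwoCut P c A B) :
    IsTwoCut (timage f P) (c.map g) (timage f A) (timage f B) where
  isCut :=
    { chain := by
        rw [List.isChain_map]
        exact h.isCut.chain.imp fun a b hab => (hf.adj_corner a b).2 hab
      nodup := h.isCut.nodup.map g.injective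
      start_not_interior := by
        intro u hu
        rw [List.head?_map, Option.mem_def, Option.map_eq_some_iff] at hu
        obtain ⟨u', hu', rfl⟩ := hu
        exact hf.nonInterior (h.isCut.start_not_interior u' hu')
      end_not_interior := by
        intro u hu
        rw [List.getLast?_map, Option.mem_def, Option.map_eq_some_iff] at hu
        obtain ⟨u', hu', rfl⟩ := hu
        exact hf.nonInterior (h.isCut.end_not_interior u' hu') }
  nonempty_left := h.nonempty_left.map
  nonempty_right := h.nonempty_right.map
  disjoint := (Finset.disjoint_map _).2 h.disjoint
  union := by rw [← h.union]; exact (Finset.map_union ..).symm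
  piece_left := by
    refine forall_mem_timage.2 fun p hp q => ?_
    obtain ⟨q, rfl⟩ := f.surjective q
    rw [apply_mem_timage, hf.cutGraph_reachable]
    exact h.piece_left p hp q
  piece_right := by
    refine forall_mem_timage.2 fun p hp q => ?_
    obtain ⟨q, rfl⟩ := f.surjective q
    rw [apply_mem_timage, hf.cutGraph_reachable]
    exact h.piece_right p hp q

omit hf in
theorem pullApart_timage (f : (ℤ × ℤ) ≃+ (ℤ × ℤ)) {v : ℤ × ℤ} (h : PullApart A B v) :
    PullApart (timage f A) (timage f B) (f v) := by
  intro m n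
  refine forall_mem_timage.2 fun a ha => forall_mem_timage.2 fun b hb hab => h m n a ha b hb ?_
  rw [← map_nsmul, ← map_nsmul, ← map_add, ← map_sub] at hab
  exact f.injective hab

theorem IsSymmetry.isSimple (hP : IsSimple P) : IsSimple (timage f P) := by
  let φ : gridGraph.induce (P : Set (ℤ × ℤ))ᶜ →g gridGraph.induce (timage f P : Set (ℤ × ℤ))ᶜ :=
    ⟨fun p => ⟨f p.1, fun h => p.2 (apply_mem_timage.1 h)⟩, fun {a b} h => (hf.adj a.1 b.1).2 h⟩
  refine SimpleGraph.Connected.map φ ?_ hP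
  rintro ⟨q, hq⟩
  obtain ⟨p, rfl⟩ := f.surjective q
  exact ⟨⟨p, fun h => hq (apply_mem_timage.2 h)⟩, rfl⟩

end symmetry

/-- `(p, q)` is a unit vector of the grid. -/
def IsUnitVec (p q : ℤ) : Prop :=
  (p = 1 ∧ q = 0) ∨ (p = 0 ∧ q = 1) ∨ (p = -1 ∧ q = 0) ∨ (p = 0 ∧ q = -1)

theorem IsUnitVec.sq {p q : ℤ} (h : IsUnitVec p q) : p * p + q * q = 1 := by
  rcases h with ⟨rfl, rfl⟩ | ⟨rfl, rfl⟩ | ⟨rfl, rfl⟩ | ⟨rfl, rfl⟩ <;> rfl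

theorem IsUnitVec.neg_right {p q : ℤ} (h : IsUnitVec p q) : IsUnitVec p (-q) := by
  unfold IsUnitVec at *; omega

/-- The rotation that takes `(1, 0)` to `(p, q)`. -/
def rot {p q : ℤ} (h : IsUnitVec p q) : (ℤ × ℤ) ≃+ (ℤ × ℤ) where
  toFun z := (p * z.1 - q * z.2, q * z.1 + p * z.2)
  invFun z := (p * z.1 + q * z.2, p * z.2 - q * z.1)
  left_inv z := by
    ext
    · linear_combination z.1 * h.sq
    · linear_combination z.2 * h.sq
  right_inv z := by
    ext
    · linear_combination z.1 * h.sq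
    · linear_combination z.2 * h.sq
  map_add' a b := by ext <;> simp <;> ring

theorem rot_apply {p q : ℤ} (h : IsUnitVec p q) (z : ℤ × ℤ) :
    rot h z = (p * z.1 - q * z.2, q * z.1 + p * z.2) := rfl

theorem rot_symm_apply {p q : ℤ} (h : IsUnitVec p q) (z : ℤ × ℤ) :
    (rot h).symm z = (p * z.1 + q * z.2, p * z.2 - q * z.1) := rfl

/-- The rotation as it acts on the tile corners. -/
def crot {p q : ℤ} (h : IsUnitVec p q) : (ℤ × ℤ) ≃ (ℤ × ℤ) where
  -- The corner `z` is the point `z - (1/2, 1/2)`. Conjugating the rotation with this shift produces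
  -- the constant terms, which are integers for unit vectors.
  toFun z := (p * z.1 - q * z.2 + (1 - p + q) / 2, q * z.1 + p * z.2 + (1 - p - q) / 2)
  invFun z := (p * z.1 + q * z.2 + (1 - p - q) / 2, p * z.2 - q * z.1 + (1 - p + q) / 2)
  left_inv z := by
    rcases h with ⟨rfl, rfl⟩ | ⟨rfl, rfl⟩ | ⟨rfl, rfl⟩ | ⟨rfl, rfl⟩ <;> ext <;> simp
  right_inv z := by
    rcases h with ⟨rfl, rfl⟩ | ⟨rfl, rfl⟩ | ⟨rfl, rfl⟩ | ⟨rfl, rfl⟩ <;> ext <;> simp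

theorem crot_symm_apply {p q : ℤ} (h : IsUnitVec p q) (z : ℤ × ℤ) :
    (crot h).symm z =
      (p * z.1 + q * z.2 + (1 - p - q) / 2, p * z.2 - q * z.1 + (1 - p + q) / 2) := rfl

theorem isSymmetry_rot {p q : ℤ} (h : IsUnitVec p q) : IsSymmetry (rot h) (crot h) where
  adj a b := by
    simp only [gridGraph_adj_iff, rot_apply, Prod.ext_iff]
    rcases h with ⟨rfl, rfl⟩ | ⟨rfl, rfl⟩ | ⟨rfl, rfl⟩ | ⟨rfl, rfl⟩ <;> omega
  adj_corner a b := by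
    simp only [gridGraph_adj_iff, crot, Equiv.coe_fn_mk, Prod.ext_iff]
    rcases h with ⟨rfl, rfl⟩ | ⟨rfl, rfl⟩ | ⟨rfl, rfl⟩ | ⟨rfl, rfl⟩ <;> omega
  corner a b := by
    simp only [TileCorner, crot, rot_apply, Equiv.coe_fn_mk]
    rcases h with ⟨rfl, rfl⟩ | ⟨rfl, rfl⟩ | ⟨rfl, rfl⟩ | ⟨rfl, rfl⟩ <;> omega

theorem IsSymmetry.symm {f : (ℤ × ℤ) ≃+ (ℤ × ℤ)} {g : (ℤ × ℤ) ≃ (ℤ × ℤ)} (h : IsSymmetry f g) :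
    IsSymmetry f.symm g.symm where
  adj p q := by rw [← h.adj, AddEquiv.apply_symm_apply, AddEquiv.apply_symm_apply]
  adj_corner p q := by rw [← h.adj_corner, Equiv.apply_symm_apply, Equiv.apply_symm_apply]
  corner u p := by rw [← h.corner, AddEquiv.apply_symm_apply, Equiv.apply_symm_apply]

/-- A cut of a rotated polyomino gives a valid cut of the polyomino. -/
theorem isValidTwoCut_of_rot {p q : ℤ} (h : IsUnitVec p q) {P L R : Finset (ℤ × ℤ)}
    {c : List (ℤ × ℤ)} (hc : IsTwoCut (timage (rot h) P) c L R)
    (ho : PullApart L R (-1, 0)) :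
    IsValidTwoCut P (c.map (crot h).symm) (timage (rot h).symm L) (timage (rot h).symm R) := by
  have h1 := (isSymmetry_rot h).symm.isTwoCut hc
  rw [timage_symm] at h1
  refine ⟨h1, _, ?_, pullApart_timage _ ho⟩
  rw [rot_symm_apply]
  rcases h with ⟨rfl, rfl⟩ | ⟨rfl, rfl⟩ | ⟨rfl, rfl⟩ | ⟨rfl, rfl⟩ <;> simp

theorem locallyReflex_rot {p q : ℤ} (h : IsUnitVec p q) {P : Finset (ℤ × ℤ)} {t : ℤ × ℤ}
    (ht : LocallyReflex P t) : LocallyReflex (timage (rot h) P) (rot h t) := by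
  obtain ⟨h1, dx, dy, hx, hy, h2, h3, h4⟩ := ht
  refine ⟨apply_mem_timage.2 h1, ?_⟩
  simp only [mem_timage, rot_symm_apply, rot_apply]
  obtain ⟨x, y⟩ := t
  rcases h with ⟨rfl, rfl⟩ | ⟨rfl, rfl⟩ | ⟨rfl, rfl⟩ | ⟨rfl, rfl⟩
  · exact ⟨dx, dy, hx, hy, by simpa using h2, by simpa using h3, by simpa using h4⟩
  · exact ⟨-dy, dx, by omega, by omega, by simpa [add_comm] using h3,
      by simpa [add_comm] using h2, by simpa [add_comm] using h4⟩
  · exact ⟨-dx, -dy, by omega, by omega, by simpa [add_comm] using h2,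
      by simpa [add_comm] using h3, by simpa [add_comm] using h4⟩
  · exact ⟨dy, -dx, by omega, by omega, by simpa [add_comm] using h3,
      by simpa [add_comm] using h2, by simpa [add_comm] using h4⟩

theorem timage_rot_symm {p q : ℤ} (h : IsUnitVec p q) (P : Finset (ℤ × ℤ)) :
    timage (rot h.neg_right) (timage (rot h) P) = P := by
  have : rot h.neg_right = (rot h).symm := by
    ext z <;> simp [rot_apply, rot_symm_apply]; ring
  rw [this, timage_symm]

theorem numReflex_rot {p q : ℤ} (h : IsUnitVec p q) (P : Finset (ℤ × ℤ)) :
    numReflex (timage (rot h) P) = numReflex P := by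
  have key : ∀ {p q : ℤ} (h : IsUnitVec p q) (P : Finset (ℤ × ℤ)),
      numReflex P ≤ numReflex (timage (rot h) P) := by
    intro p q h P
    unfold numReflex
    refine Finset.card_le_card_of_injOn (rot h) (fun t ht => ?_) (rot h).injective.injOn
    simp only [Finset.coe_filter, Set.mem_ofPred_eq] at ht ⊢
    exact ⟨apply_mem_timage.2 ht.1, locallyReflex_rot h ht.2⟩
  refine le_antisymm ?_ (key h P)
  have := key h.neg_right (timage (rot h) P)
  rwa [timage_rot_symm] at this

/-! ### Existence of cuts -/

theorem IsTwoCut.conn {P A B : Finset (ℤ × ℤ)} {c : List (ℤ × ℤ)} (h : IsTwoCut P c A B) :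
    Conn A ∧ Conn B := by
  have key : ∀ D : Finset (ℤ × ℤ), (∀ p ∈ D, ∀ q, q ∈ D ↔ (cutGraph P c).Reachable p q) →
      Conn D := by
    intro D hD p hp q hq
    obtain ⟨w⟩ := (hD p hp q).1 hq
    clear hq
    induction w with
    | nil => exact SimpleGraph.Reachable.refl _
    | @cons a b d hab w ih =>
      have hb := (hD a hp b).2 hab.reachable
      exact (reachable_of_adj hp hb hab.2.2.1).trans (ih hb)
  exact ⟨key A h.piece_left, key B h.piece_right⟩

theorem IsTwoCut.swap {P A B : Finset (ℤ × ℤ)} {c : List (ℤ × ℤ)} (h : IsTwoCut P c A B) :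
    IsTwoCut P c B A :=
  ⟨h.isCut, h.nonempty_right, h.nonempty_left, h.disjoint.symm, by rw [Finset.union_comm, h.union],
    h.piece_right, h.piece_left⟩

theorem HCut.rot {P L R : Finset (ℤ × ℤ)} {p q : ℤ} (h : IsUnitVec p q) (hc : Conn L)
    (hc' : Conn R) (h1 : L.Nonempty) (h2 : R.Nonempty) (h3 : Disjoint L R) (h4 : L ∪ R = P)
    (ho : ∀ a ∈ L, ∀ b ∈ R, (rot h a).2 = (rot h b).2 → (rot h a).1 < (rot h b).1) :
    HCut (timage (rot h) P) (timage (rot h) L) (timage (rot h) R) :=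
  ⟨h1.map, h2.map, (Finset.disjoint_map _).2 h3, by rw [← h4]; exact (Finset.map_union ..).symm,
    forall_mem_timage.2 fun a ha => forall_mem_timage.2 fun b hb => ho a ha b hb,
    (isSymmetry_rot h).conn hc, (isSymmetry_rot h).conn hc'⟩

theorem unit_one : IsUnitVec 1 0 := .inl ⟨rfl, rfl⟩
theorem unit_I : IsUnitVec 0 1 := .inr (.inl ⟨rfl, rfl⟩)

/-- If in some row (after the rotation) a tile of `A` were not left of a tile of `B`, then moving
`A` by the difference would make them collide. Only two directions are needed, because swapping the
pieces negates `v`. -/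
theorem exists_hcut_of_isTwoCut {P A B : Finset (ℤ × ℤ)} {c : List (ℤ × ℤ)} {v : ℤ × ℤ}
    (h : IsTwoCut P c A B) (hv : PullApart A B v)
    (hv' : v = (-1, 0) ∨ v = (0, 1)) : ∃ (p q : ℤ) (hu : IsUnitVec p q) (L R : Finset (ℤ × ℤ)),
    HCut (timage (rot hu) P) L R := by
  rcases hv' with rfl | rfl
  · refine ⟨1, 0, unit_one, _, _, HCut.rot unit_one h.conn.1 h.conn.2 h.nonempty_left
      h.nonempty_right h.disjoint h.union fun a ha b hb hab => ?_⟩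
    by_contra hcon
    simp only [rot_apply] at hab hcon
    refine hv (a.1 - b.1).toNat 0 a ha b hb ?_
    ext <;> simp <;> omega
  · refine ⟨0, 1, unit_I, _, _, HCut.rot unit_I h.conn.1 h.conn.2 h.nonempty_left
      h.nonempty_right h.disjoint h.union fun a ha b hb hab => ?_⟩
    by_contra hcon
    simp only [rot_apply] at hab hcon
    refine hv (b.2 - a.2).toNat 0 a ha b hb ?_
    ext <;> simp <;> omega

theorem pullApart_swap {A B : Finset (ℤ × ℤ)} {v : ℤ × ℤ} (h : PullApart A B v) :
    PullApart B A (-v) := by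
  intro m n a ha b hb hab
  refine h n m b hb a ha ?_
  rw [smul_neg, smul_neg, ← sub_eq_add_neg, sub_neg_eq_add] at hab
  exact hab.symm

/-- Rows become columns under the quarter turn. -/
theorem rowConvex_rot {P : Finset (ℤ × ℤ)} :
    (ColumnConvex (timage (rot unit_I) P) ↔ RowConvex P) ∧
    (RowConvex (timage (rot unit_I) P) ↔ ColumnConvex P) := by
  simp only [RowConvex, ColumnConvex, mem_timage, rot_symm_apply, zero_mul, one_mul, zero_add,
    zero_sub]
  refine ⟨⟨fun h y x₁ x x₂ h1 h2 h3 h4 => ?_, fun h x y₁ y y₂ h1 h2 h3 h4 => ?_⟩,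
    ⟨fun h x y₁ y y₂ h1 h2 h3 h4 => ?_, fun h y x₁ x x₂ h1 h2 h3 h4 => ?_⟩⟩
  · have := h (-y) x₁ x x₂ (by simpa using h1) (by simpa using h2) h3 h4
    simpa using this
  · exact h _ _ _ _ h1 h2 h3 h4
  · have := h x (-y₂) (-y) (-y₁) (by simpa using h2) (by simpa using h1) (by omega) (by omega)
    simpa using this
  · exact h _ _ _ _ h2 h1 (by omega) (by omega)

/-- Either the subdivision starts with a valid cut, or `P` is monotone already; in the latter case
non-convexity leaves room for a straight cut along a column or, after a quarter turn, along a row.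
-/
theorem exists_rot_hcut {P : Finset (ℤ × ℤ)} (hP : Conn P) (hnc : ¬ IsConvex P)
    (h : TwoCuttable P) : ∃ (p q : ℤ) (hu : IsUnitVec p q) (L R : Finset (ℤ × ℤ)),
    HCut (timage (rot hu) P) L R := by
  cases h with
  | monotone _ hm =>
    by_cases hc : ColumnConvex P
    · obtain ⟨L, R, h⟩ := exists_hcut_of_columnConvex hP hc fun hr => hnc ⟨hc, hr⟩
      refine ⟨1, 0, unit_one, L, R, ?_⟩
      have : timage (rot unit_one) P = P := by
        ext z; simp [mem_timage, rot_symm_apply]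
      rwa [this]
    · have hr : RowConvex P := hm.resolve_left hc
      obtain ⟨L, R, h⟩ := exists_hcut_of_columnConvex ((isSymmetry_rot unit_I).conn hP)
        (rowConvex_rot.1.2 hr) (fun h => hc (rowConvex_rot.2.1 h))
      exact ⟨0, 1, unit_I, L, R, h⟩
  | cut _ c A B hv _ _ =>
    obtain ⟨h1, v, hv, h2⟩ := hv
    rcases hv with rfl | rfl | rfl | rfl
    · exact exists_hcut_of_isTwoCut h1.swap (pullApart_swap h2) (.inl rfl)
    · exact exists_hcut_of_isTwoCut h1 h2 (.inl rfl)
    · exact exists_hcut_of_isTwoCut h1 h2 (.inr rfl)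
    · exact exists_hcut_of_isTwoCut h1.swap (pullApart_swap h2) (.inr rfl)

/-- `P` has no tile that can be cut off, and no cut separates two of its locally reflex tiles. -/
def NoCut (P : Finset (ℤ × ℤ)) : Prop :=
  (∀ t, ¬ Bite P t) ∧ ∀ l r, LocallyReflex P l → LocallyReflex P r →
    ∀ L R, HCut P L R → l ∈ L → r ∉ R

/-- Take any cut. If both sides contain locally reflex tiles of `P`, it separates a pair of them. If
the left side contains none, there is a bite; if the right side contains none, there is a bite after
a half turn. -/
theorem exists_not_noCut {P : Finset (ℤ × ℤ)} (hP : Conn P) (hs : IsSimple P)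
    (hnc : ¬ IsConvex P) (h : TwoCuttable P) :
    ∃ (p q : ℤ) (hu : IsUnitVec p q), ¬ NoCut (timage (rot hu) P) := by
  obtain ⟨p, q, hu, L, R, h⟩ := exists_rot_hcut hP hnc h
  by_contra hcon
  push Not at hcon
  obtain ⟨h1, h2⟩ := hcon p q hu
  by_cases hL : ∃ l ∈ L, LocallyReflex (timage (rot hu) P) l
  · by_cases hR : ∃ r ∈ R, LocallyReflex (timage (rot hu) P) r
    · obtain ⟨l, hl, hl'⟩ := hL
      obtain ⟨r, hr, hr'⟩ := hR
      exact h2 l r hl' hr' L R h hl hr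
    · push Not at hR
      have hu' : IsUnitVec (-p) (-q) := by unfold IsUnitVec at *; omega
      have hneg : IsUnitVec (-1) 0 := .inr (.inr (.inl ⟨rfl, rfl⟩))
      have heq : timage (rot hneg) (timage (rot hu) P) = timage (rot hu') P := by
        ext z
        simp only [mem_timage, rot_symm_apply]
        ring_nf
      have h' : HCut (timage (rot hu') P) (timage (rot hneg) R) (timage (rot hneg) L) := by
        rw [← heq]
        refine HCut.rot hneg h.conn_right h.conn_left h.nonempty_right h.nonempty_left
          h.disjoint.symm (by rw [Finset.union_comm, h.union]) fun a ha b hb hab => ?_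
        simp only [rot_apply] at hab ⊢
        have := h.order b hb a ha (by omega)
        omega
      obtain ⟨t, ht⟩ := h'.exists_bite ((isSymmetry_rot hu').isSimple hs) (by
        refine forall_mem_timage.2 fun t ht h3 => hR t ht ?_
        have h4 := locallyReflex_rot hneg.neg_right h3
        rw [← heq, timage_rot_symm] at h4
        simpa [rot_apply] using h4)
      exact (hcon _ _ hu').1 t ht
  · push Not at hL
    obtain ⟨t, ht⟩ := h.exists_bite ((isSymmetry_rot hu).isSimple hs) hL
    exact h1 t ht

theorem exists_column {P : Finset (ℤ × ℤ)} (hP : Conn P) {a b : ℤ × ℤ} (ha : a ∈ P) (hb : b ∈ P)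
    {x : ℤ} (h1 : a.1 ≤ x) (h2 : x ≤ b.1) : ∃ y, (x, y) ∈ P := by
  obtain ⟨w⟩ := hP a ha b hb
  induction w with
  | @nil a => exact ⟨a.2, by rwa [show x = a.1 by omega]⟩
  | @cons a b c hab w ih =>
    by_cases h : b.1 ≤ x
    · exact ih hab.2.1 hb h h2
    · have h3 := eq_right_of_adj hab.2.2 (by omega)
      rw [h3] at h
      exact ⟨a.2, by rwa [show x = a.1 by dsimp only at h; omega]⟩

theorem exists_row {P : Finset (ℤ × ℤ)} (hP : Conn P) {a b : ℤ × ℤ} (ha : a ∈ P) (hb : b ∈ P)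
    {y : ℤ} (h1 : a.2 ≤ y) (h2 : y ≤ b.2) : ∃ x, (x, y) ∈ P := by
  obtain ⟨z, hz⟩ := exists_column ((isSymmetry_rot unit_I).conn hP) (apply_mem_timage.2 hb)
    (apply_mem_timage.2 ha) (x := -y) (by simp only [rot_apply]; omega)
    (by simp only [rot_apply]; omega)
  rw [mem_timage, rot_symm_apply] at hz
  exact ⟨z, by simpa using hz⟩

/-- Without locally reflex tiles, `P` contains every cell in the row of one of its tiles and the
column of another, so it is a full rectangle and thus convex. -/
theorem one_le_numReflex {P : Finset (ℤ × ℤ)} (hP : Conn P) (hnc : ¬ IsConvex P) :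
    1 ≤ numReflex P := by
  classical
  unfold numReflex
  rw [Nat.one_le_iff_ne_zero, Ne, Finset.card_eq_zero]
  intro h0
  have hr : ∀ t ∈ P, ¬ LocallyReflex P t := by
    intro t ht h
    have : t ∈ P.filter (LocallyReflex P) := Finset.mem_filter.2 ⟨ht, h⟩
    rw [h0] at this
    simp at this
  let Full : ℤ × ℤ → ℤ → Prop := fun a x =>
    ∀ z, (a.1 ≤ z ∧ z ≤ x) ∨ (x ≤ z ∧ z ≤ a.1) → (z, a.2) ∈ P
  -- A full row segment is copied to the adjacent row tile by tile, beginning at one tile there: at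
  -- each step three cells of a `2 × 2` square are present, hence so is the fourth. Therefore `Full
  -- · x` is carried along walks.
  have hver : ∀ n : ℕ, ∀ x₀ y d x : ℤ, (d = 1 ∨ d = -1) → (x₀, y + d) ∈ P → |x - x₀| ≤ n →
      Full (x₀, y) x → (x, y + d) ∈ P := by
    intro n
    induction n with
    | zero =>
      intro x₀ y d x hd h1 h2 _
      obtain rfl : x = x₀ := by have := abs_nonpos_iff.1 h2; omega
      exact h1
    | succ n ih =>
      intro x₀ y d x hd h1 h2 h3
      push_cast at h2
      rw [abs_le] at h2
      rcases lt_trichotomy x x₀ with hx | rfl | hx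
      · have h4 := ih x₀ y d (x + 1) hd h1 (by rw [abs_le]; omega)
          fun z hz => h3 z (by dsimp only at hz ⊢; omega)
        have h5 := h3 (x + 1) (by dsimp only; omega)
        have h6 := h3 x (by dsimp only; omega)
        have := diag_mem (hr _ h5) (.inr rfl) hd h5 (by simpa using h6) h4
        simpa using this
      · exact h1
      · have h4 := ih x₀ y d (x - 1) hd h1 (by rw [abs_le]; omega)
          fun z hz => h3 z (by dsimp only at hz ⊢; omega)
        have h5 := h3 (x - 1) (by dsimp only; omega)
        have h6 := h3 x (by dsimp only; omega)
        have := diag_mem (hr _ h5) (.inl rfl) hd h5 (by simpa using h6) h4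
        simpa using this
  have hwalk : ∀ a b : ℤ × ℤ, (pg P).Walk a b → ∀ x, Full a x → Full b x := by
    intro a b w
    induction w with
    | nil => exact fun x h => h
    | @cons a b c hab w ih =>
      refine fun x h => ih x ?_
      obtain ⟨ha, hb, hab⟩ := hab
      obtain ⟨x₀, y⟩ := a
      rw [gridGraph_adj_iff] at hab
      rcases hab with rfl | rfl | rfl | rfl
      · intro z hz
        by_cases hzx : z = x₀
        · exact hzx ▸ ha
        · by_cases hzx' : z = x₀ + 1
          · exact hzx' ▸ hb
          · exact h z (by dsimp only at hz ⊢; omega)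
      · intro z hz
        by_cases hzx : z = x₀
        · exact hzx ▸ ha
        · by_cases hzx' : z = x₀ - 1
          · exact hzx' ▸ hb
          · exact h z (by dsimp only at hz ⊢; omega)
      · exact fun z hz => hver (z - x₀).natAbs x₀ y 1 z (.inl rfl) hb (by simp)
          fun z' hz' => h z' (by dsimp only at hz hz' ⊢; omega)
      · exact fun z hz => hver (z - x₀).natAbs x₀ y (-1) z (.inr rfl) hb (by simp)
          fun z' hz' => h z' (by dsimp only at hz hz' ⊢; omega)
  have hself : ∀ b ∈ P, Full b b.1 := fun b hb z hz => by
    rwa [show z = b.1 by omega]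
  have hfull : ∀ a ∈ P, ∀ b ∈ P, Full a b.1 := by
    intro a ha b hb
    obtain ⟨w⟩ := hP b hb a ha
    exact hwalk b a w _ (hself b hb)
  refine hnc ⟨fun x y₁ y y₂ h1 h2 h3 h4 => ?_, fun y x₁ x x₂ h1 h2 h3 h4 => ?_⟩
  · obtain ⟨x', hx'⟩ := exists_row hP h1 h2 h3 h4
    exact hfull _ hx' _ h1 x (by dsimp only; omega)
  · exact hfull _ h1 _ h2 x (.inl ⟨h3, h4⟩)

/-- A connected set leaves no column empty between two of its tiles. This makes a sweep over all
columns linear in the number of tiles. -/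
theorem width_le {P : Finset (ℤ × ℤ)} (hP : Conn P) {a b : ℤ × ℤ} (ha : a ∈ P) (hb : b ∈ P) :
    b.1 - a.1 < P.card := by
  have h : Finset.Icc a.1 b.1 ⊆ P.image Prod.fst := by
    intro x hx
    rw [Finset.mem_Icc] at hx
    obtain ⟨y, hy⟩ := exists_column hP ha hb hx.1 hx.2
    exact Finset.mem_image.2 ⟨_, hy, rfl⟩
  have h1 := (Finset.card_le_card h).trans Finset.card_image_le
  rw [Int.card_Icc] at h1
  have : 0 < P.card := Finset.card_pos.2 ⟨a, ha⟩
  omega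

end Polyomino


/-! ### Machine words that are large enough, and a program logic with time bounds. -/

namespace WordRAM

/-- The value of an expression on a machine with unbounded words. -/
def Term.den (s : Store) : Term → ℤ
  | .const z => z
  | .reg i => s.reg i
  | .load a => s.mem (a.den s)
  | .add a b => a.den s + b.den s
  | .sub a b => a.den s - b.den s
  | .mul a b => a.den s * b.den s
  | .div a b => a.den s / b.den s
  | .le a b => if a.den s ≤ b.den s then 1 else 0

/-- A bound for the exponent in the growth of the values in an expression. -/
def Term.size : Term → ℕ
  | .const _ => 1
  | .reg _ => 1
  | .load a => a.size
  | .add a b => a.size + b.size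
  | .sub a b => a.size + b.size
  | .mul a b => a.size + b.size
  | .div a b => a.size + b.size
  | .le a b => a.size + b.size

/-- All constants are small. -/
def Term.small : Term → Bool
  | .const z => decide (|z| ≤ 64)
  | .reg _ => true
  | .load a => a.small
  | .add a b => a.small && b.small
  | .sub a b => a.small && b.small
  | .mul a b => a.small && b.small
  | .div a b => a.small && b.small
  | .le a b => a.small && b.small

/-- All registers and memory cells are bounded by `V`. -/
def Store.Bounded (V : ℕ) (s : Store) : Prop := (∀ i, |s.reg i| ≤ V) ∧ ∀ a, |s.mem a| ≤ V

theorem Term.one_le_size (e : Term) : 1 ≤ e.size := by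
  induction e <;> simp only [Term.size] <;> omega

/-- Sizes add under binary operations, and so do the exponents in the bound by a power of `V`; loads
return to values of size at most `V`. So no intermediate result exceeds `V ^ S`, and the overflow
checks never fail. -/
theorem Term.value_eq {V W S : ℕ} {s : Store} (hV : 64 ≤ V) (hW : V ^ S ≤ W) (hs : s.Bounded V) :
    ∀ e : Term, e.size ≤ S → e.small → e.value W s = some (e.den s) ∧ |e.den s| ≤
      (V : ℤ) ^ e.size := by
  have hV' : (64 : ℤ) ≤ V := by exact_mod_cast hV
  have hword : ∀ (z : ℤ) (n : ℕ), n ≤ S → |z| ≤ (V : ℤ) ^ n → word W z = some z := by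
    intro z n hn hz
    rw [word, if_pos]
    refine hz.trans ?_
    have : V ^ n ≤ W := (Nat.pow_le_pow_right (by omega) hn).trans hW
    exact_mod_cast this
  have hpow : ∀ n : ℕ, 1 ≤ n → (V : ℤ) ≤ (V : ℤ) ^ n := by
    intro n hn
    exact le_self_pow₀ (by omega) (by omega)
  have hle : ∀ m n : ℕ, (V : ℤ) ^ m ≤ (V : ℤ) ^ (m + n) := fun m n =>
    pow_le_pow_right₀ (by omega) (by omega)
  have hadd : ∀ m n : ℕ, 1 ≤ m → 1 ≤ n → (V : ℤ) ^ m + (V : ℤ) ^ n ≤ (V : ℤ) ^ (m + n) := by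
    intro m n hm hn
    have h1 := hpow m hm
    have h2 := hpow n hn
    rw [pow_add]
    nlinarith
  intro e
  induction e with
  | const z =>
    intro h1 h2
    have h3 : |z| ≤ (V : ℤ) ^ 1 := by
      simp only [Term.small, decide_eq_true_eq] at h2
      rw [pow_one]; exact h2.trans hV'
    exact ⟨hword z 1 h1 h3, h3⟩
  | reg i =>
    intro h1 _
    have h3 : |s.reg i| ≤ (V : ℤ) ^ 1 := by rw [pow_one]; exact hs.1 i
    exact ⟨hword _ 1 h1 h3, h3⟩
  | load a ih =>
    intro h1 h2
    obtain ⟨h3, -⟩ := ih h1 h2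
    have h4 : |s.mem (a.den s)| ≤ (V : ℤ) ^ a.size := (hs.2 _).trans (hpow _ a.one_le_size)
    refine ⟨?_, h4⟩
    rw [Term.value, h3]
    exact hword _ _ h1 h4
  | add a b iha ihb =>
    intro h1 h2
    simp only [Term.size, Term.small, Bool.and_eq_true] at h1 h2
    obtain ⟨h3, h3'⟩ := iha (by omega) h2.1
    obtain ⟨h4, h4'⟩ := ihb (by omega) h2.2
    have h5 : |a.den s + b.den s| ≤ (V : ℤ) ^ (a.size + b.size) :=
      (abs_add_le _ _).trans ((add_le_add h3' h4').trans (hadd _ _ a.one_le_size b.one_le_size))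
    refine ⟨?_, h5⟩
    rw [Term.value, h3, h4]
    exact hword _ _ h1 h5
  | sub a b iha ihb =>
    intro h1 h2
    simp only [Term.size, Term.small, Bool.and_eq_true] at h1 h2
    obtain ⟨h3, h3'⟩ := iha (by omega) h2.1
    obtain ⟨h4, h4'⟩ := ihb (by omega) h2.2
    have h5 : |a.den s - b.den s| ≤ (V : ℤ) ^ (a.size + b.size) :=
      (abs_sub _ _).trans ((add_le_add h3' h4').trans (hadd _ _ a.one_le_size b.one_le_size))
    refine ⟨?_, h5⟩
    rw [Term.value, h3, h4]
    exact hword _ _ h1 h5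
  | mul a b iha ihb =>
    intro h1 h2
    simp only [Term.size, Term.small, Bool.and_eq_true] at h1 h2
    obtain ⟨h3, h3'⟩ := iha (by omega) h2.1
    obtain ⟨h4, h4'⟩ := ihb (by omega) h2.2
    have h5 : |a.den s * b.den s| ≤ (V : ℤ) ^ (a.size + b.size) := by
      rw [abs_mul, pow_add]
      exact mul_le_mul h3' h4' (abs_nonneg _) (by positivity)
    refine ⟨?_, h5⟩
    rw [Term.value, h3, h4]
    exact hword _ _ h1 h5
  | div a b iha ihb =>
    intro h1 h2
    simp only [Term.size, Term.small, Bool.and_eq_true] at h1 h2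
    obtain ⟨h3, h3'⟩ := iha (by omega) h2.1
    obtain ⟨h4, h4'⟩ := ihb (by omega) h2.2
    have h5 : |a.den s / b.den s| ≤ (V : ℤ) ^ (a.size + b.size) :=
      (Int.abs_ediv_le_abs _ _).trans (h3'.trans (hle _ _))
    refine ⟨?_, h5⟩
    rw [Term.value, h3, h4]
    exact hword _ _ h1 h5
  | le a b iha ihb =>
    intro h1 h2
    simp only [Term.size, Term.small, Bool.and_eq_true] at h1 h2
    obtain ⟨h3, h3'⟩ := iha (by omega) h2.1
    obtain ⟨h4, h4'⟩ := ihb (by omega) h2.2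
    have h5 : |if a.den s ≤ b.den s then (1 : ℤ) else 0| ≤ (V : ℤ) ^ (a.size + b.size) := by
      have := hpow (a.size + b.size) (by have := a.one_le_size; omega)
      split_ifs <;> simp only [abs_one, abs_zero] <;> omega
    refine ⟨?_, h5⟩
    rw [Term.value, h3, h4]
    exact hword _ _ h1 h5

instance : Add Term := ⟨.add⟩
instance : Sub Term := ⟨.sub⟩
instance : Mul Term := ⟨.mul⟩
instance : Div Term := ⟨.div⟩
instance (n : ℕ) : OfNat Term n := ⟨.const n⟩

/-! ### Arrays

The memory is divided into 32 arrays. -/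

/-- The address of the entry `i` of the array `k`. -/
def addr (k : Fin 32) (i : Term) : Term := .sub (.const (-1 - (k.val : ℤ))) (.mul (.const 32) i)

/-- The entry `i` of the array `k`. -/
def arr (k : Fin 32) (i : Term) : Term := .load (addr k i)

/-- The entry `i` of the array `k`. -/
def Store.A (s : Store) (k : Fin 32) (i : ℤ) : ℤ := s.mem (-1 - (k.val : ℤ) - 32 * i)

/-- Change of a register. -/
def Store.setR (s : Store) (i : ℕ) (z : ℤ) : Store := ⟨Function.update s.reg i z, s.mem⟩
/-- Change of a memory cell. -/
def Store.setM (s : Store) (a z : ℤ) : Store := ⟨s.reg, Function.update s.mem a z⟩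
/-- Change of an array entry. -/
def Store.setA (s : Store) (k : Fin 32) (i z : ℤ) : Store := s.setM (-1 - (k.val : ℤ) - 32 * i) z

@[simp] theorem setR_reg (s : Store) (i j : ℕ) (z : ℤ) :
    (s.setR i z).reg j = if j = i then z else s.reg j := by
  simp [Store.setR, Function.update_apply]
@[simp] theorem setR_A (s : Store) (i : ℕ) (z : ℤ) (k : Fin 32) (j : ℤ) :
    (s.setR i z).A k j = s.A k j := rfl
@[simp] theorem setR_mem (s : Store) (i : ℕ) (z : ℤ) : (s.setR i z).mem = s.mem := rfl
@[simp] theorem setA_reg (s : Store) (k : Fin 32) (i z : ℤ) : (s.setA k i z).reg = s.reg := rfl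
@[simp] theorem setM_reg (s : Store) (a z : ℤ) : (s.setM a z).reg = s.reg := rfl
@[simp] theorem setA_A (s : Store) (k k' : Fin 32) (i j z : ℤ) :
    (s.setA k i z).A k' j = if k' = k ∧ j = i then z else s.A k' j := by
  simp only [Store.setA, Store.setM, Store.A, Function.update_apply]
  congr 1
  rw [eq_iff_iff, Fin.ext_iff]
  constructor
  · intro h; have := k.isLt; have := k'.isLt; omega
  · rintro ⟨h, rfl⟩; rw [h]

@[simp] theorem den_add (s : Store) (a b : Term) : (a + b).den s = a.den s + b.den s := rfl
@[simp] theorem den_sub (s : Store) (a b : Term) : (a - b).den s = a.den s - b.den s := rfl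
@[simp] theorem den_mul (s : Store) (a b : Term) : (a * b).den s = a.den s * b.den s := rfl
@[simp] theorem den_div (s : Store) (a b : Term) : (a / b).den s = a.den s / b.den s := rfl
@[simp] theorem den_ofNat (s : Store) (n : ℕ) : (ofNat(n) : Term).den s = n := rfl
@[simp] theorem den_reg (s : Store) (i : ℕ) : (Term.reg i).den s = s.reg i := rfl
@[simp] theorem den_const (s : Store) (z : ℤ) : (Term.const z).den s = z := rfl
@[simp] theorem den_arr (s : Store) (k : Fin 32) (i : Term) :
    (arr k i).den s = s.A k (i.den s) := rfl
@[simp] theorem den_load (s : Store) (a : Term) : (Term.load a).den s = s.mem (a.den s) := rfl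

/-- Test for `a < b`. -/
def ltT (a b : Term) : Term := .le (a + 1) b
/-- Test for equality. -/
def eqT (a b : Term) : Term := .le a b * .le b a

@[simp] theorem den_ltT (s : Store) (a b : Term) :
    (ltT a b).den s = if a.den s < b.den s then 1 else 0 := by
  simp [ltT, Term.den]
@[simp] theorem den_eqT (s : Store) (a b : Term) :
    (eqT a b).den s = if a.den s = b.den s then 1 else 0 := by
  simp only [eqT, den_mul, Term.den]
  split_ifs <;> omega

/-! ### Commands -/

/-- Commands for programs that use arrays. -/
inductive Cmd where
  | skip
  | set (i : ℕ) (e : Term)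
  | put (k : Fin 32) (i e : Term)
  | raw (a e : Term)
  | seq (c d : Cmd)
  | ite (e : Term) (c d : Cmd)
  | loop (e : Term) (c : Cmd)

/-- Sequential composition. -/
infixr:60 " ;; " => Cmd.seq

/-- The program of a command. -/
def Cmd.prog : Cmd → Prog
  | .skip => .assign 31 (.reg 31)
  | .set i e => .assign i e
  | .put k i e => .store (addr k i) e
  | .raw a e => .store a e
  | .seq c d => .seq c.prog d.prog
  | .ite e c d => .cond e c.prog d.prog
  | .loop e c => .loop e c.prog

/-- All expressions have size at most `S` and small constants. -/
def Cmd.ok (S : ℕ) : Cmd → Bool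
  | .skip => decide (1 ≤ S)
  | .set _ e => decide (e.size ≤ S) && e.small
  | .put k i e => decide ((addr k i).size ≤ S) && (addr k i).small && decide (e.size ≤ S) && e.small
  | .raw a e => decide (a.size ≤ S) && a.small && decide (e.size ≤ S) && e.small
  | .seq c d => c.ok S && d.ok S
  | .ite e c d => decide (e.size ≤ S) && e.small && c.ok S && d.ok S
  | .loop e c => decide (e.size ≤ S) && e.small && c.ok S

/-- Execution of a command, with values bounded by `V`. -/
inductive HExec (V : ℕ) : Cmd → Store → ℕ → Store → Prop
  | skip {s : Store} : HExec V .skip s 2 s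
  | set {i : ℕ} {e : Term} {s : Store} : |e.den s| ≤ V →
      HExec V (.set i e) s (e.cost + 1) (s.setR i (e.den s))
  | put {k : Fin 32} {i e : Term} {s : Store} : |e.den s| ≤ V →
      HExec V (.put k i e) s ((addr k i).cost + e.cost + 1) (s.setA k (i.den s) (e.den s))
  | raw {a e : Term} {s : Store} : |e.den s| ≤ V →
      HExec V (.raw a e) s (a.cost + e.cost + 1) (s.setM (a.den s) (e.den s))
  | seq {c d : Cmd} {s s₁ s₂ : Store} {t₁ t₂ : ℕ} :
      HExec V c s t₁ s₁ → HExec V d s₁ t₂ s₂ → HExec V (.seq c d) s (t₁ + t₂) s₂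
  | ite_true {e : Term} {c d : Cmd} {s s' : Store} {t : ℕ} :
      e.den s ≠ 0 → HExec V c s t s' → HExec V (.ite e c d) s (e.cost + 1 + t) s'
  | ite_false {e : Term} {c d : Cmd} {s s' : Store} {t : ℕ} :
      e.den s = 0 → HExec V d s t s' → HExec V (.ite e c d) s (e.cost + 1 + t) s'
  | loop_true {e : Term} {c : Cmd} {s s₁ s₂ : Store} {t₁ t₂ : ℕ} :
      e.den s ≠ 0 → HExec V c s t₁ s₁ → HExec V (.loop e c) s₁ t₂ s₂ →
      HExec V (.loop e c) s (e.cost + 1 + t₁ + t₂) s₂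
  | loop_false {e : Term} {c : Cmd} {s : Store} :
      e.den s = 0 → HExec V (.loop e c) s (e.cost + 1) s

theorem Store.Bounded.setR {V : ℕ} {s : Store} (h : s.Bounded V) {i : ℕ} {z : ℤ} (hz : |z| ≤ V) :
    (s.setR i z).Bounded V := by
  refine ⟨fun j => ?_, h.2⟩
  rw [setR_reg]; split_ifs
  · exact hz
  · exact h.1 j

theorem Store.Bounded.setM {V : ℕ} {s : Store} (h : s.Bounded V) {a z : ℤ} (hz : |z| ≤ V) :
    (s.setM a z).Bounded V := by
  refine ⟨h.1, fun b => ?_⟩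
  simp only [Store.setM, Function.update_apply]; split_ifs
  · exact hz
  · exact h.2 b

/-- Only stored values need an explicit bound: `HExec` keeps them below `V`, and `Term.value_eq`
then covers everything computed within an expression, addresses included. The step counts agree
exactly. -/
theorem HExec.exec {V W S : ℕ} (hV : 64 ≤ V) (hW : V ^ S ≤ W) {c : Cmd} {s s' : Store} {t : ℕ}
    (h : HExec V c s t s') : c.ok S → s.Bounded V → Exec W c.prog s t s' ∧ s'.Bounded V := by
  induction h with
  | @skip s =>
    intro h hs
    refine ⟨?_, hs⟩
    have h1 := (Term.value_eq hV hW hs (.reg 31) (by simpa [Cmd.ok, Term.size] using h) rfl).1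
    have := Exec.assign (i := 31) h1
    rw [den_reg, Function.update_eq_self] at this
    exact this
  | @set i e s hb =>
    intro h hs
    simp only [Cmd.ok, Bool.and_eq_true, decide_eq_true_eq] at h
    exact ⟨.assign (Term.value_eq hV hW hs e h.1 h.2).1, hs.setR hb⟩
  | @put k i e s hb =>
    intro h hs
    simp only [Cmd.ok, Bool.and_eq_true, decide_eq_true_eq] at h
    exact ⟨.store (Term.value_eq hV hW hs _ h.1.1.1 h.1.1.2).1
      (Term.value_eq hV hW hs e h.1.2 h.2).1, hs.setM hb⟩
  | @raw a e s hb =>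
    intro h hs
    simp only [Cmd.ok, Bool.and_eq_true, decide_eq_true_eq] at h
    exact ⟨.store (Term.value_eq hV hW hs _ h.1.1.1 h.1.1.2).1
      (Term.value_eq hV hW hs e h.1.2 h.2).1, hs.setM hb⟩
  | seq _ _ ih1 ih2 =>
    intro h hs
    simp only [Cmd.ok, Bool.and_eq_true] at h
    obtain ⟨h1, h1'⟩ := ih1 h.1 hs
    obtain ⟨h2, h2'⟩ := ih2 h.2 h1'
    exact ⟨.seq h1 h2, h2'⟩
  | @ite_true e c d s s' t he _ ih =>
    intro h hs
    simp only [Cmd.ok, Bool.and_eq_true, decide_eq_true_eq] at h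
    obtain ⟨h1, h2⟩ := ih h.1.2 hs
    exact ⟨.cond_true (Term.value_eq hV hW hs e h.1.1.1 h.1.1.2).1 he h1, h2⟩
  | @ite_false e c d s s' t he _ ih =>
    intro h hs
    simp only [Cmd.ok, Bool.and_eq_true, decide_eq_true_eq] at h
    obtain ⟨h1, h2⟩ := ih h.2 hs
    exact ⟨.cond_false (he ▸ (Term.value_eq hV hW hs e h.1.1.1 h.1.1.2).1) h1, h2⟩
  | @loop_true e c s s₁ s₂ t₁ t₂ he _ _ ih1 ih2 =>
    intro h hs
    have h' := h
    simp only [Cmd.ok, Bool.and_eq_true, decide_eq_true_eq] at h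
    obtain ⟨h1, h1'⟩ := ih1 h.2 hs
    obtain ⟨h2, h2'⟩ := ih2 h' h1'
    exact ⟨.loop_true (Term.value_eq hV hW hs e h.1.1 h.1.2).1 he h1 h2, h2'⟩
  | @loop_false e c s he =>
    intro h hs
    simp only [Cmd.ok, Bool.and_eq_true, decide_eq_true_eq] at h
    exact ⟨.loop_false (he ▸ (Term.value_eq hV hW hs e h.1.1 h.1.2).1), hs⟩

/-! ### What a command leaves unchanged -/

/-- The command may write to the register `i`. -/
def Cmd.wr (i : ℕ) : Cmd → Bool
  | .skip => false
  | .set j _ => decide (i = j)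
  | .put .. => false
  | .raw .. => false
  | .seq c d => c.wr i || d.wr i
  | .ite _ c d => c.wr i || d.wr i
  | .loop _ c => c.wr i

/-- The command may write to the array `k`. -/
def Cmd.wa (k : Fin 32) : Cmd → Bool
  | .skip => false
  | .set .. => false
  | .put j _ _ => decide (k = j)
  | .raw .. => true
  | .seq c d => c.wa k || d.wa k
  | .ite _ c d => c.wa k || d.wa k
  | .loop _ c => c.wa k

/-- `s'` agrees with `s` on everything that the command `c` does not write to. -/
structure Agree (c : Cmd) (s s' : Store) : Prop where
  reg : ∀ i, c.wr i = false → s'.reg i = s.reg i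
  arr : ∀ k, c.wa k = false → ∀ i, s'.A k i = s.A k i

theorem Agree.refl (c : Cmd) (s : Store) : Agree c s s := ⟨fun _ _ => rfl, fun _ _ _ => rfl⟩

theorem Agree.trans {c : Cmd} {s s' s'' : Store} (h : Agree c s s') (h' : Agree c s' s'') :
    Agree c s s'' :=
  ⟨fun i hi => (h'.reg i hi).trans (h.reg i hi), fun k hk i => (h'.arr k hk i).trans (h.arr k hk i)⟩

theorem Agree.mono {c d : Cmd} {s s' : Store} (h : Agree c s s')
    (hr : ∀ i, d.wr i = false → c.wr i = false) (ha : ∀ k, d.wa k = false → c.wa k = false) :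
    Agree d s s' :=
  ⟨fun i hi => h.reg i (hr i hi), fun k hk i => h.arr k (ha k hk) i⟩

theorem HExec.agree {V : ℕ} {c : Cmd} {s s' : Store} {t : ℕ} (h : HExec V c s t s') :
    Agree c s s' := by
  induction h with
  | skip => exact Agree.refl _ _
  | set _ =>
    refine ⟨fun j hj => ?_, fun _ _ _ => rfl⟩
    simp only [Cmd.wr, decide_eq_false_iff_not] at hj
    rw [setR_reg, if_neg hj]
  | put _ =>
    refine ⟨fun _ _ => rfl, fun j hj i => ?_⟩
    simp only [Cmd.wa, decide_eq_false_iff_not] at hj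
    rw [setA_A, if_neg fun h => hj h.1]
  | raw _ =>
    refine ⟨fun _ _ => rfl, fun j hj i => ?_⟩
    simp [Cmd.wa] at hj
  | seq _ _ ih1 ih2 =>
    refine (ih1.mono ?_ ?_).trans (ih2.mono ?_ ?_) <;> simp +contextual [Cmd.wr, Cmd.wa]
  | ite_true _ _ ih => refine ih.mono ?_ ?_ <;> simp +contextual [Cmd.wr, Cmd.wa]
  | ite_false _ _ ih => refine ih.mono ?_ ?_ <;> simp +contextual [Cmd.wr, Cmd.wa]
  | loop_true _ _ _ ih1 ih2 =>
    refine (ih1.mono ?_ ?_).trans ih2 <;> simp +contextual [Cmd.wr, Cmd.wa]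
  | loop_false _ => exact Agree.refl _ _

/-! ### Total correctness with time bounds -/

/-- The command, started in `s`, halts after at most `T` steps in a store that satisfies `Q`. -/
def Run (V : ℕ) (c : Cmd) (s : Store) (T : ℕ) (Q : Store → Prop) : Prop :=
  ∃ t s', HExec V c s t s' ∧ t ≤ T ∧ Q s'

theorem Run.mono {V : ℕ} {c : Cmd} {s : Store} {T T' : ℕ} {Q Q' : Store → Prop}
    (h : Run V c s T Q) (hT : T ≤ T') (hQ : ∀ s', Q s' → Q' s') : Run V c s T' Q' :=
  let ⟨t, s', h1, h2, h3⟩ := h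
  ⟨t, s', h1, h2.trans hT, hQ _ h3⟩

/-- Specifications need to mention only what changes; that the remaining registers and arrays are
untouched is decided from the program text. -/
theorem Run.frame {V : ℕ} {c : Cmd} {s : Store} {T : ℕ} {Q : Store → Prop}
    (h : Run V c s T Q) : Run V c s T fun s' => Q s' ∧ Agree c s s' :=
  let ⟨t, s', h1, h2, h3⟩ := h
  ⟨t, s', h1, h2, h3, h1.agree⟩

theorem Run.seq {V : ℕ} {c d : Cmd} {s : Store} {T₁ T₂ : ℕ} {Q : Store → Prop}
    (h : Run V c s T₁ fun s' => Run V d s' T₂ Q) : Run V (c ;; d) s (T₁ + T₂) Q :=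
  let ⟨_, _, h1, h2, _, s'', h3, h4, h5⟩ := h
  ⟨_, s'', .seq h1 h3, add_le_add h2 h4, h5⟩

theorem Run.ite {V : ℕ} {e : Term} {c d : Cmd} {s : Store} {T₁ T₂ : ℕ} {Q : Store → Prop}
    (h1 : e.den s ≠ 0 → Run V c s T₁ Q) (h2 : e.den s = 0 → Run V d s T₂ Q) :
    Run V (.ite e c d) s (e.cost + 1 + max T₁ T₂) Q := by
  by_cases h : e.den s = 0
  · obtain ⟨t, s', h3, h4, h5⟩ := h2 h
    exact ⟨_, s', .ite_false h h3, by omega, h5⟩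
  · obtain ⟨t, s', h3, h4, h5⟩ := h1 h
    exact ⟨_, s', .ite_true h h3, by omega, h5⟩

/-- The index of the invariant bounds the number of iterations still to come, so termination and
running time come from the same induction. -/
theorem Run.loop {V : ℕ} {e : Term} {c : Cmd} {b : ℕ} {I : ℕ → Store → Prop}
    (hbody : ∀ n s, I n s → e.den s ≠ 0 → Run V c s b fun s' => ∃ n' < n, I n' s') :
    ∀ n s, I n s → Run V (.loop e c) s (n * (b + e.cost + 1) + (e.cost + 1))
      fun s' => e.den s' = 0 ∧ ∃ n', I n' s' := by
  intro n
  induction n using Nat.strong_induction_on with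
  | _ n ih =>
    intro s hs
    by_cases h : e.den s = 0
    · exact ⟨_, s, .loop_false h, by omega, h, n, hs⟩
    · obtain ⟨t, s', h1, h2, n', h3, h4⟩ := hbody n s hs h
      obtain ⟨t', s'', h5, h6, h7⟩ := ih n' h3 s' h4
      refine ⟨_, s'', .loop_true h h1 h5, ?_, h7⟩
      have : (n' + 1) * (b + e.cost + 1) ≤ n * (b + e.cost + 1) :=
        Nat.mul_le_mul_right _ h3
      rw [add_mul, one_mul] at this
      omega

/-- The loop rule, with the information about what the body leaves unchanged. -/
theorem Run.loopA {V : ℕ} {e : Term} {c : Cmd} {b : ℕ} {I : ℕ → Store → Prop} {n : ℕ} {s₀ : Store}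
    (h0 : I n s₀)
    (hbody : ∀ n s, I n s → Agree c s₀ s → e.den s ≠ 0 →
      Run V c s b fun s' => ∃ n' < n, I n' s') :
    Run V (.loop e c) s₀ (n * (b + e.cost + 1) + (e.cost + 1))
      fun s' => e.den s' = 0 ∧ Agree c s₀ s' ∧ ∃ n', I n' s' := by
  refine (Run.loop (I := fun n s => Agree c s₀ s ∧ I n s) (fun n s hs he => ?_) n s₀
    ⟨Agree.refl _ _, h0⟩).mono le_rfl fun s' h => ⟨h.1, ?_⟩
  · exact (hbody n s hs.2 hs.1 he).frame.mono le_rfl fun s' ⟨⟨n', h1, h2⟩, h3⟩ =>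
      ⟨n', h1, hs.1.trans h3, h2⟩
  · obtain ⟨_, n', h1, h2⟩ := h
    exact ⟨h1, n', h2⟩

/-- The effect of a command without loops. -/
def Cmd.eval : Cmd → Store → Store
  | .skip, s => s
  | .set i e, s => s.setR i (e.den s)
  | .put k i e, s => s.setA k (i.den s) (e.den s)
  | .raw a e, s => s.setM (a.den s) (e.den s)
  | .seq c d, s => d.eval (c.eval s)
  | .ite e c d, s => if e.den s = 0 then d.eval s else c.eval s
  | .loop _ _, s => s

/-- The command has no loops and computes no values beyond `V`. -/
def Cmd.safe (V : ℕ) : Cmd → Store → Prop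
  | .skip, _ => True
  | .set _ e, s => |e.den s| ≤ V
  | .put _ _ e, s => |e.den s| ≤ V
  | .raw _ e, s => |e.den s| ≤ V
  | .seq c d, s => c.safe V s ∧ d.safe V (c.eval s)
  | .ite e c d, s => (e.den s ≠ 0 → c.safe V s) ∧ (e.den s = 0 → d.safe V s)
  | .loop _ _, _ => False

/-- A bound for the running time of a command without loops. -/
def Cmd.time : Cmd → ℕ
  | .skip => 2
  | .set _ e => e.cost + 1
  | .put k i e => (addr k i).cost + e.cost + 1
  | .raw a e => a.cost + e.cost + 1
  | .seq c d => c.time + d.time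
  | .ite e c d => e.cost + 1 + max c.time d.time
  | .loop _ _ => 0

/-- Loop-free code is verified by computing its effect, which the simplifier can do. -/
theorem Run.of_eval {V : ℕ} {Q : Store → Prop} :
    ∀ {c : Cmd} {s : Store}, c.safe V s → Q (c.eval s) → Run V c s c.time Q := by
  have key : ∀ (c : Cmd) (s : Store), c.safe V s → Run V c s c.time fun s' => s' = c.eval s := by
    intro c
    induction c with
    | skip => exact fun s _ => ⟨_, _, .skip, le_rfl, rfl⟩
    | set i e => exact fun s h => ⟨_, _, .set h, le_rfl, rfl⟩
    | put k i e => exact fun s h => ⟨_, _, .put h, le_rfl, rfl⟩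
    | raw a e => exact fun s h => ⟨_, _, .raw h, le_rfl, rfl⟩
    | seq c d ihc ihd =>
      intro s h
      refine Run.seq ((ihc s h.1).mono le_rfl ?_)
      rintro _ rfl
      exact ihd _ h.2
    | ite e c d ihc ihd =>
      intro s h
      refine Run.ite (fun he => (ihc s (h.1 he)).mono le_rfl ?_)
        fun he => (ihd s (h.2 he)).mono le_rfl ?_
      · rintro _ rfl; simp [Cmd.eval, he]
      · rintro _ rfl; simp [Cmd.eval, he]
    | loop e c _ => exact fun s h => h.elim
  exact fun {_ _} h hQ => (key _ _ h).mono le_rfl (by rintro _ rfl; exact hQ)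

end WordRAM


namespace WordRAM

/-! ### The registers and arrays of the program -/

/-- number of tiles -/
notation "regN" => 0
/-- bound for the coordinates -/
notation "regE" => 2
/-- length of a column in the table of cells -/
notation "regK" => 3
/-- offset of the columns -/
notation "regX" => 4
/-- first entry of the direction -/
notation "regP" => 5
/-- second entry of the direction -/
notation "regQ" => 6
/-- current stamp -/
notation "regS" => 7
/-- flag: a cut has been found -/
notation "regF" => 8
/-- a tile that can be bitten off, or `0` -/
notation "regB" => 9
/-- loop counter -/
notation "regI" => 10
/-- current column -/
notation "regC" => 11
/-- number of reflex tiles, or of corners -/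
notation "regM" => 12
/-- loop counter for pairs -/
notation "regJ" => 13
/-- left root -/
notation "regL" => 14
/-- right root -/
notation "regR" => 15
/-- head of the queue -/
notation "regH" => 16
/-- tail of the queue -/
notation "regT" => 17
/-- current cell -/
notation "regU" => 18
/-- next cell -/
notation "regV" => 19
/-- first corner -/
notation "regY" => 20
/-- current corner -/
notation "regZ" => 21
/-- auxiliary register -/
notation "regA" => 22
/-- auxiliary register -/
notation "regD" => 23

/-- first coordinates -/
notation "arrX" => 0
/-- second coordinates -/
notation "arrY" => 1
/-- cells of the tiles -/
notation "arrC" => 2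
/-- table of cells -/
notation "arrP" => 3
/-- next tile in the same column -/
notation "arrN" => 4
/-- first tile of a column -/
notation "arrH" => 5
/-- last tile of a row -/
notation "arrT" => 6
/-- previous tile in the same row, or `0` -/
notation "arrR" => 7
/-- stamps -/
notation "arrV" => 8
/-- queue -/
notation "arrQ" => 9
/-- parents of the left tree -/
notation "parA" => 10
/-- parents of the right tree -/
notation "parB" => 11
/-- parents of the closure -/
notation "parC" => 12
/-- reflex tiles -/
notation "arrS" => 13

/-! ### Cells -/

/-- A set of tiles, with the parameters of the numbering of the cells. -/
structure Geo where
  /-- the tiles -/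
  P : Finset (ℤ × ℤ)
  /-- bound for the coordinates -/
  E : ℤ
  /-- offset of the columns -/
  X : ℤ
  two_le : 2 ≤ E
  le : E ≤ X
  bound : ∀ p ∈ P, |p.1| + 2 ≤ E ∧ |p.2| + 2 ≤ E

namespace Geo

variable (G : Geo)

/-- Length of a column. -/
def K : ℤ := 2 * G.E + 1

/-- The number of a cell. -/
def cd (z : ℤ × ℤ) : ℤ := G.K * (z.1 + G.X) + (z.2 + G.E)

/-- Cells that have a proper number. -/
def Near (z : ℤ × ℤ) : Prop := -G.E ≤ z.1 ∧ z.1 ≤ G.E ∧ -G.E ≤ z.2 ∧ z.2 ≤ G.E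

theorem K_pos : 5 ≤ G.K := by have := G.two_le; unfold K; omega

theorem near_of_mem {p : ℤ × ℤ} (hp : p ∈ G.P) : -G.E + 2 ≤ p.1 ∧ p.1 + 2 ≤ G.E ∧
    -G.E + 2 ≤ p.2 ∧ p.2 + 2 ≤ G.E := by
  obtain ⟨h1, h2⟩ := G.bound p hp
  have := abs_le.1 (show |p.1| ≤ G.E - 2 by omega)
  have := abs_le.1 (show |p.2| ≤ G.E - 2 by omega)
  omega

theorem near {p : ℤ × ℤ} (hp : p ∈ G.P) : G.Near p := by
  have := G.near_of_mem hp
  unfold Near; omega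

theorem cd_div {z : ℤ × ℤ} (hz : G.Near z) : G.cd z / G.K = z.1 + G.X := by
  have := G.K_pos
  obtain ⟨-, -, h1, h2⟩ := hz
  rw [cd, Int.mul_add_ediv_left _ _ (by omega), Int.ediv_eq_zero_of_lt (by omega)
      (by unfold K; omega)]
  omega

theorem cd_inj {z w : ℤ × ℤ} (hz : G.Near z) (hw : G.Near w) (h : G.cd z = G.cd w) : z = w := by
  have h1 := G.cd_div hz
  rw [h, G.cd_div hw] at h1
  have h2 : z.1 = w.1 := by omega
  refine Prod.ext h2 ?_
  rw [cd, cd, h2] at h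
  omega

theorem cd_right (x y : ℤ) : G.cd (x + 1, y) = G.cd (x, y) + G.K := by simp only [cd]; ring
theorem cd_left (x y : ℤ) : G.cd (x - 1, y) = G.cd (x, y) - G.K := by simp only [cd]; ring
theorem cd_up (x y : ℤ) : G.cd (x, y + 1) = G.cd (x, y) + 1 := by simp only [cd]; ring
theorem cd_down (x y : ℤ) : G.cd (x, y - 1) = G.cd (x, y) - 1 := by simp only [cd]; ring

/-- Since tiles have positive numbers, `0` can stand for an absent tile: no previous tile, end of a
list, no bite. -/
theorem cd_pos {p : ℤ × ℤ} (hp : p ∈ G.P) : 0 < G.cd p := by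
  have := G.near_of_mem hp
  have := G.K_pos
  have := G.le
  unfold cd
  nlinarith

/-- With `cd_lt`, the numbers lie in a window that ends at `top`. Increasing the offset `X` by `K`
gives the window that begins exactly there, so different directions use disjoint parts of the
arrays. -/
theorem le_cd {z : ℤ × ℤ} (hz : G.Near z) : G.K * (G.X - G.E) ≤ G.cd z := by
  have := G.K_pos
  obtain ⟨h0, -, h1, h2⟩ := hz
  unfold cd
  nlinarith

/-- A bound for the numbers of the cells. -/
def top : ℤ := G.K * (G.X + G.E + 1)

theorem cd_lt {z : ℤ × ℤ} (hz : G.Near z) : G.cd z < G.top := by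
  have := G.K_pos
  obtain ⟨-, h0, h1, h2⟩ := hz
  unfold cd top
  have : G.K * (z.1 + G.X) ≤ G.K * (G.X + G.E) := mul_le_mul_of_nonneg_left (by omega) (by omega)
  have : z.2 + G.E < G.K := by unfold K; omega
  linarith [mul_add G.K (G.X + G.E) 1]

theorem abs_cd_le {V : ℕ} (hV : G.top ≤ V) {p : ℤ × ℤ} (hp : p ∈ G.P) : |G.cd p| ≤ V := by
  rw [abs_of_pos (G.cd_pos hp)]
  have := G.cd_lt (G.near hp)
  omega

/-- The table of cells is correct. -/
def Table (s : Store) : Prop := ∀ z, G.Near z → s.A arrP (G.cd z) = if z ∈ G.P then 1 else 0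

end Geo

/-! ### Graph search -/

/-- Follow one edge out of the current cell. -/
def visit (kp : Fin 32) (e : Term × Term) : Cmd :=
  .ite e.1
    (.set regV e.2 ;;
      .ite (eqT (arr arrV (.reg regV)) (.reg regS)) .skip
        (.put kp (.reg regV) (.reg regU) ;; .put arrQ (.reg regT) (.reg regV) ;;
          .put arrV (.reg regV) (.reg regS) ;; .set regT (.reg regT + 1)))
    .skip

/-- Follow all edges out of the current cell. -/
def visits (kp : Fin 32) : List (Term × Term) → Cmd
  | [] => .skip
  | e :: es => visit kp e ;; visits kp es

/-- Breadth first search from a root, with storage of the parents. -/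
def search (kp : Fin 32) (root : ℕ) (es : List (Term × Term)) : Cmd :=
  (.set regS (.reg regS + 1) ;; .put arrQ 0 (.reg root) ;; .put arrV (.reg root) (.reg regS) ;;
    .put kp (.reg root) (.reg root) ;; .set regH 0 ;; .set regT 1) ;;
  .loop (ltT (.reg regH) (.reg regT))
    ((.set regU (arr arrQ (.reg regH)) ;; .set regH (.reg regH + 1)) ;; visits kp es)

/-- The search changes nothing else. -/
structure SearchFrame (kp : Fin 32) (s₀ s : Store) : Prop where
  reg : ∀ r, r ≠ regS → r ≠ regH → r ≠ regT → r ≠ regU → r ≠ regV → s.reg r = s₀.reg r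
  arr : ∀ k, k ≠ arrV → k ≠ arrQ → k ≠ kp → ∀ i, s.A k i = s₀.A k i

/-- The list `es` describes the edges of the relation `Rel`. -/
structure Edges (G : Geo) (kp : Fin 32) (s₀ : Store) (es : List (Term × Term))
    (Rel : ℤ × ℤ → ℤ × ℤ → Prop) : Prop where
  mem : ∀ u v, Rel u v → v ∈ G.P
  sound : ∀ s u, SearchFrame kp s₀ s → u ∈ G.P → s.reg regU = G.cd u → ∀ e ∈ es, e.1.den s ≠ 0 →
    ∃ v, Rel u v ∧ e.2.den s = G.cd v
  complete : ∀ u v, u ∈ G.P → Rel u v → ∃ e ∈ es, ∀ s, SearchFrame kp s₀ s → s.reg regU = G.cd u →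
    e.1.den s ≠ 0 ∧ e.2.den s = G.cd v

/-- The invariant of the search; `q` is the queue. -/
structure SearchInv (G : Geo) (kp : Fin 32) (Rel : ℤ × ℤ → ℤ × ℤ → Prop) (s₀ : Store)
    (root : ℤ × ℤ) (h : ℕ) (u : ℤ) (q : List (ℤ × ℤ)) (s : Store) : Prop where
  frame : SearchFrame kp s₀ s
  stamp : s.reg regS = s₀.reg regS + 1
  head : s.reg regH = h
  tail : s.reg regT = q.length
  cur : s.reg regU = u
  nodup : q.Nodup
  mem : ∀ v ∈ q, v ∈ G.P
  queue : ∀ (i : ℕ) v, q[i]? = some v → s.A arrQ i = G.cd v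
  vis : ∀ v ∈ G.P, s.A arrV (G.cd v) = s₀.reg regS + 1 ↔ v ∈ q
  par : ∀ (i : ℕ) v, q[i]? = some v → i ≠ 0 →
    ∃ (j : ℕ) (w : ℤ × ℤ), j < i ∧ q[j]? = some w ∧ Rel w v ∧ s.A kp (G.cd v) = G.cd w
  first : q[0]? = some root
  root_par : s.A kp (G.cd root) = G.cd root
  le : ∀ i, 0 ≤ i → s.A arrV i ≤ s₀.reg regS + 1

variable {V : ℕ} {G : Geo} {kp : Fin 32} {es : List (Term × Term)} {Rel : ℤ × ℤ → ℤ × ℤ → Prop}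
  {s₀ : Store} {root : ℤ × ℤ}

/-- Three cases: the edge is absent, its end already carries the current stamp, or its end is new
and is appended to the queue with the current tile as its parent. -/
theorem visit_spec (hG : G.top ≤ V) (hN : (G.P.card : ℤ) < V) (hS : |s₀.reg regS + 1| ≤ V)
    (hkV : kp ≠ arrV) (hkQ : kp ≠ arrQ) (hE : Edges G kp s₀ es Rel) {e : Term × Term} (he : e ∈ es)
    {h j : ℕ} {u : ℤ × ℤ} {q : List (ℤ × ℤ)} {s : Store} (hj : q[j]? = some u)
    (hI : SearchInv G kp Rel s₀ root h (G.cd u) q s) :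
    Run V (visit kp e) s (visit kp e).time fun s' => ∃ q', q <+: q' ∧
      SearchInv G kp Rel s₀ root h (G.cd u) q' s' ∧
      ∀ v ∈ G.P, e.1.den s ≠ 0 → e.2.den s = G.cd v → v ∈ q' := by
  have hu : u ∈ G.P := hI.mem u (List.mem_of_getElem? hj)
  by_cases h1 : e.1.den s = 0
  · refine Run.of_eval ?_ ?_
    · simp [visit, Cmd.safe, h1]
    · simp only [visit, Cmd.eval, h1, if_true]
      exact ⟨q, List.prefix_rfl, hI, fun v _ h2 => (h2 rfl).elim⟩
  obtain ⟨v, hv, hev⟩ := hE.sound s u hI.frame hu hI.cur e he h1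
  have hvP := hE.mem u v hv
  by_cases h2 : s.A arrV (G.cd v) = s₀.reg regS + 1
  · refine Run.of_eval ?_ ?_
    · simp [visit, Cmd.safe, Cmd.eval, h1, hev, hI.stamp, h2, G.abs_cd_le hG hvP]
    · simp only [visit, Cmd.eval, h1, if_false]
      simp only [den_eqT, den_arr, den_reg, setR_reg, setR_A, hev, hI.stamp]
      simp only [show (7 : ℕ) ≠ 19 by decide, if_false]
      simp only [h2, if_true, one_ne_zero, if_false]
      refine ⟨q, List.prefix_rfl, ?_, fun w hw _ h3 => ?_⟩
      · exact { hI with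
          frame := ⟨fun r h1 h2 h3 h4 h5 => by
            rw [setR_reg, if_neg h5]; exact hI.frame.reg r h1 h2 h3 h4 h5, hI.frame.arr⟩
          stamp := by simp [hI.stamp]
          head := by simpa using hI.head
          tail := by simp [hI.tail]
          cur := by simp [hI.cur] }
      · rw [← G.cd_inj (G.near hvP) (G.near hw) h3]
        exact (hI.vis v hvP).1 h2
  · have hvq : v ∉ q := fun h => h2 ((hI.vis v hvP).2 h)
    -- The queue has no repetitions and consists of tiles, so its length stays within the word
    -- bound.
    have hlen : q.length + 1 ≤ G.P.card := by
      have h3 : (v :: q).Nodup := List.nodup_cons.2 ⟨hvq, hI.nodup⟩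
      have := (List.toFinset_card_of_nodup h3).symm.le.trans
        (Finset.card_le_card (t := G.P) fun w hw => by
          rcases List.mem_cons.1 (List.mem_toFinset.1 hw) with rfl | h
          · exact hvP
          · exact hI.mem w h)
      simpa using this
    have hlast : ∀ w, w ∈ G.P → G.cd w = G.cd v → w = v := fun w hw h =>
      G.cd_inj (G.near hw) (G.near hvP) h
    refine Run.of_eval ?_ ?_
    · have h3 : |(q.length : ℤ) + 1| ≤ V := by rw [abs_of_nonneg (by omega)]; omega
      simp [visit, Cmd.safe, Cmd.eval, h1, hev, hI.stamp, h2, G.abs_cd_le hG hvP, hI.cur,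
        G.abs_cd_le hG hu, hS, hI.tail, h3]
    · simp only [visit, Cmd.eval, h1, if_false]
      simp only [den_eqT, den_arr, den_reg, setR_reg, setR_A, hev, hI.stamp, setA_reg, hI.tail,
        hI.cur, den_add, den_ofNat]
      simp only [if_true, show (7 : ℕ) ≠ 19 by decide, show (18 : ℕ) ≠ 19 by decide,
        show (17 : ℕ) ≠ 19 by decide, if_false, h2]
      refine ⟨q ++ [v], List.prefix_append _ _, ?_, fun w hw _ h3 => ?_⟩
      swap
      · rw [hlast w hw h3.symm]; simp
      have hget : ∀ (i : ℕ) w, (q ++ [v])[i]? = some w →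
          (i < q.length ∧ q[i]? = some w) ∨ (i = q.length ∧ w = v) := by
        intro i w hw
        rcases lt_or_ge i q.length with h | h
        · rw [List.getElem?_append_left h] at hw
          exact .inl ⟨h, hw⟩
        · rw [List.getElem?_append_right h] at hw
          have : i - q.length = 0 := by
            by_contra h'
            rw [List.getElem?_eq_none (by simp; omega)] at hw
            simp at hw
          rw [this] at hw
          refine .inr ⟨by omega, ?_⟩
          simpa using hw.symm
      have hget' : ∀ (i : ℕ) w, q[i]? = some w → (q ++ [v])[i]? = some w := by
        intro i w hw
        rw [List.getElem?_append_left ((List.getElem?_eq_some_iff.1 hw).1)]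
        exact hw
      have hne : ∀ w ∈ q, w ≠ v := fun w hw h => hvq (h ▸ hw)
      refine ⟨⟨?_, ?_⟩, ?_, ?_, ?_, ?_, ?_, ?_, ?_, ?_, ?_, ?_, ?_, ?_⟩
      · intro r h1 h2 h3 h4 h5
        simp [h3, h5, hI.frame.reg r h1 h2 h3 h4 h5]
      · intro k h1 h2 h3 i
        simp [h1, h2, h3, hI.frame.arr k h1 h2 h3 i]
      · simp [hI.stamp]
      · simp [hI.head]
      · simp
      · simp [hI.cur]
      · rw [List.nodup_append]
        refine ⟨hI.nodup, by simp, ?_⟩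
        intro a ha b hb
        rw [List.mem_singleton.1 hb]
        exact hne a ha
      · intro w hw
        rcases List.mem_append.1 hw with h | h
        · exact hI.mem w h
        · rw [List.mem_singleton.1 h]; exact hvP
      · intro i w hw
        rcases hget i w hw with ⟨h3, h4⟩ | ⟨rfl, rfl⟩
        · have : (i : ℤ) ≠ (q.length : ℤ) := by omega
          simp [this, hkQ.symm, hI.queue i w h4]
        · simp
      · intro w hw
        by_cases h3 : w = v
        · subst h3; simp
        · have h4 : G.cd w ≠ G.cd v := fun h => h3 (hlast w hw h)
          simp [h4, hkV.symm, hI.vis w hw, h3]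
      · intro i w hw hi
        rcases hget i w hw with ⟨h3, h4⟩ | ⟨rfl, rfl⟩
        · obtain ⟨j, w', h5, h6, h7, h8⟩ := hI.par i w h4 hi
          refine ⟨j, w', h5, hget' j w' h6, h7, ?_⟩
          have h9 : G.cd w ≠ G.cd v := fun h =>
            hne w (List.mem_of_getElem? h4) (hlast w (hI.mem w (List.mem_of_getElem? h4)) h)
          simp [h9, hkV, hkQ, h8]
        · refine ⟨j, u, (List.getElem?_eq_some_iff.1 hj).1, hget' j u hj, hv, ?_⟩
          simp [hkV, hkQ]
      · exact hget' 0 root hI.first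
      · have h9 : G.cd root ≠ G.cd v := fun h =>
          hne root (List.mem_of_getElem? hI.first)
            (hlast root (hI.mem root (List.mem_of_getElem? hI.first)) h)
        simp [h9, hkV, hkQ, hI.root_par]
      · intro i hi0
        have := hI.le i hi0
        simp only [setR_A, setA_A, hkV.symm, false_and, if_false]
        split_ifs <;> omega

theorem visits_spec (hG : G.top ≤ V) (hN : (G.P.card : ℤ) < V) (hS : |s₀.reg regS + 1| ≤ V)
    (hkV : kp ≠ arrV) (hkQ : kp ≠ arrQ) (hE : Edges G kp s₀ es Rel)
    {h j : ℕ} {u : ℤ × ℤ} : ∀ (fs : List (Term × Term)), (∀ e ∈ fs, e ∈ es) →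
    ∀ {q : List (ℤ × ℤ)} {s : Store}, q[j]? = some u →
    SearchInv G kp Rel s₀ root h (G.cd u) q s →
    Run V (visits kp fs) s (visits kp fs).time fun s' => ∃ q', q <+: q' ∧
      SearchInv G kp Rel s₀ root h (G.cd u) q' s' ∧
      ∀ v ∈ G.P, ∀ e ∈ fs, (∀ s, SearchFrame kp s₀ s → s.reg regU = G.cd u →
        e.1.den s ≠ 0 ∧ e.2.den s = G.cd v) → v ∈ q' := by
  intro fs
  induction fs with
  | nil =>
    intro _ q s _ hI
    exact Run.of_eval (by simp [visits, Cmd.safe]) ⟨q, List.prefix_rfl, hI, by simp⟩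
  | cons e fs ih =>
    intro hes q s hj hI
    refine Run.seq ((visit_spec hG hN hS hkV hkQ hE (hes e (by simp)) hj hI).mono le_rfl ?_)
    rintro s' ⟨q', h1, h2, h3⟩
    have hj' : q'[j]? = some u := by
      obtain ⟨l, rfl⟩ := h1
      rw [List.getElem?_append_left ((List.getElem?_eq_some_iff.1 hj).1)]
      exact hj
    refine (ih (fun e he => hes e (by simp [he])) hj' h2).mono le_rfl ?_
    rintro s'' ⟨q'', h4, h5, h6⟩
    refine ⟨q'', h1.trans h4, h5, ?_⟩
    intro v hv e' he' h7
    rcases List.mem_cons.1 he' with rfl | he'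
    · obtain ⟨h8, h9⟩ := h7 s hI.frame hI.cur
      exact h4.subset (h3 v hv h8 h9)
    · exact h6 v hv e' he' h7

/-- The result of a search. -/
structure Searched (G : Geo) (kp : Fin 32) (Rel : ℤ × ℤ → ℤ × ℤ → Prop) (root : ℤ × ℤ)
    (s₀ s : Store) : Prop where
  frame : SearchFrame kp s₀ s
  stamp : s.reg regS = s₀.reg regS + 1
  le : ∀ i, 0 ≤ i → s.A arrV i ≤ s₀.reg regS + 1
  vis : ∀ v ∈ G.P, s.A arrV (G.cd v) = s₀.reg regS + 1 ↔ Relation.ReflTransGen Rel root v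
  par : ∃ par : ℤ × ℤ → ℤ × ℤ, par root = root ∧
    (∀ v, Relation.ReflTransGen Rel root v → s.A kp (G.cd v) = G.cd (par v) ∧ par v ∈ G.P) ∧
    ∃ rank : ℤ × ℤ → ℕ, ∀ v, Relation.ReflTransGen Rel root v → v ≠ root →
      Rel (par v) v ∧ rank (par v) < rank v

/-- Stamps replace the clearing of marks: a search raises the stamp by one, and all older marks are
smaller. Each tile enters the queue at most once, and the number of edge tests per tile is fixed by
`es`; hence linear time with a constant that does not depend on the input. -/
theorem search_spec (kp : Fin 32) (hkV : kp ≠ arrV) (hkQ : kp ≠ arrQ) (rr : ℕ)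
    (hr : rr ≠ regS) (es : List (Term × Term)) : ∃ a : ℕ, ∀ {V : ℕ} {G : Geo}
    {Rel : ℤ × ℤ → ℤ × ℤ → Prop} {s₀ : Store} {root : ℤ × ℤ},
    G.top ≤ V → (G.P.card : ℤ) < V → |s₀.reg regS + 1| ≤ V →
    Edges G kp s₀ es Rel → root ∈ G.P → s₀.reg rr = G.cd root →
    (∀ i, 0 ≤ i → s₀.A arrV i ≤ s₀.reg regS) →
    Run V (search kp rr es) s₀ (a * G.P.card) (Searched G kp Rel root s₀) := by
  generalize hi : (Cmd.set regS (.reg regS + 1) ;; .put arrQ 0 (.reg rr) ;;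
    .put arrV (.reg rr) (.reg regS) ;; .put kp (.reg rr) (.reg rr) ;; .set regH 0 ;;
    .set regT 1) = ini
  generalize hc : (Cmd.set regU (arr arrQ (.reg regH)) ;; .set regH (.reg regH + 1)) = pop
  refine ⟨ini.time + (pop.time + (visits kp es).time + (ltT (.reg regH) (.reg regT)).cost + 1) +
    ((ltT (.reg regH) (.reg regT)).cost + 1), ?_⟩
  intro V G Rel s₀ root hG hN hS hE hroot hrr hle
  have hcard : 1 ≤ G.P.card := Finset.card_pos.2 ⟨root, hroot⟩
  have hlast : ∀ w, w ∈ G.P → G.cd w = G.cd root → w = root := fun w hw h =>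
    G.cd_inj (G.near hw) (G.near hroot) h
  have h1 : Run V ini s₀ ini.time fun s => SearchInv G kp Rel s₀ root 0 (s₀.reg regU) [root] s := by
    have h1V : (1 : ℤ) ≤ V := by omega
    subst hi
    refine Run.of_eval ?_ ?_
    · simp [Cmd.safe, Cmd.eval, hS, hr, hrr, G.abs_cd_le hG hroot, h1V]
    · simp only [Cmd.eval, den_add, den_reg, den_ofNat, setA_reg, setR_reg, hr, hrr, if_false,
        if_true]
      refine ⟨⟨?_, ?_⟩, ?_, ?_, ?_, ?_, ?_, ?_, ?_, ?_, ?_, ?_, ?_, ?_⟩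
      · intro r h1 h2 h3 h4 h5
        simp [h1, h2, h3]
      · intro k h1 h2 h3 i
        simp [h1, h2, h3]
      · simp
      · simp
      · simp
      · simp
      · simp
      · simpa using hroot
      · intro i v h
        rcases i with _ | i
        · simp only [List.getElem?_cons_zero, Option.some.injEq] at h
          simp [hkQ.symm, h]
        · simp at h
      · intro w hw
        by_cases h3 : w = root
        · subst h3; simp [hkV.symm]
        · have h4 : G.cd w ≠ G.cd root := fun h => h3 (hlast w hw h)
          have := hle (G.cd w) (G.cd_pos hw).le
          simp only [setR_A, setA_A, hkV.symm, false_and, if_false, h4, and_false,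
              List.mem_singleton,
            h3, iff_false, show (8 : Fin 32) ≠ 9 by decide]
          omega
      · intro i v h hi
        rcases i with _ | i
        · exact absurd rfl hi
        · simp at h
      · simp
      · simp
      · intro i hi0
        have := hle i hi0
        simp only [setR_A, setA_A, hkV.symm, false_and, if_false, show (8 : Fin 32) ≠ 9 by decide]
        split_ifs <;> omega
  have h2 : ∀ s, SearchInv G kp Rel s₀ root 0 (s₀.reg regU) [root] s →
      Run V (.loop (ltT (.reg regH) (.reg regT)) (pop ;; visits kp es)) s
      (G.P.card * (pop.time + (visits kp es).time + (ltT (.reg regH) (.reg regT)).cost + 1) +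
        ((ltT (.reg regH) (.reg regT)).cost + 1)) (Searched G kp Rel root s₀) := by
    intro s hs
    -- The first `h` entries of the queue have been processed: all their successors are in the
    -- queue. When `h` reaches the end, the queue is closed under `Rel`.
    refine (Run.loop (I := fun n s => ∃ (h : ℕ) (u : ℤ) (q : List (ℤ × ℤ)), n + h = G.P.card ∧
      h ≤ q.length ∧
      SearchInv G kp Rel s₀ root h u q s ∧ ∀ i < h, ∀ w, q[i]? = some w → ∀ v, Rel w v → v ∈ q)
      ?_ G.P.card s ⟨0, _, [root], by simp, by simp, hs, by simp⟩).mono le_rfl ?_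
    · rintro n s ⟨h, u', q, hn, hhq, hI, hdone⟩ he
      have hlt : h < q.length := by
        by_contra hcon
        apply he
        simp only [den_ltT, den_reg, hI.head, hI.tail]
        rw [if_neg (by omega)]
      have hqN : q.length ≤ G.P.card := by
        have := (List.toFinset_card_of_nodup hI.nodup).symm.le.trans
          (Finset.card_le_card (t := G.P) fun w hw => hI.mem w (List.mem_toFinset.1 hw))
        exact this
      obtain ⟨w, hw⟩ : ∃ w, q[h]? = some w := ⟨q[h], List.getElem?_eq_getElem hlt⟩
      have hwP := hI.mem w (List.mem_of_getElem? hw)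
      have h3 : Run V pop s pop.time fun s => SearchInv G kp Rel s₀ root (h + 1) (G.cd w) q s := by
        have hqh := hI.queue h w hw
        have h4 : |(h : ℤ) + 1| ≤ V := by rw [abs_of_nonneg (by omega)]; omega
        subst hc
        refine Run.of_eval ?_ ?_
        · simp [Cmd.safe, Cmd.eval, hI.head, hqh, G.abs_cd_le hG hwP, h4]
        · simp only [Cmd.eval, den_arr, den_reg, hI.head, hqh]
          exact { hI with
            frame := ⟨fun r h1 h2 h3 h4 h5 => by
              simp [h2, h4, hI.frame.reg r h1 h2 h3 h4 h5], hI.frame.arr⟩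
            stamp := by simp [hI.stamp]
            head := by simp [hI.head]
            tail := by simp [hI.tail]
            cur := by simp }
      refine Run.seq (h3.mono le_rfl fun s' hI' => ?_)
      refine (visits_spec hG hN hS hkV hkQ hE es (fun _ h => h) hw hI').mono le_rfl ?_
      rintro s'' ⟨q', ⟨l, rfl⟩, hI'', hall⟩
      refine ⟨n - 1, by omega, h + 1, _, _, by omega, ?_, hI'', ?_⟩
      · simp; omega
      · intro i hi x hx v hv
        rcases Nat.lt_succ_iff_lt_or_eq.1 hi with hi | rfl
        · rw [List.getElem?_append_left (by omega)] at hx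
          exact List.mem_append_left _ (hdone i hi x hx v hv)
        · rw [List.getElem?_append_left (by omega), hw, Option.some.injEq] at hx
          subst hx
          obtain ⟨e, he, h5⟩ := hE.complete w v hwP hv
          exact hall v (hE.mem _ _ hv) e he h5
    · rintro s' ⟨he, n, h, u, q, hn, hhq, hI, hdone⟩
      have hh : h = q.length := by
        by_contra hcon
        simp only [den_ltT, den_reg, hI.head, hI.tail] at he
        rw [if_pos (by omega)] at he
        omega
      have hrq : root ∈ q := List.mem_of_getElem? hI.first
      have hreach : ∀ v, v ∈ q ↔ Relation.ReflTransGen Rel root v := by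
        intro v
        constructor
        · intro hv
          obtain ⟨i, hi⟩ := List.mem_iff_getElem?.1 hv
          clear hv
          induction i using Nat.strong_induction_on generalizing v with
          | _ i ih =>
            by_cases h0 : i = 0
            · subst h0
              rw [hI.first, Option.some.injEq] at hi
              rw [hi]
            · obtain ⟨j, w, h1, h2, h3, -⟩ := hI.par i v hi h0
              exact (ih j h1 w h2).tail h3
        · intro hv
          induction hv with
          | refl => exact hrq
          | tail _ hbc ih =>
            obtain ⟨i, hi⟩ := List.mem_iff_getElem?.1 ih
            exact hdone i (by rw [hh]; exact (List.getElem?_eq_some_iff.1 hi).1) _ hi _ hbc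
      refine ⟨hI.frame, hI.stamp, hI.le, fun v hv => (hI.vis v hv).trans (hreach v), ?_⟩
      -- A parent is enqueued before its children, so the position in the queue serves as the rank.
      have hpar : ∀ v, ∃ w, (v = root → w = root) ∧ (v ∈ q → w ∈ G.P ∧ s'.A kp (G.cd v) = G.cd w ∧
          (v ≠ root → Rel w v ∧ q.idxOf w < q.idxOf v)) := by
        intro v
        by_cases hv : v ∈ q
        · by_cases hvr : v = root
          · subst hvr
            exact ⟨v, fun _ => rfl, fun _ => ⟨hroot, hI.root_par, fun h => absurd rfl h⟩⟩
          · have hi : q[q.idxOf v]? = some v := by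
              rw [List.getElem?_eq_getElem (List.idxOf_lt_length_iff.2 hv), List.getElem_idxOf]
            have h0 : q.idxOf v ≠ 0 := by
              intro h0
              rw [h0, hI.first, Option.some.injEq] at hi
              exact hvr hi.symm
            obtain ⟨j, w, h1, h2, h3, h4⟩ := hI.par _ v hi h0
            refine ⟨w, fun h => absurd h hvr, fun _ => ⟨hI.mem w (List.mem_of_getElem? h2), h4,
                fun _ => ⟨h3, ?_⟩⟩⟩
            obtain ⟨h5, h6⟩ := List.getElem?_eq_some_iff.1 h2
            rw [← h6, hI.nodup.idxOf_getElem]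
            exact h1
        · exact ⟨root, fun _ => rfl, fun h => absurd h hv⟩
      choose par h1 h2 using hpar
      refine ⟨par, h1 root rfl, fun v hv => ?_, fun v => q.idxOf v, fun v hv hvr => ?_⟩
      · obtain ⟨h3, h4, -⟩ := h2 v ((hreach v).2 hv)
        exact ⟨h4, h3⟩
      · exact (h2 v ((hreach v).2 hv)).2.2 hvr
  have h3 := Run.seq (h1.mono le_rfl h2)
  rw [search, hi, hc]
  refine h3.mono ?_ fun _ h => h
  nlinarith

end WordRAM


namespace WordRAM

open Polyomino

theorem Geo.Table.get {G : Geo} {s : Store} (h : G.Table s) {x y c : ℤ} (hz : G.Near (x, y))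
    (hc : c = G.cd (x, y)) : s.A arrP c = if (x, y) ∈ G.P then 1 else 0 := hc ▸ h _ hz

/-- The tile before each tile in its row is known. -/
def Geo.Prevs (G : Geo) (s : Store) : Prop := ∀ u ∈ G.P,
  (s.A arrR (G.cd u) = 0 ∧ ∀ v, ¬ IsPrev G.P v u) ∨
    ∃ v, IsPrev G.P v u ∧ s.A arrR (G.cd u) = G.cd v

theorem IsPrev.unique {P : Finset (ℤ × ℤ)} {u v w : ℤ × ℤ} (hv : IsPrev P v u)
    (hw : IsPrev P w u) : v = w := by
  obtain ⟨h1, h2, h3, h4⟩ := hv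
  obtain ⟨h5, h6, h7, h8⟩ := hw
  have := h4 w h5 h6 h7
  have := h8 v h1 h2 h3
  exact Prod.ext (by omega) (by omega)

/-! ### The searches -/

/-- The edges of the graph `hug`, where `b` moves to the neighbouring column. -/
def hugEdges (b : Term → Term) : List (Term × Term) :=
  [(arr arrP (.reg regU + .reg regK), .reg regU + .reg regK),
    (arr arrP (.reg regU - .reg regK), .reg regU - .reg regK),
    (arr arrP (.reg regU + 1) * (1 - arr arrP (b (.reg regU)) * arr arrP (b (.reg regU + 1))),
      .reg regU + 1),
    (arr arrP (.reg regU - 1) * (1 - arr arrP (b (.reg regU)) * arr arrP (b (.reg regU - 1))),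
      .reg regU - 1)]

/-- A vertical edge is tested with the factor `1 - x * y`, where `x` and `y` are the table entries
of the two neighbours on the `e`-side: it is nonzero unless both are tiles. -/
theorem hugEdges_spec {G : Geo} {kp : Fin 32} (hkp : kp ≠ arrP) {s₀ : Store} (hT : G.Table s₀)
    (hK : s₀.reg regK = G.K) {e : ℤ} (he : e = 1 ∨ e = -1) {b : Term → Term}
    (hb : ∀ s t, (b t).den s = t.den s + e * s.reg regK) :
    Edges G kp s₀ (hugEdges b) (HugAdj G.P e) := by
  have hfr : ∀ s, SearchFrame kp s₀ s → G.Table s ∧ s.reg regK = G.K := fun s hs =>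
    ⟨fun z hz => by rw [hs.arr _ (by decide) (by decide) hkp.symm]; exact hT z hz, by
      rw [hs.reg _ (by decide) (by decide) (by decide) (by decide) (by decide)]; exact hK⟩
  have hden : ∀ s, SearchFrame kp s₀ s → ∀ x y : ℤ, (x, y) ∈ G.P → s.reg regU = G.cd (x, y) →
      s.A arrP (G.cd (x, y) + G.K) = (if (x + 1, y) ∈ G.P then 1 else 0) ∧
      s.A arrP (G.cd (x, y) - G.K) = (if (x - 1, y) ∈ G.P then 1 else 0) ∧
      s.A arrP (G.cd (x, y) + 1) = (if (x, y + 1) ∈ G.P then 1 else 0) ∧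
      s.A arrP (G.cd (x, y) - 1) = (if (x, y - 1) ∈ G.P then 1 else 0) ∧
      s.A arrP (G.cd (x, y) + e * G.K) = (if (x + e, y) ∈ G.P then 1 else 0) ∧
      s.A arrP (G.cd (x, y) + 1 + e * G.K) = (if (x + e, y + 1) ∈ G.P then 1 else 0) ∧
      s.A arrP (G.cd (x, y) - 1 + e * G.K) = (if (x + e, y - 1) ∈ G.P then 1 else 0) := by
    intro s hs x y hu hsu
    obtain ⟨hT', hK'⟩ := hfr s hs
    obtain ⟨h1, h2, h3, h4⟩ := G.near_of_mem hu
    simp only at h1 h2 h3 h4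
    refine ⟨hT'.get ?_ ?_, hT'.get ?_ ?_, hT'.get ?_ ?_, hT'.get ?_ ?_, hT'.get ?_ ?_,
      hT'.get ?_ ?_, hT'.get ?_ ?_⟩ <;>
    first
    | (simp only [Geo.Near]; omega)
    | (simp only [Geo.cd]; ring)
  refine ⟨fun u v h => h.2.1, ?_, ?_⟩
  · rintro s ⟨x, y⟩ hs hu hsu f hf
    obtain ⟨hT', hK'⟩ := hfr s hs
    obtain ⟨h1, h2, h3, h4, h5, h6, h7⟩ := hden s hs x y hu hsu
    simp only [hugEdges, List.mem_cons, List.not_mem_nil, or_false] at hf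
    rcases hf with rfl | rfl | rfl | rfl
    · simp only [den_arr, den_add, den_reg, hsu, hK', h1]
      intro h
      refine ⟨(x + 1, y), ⟨hu, by simpa using h, ?_, .inl rfl⟩, (G.cd_right x y).symm⟩
      rw [gridGraph_adj_iff]; simp
    · simp only [den_arr, den_sub, den_reg, hsu, hK', h2]
      intro h
      refine ⟨(x - 1, y), ⟨hu, by simpa using h, ?_, .inl rfl⟩, (G.cd_left x y).symm⟩
      rw [gridGraph_adj_iff]; simp
    · simp only [den_arr, den_add, den_sub, den_mul, den_reg, den_ofNat, hb, hsu, hK', Nat.cast_one,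
        h3, h5, h6]
      intro h
      refine ⟨(x, y + 1), ⟨hu, ?_, ?_, .inr ?_⟩, (G.cd_up x y).symm⟩
      · by_contra hcon; simp [hcon] at h
      · rw [gridGraph_adj_iff]; simp
      · rintro ⟨h8, h9⟩; simp only at h8 h9; simp [h8, h9] at h
    · simp only [den_arr, den_sub, den_mul, den_reg, den_ofNat, hb, hsu, hK', Nat.cast_one,
        h4, h5, h7]
      intro h
      refine ⟨(x, y - 1), ⟨hu, ?_, ?_, .inr ?_⟩, (G.cd_down x y).symm⟩
      · by_contra hcon; simp [hcon] at h
      · rw [gridGraph_adj_iff]; simp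
      · rintro ⟨h8, h9⟩; simp only at h8 h9; simp [h8, h9] at h
  · rintro ⟨x, y⟩ v hu ⟨-, hv, hadj, hor⟩
    rw [gridGraph_adj_iff] at hadj
    simp only at hadj hor
    rcases hadj with rfl | rfl | rfl | rfl
    · refine ⟨_, List.mem_cons_self, fun s hs hsu => ?_⟩
      obtain ⟨h1, h2, h3, h4, h5, h6, h7⟩ := hden s hs x y hu hsu
      simp only [den_arr, den_add, den_reg, hsu, (hfr s hs).2, h1, if_pos hv]
      exact ⟨one_ne_zero, (G.cd_right x y).symm⟩
    · refine ⟨_, List.mem_cons_of_mem _ List.mem_cons_self, fun s hs hsu => ?_⟩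
      obtain ⟨h1, h2, h3, h4, h5, h6, h7⟩ := hden s hs x y hu hsu
      simp only [den_arr, den_sub, den_reg, hsu, (hfr s hs).2, h2, if_pos hv]
      exact ⟨one_ne_zero, (G.cd_left x y).symm⟩
    · refine ⟨_, List.mem_cons_of_mem _ (List.mem_cons_of_mem _ List.mem_cons_self),
        fun s hs hsu => ?_⟩
      obtain ⟨h1, h2, h3, h4, h5, h6, h7⟩ := hden s hs x y hu hsu
      simp only [den_arr, den_add, den_sub, den_mul, den_reg, den_ofNat, hb, hsu, (hfr s hs).2,
        Nat.cast_one, h3, h5, h6, if_pos hv]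
      refine ⟨?_, (G.cd_up x y).symm⟩
      have : ¬ ((x + e, y) ∈ G.P ∧ (x + e, y + 1) ∈ G.P) := hor.resolve_left (by omega)
      by_cases h8 : (x + e, y) ∈ G.P <;> by_cases h9 : (x + e, y + 1) ∈ G.P
      · exact absurd ⟨h8, h9⟩ this
      all_goals simp [h8, h9]
    · refine ⟨_, List.mem_cons_of_mem _ (List.mem_cons_of_mem _ (List.mem_cons_of_mem _
        List.mem_cons_self)), fun s hs hsu => ?_⟩
      obtain ⟨h1, h2, h3, h4, h5, h6, h7⟩ := hden s hs x y hu hsu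
      simp only [den_arr, den_sub, den_mul, den_reg, den_ofNat, hb, hsu, (hfr s hs).2,
        Nat.cast_one, h4, h5, h7, if_pos hv]
      refine ⟨?_, (G.cd_down x y).symm⟩
      have : ¬ ((x + e, y) ∈ G.P ∧ (x + e, y - 1) ∈ G.P) := hor.resolve_left (by omega)
      by_cases h8 : (x + e, y) ∈ G.P <;> by_cases h9 : (x + e, y - 1) ∈ G.P
      · exact absurd ⟨h8, h9⟩ this
      all_goals simp [h8, h9]

/-- `P` itself is closed in direction `e`, so `hugOn_reachable` with `D = P` shows that the search
tree spans `P`. -/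
theorem reach_of_searched {G : Geo} (hP : Conn G.P) {e : ℤ} (he : e = 1 ∨ e = -1) {l : ℤ × ℤ}
    (hl : l ∈ G.P) {v : ℤ × ℤ} (hv : v ∈ G.P) : Relation.ReflTransGen (HugAdj G.P e) l v := by
  have h := hugOn_reachable (P := G.P) (D := G.P) (fun _ h => h) he (fun _ _ h => h) hP hl hv
  rw [SimpleGraph.reachable_iff_reflTransGen] at h
  exact Relation.ReflTransGen.mono (fun a b hab => hab.2.2) _ _ h

/-- The parents form a tree in the graph `hug`. -/
theorem Searched.isHugTree {G : Geo} (hP : Conn G.P) {e : ℤ} (he : e = 1 ∨ e = -1) {l : ℤ × ℤ}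
    (hl : l ∈ G.P) {kp : Fin 32} {s₀ s : Store} (h : Searched G kp (HugAdj G.P e) l s₀ s) :
    ∃ par, IsHugTree G.P e l par ∧ ∀ v ∈ G.P, s.A kp (G.cd v) = G.cd (par v) ∧ par v ∈ G.P := by
  obtain ⟨par, h1, h2, rank, h3⟩ := h.par
  exact ⟨par, ⟨h1, rank, fun v hv hne => h3 v (reach_of_searched hP he hl hv) hne⟩,
    fun v hv => h2 v (reach_of_searched hP he hl hv)⟩

/-- A vertical or horizontal neighbour whose parent is the current cell. -/
def childEdge (v : Term) : Term × Term :=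
  (arr arrP v * eqT (arr parB v) (.reg regU), v)

/-- The edges for the closure. -/
def closureEdges : List (Term × Term) :=
  [(arr arrR (.reg regU), arr arrR (.reg regU)), (1, arr parA (.reg regU)),
    childEdge (.reg regU + .reg regK), childEdge (.reg regU - .reg regK),
    childEdge (.reg regU + 1), childEdge (.reg regU - 1)]

/-- Children in the right tree need not be stored: they are those of the four neighbours whose
recorded parent is the current tile. So each tile has at most six outgoing edges to test. -/
theorem closureEdges_spec {G : Geo} {s₀ : Store} (hT : G.Table s₀) (hR : G.Prevs s₀)
    (hK : s₀.reg regK = G.K) {pa pb : ℤ × ℤ → ℤ × ℤ}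
    (ha : ∀ v ∈ G.P, s₀.A parA (G.cd v) = G.cd (pa v) ∧ pa v ∈ G.P)
    (hb : ∀ v ∈ G.P, s₀.A parB (G.cd v) = G.cd (pb v) ∧ pb v ∈ G.P) :
    Edges G parC s₀ closureEdges (Forces G.P pa pb) := by
  have hk : ∀ s, SearchFrame parC s₀ s → s.reg regK = G.K := fun s hs => by
    rw [hs.reg _ (by decide) (by decide) (by decide) (by decide) (by decide)]; exact hK
  have hchild : ∀ s, SearchFrame parC s₀ s → ∀ u ∈ G.P, s.reg regU = G.cd u → ∀ v, G.Near v →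
      ∀ t : Term, t.den s = G.cd v → ((childEdge t).1.den s ≠ 0 ↔ v ∈ G.P ∧ pb v = u) := by
    intro s hs u hu hsu v hv t ht
    simp only [childEdge, den_mul, den_arr, den_eqT, ht, den_reg, hsu]
    rw [hs.arr _ (by decide) (by decide) (by decide), hs.arr _ (by decide) (by decide) (by decide),
      hT v hv]
    by_cases hvP : v ∈ G.P
    · rw [(hb v hvP).1, if_pos hvP]
      have : G.cd (pb v) = G.cd u ↔ pb v = u :=
        ⟨G.cd_inj (G.near (hb v hvP).2) (G.near hu), fun h => by rw [h]⟩
      simp [this, hvP]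
    · simp [hvP]
  have hnear : ∀ x y, (x, y) ∈ G.P → G.Near (x + 1, y) ∧ G.Near (x - 1, y) ∧ G.Near (x, y + 1) ∧
      G.Near (x, y - 1) := by
    intro x y hu
    obtain ⟨h1, h2, h3, h4⟩ := G.near_of_mem hu
    simp only at h1 h2 h3 h4
    simp only [Geo.Near]
    omega
  refine ⟨fun u v h => h.1, ?_, ?_⟩
  · rintro s ⟨x, y⟩ hs hu hsu f hf
    obtain ⟨n1, n2, n3, n4⟩ := hnear x y hu
    simp only [closureEdges, List.mem_cons, List.not_mem_nil, or_false] at hf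
    rcases hf with rfl | rfl | rfl | rfl | rfl | rfl
    · simp only [den_arr, den_reg, hsu]
      rw [hs.arr _ (by decide) (by decide) (by decide)]
      intro h
      rcases hR _ hu with ⟨h1, -⟩ | ⟨v, h1, h2⟩
      · exact absurd h1 h
      · exact ⟨v, ⟨h1.1, .inl h1⟩, h2⟩
    · simp only [den_arr, den_reg, hsu]
      rw [hs.arr _ (by decide) (by decide) (by decide)]
      intro _
      exact ⟨pa (x, y), ⟨(ha _ hu).2, .inr (.inl rfl)⟩, (ha _ hu).1⟩
    all_goals intro h
    · have hd : (Term.reg regU + .reg regK).den s = G.cd (x + 1, y) := by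
        simp only [den_add, den_reg, hsu, hk s hs, G.cd_right]
      obtain ⟨h1, h2⟩ := (hchild s hs _ hu hsu _ n1 _ hd).1 h
      exact ⟨_, ⟨h1, .inr (.inr ⟨by rw [gridGraph_adj_iff]; simp, h2⟩)⟩, hd⟩
    · have hd : (Term.reg regU - .reg regK).den s = G.cd (x - 1, y) := by
        simp only [den_sub, den_reg, hsu, hk s hs, G.cd_left]
      obtain ⟨h1, h2⟩ := (hchild s hs _ hu hsu _ n2 _ hd).1 h
      exact ⟨_, ⟨h1, .inr (.inr ⟨by rw [gridGraph_adj_iff]; simp, h2⟩)⟩, hd⟩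
    · have hd : (Term.reg regU + 1).den s = G.cd (x, y + 1) := by
        simp only [den_add, den_reg, den_ofNat, hsu, Nat.cast_one, G.cd_up]
      obtain ⟨h1, h2⟩ := (hchild s hs _ hu hsu _ n3 _ hd).1 h
      exact ⟨_, ⟨h1, .inr (.inr ⟨by rw [gridGraph_adj_iff]; simp, h2⟩)⟩, hd⟩
    · have hd : (Term.reg regU - 1).den s = G.cd (x, y - 1) := by
        simp only [den_sub, den_reg, den_ofNat, hsu, Nat.cast_one, G.cd_down]
      obtain ⟨h1, h2⟩ := (hchild s hs _ hu hsu _ n4 _ hd).1 h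
      exact ⟨_, ⟨h1, .inr (.inr ⟨by rw [gridGraph_adj_iff]; simp, h2⟩)⟩, hd⟩
  · rintro ⟨x, y⟩ v hu ⟨hv, h⟩
    obtain ⟨n1, n2, n3, n4⟩ := hnear x y hu
    rcases h with h | rfl | ⟨hadj, hpb⟩
    · refine ⟨_, List.mem_cons_self, fun s hs hsu => ?_⟩
      simp only [den_arr, den_reg, hsu]
      rw [hs.arr _ (by decide) (by decide) (by decide)]
      rcases hR _ hu with ⟨-, h1⟩ | ⟨w, h1, h2⟩
      · exact absurd h (h1 v)
      · rw [h2, IsPrev.unique h h1]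
        exact ⟨(G.cd_pos h1.1).ne', rfl⟩
    · refine ⟨_, List.mem_cons_of_mem _ List.mem_cons_self, fun s hs hsu => ?_⟩
      simp only [den_arr, den_reg, hsu]
      rw [hs.arr _ (by decide) (by decide) (by decide)]
      exact ⟨by simp, (ha _ hu).1⟩
    · have key : ∀ t : Term, childEdge t ∈ closureEdges → G.Near v → (∀ s, SearchFrame parC s₀ s →
          s.reg regU = G.cd (x, y) → t.den s = G.cd v) → ∃ e ∈ closureEdges, ∀ s,
          SearchFrame parC s₀ s → s.reg regU = G.cd (x, y) → e.1.den s ≠ 0 ∧ e.2.den s = G.cd v :=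
        fun t ht hn h => ⟨_, ht, fun s hs hsu =>
          ⟨(hchild s hs _ hu hsu _ hn _ (h s hs hsu)).2 ⟨hv, hpb⟩, h s hs hsu⟩⟩
      rw [gridGraph_adj_iff] at hadj
      simp only at hadj
      rcases hadj with rfl | rfl | rfl | rfl
      · refine key (.reg regU + .reg regK) (by simp [closureEdges]) n1 fun s hs hsu => ?_
        simp only [den_add, den_reg, hsu, hk s hs, G.cd_right]
      · refine key (.reg regU - .reg regK) (by simp [closureEdges]) n2 fun s hs hsu => ?_
        simp only [den_sub, den_reg, hsu, hk s hs, G.cd_left]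
      · refine key (.reg regU + 1) (by simp [closureEdges]) n3 fun s hs hsu => ?_
        simp only [den_add, den_reg, den_ofNat, hsu, Nat.cast_one, G.cd_up]
      · refine key (.reg regU - 1) (by simp [closureEdges]) n4 fun s hs hsu => ?_
        simp only [den_sub, den_reg, den_ofNat, hsu, Nat.cast_one, G.cd_down]

/-! ### The test of a pair of reflex tiles -/

/-- The three searches for a pair of roots. -/
def pairSearch : Cmd :=
  search parA regL (hugEdges fun t => t - .reg regK) ;;
    search parB regR (hugEdges fun t => t + .reg regK) ;; search parC regL closureEdges

/-- The left part of a cut carries the current stamp. -/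
def Marked (G : Geo) (s : Store) : Prop := ∃ L R, HCut G.P L R ∧
  ∀ p ∈ G.P, s.A arrV (G.cd p) = s.reg regS ↔ p ∈ L

/-- The two trees and the closure cost one search, and one stamp, each. If the closure of `l`
reaches `r`, then `HCut.forces` excludes a separating cut; otherwise the stamped tiles are the left
side given by `hcut_of_forces`. -/
theorem pairSearch_spec : ∃ a : ℕ, ∀ {V : ℕ} {G : Geo} {s₀ : Store} {l r : ℤ × ℤ},
    G.top ≤ V → (G.P.card : ℤ) < V → 0 ≤ s₀.reg regS → s₀.reg regS + 3 ≤ V → G.Table s₀ →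
    G.Prevs s₀ → s₀.reg regK = G.K → (∀ i, 0 ≤ i → s₀.A arrV i ≤ s₀.reg regS) → Conn G.P →
        IsSimple G.P →
    l ∈ G.P → r ∈ G.P → s₀.reg regL = G.cd l → s₀.reg regR = G.cd r →
    Run V pairSearch s₀ (a * G.P.card) fun s => s.reg regS = s₀.reg regS + 3 ∧
      (∀ i, 0 ≤ i → s.A arrV i ≤ s.reg regS) ∧ s.reg regR = G.cd r ∧
      (s.A arrV (G.cd r) = s.reg regS → ∀ L R, HCut G.P L R → l ∈ L → r ∉ R) ∧
      (s.A arrV (G.cd r) ≠ s.reg regS → Marked G s) := by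
  obtain ⟨a1, h1⟩ := search_spec parA (by decide) (by decide) regL (by decide)
    (hugEdges fun t => t - .reg regK)
  obtain ⟨a2, h2⟩ := search_spec parB (by decide) (by decide) regR (by decide)
    (hugEdges fun t => t + .reg regK)
  obtain ⟨a3, h3⟩ := search_spec parC (by decide) (by decide) regL (by decide) closureEdges
  refine ⟨a1 + (a2 + a3), ?_⟩
  intro V G s₀ l r hG hN hS0 hSV hT hR hK hle hP hs hl hr hsl hsr
  rw [add_mul, add_mul]
  refine Run.seq ((h1 hG hN (by rw [abs_le]; omega) (hugEdges_spec (by decide) hT hK (.inr rfl)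
    (fun s t => by simp only [den_sub, den_reg]; ring)) hl hsl hle).mono le_rfl fun s1 H1 => ?_)
  have hT1 : G.Table s1 := fun z hz => by
    rw [H1.frame.arr _ (by decide) (by decide) (by decide)]; exact hT z hz
  have hR1 : G.Prevs s1 := fun z hz => by
    rw [H1.frame.arr _ (by decide) (by decide) (by decide)]; exact hR z hz
  have hr1 : ∀ k, k ≠ regS → k ≠ regH → k ≠ regT → k ≠ regU → k ≠ regV → s1.reg k = s₀.reg k :=
    H1.frame.reg
  obtain ⟨pa, ha, ha'⟩ := H1.isHugTree hP (.inr rfl) hl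
  refine Run.seq ((h2 hG hN (by rw [H1.stamp, abs_le]; omega) (hugEdges_spec (by decide) hT1
    (by rw [hr1 _ (by decide) (by decide) (by decide) (by decide) (by decide)]; exact hK) (.inl rfl)
    (fun s t => by simp only [den_add, den_reg]; ring)) hr
    (by rw [hr1 _ (by decide) (by decide) (by decide) (by decide) (by decide)]; exact hsr)
    (fun i hi => by rw [H1.stamp]; exact H1.le i hi)).mono le_rfl fun s2 H2 => ?_)
  have hT2 : G.Table s2 := fun z hz => by
    rw [H2.frame.arr _ (by decide) (by decide) (by decide)]; exact hT1 z hz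
  have hR2 : G.Prevs s2 := fun z hz => by
    rw [H2.frame.arr _ (by decide) (by decide) (by decide)]; exact hR1 z hz
  have hr2 : ∀ k, k ≠ regS → k ≠ regH → k ≠ regT → k ≠ regU → k ≠ regV → s2.reg k = s₀.reg k :=
    fun k a b c d e => (H2.frame.reg k a b c d e).trans (hr1 k a b c d e)
  obtain ⟨pb, hb, hb'⟩ := H2.isHugTree hP (.inl rfl) hr
  have ha'' : ∀ v ∈ G.P, s2.A parA (G.cd v) = G.cd (pa v) ∧ pa v ∈ G.P := fun v hv => by
    rw [H2.frame.arr _ (by decide) (by decide) (by decide)]; exact ha' v hv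
  refine (h3 hG hN (by rw [H2.stamp, H1.stamp, abs_le]; omega) (closureEdges_spec hT2 hR2
    (by rw [hr2 _ (by decide) (by decide) (by decide) (by decide) (by decide)]; exact hK)
    ha'' hb') hl
    (by rw [hr2 _ (by decide) (by decide) (by decide) (by decide) (by decide)]; exact hsl)
    (fun i hi => by rw [H2.stamp]; exact H2.le i hi)).mono le_rfl fun s3 H3 => ?_
  refine ⟨by rw [H3.stamp, H2.stamp, H1.stamp]; ring,
    fun i hi => by rw [H3.stamp]; exact H3.le i hi, ?_,
    ?_, ?_⟩
  · rw [H3.frame.reg _ (by decide) (by decide) (by decide) (by decide) (by decide),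
      hr2 _ (by decide) (by decide) (by decide) (by decide) (by decide)]
    exact hsr
  · intro h L R hLR hlL hrR
    rw [H3.stamp, H3.vis r hr] at h
    exact hLR.not_mem_left hrR (hLR.forces hs hlL hrR ha hb h)
  · intro h
    rw [H3.stamp, Ne, H3.vis r hr] at h
    classical
    refine ⟨G.P.filter fun v => Relation.ReflTransGen (Forces G.P pa pb) l v, _,
      hcut_of_forces hl hr ha hb (fun v => Finset.mem_filter) fun h' => h
          (Finset.mem_filter.1 h').2,
      fun p hp => ?_⟩
    rw [H3.stamp, H3.vis p hp, Finset.mem_filter]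
    simp [hp]

end WordRAM


namespace WordRAM

open Polyomino

/-! ### All pairs of reflex tiles -/

/-- One step of the loop over all pairs of reflex tiles. -/
def pairStep : Cmd :=
  (.set regL (arr arrS (.reg regJ / .reg regM)) ;;
    .set regR (arr arrS (.reg regJ - .reg regM * (.reg regJ / .reg regM)))) ;;
  pairSearch ;;
  (.ite (eqT (arr arrV (.reg regR)) (.reg regS)) .skip (.set regF 1) ;;
    .set regJ (.reg regJ + 1))

/-- The loop over all pairs of reflex tiles. -/
def pairLoop : Cmd :=
  .loop ((1 - .reg regF) * ltT (.reg regJ) (.reg regM * .reg regM)) pairStep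

/-- Search for a cut that separates two reflex tiles. -/
def pairs : Cmd := .set regJ 0 ;; pairLoop

/-- The reflex tiles are known. -/
def Geo.Reflexes (G : Geo) (l : List (ℤ × ℤ)) (s : Store) : Prop :=
  s.reg regM = l.length ∧ (∀ (i : ℕ) t, l[i]? = some t → s.A arrS i = G.cd t) ∧
    ∀ t, t ∈ l ↔ LocallyReflex G.P t

/-- The stamps are not larger than the current stamp. -/
def Stamps (s : Store) : Prop := 0 ≤ s.reg regS ∧ ∀ i, 0 ≤ i → s.A arrV i ≤ s.reg regS

/-- One counter `j` runs through all ordered pairs, decoded as quotient and remainder by the number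
of reflex tiles. Each pair consumes three stamps, which bounds the stamps by the number of pairs. -/
theorem pairs_spec : ∃ a : ℕ, ∀ {V : ℕ} {G : Geo} {s₀ : Store} {l : List (ℤ × ℤ)},
    G.top ≤ V → (G.P.card : ℤ) < V → 3 * (l.length * l.length : ℕ) + s₀.reg regS ≤ V →
    1 ≤ G.P.card →
    G.Table s₀ → G.Prevs s₀ → G.Reflexes l s₀ → Stamps s₀ → s₀.reg regK = G.K → Conn G.P →
    IsSimple G.P → s₀.reg regF = 0 →
    Run V pairs s₀ (a * (G.P.card * (l.length * l.length + 1))) fun s =>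
      s.reg regS ≤ s₀.reg regS + 3 * (l.length * l.length : ℕ) ∧ Stamps s ∧
      ((s.reg regF = 0 ∧ ∀ t u, LocallyReflex G.P t → LocallyReflex G.P u → ∀ L R, HCut G.P L R →
        t ∈ L → u ∉ R) ∨ (s.reg regF = 1 ∧ Marked G s)) := by
  obtain ⟨a, ha⟩ := pairSearch_spec
  generalize hpre : (Cmd.set regL (arr arrS (.reg regJ / .reg regM)) ;;
    .set regR (arr arrS (.reg regJ - .reg regM * (.reg regJ / .reg regM)))) = pre
  generalize hpost : (Cmd.ite (eqT (arr arrV (.reg regR)) (.reg regS)) .skip (.set regF 1) ;;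
    .set regJ (.reg regJ + 1)) = post
  generalize hT : ((1 - .reg regF) * ltT (.reg regJ) (.reg regM * .reg regM) : Term) = test
  have hstep : pairStep = (pre ;; pairSearch ;; post) := by rw [← hpre, ← hpost]; rfl
  refine ⟨Cmd.time (.set regJ 0) + (pre.time + (a + post.time) + test.cost + 1) +
    (test.cost + 1), ?_⟩
  intro V G s₀ l hG hN hm hcard hTab hPrev hRef hSt hK hP hs hF
  have hloop : ∀ s, s = s₀.setR regJ 0 → Run V pairLoop s
      ((l.length * l.length) * (pre.time + (a * G.P.card + post.time) + test.cost + 1) +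
        (test.cost + 1)) fun s => test.den s = 0 ∧ Agree pairStep (s₀.setR regJ 0) s ∧
        ∃ n, ∃ j : ℕ, n + j = l.length * l.length ∧ s.reg regJ = j ∧
        s.reg regS ≤ s₀.reg regS + 3 * j ∧ Stamps s ∧
        ((s.reg regF = 0 ∧ ∀ i < j, ∀ t u, l[i / l.length]? = some t → l[i % l.length]? = some u →
          ∀ L R, HCut G.P L R → t ∈ L → u ∉ R) ∨ (s.reg regF = 1 ∧ Marked G s)) := by
    rintro _ rfl
    rw [pairLoop, hT]
    refine (Run.loopA (I := fun n s => ∃ j : ℕ, n + j = l.length * l.length ∧ s.reg regJ = j ∧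
        s.reg regS ≤ s₀.reg regS + 3 * j ∧ Stamps s ∧
        ((s.reg regF = 0 ∧ ∀ i < j, ∀ t u, l[i / l.length]? = some t → l[i % l.length]? = some u →
          ∀ L R, HCut G.P L R → t ∈ L → u ∉ R) ∨ (s.reg regF = 1 ∧ Marked G s)))
        ?_ ?_).mono le_rfl fun s h => h
    · refine ⟨0, by simp, by simp, by simp, ⟨by simpa using hSt.1, by simpa using hSt.2⟩,
        .inl ⟨by simpa using hF, by simp⟩⟩
    · rintro n s ⟨j, hn, hj, hS, hst, hor⟩ hag he
      rw [← hT] at he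
      have harr : ∀ k, pairStep.wa k = false → ∀ i, s.A k i = s₀.A k i := fun k hk i =>
        hag.arr k hk i
      have hreg : ∀ k, k ≠ regJ → pairStep.wr k = false → s.reg k = s₀.reg k := fun k hk hk' => by
        rw [hag.reg k hk', setR_reg, if_neg hk]
      have hM : s.reg regM = l.length := by rw [hreg _ (by decide) (by decide)]; exact hRef.1
      have hF0 : s.reg regF = 0 := by
        rcases hor with h | h
        · exact h.1
        · exact absurd (by simp [h.1]) he
      have hlt : j < l.length * l.length := by
        by_contra hcon
        apply he
        simp only [den_mul, den_ltT, den_reg, hj, hM]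
        rw [if_neg (by push_cast at *; exact_mod_cast hcon), mul_zero]
      have hl0 : 0 < l.length := by
        rcases Nat.eq_zero_or_pos l.length with h | h
        · rw [h] at hlt; simp at hlt
        · exact h
      have hd : j / l.length < l.length := Nat.div_lt_of_lt_mul hlt
      have hmo : j % l.length < l.length := Nat.mod_lt _ hl0
      obtain ⟨t, ht⟩ : ∃ t, l[j / l.length]? = some t := ⟨_, List.getElem?_eq_getElem hd⟩
      obtain ⟨u, hu⟩ : ∃ u, l[j % l.length]? = some u := ⟨_, List.getElem?_eq_getElem hmo⟩
      have htP : t ∈ G.P := ((hRef.2.2 t).1 (List.mem_of_getElem? ht)).1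
      have huP : u ∈ G.P := ((hRef.2.2 u).1 (List.mem_of_getElem? hu)).1
      have hdiv : s.reg regJ / s.reg regM = ((j / l.length : ℕ) : ℤ) := by
        rw [hj, hM]; norm_cast
      have hmod : s.reg regJ - s.reg regM * (s.reg regJ / s.reg regM) =
          ((j % l.length : ℕ) : ℤ) := by
        rw [hj, hM]
        have := Nat.mod_add_div j l.length
        have h2 : ((j : ℤ) / (l.length : ℤ)) = ((j / l.length : ℕ) : ℤ) := by norm_cast
        rw [h2]
        have h3 : (j : ℤ) = ((j % l.length : ℕ) : ℤ) + (l.length : ℤ) *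
            ((j / l.length : ℕ) : ℤ) := by
          exact_mod_cast this.symm
        linarith
      have hSt' : s.A arrS ((j / l.length : ℕ) : ℤ) = G.cd t := by
        rw [harr _ (by decide)]; exact hRef.2.1 _ _ ht
      have hSu' : s.A arrS ((j % l.length : ℕ) : ℤ) = G.cd u := by
        rw [harr _ (by decide)]; exact hRef.2.1 _ _ hu
      have h1 : Run V pre s pre.time fun s' => s' = (s.setR regL (G.cd t)).setR regR (G.cd u) := by
        rw [← hpre]
        refine Run.of_eval ?_ ?_
        · simp only [Cmd.safe, Cmd.eval, den_arr, den_div, den_reg, den_sub, den_mul, setR_A,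
            setR_reg, hdiv, hSt']
          refine ⟨G.abs_cd_le hG htP, ?_⟩
          simp only [show (13 : ℕ) ≠ 14 by decide, show (12 : ℕ) ≠ 14 by decide, if_false, hmod,
            hSu']
          exact G.abs_cd_le hG huP
        · simp only [Cmd.eval, den_arr, den_div, den_reg, den_sub, den_mul, setR_A,
            setR_reg, hdiv, hSt']
          simp only [show (13 : ℕ) ≠ 14 by decide, show (12 : ℕ) ≠ 14 by decide, if_false, hmod,
            hSu']
      rw [hstep]
      refine Run.seq (h1.mono le_rfl ?_)
      rintro _ rfl
      have hjj : (j : ℤ) + 1 ≤ (l.length * l.length : ℕ) := by exact_mod_cast hlt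
      refine Run.seq ((ha (l := t) (r := u) hG hN (by simpa using hst.1)
        (by simp; omega) (fun z hz => by rw [setR_A, setR_A, harr _ (by decide)]; exact hTab z hz)
        (fun z hz => by rw [setR_A, setR_A, harr _ (by decide)]; exact hPrev z hz)
        (by simp only [setR_reg]; simp [hreg 3 (by decide) (by decide), hK])
        (by simpa using hst.2) hP hs htP huP (by simp) (by simp)).frame.mono le_rfl ?_)
      rintro s2 ⟨⟨g1, g2, g3, g4, g5⟩, hag2⟩
      simp only [setR_reg] at g1
      simp only [show (7 : ℕ) ≠ 15 by decide, show (7 : ℕ) ≠ 14 by decide, if_false] at g1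
      have hJ2 : s2.reg regJ = j := by rw [hag2.reg _ (by decide)]; simpa using hj
      have hF2 : s2.reg regF = 0 := by rw [hag2.reg _ (by decide)]; simpa using hF0
      have hSt2 : Stamps s2 := ⟨by have := hst.1; omega, g2⟩
      have hV : |(j : ℤ) + 1| ≤ V := by
        rw [abs_of_nonneg (by omega)]
        have := hSt.1
        omega
      have hV1 : (1 : ℤ) ≤ V := by omega
      rw [← hpost]
      refine Run.of_eval ?_ ?_
      · simp only [Cmd.safe, Cmd.eval, den_eqT, den_arr, den_reg, g3]
        by_cases h3 : s2.A arrV (G.cd u) = s2.reg regS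
        · simp [h3, hJ2, hV]
        · simp [h3, hJ2, hV, hV1]
      · simp only [Cmd.eval, den_eqT, den_arr, den_reg, g3, den_add, den_ofNat]
        by_cases h3 : s2.A arrV (G.cd u) = s2.reg regS
        · simp only [h3, if_true, one_ne_zero, if_false, hJ2]
          refine ⟨n - 1, by omega, j + 1, by omega, by simp, ?_, ?_, .inl ⟨by simpa using hF2, ?_⟩⟩
          · simp; omega
          · exact ⟨by simpa using hSt2.1, by simpa using hSt2.2⟩
          · intro i hi t' u' ht' hu'
            rcases Nat.lt_succ_iff_lt_or_eq.1 hi with hi | rfl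
            · rcases hor with h | h
              · exact h.2 i hi t' u' ht' hu'
              · exact absurd (h.1.symm.trans hF0) (by decide)
            · rw [ht, Option.some.injEq] at ht'
              rw [hu, Option.some.injEq] at hu'
              subst ht' hu'
              exact g4 h3
        · simp only [h3, if_false, if_true, hJ2, setR_reg]
          simp only [show (13 : ℕ) ≠ 8 by decide, if_false]
          refine ⟨n - 1, by omega, j + 1, by omega, by simp, ?_, ?_, .inr ⟨by simp, ?_⟩⟩
          · simp; omega
          · exact ⟨by simpa using hSt2.1, by simpa using hSt2.2⟩
          · obtain ⟨L, R, h4, h5⟩ := g5 h3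
            exact ⟨L, R, h4, by simpa using h5⟩
  have h0 : Run V (.set regJ 0) s₀ (Cmd.time (.set regJ 0)) fun s => s = s₀.setR regJ 0 :=
    Run.of_eval (by simp [Cmd.safe]) rfl
  rw [pairs]
  refine (Run.seq (h0.mono le_rfl hloop)).mono ?_ ?_
  · have : pre.time + (a * G.P.card + post.time) + test.cost + 1 ≤
        (pre.time + (a + post.time) + test.cost + 1) * G.P.card := by nlinarith
    have h2 := Nat.mul_le_mul_left (l.length * l.length) this
    have h3 : 1 ≤ G.P.card * (l.length * l.length + 1) := Nat.mul_pos hcard (by omega)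
    calc _ ≤ Cmd.time (.set regJ 0) * (G.P.card * (l.length * l.length + 1)) +
          ((pre.time + (a + post.time) + test.cost + 1) * (G.P.card * (l.length * l.length + 1)) +
          (test.cost + 1) * (G.P.card * (l.length * l.length + 1))) := by
          refine Nat.add_le_add (Nat.le_mul_of_pos_right _ h3) (Nat.add_le_add (h2.trans ?_)
            (Nat.le_mul_of_pos_right _ h3))
          rw [mul_left_comm]
          exact Nat.mul_le_mul_left _ (by rw [mul_comm]; exact Nat.mul_le_mul_left _ (by omega))
      _ = _ := by ring
  · rintro s ⟨he, hag, n, j, hn, hj, hS, hst, hor⟩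
    have hjm : j ≤ l.length * l.length := by omega
    have hjm' : (j : ℤ) ≤ (l.length * l.length : ℕ) := by exact_mod_cast hjm
    refine ⟨by omega, hst, ?_⟩
    rcases hor with ⟨h1, h2⟩ | h
    · refine .inl ⟨h1, ?_⟩
      have hM : s.reg regM = l.length := by
        rw [hag.reg _ (by decide)]; simpa using hRef.1
      have hj' : l.length * l.length ≤ j := by
        by_contra hcon
        rw [← hT] at he
        simp only [den_mul, den_ltT, den_reg, hj, hM, den_sub, den_ofNat, h1] at he
        rw [if_pos (by push_cast at *; exact_mod_cast not_le.1 hcon)] at he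
        simp at he
      intro t u ht hu
      obtain ⟨x, hx⟩ := List.mem_iff_getElem?.1 ((hRef.2.2 t).2 ht)
      obtain ⟨y, hy⟩ := List.mem_iff_getElem?.1 ((hRef.2.2 u).2 hu)
      have hx' := (List.getElem?_eq_some_iff.1 hx).1
      have hy' := (List.getElem?_eq_some_iff.1 hy).1
      -- The counter value that encodes the pair of positions `(x, y)`.
      refine h2 (y + l.length * x) ?_ t u ?_ ?_
      · have := Nat.mul_le_mul_left l.length (show x + 1 ≤ l.length from hx')
        rw [mul_add, mul_one] at this
        omega
      · rw [Nat.add_mul_div_left _ _ (by omega), Nat.div_eq_of_lt hy', zero_add]; exact hx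
      · rw [Nat.add_mul_mod_self_left, Nat.mod_eq_of_lt hy']; exact hy
    · exact .inr h

end WordRAM


namespace WordRAM

open Polyomino

/-! ### The tables for the tiles -/

/-- The registers hold the parameters. -/
structure Geo.Params (G : Geo) (s : Store) : Prop where
  card : s.reg regN = G.P.card
  bd : s.reg regE = G.E
  height : s.reg regK = G.K
  offset : s.reg regX = G.X

/-- The tables are empty beyond the offset. -/
structure Fresh (E X : ℤ) (s : Store) : Prop where
  table : ∀ c, (2 * E + 1) * (X - E) ≤ c → s.A arrP c = 0
  col : ∀ c, X - E ≤ c → s.A arrH c = 0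
  row : ∀ c, X ≤ c → s.A arrT c = 0

/-- The cell `c` is the first of the linked list `l`. -/
def Geo.Chain (G : Geo) (s : Store) : ℤ → List (ℤ × ℤ) → Prop
  | c, [] => c = 0
  | c, t :: l => c = G.cd t ∧ Geo.Chain G s (s.A arrN c) l

theorem Geo.Chain.congr {G : Geo} {s s' : Store} : ∀ {l : List (ℤ × ℤ)} {c : ℤ},
    G.Chain s c l → (∀ t ∈ l, s'.A arrN (G.cd t) = s.A arrN (G.cd t)) → G.Chain s' c l := by
  intro l
  induction l with
  | nil => exact fun h _ => h
  | cons t l ih =>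
    rintro c ⟨rfl, h⟩ hs
    refine ⟨rfl, ?_⟩
    rw [hs t (by simp)]
    exact ih h fun u hu => hs u (by simp [hu])

/-- Computation of the cell of a tile. -/
def locate : Cmd :=
  .set regA (.reg regP * arr arrX (.reg regI) - .reg regQ * arr arrY (.reg regI) + .reg regX) ;;
  .set regD (.reg regQ * arr arrX (.reg regI) + .reg regP * arr arrY (.reg regI) + .reg regE) ;;
  .set regU (.reg regK * .reg regA + .reg regD)

/-- Insertion of a tile into the tables. -/
def insertTile : Cmd :=
  .put arrC (.reg regI) (.reg regU) ;; .put arrP (.reg regU) 1 ;;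
  .put arrN (.reg regU) (arr arrH (.reg regA)) ;; .put arrH (.reg regA) (.reg regU) ;;
  .ite (ltT (.reg regA) (.reg regC)) (.set regC (.reg regA)) .skip ;;
  .set regI (.reg regI + 1)

/-- Construction of the tables. -/
def build : Cmd :=
  (.set regI 0 ;; .set regC (.reg regX + .reg regE)) ;;
  .loop (ltT (.reg regI) (.reg regN)) (locate ;; insertTile)

/-- The rotated tiles are the members of `ts`. -/
structure Geo.Tiles (G : Geo) (ts : List (ℤ × ℤ)) (s : Store) : Prop where
  nodup : ts.Nodup
  mem : ∀ t, t ∈ ts ↔ t ∈ G.P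
  fst : ∀ (i : ℕ) t, ts[i]? = some t →
    s.reg regP * s.A arrX i - s.reg regQ * s.A arrY i = t.1
  snd : ∀ (i : ℕ) t, ts[i]? = some t →
    s.reg regQ * s.A arrX i + s.reg regP * s.A arrY i = t.2

theorem Geo.Tiles.length {G : Geo} {ts : List (ℤ × ℤ)} {s : Store} (h : G.Tiles ts s) :
    ts.length = G.P.card := by
  rw [← List.toFinset_card_of_nodup h.nodup]
  congr 1
  ext t
  rw [List.mem_toFinset, h.mem]

/-- The tables are correct for the tiles in the list `l`. -/
structure Geo.Built (G : Geo) (ts l : List (ℤ × ℤ)) (s : Store) : Prop where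
  cells : ∀ (i : ℕ) t, i < l.length → ts[i]? = some t → s.A arrC i = G.cd t
  -- Any decidable reformulation `p` of the membership is allowed, so that later uses can choose
  -- membership in `P`, or `False` beyond the window.
  table : ∀ c, G.K * (G.X - G.E) ≤ c → ∀ p : Prop, [Decidable p] → (p ↔ ∃ t ∈ l, c = G.cd t) →
    s.A arrP c = if p then 1 else 0
  cols : ∀ x, -G.E ≤ x → ∃ m : List (ℤ × ℤ), G.Chain s (s.A arrH (x + G.X)) m ∧ m.Nodup ∧
    ∀ t, t ∈ m ↔ t ∈ l ∧ t.1 = x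
  col : ∀ c, G.X + G.E < c → s.A arrH c = 0
  first_le : ∀ t ∈ l, s.reg regC ≤ t.1 + G.X
  first : s.reg regC = G.X + G.E ∨ ∃ t ∈ l, s.reg regC = t.1 + G.X

/-- The tiles are distributed to columns as linked lists, each tile being put in front of its list;
this replaces sorting. The register of the smallest column starts at `X + E`, to the right of every
tile. -/
theorem build_spec : ∃ a : ℕ, ∀ {V : ℕ} {G : Geo} {s₀ : Store} {ts : List (ℤ × ℤ)},
    G.top ≤ V → (G.P.card : ℤ) < V → 1 ≤ G.P.card → G.Params s₀ → G.Tiles ts s₀ →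
    Fresh G.E G.X s₀ → Run V build s₀ (a * G.P.card) (G.Built ts ts) := by
  generalize hini : (Cmd.set regI 0 ;; .set regC (.reg regX + .reg regE)) = ini
  refine ⟨ini.time + (locate.time + insertTile.time + (ltT (.reg regI) (.reg regN)).cost + 1) +
    ((ltT (.reg regI) (.reg regN)).cost + 1), ?_⟩
  intro V G s₀ ts hG hN hcard hpar hts hfr
  have hK := G.K_pos
  have hE2 := G.two_le
  have hEX := G.le
  have htop : G.X + G.E + 1 ≤ G.top := by
    unfold Geo.top; nlinarith
  have htop' : G.K ≤ G.top := by
    unfold Geo.top; nlinarith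
  have hlen := hts.length
  have h1 : Run V ini s₀ ini.time fun s => s.reg regI = 0 ∧ s.reg regC = G.X + G.E ∧
      Agree ini s₀ s := by
    have : Run V ini s₀ ini.time fun s => s.reg regI = 0 ∧ s.reg regC = G.X + G.E := by
      rw [← hini]
      refine Run.of_eval ?_ ?_
      · simp only [Cmd.safe, Cmd.eval, den_add, den_reg, setR_reg, den_ofNat]
        simp only [show (4 : ℕ) ≠ 10 by decide, show (2 : ℕ) ≠ 10 by decide, if_false, hpar.offset,
          hpar.bd, abs_le]
        omega
      · simp [Cmd.eval, hpar.offset, hpar.bd]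
    exact this.frame.mono le_rfl fun s h => ⟨h.1.1, h.1.2, h.2⟩
  have h2 : ∀ s, (s.reg regI = 0 ∧ s.reg regC = G.X + G.E ∧ Agree ini s₀ s) →
      Run V (.loop (ltT (.reg regI) (.reg regN)) (locate ;; insertTile)) s
      (G.P.card * (locate.time + insertTile.time + (ltT (.reg regI) (.reg regN)).cost + 1) +
        ((ltT (.reg regI) (.reg regN)).cost + 1)) (G.Built ts ts) := by
    rintro s1 ⟨g1, g2, g3⟩
    refine (Run.loopA (I := fun n s => ∃ i : ℕ, n + i = G.P.card ∧ s.reg regI = i ∧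
      G.Built ts (ts.take i) s) ?_ ?_).mono le_rfl ?_
    · refine ⟨0, by simp, by simpa using g1, ?_⟩
      rw [List.take_zero]
      refine ⟨by simp, ?_, ?_, ?_, by simp, .inl g2⟩
      · intro c hc p _ hp
        have : ¬ p := by simpa using hp
        rw [if_neg this, g3.arr _ (by subst hini; decide)]
        exact hfr.table c hc
      · intro x hx
        refine ⟨[], ?_, by simp, by simp⟩
        rw [Geo.Chain, g3.arr _ (by subst hini; decide)]
        exact hfr.col _ (by omega)
      · intro c hc
        rw [g3.arr _ (by subst hini; decide)]
        exact hfr.col _ (by omega)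
    · rintro n s ⟨i, hn, hi, hB⟩ hag he
      have hreg : ∀ k, (locate ;; insertTile).wr k = false → ini.wr k = false →
          s.reg k = s₀.reg k := fun k h h' => by rw [hag.reg k h, g3.reg k h']
      have harr : ∀ k, (locate ;; insertTile).wa k = false → ini.wa k = false →
          ∀ i, s.A k i = s₀.A k i := fun k h h' i => by rw [hag.arr k h, g3.arr k h']
      have hilt : i < G.P.card := by
        by_contra hcon
        apply he
        simp only [den_ltT, den_reg, hi, hreg 0 (by decide) (by subst hini; decide), hpar.card]
        rw [if_neg (by omega)]
      obtain ⟨t, ht⟩ : ∃ t, ts[i]? = some t := ⟨_, List.getElem?_eq_getElem (by omega)⟩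
      have htP : t ∈ G.P := (hts.mem t).1 (List.mem_of_getElem? ht)
      have htake : ts.take (i + 1) = ts.take i ++ [t] := by
        rw [List.take_add_one, ht]; rfl
      have hnotin : t ∉ ts.take i := by
        have h := hts.nodup.sublist (List.take_sublist (i + 1) ts)
        rw [htake, List.nodup_append] at h
        exact fun h' => h.2.2 t h' t (by simp) rfl
      have hsub : ∀ u ∈ ts.take i, u ∈ G.P := fun u hu => (hts.mem u).1 (List.mem_of_mem_take hu)
      have hcdne : ∀ u ∈ ts.take i, G.cd u ≠ G.cd t := fun u hu h =>
        hnotin (G.cd_inj (G.near (hsub u hu)) (G.near htP) h ▸ hu)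
      obtain ⟨n1, n2, n3, n4⟩ := G.near_of_mem htP
      have h3 : Run V locate s locate.time fun s' =>
          s' = ((s.setR regA (t.1 + G.X)).setR regD (t.2 + G.E)).setR regU (G.cd t) := by
        have e1 := hts.fst i t ht
        have e2 := hts.snd i t ht
        rw [← harr 0 (by decide) (by subst hini; decide),
          ← harr 1 (by decide) (by subst hini; decide),
          ← hreg 5 (by decide) (by subst hini; decide),
          ← hreg 6 (by decide) (by subst hini; decide)] at e1 e2
        have e3 : s.reg regX = G.X := by
          rw [hreg _ (by decide) (by subst hini; decide)]; exact hpar.offset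
        have e4 : s.reg regE = G.E := by
          rw [hreg _ (by decide) (by subst hini; decide)]; exact hpar.bd
        have e5 : s.reg regK = G.K := by
          rw [hreg _ (by decide) (by subst hini; decide)]; exact hpar.height
        have habs := abs_le.1 (G.abs_cd_le hG htP)
        simp only [Geo.cd] at habs
        refine Run.of_eval ?_ ?_
        · simp only [locate, Cmd.safe, Cmd.eval, den_add, den_sub, den_mul, den_reg, den_arr, hi,
            e1, e3, setR_reg, setR_A]
          simp only [show (6 : ℕ) ≠ 22 by decide, show (5 : ℕ) ≠ 22 by decide,
            show (2 : ℕ) ≠ 22 by decide, show (3 : ℕ) ≠ 22 by decide, show (3 : ℕ) ≠ 23 by decide,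
            show (22 : ℕ) ≠ 23 by decide, show (10 : ℕ) ≠ 22 by decide, if_false, if_true, e2,
            e4, e5, abs_le]
          have : G.K ≤ V := by omega
          unfold Geo.K at this
          exact ⟨by omega, by omega, habs⟩
        · simp only [locate, Cmd.eval, den_add, den_sub, den_mul, den_reg, den_arr, hi,
            e1, e3, setR_reg, setR_A]
          simp only [show (6 : ℕ) ≠ 22 by decide, show (5 : ℕ) ≠ 22 by decide,
            show (2 : ℕ) ≠ 22 by decide, show (3 : ℕ) ≠ 22 by decide, show (3 : ℕ) ≠ 23 by decide,
            show (22 : ℕ) ≠ 23 by decide, show (10 : ℕ) ≠ 22 by decide, if_false, if_true, e2,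
            e4, e5, Geo.cd]
      refine Run.seq (h3.mono le_rfl ?_)
      rintro _ rfl
      obtain ⟨m, m1, m2, m3⟩ := hB.cols t.1 (by omega)
      have hHV : |s.A arrH (t.1 + G.X)| ≤ V := by
        rcases m with _ | ⟨u, m⟩
        · rw [show s.A arrH (t.1 + G.X) = 0 from m1]; simp
        · rw [m1.1]
          exact G.abs_cd_le hG (hsub u ((m3 u).1 (by simp)).1)
      -- the registers after the insertion
      have h4 : ∀ s', s' = ((s.setR regA (t.1 + G.X)).setR regD (t.2 + G.E)).setR regU (G.cd t) →
          Run V insertTile s' insertTile.time fun s'' =>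
          s''.reg regI = i + 1 ∧ s''.reg regC = min (t.1 + G.X) (s.reg regC) ∧
          (∀ j, s''.A arrC j = if j = i then G.cd t else s.A arrC j) ∧
          (∀ j, s''.A arrP j = if j = G.cd t then 1 else s.A arrP j) ∧
          (∀ j, s''.A arrN j = if j = G.cd t then s.A arrH (t.1 + G.X) else s.A arrN j) ∧
          (∀ j, s''.A arrH j = if j = t.1 + G.X then G.cd t else s.A arrH j) := by
        rintro s' hs'
        have q1 : s'.reg regA = t.1 + G.X := by subst hs'; simp
        have q2 : s'.reg regU = G.cd t := by subst hs'; simp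
        have q3 : s'.reg regI = i := by subst hs'; simpa using hi
        have q4 : s'.reg regC = s.reg regC := by subst hs'; simp
        have q5 : ∀ k j, s'.A k j = s.A k j := by subst hs'; simp
        have hV1 : (1 : ℤ) ≤ V := by omega
        have hV2 : |(i : ℤ) + 1| ≤ V := by rw [abs_le]; omega
        have hV3 : |t.1 + G.X| ≤ V := by rw [abs_le]; omega
        by_cases hc : t.1 + G.X < s.reg regC
        · refine Run.of_eval ?_ ?_
          · simp [insertTile, Cmd.safe, Cmd.eval, q1, q2, q3, q4, q5, G.abs_cd_le hG htP, hHV, hV1,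
              hV2, hV3, hc]
          · simp [insertTile, Cmd.eval, q1, q2, q3, q4, q5, hc, min_eq_left hc.le]
        · refine Run.of_eval ?_ ?_
          · simp [insertTile, Cmd.safe, Cmd.eval, q1, q2, q3, q4, q5, G.abs_cd_le hG htP, hHV, hV1,
              hV2, hV3, hc]
          · simp [insertTile, Cmd.eval, q1, q2, q3, q4, q5, hc, min_eq_right (not_lt.1 hc)]
      refine (h4 _ rfl).mono le_rfl ?_
      rintro s'' ⟨r1, r2, r3, r4, r5, r6⟩
      refine ⟨n - 1, by omega, i + 1, by omega, by simpa using r1, ?_⟩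
      rw [htake]
      have hli : (ts.take i).length = i := by rw [List.length_take]; omega
      refine ⟨?_, ?_, ?_, ?_, ?_, ?_⟩
      · intro j u hj hu
        rw [r3]
        by_cases hji : j = i
        · subst hji
          rw [ht, Option.some.injEq] at hu
          rw [if_pos rfl, hu]
        · rw [if_neg (by omega)]
          refine hB.cells j u ?_ hu
          simp at hj
          omega
      · intro c hc p _ hp
        rw [r4]
        by_cases hct : c = G.cd t
        · rw [if_pos hct, if_pos (hp.2 ⟨t, by simp, hct⟩)]
        · rw [if_neg hct]
          refine hB.table c hc p (hp.trans ?_)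
          constructor
          · rintro ⟨u, hu, rfl⟩
            rcases List.mem_append.1 hu with h | h
            · exact ⟨u, h, rfl⟩
            · rw [List.mem_singleton.1 h] at hct
              exact absurd rfl hct
          · rintro ⟨u, hu, rfl⟩
            exact ⟨u, List.mem_append_left _ hu, rfl⟩
      · intro x hx
        by_cases hxt : x = t.1
        · subst hxt
          refine ⟨t :: m, ?_, ?_, ?_⟩
          · rw [r6, if_pos rfl]
            refine ⟨rfl, ?_⟩
            rw [r5, if_pos rfl]
            exact m1.congr fun u hu => by rw [r5, if_neg (hcdne u ((m3 u).1 hu).1)]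
          · exact List.nodup_cons.2 ⟨fun h => hnotin ((m3 t).1 h).1, m2⟩
          · intro u
            rw [List.mem_cons, m3, List.mem_append, List.mem_singleton]
            constructor
            · rintro (rfl | h)
              · exact ⟨.inr rfl, rfl⟩
              · exact ⟨.inl h.1, h.2⟩
            · rintro ⟨h | h, h'⟩
              · exact .inr ⟨h, h'⟩
              · exact .inl h
        · obtain ⟨m', k1, k2, k3⟩ := hB.cols x hx
          refine ⟨m', ?_, k2, ?_⟩
          · rw [r6, if_neg (by omega)]
            exact k1.congr fun u hu => by rw [r5, if_neg (hcdne u ((k3 u).1 hu).1)]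
          · intro u
            rw [k3, List.mem_append, List.mem_singleton]
            constructor
            · rintro ⟨h, h'⟩
              exact ⟨.inl h, h'⟩
            · rintro ⟨h | rfl, h'⟩
              · exact ⟨h, h'⟩
              · exact absurd h'.symm hxt
      · intro c hc
        rw [r6, if_neg (by omega)]
        exact hB.col c hc
      · intro u hu
        rw [r2]
        rcases List.mem_append.1 hu with h | h
        · exact (min_le_right _ _).trans (hB.first_le u h)
        · rw [List.mem_singleton.1 h]
          exact min_le_left _ _
      · rw [r2]
        rcases le_total (t.1 + G.X) (s.reg regC) with h | h
        · exact .inr ⟨t, by simp, min_eq_left h⟩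
        · rw [min_eq_right h]
          rcases hB.first with h' | ⟨u, hu, h'⟩
          · exact .inl h'
          · exact .inr ⟨u, List.mem_append_left _ hu, h'⟩
    · rintro s ⟨he, hag, n, i, hn, hi, hB⟩
      have hge : ts.length ≤ i := by
        by_contra hcon
        have : s.reg regN = G.P.card := by
          rw [hag.reg _ (by decide), g3.reg _ (by subst hini; decide)]; exact hpar.card
        simp only [den_ltT, den_reg, hi, this] at he
        rw [if_pos (by omega)] at he
        omega
      rwa [List.take_of_length_le hge] at hB
  have h3 := Run.seq (h1.mono le_rfl h2)
  rw [build, hini]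
  refine h3.mono ?_ fun _ h => h
  nlinarith

theorem Geo.Built.isTable {G : Geo} {ts : List (ℤ × ℤ)} {s₀ s : Store} (h : G.Built ts ts s)
    (hts : G.Tiles ts s₀) : G.Table s := by
  intro z hz
  refine h.table _ (G.le_cd hz) _ ⟨fun h => ⟨z, (hts.mem z).2 h, rfl⟩, ?_⟩
  rintro ⟨t, ht, h⟩
  have htP := (hts.mem t).1 ht
  rwa [G.cd_inj hz (G.near htP) h]

end WordRAM


namespace WordRAM

open Polyomino

/-! ### The sweep over the columns -/

/-- Treatment of the current tile. -/
def pushTile : Cmd :=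
  .set regA (.reg regU - .reg regK * (.reg regU / .reg regK) + .reg regX) ;;
  .put arrR (.reg regU) (arr arrT (.reg regA)) ;; .put arrT (.reg regA) (.reg regU) ;;
  .set regU (arr arrN (.reg regU)) ;; .set regI (.reg regI + 1)

/-- Go to the next column. -/
def nextCol : Cmd := .set regC (.reg regC + 1) ;; .set regU (arr arrH (.reg regC))

/-- Computation of the previous tiles in the rows. -/
def sweep : Cmd :=
  (.set regI 0 ;; .set regU (arr arrH (.reg regC))) ;;
  .loop (ltT (.reg regI) (.reg regN)) (.ite (.reg regU) pushTile nextCol)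

theorem Geo.Chain.abs_le {G : Geo} {V : ℕ} (hG : G.top ≤ V) {s : Store} {c : ℤ}
    {l : List (ℤ × ℤ)} (h : G.Chain s c l) (hl : ∀ t ∈ l, t ∈ G.P) : |c| ≤ V := by
  rcases l with _ | ⟨t, l⟩
  · rw [show c = 0 from h]; simp
  · rw [h.1]; exact G.abs_cd_le hG (hl t (by simp))

/-- The invariant of the sweep: the tiles in `D` have been treated. -/
structure Geo.SweepInv (G : Geo) (x : ℤ) (l : List (ℤ × ℤ)) (D : Finset (ℤ × ℤ)) (s : Store) :
    Prop where
  col : s.reg regC = x + G.X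
  chain : G.Chain s (s.reg regU) l
  nodup : l.Nodup
  mem : ∀ t ∈ l, t ∈ G.P ∧ t.1 = x
  done : ∀ t, t ∈ D ↔ t ∈ G.P ∧ (t.1 < x ∨ (t.1 = x ∧ t ∉ l))
  count : s.reg regI = D.card
  rows : ∀ y, -G.E ≤ y → y ≤ G.E → (s.A arrT (y + G.E + G.X) = 0 ∧ ∀ t ∈ D, t.2 ≠ y) ∨
    ∃ t ∈ D, t.2 = y ∧ s.A arrT (y + G.E + G.X) = G.cd t ∧ ∀ u ∈ D, u.2 = y → u.1 ≤ t.1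
  beyond : ∀ c, G.X + 2 * G.E < c → s.A arrT c = 0
  prevs : ∀ u ∈ D, (s.A arrR (G.cd u) = 0 ∧ ∀ v, ¬ IsPrev G.P v u) ∨
    ∃ v, IsPrev G.P v u ∧ s.A arrR (G.cd u) = G.cd v

/-- As columns are treated from left to right, the last tile recorded in the row of `t` is the
previous tile of that row; an entry `0` means that `t` is leftmost. -/
theorem pushTile_spec {V : ℕ} {G : Geo} (hG : G.top ≤ V) (hN : (G.P.card : ℤ) < V) {x : ℤ}
    {t : ℤ × ℤ} {l : List (ℤ × ℤ)} {D : Finset (ℤ × ℤ)} {s : Store}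
    (hK : s.reg regK = G.K) (hX : s.reg regX = G.X) (h : G.SweepInv x (t :: l) D s) :
    Run V pushTile s pushTile.time fun s' =>
      D.card + 1 ≤ G.P.card ∧ ∃ D' : Finset (ℤ × ℤ), D'.card = D.card + 1 ∧ G.SweepInv x l D' s'
          := by
  classical
  have hKpos := G.K_pos
  have hEX := G.le
  have hE2 := G.two_le
  obtain ⟨htP, htx⟩ := h.mem t (by simp)
  obtain ⟨n1, n2, n3, n4⟩ := G.near_of_mem htP
  have hDP : D ⊆ G.P := fun u hu => ((h.done u).1 hu).1
  have htD : t ∉ D := by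
    rw [h.done]; rintro ⟨-, h1 | h1⟩
    · omega
    · exact h1.2 (by simp)
  have hcard : D.card + 1 ≤ G.P.card := by
    rw [← Finset.card_insert_of_notMem htD]
    exact Finset.card_le_card (Finset.insert_subset htP hDP)
  have hU : s.reg regU = G.cd t := h.chain.1
  have hchain : G.Chain s (s.A arrN (G.cd t)) l := hU ▸ h.chain.2
  -- The remainder modulo `K` recovers the row. Adding `X` keeps the row entries of different
  -- directions apart.
  have hrow : s.reg regU - s.reg regK * (s.reg regU / s.reg regK) + s.reg regX =
      t.2 + G.E + G.X := by
    rw [hU, hK, hX, G.cd_div (G.near htP), Geo.cd]; ring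
  have hrV : |t.2 + G.E + G.X| ≤ V := by
    rw [_root_.abs_le]
    have : G.X + 2 * G.E ≤ G.top := by unfold Geo.top; nlinarith
    omega
  have hTV : |s.A arrT (t.2 + G.E + G.X)| ≤ V := by
    rcases h.rows t.2 (by omega) (by omega) with h1 | ⟨u, hu, -, h1, -⟩
    · rw [h1.1]; simp
    · rw [h1]; exact G.abs_cd_le hG (hDP hu)
  have hNV := hchain.abs_le hG fun u hu => (h.mem u (by simp [hu])).1
  have hcV : |(D.card : ℤ) + 1| ≤ V := by rw [_root_.abs_le]; omega
  have hcdne : ∀ u ∈ G.P, u ≠ t → G.cd u ≠ G.cd t := fun u hu hne he =>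
    hne (G.cd_inj (G.near hu) (G.near htP) he)
  have h4 : Run V pushTile s pushTile.time fun s' => s'.reg regU = s.A arrN (G.cd t) ∧
      s'.reg regI = D.card + 1 ∧ s'.reg regC = s.reg regC ∧ (∀ j, s'.A arrN j = s.A arrN j) ∧
      (∀ j, s'.A arrR j = if j = G.cd t then s.A arrT (t.2 + G.E + G.X) else s.A arrR j) ∧
      (∀ j, s'.A arrT j = if j = t.2 + G.E + G.X then G.cd t else s.A arrT j) := by
    refine Run.of_eval ?_ ?_
    · simp only [pushTile, Cmd.safe, Cmd.eval, den_add, den_sub, den_mul, den_div, den_reg, hrow]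
      simp [hU, hrV, hTV, h.count, hcV, G.abs_cd_le hG htP, hNV]
    · simp only [pushTile, Cmd.eval, den_add, den_sub, den_mul, den_div, den_reg, hrow]
      simp [hU, h.count]
  refine h4.mono le_rfl ?_
  rintro s' ⟨r1, r2, r3, r4, r5, r6⟩
  refine ⟨hcard, insert t D, Finset.card_insert_of_notMem htD, ?_⟩
  have htl := (List.nodup_cons.1 h.nodup).1
  refine ⟨r3.trans h.col, ?_, (List.nodup_cons.1 h.nodup).2, fun u hu => h.mem u (by simp [hu]), ?_,
    ?_, ?_, ?_, ?_⟩
  · rw [r1]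
    exact hchain.congr fun u _ => r4 _
  · intro u
    rw [Finset.mem_insert, h.done, List.mem_cons]
    by_cases hut : u = t
    · subst hut
      simp [htP, htx, htl]
    · simp [hut]
  · rw [r2, Finset.card_insert_of_notMem htD]; push_cast; rfl
  · intro y hy1 hy2
    rw [r6]
    by_cases hyt : y = t.2
    · subst hyt
      rw [if_pos rfl]
      refine .inr ⟨t, Finset.mem_insert_self _ _, rfl, rfl, fun u hu _ => ?_⟩
      rcases Finset.mem_insert.1 hu with rfl | hu
      · exact le_rfl
      · have := (h.done u).1 hu
        omega
    · rw [if_neg (by omega)]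
      rcases h.rows y hy1 hy2 with ⟨h1, h2⟩ | ⟨u, h1, h2, h3, h4⟩
      · refine .inl ⟨h1, fun u hu => ?_⟩
        rcases Finset.mem_insert.1 hu with rfl | hu
        · exact fun h => hyt h.symm
        · exact h2 u hu
      · refine .inr ⟨u, Finset.mem_insert_of_mem h1, h2, h3, fun v hv hvy => ?_⟩
        rcases Finset.mem_insert.1 hv with rfl | hv
        · exact absurd hvy.symm hyt
        · exact h4 v hv hvy
  · intro c hc
    rw [r6, if_neg (by omega)]
    exact h.beyond c hc
  · intro u hu
    rw [r5]
    rcases Finset.mem_insert.1 hu with rfl | hu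
    · rw [if_pos rfl]
      have hleft : ∀ v ∈ G.P, v.2 = u.2 → v.1 < u.1 → v ∈ D := fun v hv _ hlt =>
        (h.done v).2 ⟨hv, .inl (by omega)⟩
      have hright : ∀ v ∈ D, v.2 = u.2 → v.1 < u.1 := by
        intro v hv hvu
        rcases ((h.done v).1 hv).2 with h1 | h1
        · omega
        · have : v = u := Prod.ext (by omega) hvu
          exact absurd (this ▸ hv) htD
      rcases h.rows u.2 (by omega) (by omega) with ⟨h1, h2⟩ | ⟨v, h1, h2, h3, h4⟩
      · exact .inl ⟨h1, fun v hv => h2 v (hleft v hv.1 hv.2.1 hv.2.2.1) hv.2.1⟩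
      · exact .inr ⟨v, ⟨hDP h1, h2, hright v h1 h2, fun z hz hz2 hz1 =>
          h4 z (hleft z hz hz2 hz1) hz2⟩, h3⟩
    · rw [if_neg (hcdne u (hDP hu) fun h' => htD (h' ▸ hu))]
      exact h.prevs u hu

/-- An iteration either treats a tile or advances one column. There are `N` tiles, and by `width_le`
fewer than `N` advances after the leftmost column, so at most `2 N` iterations suffice. -/
theorem sweep_spec : ∃ a : ℕ, ∀ {V : ℕ} {G : Geo} {s₀ : Store} {ts : List (ℤ × ℤ)},
    G.top ≤ V → (G.P.card : ℤ) < V → 1 ≤ G.P.card → Conn G.P → G.Params s₀ →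
    (∀ t, t ∈ ts ↔ t ∈ G.P) → G.Built ts ts s₀ → (∀ c, G.X ≤ c → s₀.A arrT c = 0) →
    Run V sweep s₀ (a * G.P.card) fun s => G.Prevs s ∧
      ∀ c, G.X + 2 * G.E < c → s.A arrT c = 0 := by
  generalize hini : (Cmd.set regI 0 ;; .set regU (arr arrH (.reg regC))) = ini
  generalize hbody : (Cmd.ite (.reg regU) pushTile nextCol) = body
  refine ⟨ini.time + 2 * (body.time + (ltT (.reg regI) (.reg regN)).cost + 1) +
    ((ltT (.reg regI) (.reg regN)).cost + 1), ?_⟩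
  intro V G s₀ ts hG hN hcard hP hpar hts hB hT
  classical
  have hE2 := G.two_le
  have hEX := G.le
  have hKpos := G.K_pos
  have htop : G.X + G.E + 1 ≤ G.top := by
    unfold Geo.top; nlinarith
  obtain ⟨t₀, ht₀, hC⟩ : ∃ t ∈ G.P, s₀.reg regC = t.1 + G.X := by
    rcases hB.first with h | ⟨t, ht, h⟩
    · obtain ⟨t, ht⟩ := Finset.card_pos.1 hcard
      have := hB.first_le t ((hts t).2 ht)
      have := G.near_of_mem ht
      omega
    · exact ⟨t, (hts t).1 ht, h⟩
  have hfirst : ∀ t ∈ G.P, t₀.1 ≤ t.1 := fun t ht => by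
    have := hB.first_le t ((hts t).2 ht); omega
  have hcols : ∀ s, (∀ i, s.A arrH i = s₀.A arrH i) → (∀ i, s.A arrN i = s₀.A arrN i) →
      ∀ x, -G.E ≤ x → ∃ m : List (ℤ × ℤ), G.Chain s (s.A arrH (x + G.X)) m ∧ m.Nodup ∧
        ∀ t, t ∈ m ↔ t ∈ G.P ∧ t.1 = x := by
    intro s h1 h2 x hx
    obtain ⟨m, h3, h4, h5⟩ := hB.cols x hx
    refine ⟨m, ?_, h4, fun t => (h5 t).trans (by rw [hts])⟩
    rw [h1]
    exact h3.congr fun t _ => h2 _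
  have hn0 := G.near_of_mem ht₀
  have h1 : Run V ini s₀ ini.time fun s => (∃ l, G.SweepInv t₀.1 l ∅ s) ∧ Agree ini s₀ s := by
    have : Run V ini s₀ ini.time fun s => (∃ l, G.SweepInv t₀.1 l ∅ s) := by
      subst hini
      obtain ⟨m, m1, m2, m3⟩ := hcols s₀ (fun _ => rfl) (fun _ => rfl) t₀.1 (by omega)
      have hV := m1.abs_le hG fun t ht => ((m3 t).1 ht).1
      refine Run.of_eval ?_ ?_
      · simp [Cmd.safe, Cmd.eval, hC, hV]
      · refine ⟨m, ?_, ?_, m2, fun t ht => (m3 t).1 ht, ?_, ?_, ?_, ?_, by simp⟩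
        · simp [Cmd.eval, hC]
        · simp only [Cmd.eval, den_arr, den_reg, setR_reg, den_ofNat, setR_A]
          simp only [show (11 : ℕ) ≠ 10 by decide, if_false, if_true, hC]
          exact m1.congr fun _ _ => rfl
        · intro t
          simp only [Finset.notMem_empty, m3, false_iff]
          rintro ⟨ht, h | ⟨h, h'⟩⟩
          · have := hfirst t ht; omega
          · exact h' ⟨ht, h⟩
        · simp [Cmd.eval]
        · intro y hy1 hy2
          exact .inl ⟨hT _ (by omega), by simp⟩
        · intro c hc
          exact hT _ (by omega)
    exact this.frame
  have h2 : ∀ s, ((∃ l, G.SweepInv t₀.1 l ∅ s) ∧ Agree ini s₀ s) →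
      Run V (.loop (ltT (.reg regI) (.reg regN)) body) s
      ((2 * G.P.card) * (body.time + (ltT (.reg regI) (.reg regN)).cost + 1) +
        ((ltT (.reg regI) (.reg regN)).cost + 1)) fun s => G.Prevs s ∧
      ∀ c, G.X + 2 * G.E < c → s.A arrT c = 0 := by
    rintro s1 ⟨⟨l₀, hI₀⟩, g3⟩
    refine (Run.loopA (I := fun n s => ∃ x l, ∃ D : Finset (ℤ × ℤ),
      (n : ℤ) + D.card + x = 2 * G.P.card + t₀.1 ∧ t₀.1 ≤ x ∧ G.SweepInv x l D s) ?_ ?_).mono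
      le_rfl ?_
    · exact ⟨t₀.1, l₀, ∅, by simp, le_rfl, hI₀⟩
    · rintro n s ⟨x, l, D, hn, hx, hI⟩ hag he
      have hK : s.reg regK = G.K := by
        rw [hag.reg _ (by subst hbody; decide), g3.reg _ (by subst hini; decide)]; exact hpar.height
      have hX : s.reg regX = G.X := by
        rw [hag.reg _ (by subst hbody; decide), g3.reg _ (by subst hini; decide)]; exact hpar.offset
      have hNr : s.reg regN = G.P.card := by
        rw [hag.reg _ (by subst hbody; decide), g3.reg _ (by subst hini; decide)]; exact hpar.card
      have hlt : D.card < G.P.card := by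
        by_contra hcon
        apply he
        simp only [den_ltT, den_reg, hI.count, hNr]
        rw [if_neg (by omega)]
      have hDP : D ⊆ G.P := fun u hu => ((hI.done u).1 hu).1
      subst hbody
      refine Run.mono (T := (Term.reg regU).cost + 1 + max pushTile.time nextCol.time) ?_ le_rfl
        fun _ h => h
      obtain ⟨w, hw, hwD⟩ : ∃ w ∈ G.P, w ∉ D := by
        by_contra! hcon
        exact absurd (Finset.card_le_card (t := D) hcon) (by omega)
      have hwx : x ≤ w.1 := by
        by_contra hcon
        exact hwD ((hI.done w).2 ⟨hw, .inl (by omega)⟩)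
      have hwid := width_le hP ht₀ hw
      refine Run.ite (fun h => ?_) fun h => ?_
      · rcases l with _ | ⟨t, l⟩
        · exact absurd hI.chain h
        · refine (pushTile_spec hG hN hK hX hI).mono le_rfl ?_
          rintro s' ⟨h1, D', h2, h3⟩
          exact ⟨n - 1, by omega, x, l, D', by push_cast [h2]; omega, hx, h3⟩
      -- The current list is exhausted but some tile `w` is untreated. It lies strictly to the
      -- right, so advancing the column stays within the width of `P`.
      · rcases l with _ | ⟨t, l⟩
        swap
        · have := hI.chain.1
          have := G.cd_pos (hI.mem t (by simp)).1
          rw [den_reg] at h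
          omega
        have hwx' : x + 1 ≤ w.1 := by
          rcases lt_or_eq_of_le hwx with h1 | h1
          · omega
          · exact absurd ((hI.done w).2 ⟨hw, .inr ⟨h1.symm, by simp⟩⟩) hwD
        have hnw := G.near_of_mem hw
        have hH : ∀ i, s.A arrH i = s₀.A arrH i := fun i => by
          rw [hag.arr _ (by decide), g3.arr _ (by subst hini; decide)]
        have hNn : ∀ i, s.A arrN i = s₀.A arrN i := fun i => by
          rw [hag.arr _ (by decide), g3.arr _ (by subst hini; decide)]
        obtain ⟨m, m1, m2, m3⟩ := hcols s hH hNn (x + 1) (by omega)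
        have hV := m1.abs_le hG fun t ht => ((m3 t).1 ht).1
        have hcol : x + G.X + 1 = x + 1 + G.X := by ring
        have hV2 : |x + 1 + G.X| ≤ V := by rw [_root_.abs_le]; omega
        refine Run.of_eval ?_ ?_
        · simp only [nextCol, Cmd.safe, Cmd.eval, den_add, den_reg, den_ofNat, hI.col, Nat.cast_one,
            hcol, den_arr, setR_reg, setR_A]
          exact ⟨hV2, by simpa using hV⟩
        · refine ⟨n - 1, by omega, x + 1, m, D, by omega, by omega, ?_⟩
          simp only [nextCol, Cmd.eval, den_add, den_reg, den_ofNat, hI.col, Nat.cast_one,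
            hcol, den_arr, setR_reg, setR_A]
          refine ⟨by simp, ?_, m2, fun t ht => (m3 t).1 ht, ?_, by simpa using hI.count,
            by simpa using hI.rows, by simpa using hI.beyond, by simpa using hI.prevs⟩
          · simp only [setR_reg, if_true]
            exact m1.congr fun _ _ => rfl
          · intro t
            rw [hI.done, m3]
            constructor
            · rintro ⟨h1, h2 | h2⟩
              · exact ⟨h1, .inl (by omega)⟩
              · exact ⟨h1, .inl (by omega)⟩
            · rintro ⟨h1, h2 | h2⟩
              · refine ⟨h1, ?_⟩
                rcases lt_or_eq_of_le (show t.1 ≤ x by omega) with h3 | h3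
                · exact .inl h3
                · exact .inr ⟨h3, by simp⟩
              · exact absurd ⟨h1, h2.1⟩ h2.2
    · rintro s ⟨he, hag, n, x, l, D, hn, hx, hI⟩
      have hNr : s.reg regN = G.P.card := by
        rw [hag.reg _ (by subst hbody; decide), g3.reg _ (by subst hini; decide)]; exact hpar.card
      have hge : G.P.card ≤ D.card := by
        by_contra hcon
        simp only [den_ltT, den_reg, hI.count, hNr] at he
        rw [if_pos (by omega)] at he
        omega
      have hDP : D = G.P := Finset.eq_of_subset_of_card_le
        (fun u hu => ((hI.done u).1 hu).1) hge
      exact ⟨fun u hu => hI.prevs u (hDP ▸ hu), hI.beyond⟩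
  rw [sweep, hini, hbody]
  refine (Run.seq (h1.mono le_rfl h2)).mono ?_ fun _ h => h
  nlinarith

end WordRAM


namespace WordRAM

open Polyomino

/-! ### Reflex tiles and bites -/

/-- A tile is reflex with respect to the directions `a` and `b`. -/
def cornerT (a b c : Term) : Term := arr arrP a * arr arrP b * (1 - arr arrP c)

/-- Test for locally reflex tiles. -/
def reflexT : Term :=
  cornerT (.reg regU + .reg regK) (.reg regU + 1) (.reg regU + .reg regK + 1) +
  cornerT (.reg regU + .reg regK) (.reg regU - 1) (.reg regU + .reg regK - 1) +
  cornerT (.reg regU - .reg regK) (.reg regU + 1) (.reg regU - .reg regK + 1) +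
  cornerT (.reg regU - .reg regK) (.reg regU - 1) (.reg regU - .reg regK - 1)

/-- Test for tiles that can be bitten off, unless they are locally reflex. -/
def biteT : Term :=
  eqT (arr arrR (.reg regU)) 0 *
    (1 - cornerT (.reg regU + 1) (.reg regU - 1) (.reg regU + .reg regK))

/-- Treatment of one tile. -/
def scanTile : Cmd :=
  .ite reflexT (.put arrS (.reg regM) (.reg regU) ;; .set regM (.reg regM + 1))
    (.ite biteT (.set regB (.reg regU)) .skip) ;;
  .set regI (.reg regI + 1)

/-- Collection of the reflex tiles, and search for a bite. -/
def scan : Cmd :=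
  (.set regI 0 ;; .set regM 0 ;; .set regB 0) ;;
  .loop (ltT (.reg regI) (.reg regN)) (.set regU (arr arrC (.reg regI)) ;; scanTile)

theorem den_cornerT {G : Geo} {s : Store} (hT : G.Table s) {a b c : Term} {x y z : ℤ × ℤ}
    (hx : G.Near x) (hy : G.Near y) (hz : G.Near z) (ha : a.den s = G.cd x) (hb : b.den s = G.cd y)
    (hc : c.den s = G.cd z) : (cornerT a b c).den s =
      @ite ℤ (x ∈ G.P ∧ y ∈ G.P ∧ z ∉ G.P) (Classical.dec _) 1 0 := by
  simp only [cornerT, den_mul, den_arr, den_sub, den_ofNat, ha, hb, hc, hT _ hx, hT _ hy, hT _ hz]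
  by_cases h1 : x ∈ G.P <;> by_cases h2 : y ∈ G.P <;> by_cases h3 : z ∈ G.P <;> simp [h1, h2, h3]

theorem near_add {G : Geo} {t : ℤ × ℤ} (ht : t ∈ G.P) {dx dy : ℤ} (h1 : -1 ≤ dx) (h2 : dx ≤ 1)
    (h3 : -1 ≤ dy) (h4 : dy ≤ 1) : G.Near (t.1 + dx, t.2 + dy) := by
  have := G.near_of_mem ht
  simp only [Geo.Near]
  omega

theorem cd_add {G : Geo} (t : ℤ × ℤ) (dx dy : ℤ) :
    G.cd (t.1 + dx, t.2 + dy) = G.cd t + G.K * dx + dy := by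
  simp only [Geo.cd]; ring

theorem reflexT_spec {G : Geo} {s : Store} (hT : G.Table s) (hK : s.reg regK = G.K) {t : ℤ × ℤ}
    (ht : t ∈ G.P) (hU : s.reg regU = G.cd t) :
    reflexT.den s ≠ 0 ↔ LocallyReflex G.P t := by
  classical
  have n := fun dx dy h1 h2 h3 h4 => near_add (G := G) ht (dx := dx) (dy := dy) h1 h2 h3 h4
  have e1 := den_cornerT hT (n 1 0 (by decide) (by decide) (by decide) (by decide))
    (n 0 1 (by decide) (by decide) (by decide) (by decide))
    (n 1 1 (by decide) (by decide) (by decide) (by decide))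
    (a := .reg regU + .reg regK) (b := .reg regU + 1) (c := .reg regU + .reg regK + 1)
    (by rw [cd_add]; simp [hU, hK]) (by rw [cd_add]; simp [hU]) (by rw [cd_add]; simp [hU, hK])
  have e2 := den_cornerT hT (n 1 0 (by decide) (by decide) (by decide) (by decide))
    (n 0 (-1) (by decide) (by decide) (by decide) (by decide))
    (n 1 (-1) (by decide) (by decide) (by decide) (by decide))
    (a := .reg regU + .reg regK) (b := .reg regU - 1) (c := .reg regU + .reg regK - 1)
    (by rw [cd_add]; simp [hU, hK]) (by rw [cd_add]; simp [hU]; ring)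
    (by rw [cd_add]; simp [hU, hK]; ring)
  have e3 := den_cornerT hT (n (-1) 0 (by decide) (by decide) (by decide) (by decide))
    (n 0 1 (by decide) (by decide) (by decide) (by decide))
    (n (-1) 1 (by decide) (by decide) (by decide) (by decide))
    (a := .reg regU - .reg regK) (b := .reg regU + 1) (c := .reg regU - .reg regK + 1)
    (by rw [cd_add]; simp [hU, hK]; ring) (by rw [cd_add]; simp [hU])
    (by rw [cd_add]; simp [hU, hK]; ring)
  have e4 := den_cornerT hT (n (-1) 0 (by decide) (by decide) (by decide) (by decide))
    (n 0 (-1) (by decide) (by decide) (by decide) (by decide))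
    (n (-1) (-1) (by decide) (by decide) (by decide) (by decide))
    (a := .reg regU - .reg regK) (b := .reg regU - 1) (c := .reg regU - .reg regK - 1)
    (by rw [cd_add]; simp [hU, hK]; ring) (by rw [cd_add]; simp [hU]; ring)
      (by rw [cd_add]; simp [hU, hK]; ring)
  simp only [add_zero] at e1 e2 e3 e4
  simp only [reflexT, den_add, e1, e2, e3, e4]
  constructor
  · intro h
    refine ⟨ht, ?_⟩
    by_contra hcon
    apply h
    rw [if_neg, if_neg, if_neg, if_neg] <;> try rfl
    all_goals
      intro h'
      exact hcon ⟨_, _, by decide, by decide, h'⟩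
  · rintro ⟨-, dx, dy, rfl | rfl, rfl | rfl, h⟩
    all_goals
      rw [if_pos h]
      split_ifs <;> decide

/-- Being leftmost in the row becomes the absence of a previous tile, which the sweep has recorded.
-/
theorem bite_iff {P : Finset (ℤ × ℤ)} {t : ℤ × ℤ} (ht : t ∈ P) :
    Bite P t ↔ (∀ v, ¬ IsPrev P v t) ∧ ¬ LocallyReflex P t ∧
      ¬ ((t.1, t.2 + 1) ∈ P ∧ (t.1, t.2 - 1) ∈ P ∧ (t.1 + 1, t.2) ∉ P) := by
  constructor
  · rintro ⟨-, h1, h2⟩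
    refine ⟨fun v hv => ?_, h2⟩
    have := h1 v hv.1 hv.2.1
    have := hv.2.2.1
    omega
  · rintro ⟨h1, h2⟩
    refine ⟨ht, fun q hq hqt => ?_, h2⟩
    by_contra hlt
    obtain ⟨v, hv, hmax⟩ := Finset.exists_max_image
      (P.filter fun q => q.2 = t.2 ∧ q.1 < t.1) (fun q => q.1)
      ⟨q, Finset.mem_filter.2 ⟨hq, hqt, not_le.1 hlt⟩⟩
    rw [Finset.mem_filter] at hv
    exact h1 v ⟨hv.1, hv.2.1, hv.2.2, fun z hz h3 h4 =>
      hmax z (Finset.mem_filter.2 ⟨hz, h3, h4⟩)⟩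

/-- The test runs only on tiles that failed `reflexT`, so it need not check again that the tile is
not locally reflex. -/
theorem biteT_spec {G : Geo} {s : Store} (hT : G.Table s) (hR : G.Prevs s) (hK : s.reg regK = G.K)
    {t : ℤ × ℤ} (ht : t ∈ G.P) (hU : s.reg regU = G.cd t) (hr : ¬ LocallyReflex G.P t) :
    biteT.den s ≠ 0 ↔ Bite G.P t := by
  classical
  have n := fun dx dy h1 h2 h3 h4 => near_add (G := G) ht (dx := dx) (dy := dy) h1 h2 h3 h4
  have e1 := den_cornerT hT (n 0 1 (by decide) (by decide) (by decide) (by decide))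
    (n 0 (-1) (by decide) (by decide) (by decide) (by decide))
    (n 1 0 (by decide) (by decide) (by decide) (by decide))
    (a := .reg regU + 1) (b := .reg regU - 1) (c := .reg regU + .reg regK)
    (by rw [cd_add]; simp [hU]) (by rw [cd_add]; simp [hU]; ring) (by rw [cd_add]; simp [hU, hK])
  simp only [add_zero, ← sub_eq_add_neg] at e1
  rw [bite_iff ht]
  simp only [biteT, den_mul, den_eqT, den_arr, den_reg, hU, den_ofNat, den_sub, e1, Nat.cast_zero]
  rcases hR t ht with ⟨h1, h2⟩ | ⟨v, h1, h2⟩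
  · rw [h1]
    split_ifs <;> simp_all
  · rw [h2, if_neg (G.cd_pos h1.1).ne']
    simp only [zero_mul, ne_eq, not_true_eq_false, false_iff]
    exact fun h => h.1 v h1

theorem scan_spec : ∃ a : ℕ, ∀ {V : ℕ} {G : Geo} {s₀ : Store} {ts : List (ℤ × ℤ)},
    G.top ≤ V → (G.P.card : ℤ) < V → 1 ≤ G.P.card → G.Params s₀ → ts.length = G.P.card →
    ts.Nodup → (∀ t, t ∈ ts ↔ t ∈ G.P) → (∀ (i : ℕ) t, ts[i]? = some t → s₀.A arrC i = G.cd t) →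
    G.Table s₀ → G.Prevs s₀ →
    Run V scan s₀ (a * G.P.card) fun s => ∃ l : List (ℤ × ℤ), l.Nodup ∧ G.Reflexes l s ∧
      ((s.reg regB = 0 ∧ ∀ t, ¬ Bite G.P t) ∨ ∃ t, Bite G.P t ∧ s.reg regB = G.cd t) := by
  generalize hini : (Cmd.set regI 0 ;; .set regM 0 ;; .set regB 0) = ini
  refine ⟨ini.time + (Cmd.time (.set regU (arr arrC (.reg regI))) + scanTile.time +
    (ltT (.reg regI) (.reg regN)).cost + 1) + ((ltT (.reg regI) (.reg regN)).cost + 1), ?_⟩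
  intro V G s₀ ts hG hN hcard hpar hlen hnd hts hC hT hR
  classical
  have h1 : Run V ini s₀ ini.time fun s => (s.reg regI = 0 ∧ s.reg regM = 0 ∧ s.reg regB = 0) ∧
      Agree ini s₀ s := by
    have : Run V ini s₀ ini.time fun s => s.reg regI = 0 ∧ s.reg regM = 0 ∧ s.reg regB = 0 := by
      subst hini
      refine Run.of_eval ?_ ?_
      · simp [Cmd.safe, Cmd.eval]
      · simp [Cmd.eval]
    exact this.frame
  have h2 : ∀ s, ((s.reg regI = 0 ∧ s.reg regM = 0 ∧ s.reg regB = 0) ∧ Agree ini s₀ s) →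
      Run V (.loop (ltT (.reg regI) (.reg regN))
        (.set regU (arr arrC (.reg regI)) ;; scanTile)) s
      (G.P.card * (Cmd.time (.set regU (arr arrC (.reg regI))) + scanTile.time +
      (ltT (.reg regI) (.reg regN)).cost + 1) + ((ltT (.reg regI) (.reg regN)).cost + 1))
      fun s => ∃ l : List (ℤ × ℤ), l.Nodup ∧ G.Reflexes l s ∧
      ((s.reg regB = 0 ∧ ∀ t, ¬ Bite G.P t) ∨ ∃ t, Bite G.P t ∧ s.reg regB = G.cd t) := by
    rintro s1 ⟨⟨g1, g2, g2'⟩, g3⟩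
    refine (Run.loopA (I := fun n s => ∃ (i : ℕ) (l : List (ℤ × ℤ)), n + i = G.P.card ∧
      s.reg regI = i ∧ l.Nodup ∧ (s.reg regM = l.length ∧
      (∀ (i : ℕ) t, l[i]? = some t → s.A arrS i = G.cd t) ∧
      ∀ t, t ∈ l ↔ t ∈ ts.take i ∧ LocallyReflex G.P t) ∧
      ((s.reg regB = 0 ∧ ∀ t ∈ ts.take i, ¬ Bite G.P t) ∨
        ∃ t, Bite G.P t ∧ s.reg regB = G.cd t)) ?_ ?_).mono le_rfl ?_
    · exact ⟨0, [], by simp, by simpa using g1, by simp, ⟨by simpa using g2, by simp, by simp⟩,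
        .inl ⟨g2', by simp⟩⟩
    · rintro n s ⟨i, l, hn, hi, hl, ⟨k1, k2, k3⟩, hb⟩ hag he
      have hreg : ∀ k, (Cmd.set regU (arr arrC (.reg regI)) ;; scanTile).wr k = false →
          ini.wr k = false → s.reg k = s₀.reg k := fun k h h' => by rw [hag.reg k h, g3.reg k h']
      have harr : ∀ k, (Cmd.set regU (arr arrC (.reg regI)) ;; scanTile).wa k = false →
          ini.wa k = false → ∀ i, s.A k i = s₀.A k i := fun k h h' i => by
        rw [hag.arr k h, g3.arr k h']
      have hilt : i < G.P.card := by
        by_contra hcon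
        apply he
        simp only [den_ltT, den_reg, hi, hreg 0 (by decide) (by subst hini; decide), hpar.card]
        rw [if_neg (by omega)]
      obtain ⟨t, ht⟩ : ∃ t, ts[i]? = some t := ⟨_, List.getElem?_eq_getElem (by omega)⟩
      have htP : t ∈ G.P := (hts t).1 (List.mem_of_getElem? ht)
      have htake : ts.take (i + 1) = ts.take i ++ [t] := by
        rw [List.take_add_one, ht]; rfl
      have hnotin : t ∉ ts.take i := by
        have h := hnd.sublist (List.take_sublist (i + 1) ts)
        rw [htake, List.nodup_append] at h
        exact fun h' => h.2.2 t h' t (by simp) rfl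
      have hCt : s.A arrC i = G.cd t := by
        rw [harr _ (by decide) (by subst hini; decide)]; exact hC i t ht
      have hU : Run V (.set regU (arr arrC (.reg regI))) s
          (Cmd.time (.set regU (arr arrC (.reg regI)))) fun s' => s' = s.setR regU (G.cd t) := by
        refine Run.of_eval ?_ ?_
        · simp [Cmd.safe, hi, hCt, G.abs_cd_le hG htP]
        · simp [Cmd.eval, hi, hCt]
      refine Run.seq (hU.mono le_rfl ?_)
      intro s' hs'
      have q1 : s'.reg regU = G.cd t := by subst hs'; simp
      have q2 : s'.reg regI = i := by subst hs'; simpa using hi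
      have q3 : s'.reg regM = l.length := by subst hs'; simpa using k1
      have q4 : s'.reg regB = s.reg regB := by subst hs'; simp
      have q5 : ∀ k j, s'.A k j = s.A k j := by subst hs'; simp
      have hT' : G.Table s' := fun z hz => by
        rw [q5, harr _ (by decide) (by subst hini; decide)]; exact hT z hz
      have hR' : G.Prevs s' := fun z hz => by
        rw [q5, harr _ (by decide) (by subst hini; decide)]; exact hR z hz
      have hK' : s'.reg regK = G.K := by
        subst hs'
        rw [setR_reg, if_neg (by decide), hreg _ (by decide) (by subst hini; decide)]
        exact hpar.height
      clear hs' hU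
      have hlle : l.length < G.P.card := by
        have h3 : (t :: l).Nodup := List.nodup_cons.2 ⟨fun h => hnotin ((k3 t).1 h).1, hl⟩
        have := (List.toFinset_card_of_nodup h3).symm.le.trans
          (Finset.card_le_card (t := G.P) fun w hw => by
            rcases List.mem_cons.1 (List.mem_toFinset.1 hw) with rfl | h
            · exact htP
            · exact (hts w).1 (List.mem_of_mem_take ((k3 w).1 h).1))
        simpa using this
      have hV1 : |(i : ℤ) + 1| ≤ V := by rw [abs_le]; omega
      have hV2 : |(l.length : ℤ) + 1| ≤ V := by rw [abs_le]; omega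
      have hrs := reflexT_spec hT' hK' htP q1
      by_cases hr : LocallyReflex G.P t
      · have hr' := hrs.2 hr
        refine Run.of_eval ?_ ?_
        · simp [scanTile, Cmd.safe, Cmd.eval, hr', q1, q2, q3, hV1, hV2, G.abs_cd_le hG htP]
        · refine ⟨n - 1, by omega, i + 1, l ++ [t], by omega, ?_, ?_, ⟨?_, ?_, ?_⟩, ?_⟩
          · simp [scanTile, Cmd.eval, hr', q2]
          · rw [List.nodup_append]
            refine ⟨hl, by simp, fun a ha b hb => ?_⟩
            rw [List.mem_singleton.1 hb]
            rintro rfl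
            exact hnotin ((k3 a).1 ha).1
          · simp [scanTile, Cmd.eval, hr', q3]
          · intro j w hw
            simp only [scanTile, Cmd.eval, hr', if_false, den_reg, q1, q3, setR_A, setA_A, true_and]
            rcases lt_or_ge j l.length with h | h
            · rw [List.getElem?_append_left h] at hw
              rw [if_neg (by omega), q5]
              exact k2 j w hw
            · rw [List.getElem?_append_right h] at hw
              have : j - l.length = 0 := by
                by_contra h'
                rw [List.getElem?_eq_none (by simp; omega)] at hw
                simp at hw
              rw [this] at hw
              simp only [List.getElem?_cons_zero, Option.some.injEq] at hw
              rw [if_pos (by omega), hw]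
          · intro w
            rw [List.mem_append, k3, htake, List.mem_append, List.mem_singleton]
            constructor
            · rintro (h | rfl)
              · exact ⟨.inl h.1, h.2⟩
              · exact ⟨.inr rfl, hr⟩
            · rintro ⟨h | h, h'⟩
              · exact .inl ⟨h, h'⟩
              · exact .inr h
          · have : (scanTile.eval s').reg regB = s.reg regB := by
              simp [scanTile, Cmd.eval, hr', q4]
            rw [this]
            refine hb.imp (fun h => ⟨h.1, fun u hu => ?_⟩) id
            rw [htake] at hu
            rcases List.mem_append.1 hu with h' | h'
            · exact h.2 u h'
            · rw [List.mem_singleton.1 h']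
              exact fun h => h.2.2.1 hr
      · have hr' : reflexT.den s' = 0 := by by_contra h; exact hr (hrs.1 h)
        have hbs := biteT_spec hT' hR' hK' htP q1 hr
        have hrefl : ∀ s'' : Store, (∀ j, s''.A arrS j = s.A arrS j) → s''.reg regM = s.reg regM →
            s''.reg regM = l.length ∧ (∀ (i : ℕ) t, l[i]? = some t → s''.A arrS i = G.cd t) ∧
            ∀ t, t ∈ l ↔ t ∈ ts.take (i + 1) ∧ LocallyReflex G.P t := by
          intro s'' h1 h2
          refine ⟨h2.trans k1, fun j w hw => (h1 _).trans (k2 j w hw), fun w => ?_⟩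
          rw [k3, htake, List.mem_append, List.mem_singleton]
          constructor
          · rintro ⟨h, h'⟩
            exact ⟨.inl h, h'⟩
          · rintro ⟨h | rfl, h'⟩
            · exact ⟨h, h'⟩
            · exact absurd h' hr
        by_cases hbt : Bite G.P t
        · have hbt' := hbs.2 hbt
          refine Run.of_eval ?_ ?_
          · simp [scanTile, Cmd.safe, Cmd.eval, hr', hbt', q1, q2, hV1, G.abs_cd_le hG htP]
          · refine ⟨n - 1, by omega, i + 1, l, by omega, ?_, hl, hrefl _ ?_ ?_, .inr ⟨t, hbt, ?_⟩⟩
            · simp [scanTile, Cmd.eval, hr', hbt', q2]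
            · simp [scanTile, Cmd.eval, hr', hbt', q5]
            · simp [scanTile, Cmd.eval, hr', hbt', q3, k1]
            · simp [scanTile, Cmd.eval, hr', hbt', q1]
        · have hbt' : biteT.den s' = 0 := by by_contra h; exact hbt (hbs.1 h)
          refine Run.of_eval ?_ ?_
          · simp [scanTile, Cmd.safe, Cmd.eval, hr', hbt', q2, hV1]
          · refine ⟨n - 1, by omega, i + 1, l, by omega, ?_, hl, hrefl _ ?_ ?_, ?_⟩
            · simp [scanTile, Cmd.eval, hr', hbt', q2]
            · simp [scanTile, Cmd.eval, hr', hbt', q5]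
            · simp [scanTile, Cmd.eval, hr', hbt', q3, k1]
            · have : (scanTile.eval s').reg regB = s.reg regB := by
                simp [scanTile, Cmd.eval, hr', hbt', q4]
              rw [this]
              refine hb.imp (fun h => ⟨h.1, fun u hu => ?_⟩) id
              rw [htake] at hu
              rcases List.mem_append.1 hu with h' | h'
              · exact h.2 u h'
              · rw [List.mem_singleton.1 h']
                exact hbt
    · rintro s ⟨he, hag, n, i, l, hn, hi, hl, ⟨k1, k2, k3⟩, hb⟩
      have hge : ts.length ≤ i := by
        by_contra hcon
        have : s.reg regN = G.P.card := by
          rw [hag.reg _ (by decide), g3.reg _ (by subst hini; decide)]; exact hpar.card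
        simp only [den_ltT, den_reg, hi, this] at he
        rw [if_pos (by omega)] at he
        omega
      rw [List.take_of_length_le hge] at k3 hb
      refine ⟨l, hl, ⟨k1, k2, fun t => (k3 t).trans ⟨fun h => h.2, fun h => ⟨(hts t).2 h.1, h⟩⟩⟩,
          ?_⟩
      exact hb.imp (fun h => ⟨h.1, fun t ht => h.2 t ((hts t).2 ht.1) ht⟩) id
  rw [scan, hini]
  refine (Run.seq (h1.mono le_rfl h2)).mono ?_ fun _ h => h
  nlinarith

end WordRAM


namespace WordRAM

open Polyomino

/-! ### One direction -/

/-- Rotation of the direction. -/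
def turn : Cmd :=
  .set regA (0 - .reg regQ) ;; .set regQ (.reg regP) ;; .set regP (.reg regA) ;;
  .set regX (.reg regX + .reg regK)

/-- Use of a bite, or search for a cut that separates reflex tiles. -/
def choose : Cmd :=
  .ite (.reg regB)
    (.set regS (.reg regS + 1) ;; .put arrV (.reg regB) (.reg regS) ;; .set regF 1) pairs

/-- Search for a cut in the next direction. -/
def orient : Cmd := turn ;; build ;; sweep ;; scan ;; choose

/-- The directions. -/
def dir : ℕ → ℤ × ℤ
  -- A starting value only: each search is preceded by a quarter turn, so the directions in use are
  -- `dir 1` to `dir 4`, beginning with `(1, 0)`.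
  | 0 => (0, -1)
  | j + 1 => (-(dir j).2, (dir j).1)

theorem isUnitVec_dir (j : ℕ) : IsUnitVec (dir j).1 (dir j).2 := by
  induction j with
  | zero => exact .inr (.inr (.inr ⟨rfl, rfl⟩))
  | succ j ih =>
    simp only [dir]
    rcases ih with ⟨h1, h2⟩ | ⟨h1, h2⟩ | ⟨h1, h2⟩ | ⟨h1, h2⟩ <;> rw [h1, h2] <;>
      simp [IsUnitVec]

/-- The state after the treatment of `j` directions. -/
structure Outer (L : List (ℤ × ℤ)) (E : ℤ) (r j : ℕ) (s : Store) : Prop where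
  card : s.reg regN = L.length
  bd : s.reg regE = E
  height : s.reg regK = 2 * E + 1
  -- The offset of the previous direction; `turn` adds `K`, which gives the offset beyond which
  -- `fresh` guarantees empty tables.
  offset : s.reg regX = E + ((j : ℤ) - 1) * (2 * E + 1)
  dir_fst : s.reg regP = (dir j).1
  dir_snd : s.reg regQ = (dir j).2
  fst : ∀ (i : ℕ) t, L[i]? = some t → s.A arrX i = t.1
  snd : ∀ (i : ℕ) t, L[i]? = some t → s.A arrY i = t.2
  stamps : Stamps s
  stamp_le : s.reg regS ≤ j * (3 * (r * r : ℕ) + 1)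
  fresh : Fresh E (E + j * (2 * E + 1)) s

/-- A cut has been found in some direction. -/
def Found (V : ℕ) (P : Finset (ℤ × ℤ)) (s : Store) : Prop :=
  ∃ (p q : ℤ) (hu : IsUnitVec p q) (G : Geo) (ts : List (ℤ × ℤ)), G.P = timage (rot hu) P ∧
    G.top ≤ V ∧ s.reg regP = p ∧ s.reg regQ = q ∧ G.Params s ∧ G.Table s ∧
    ts.length = G.P.card ∧ (∀ t, t ∈ ts ↔ t ∈ G.P) ∧
    (∀ (i : ℕ) t, ts[i]? = some t → s.A arrC i = G.cd t) ∧ Marked G s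

theorem card_timage (f : (ℤ × ℤ) ≃+ (ℤ × ℤ)) (P : Finset (ℤ × ℤ)) :
    (timage f P).card = P.card := Finset.card_map _

theorem bound_rot {P : Finset (ℤ × ℤ)} {E : ℤ} (h : ∀ p ∈ P, |p.1| + 2 ≤ E ∧ |p.2| + 2 ≤ E)
    {p q : ℤ} (hu : IsUnitVec p q) :
    ∀ t ∈ timage (rot hu) P, |t.1| + 2 ≤ E ∧ |t.2| + 2 ≤ E := by
  refine forall_mem_timage.2 fun t ht => ?_
  have := h t ht
  rw [rot_apply]
  rcases hu with ⟨rfl, rfl⟩ | ⟨rfl, rfl⟩ | ⟨rfl, rfl⟩ | ⟨rfl, rfl⟩ <;> simp <;> omega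

/-- A bite is recorded by giving its tile a new stamp. Then it looks like the result of a closure,
and both kinds of cut are handed on in the form `Marked`. -/
theorem choose_spec : ∃ a : ℕ, ∀ {V : ℕ} {G : Geo} {s₀ : Store} {l : List (ℤ × ℤ)},
    G.top ≤ V → (G.P.card : ℤ) < V → 3 * (l.length * l.length : ℕ) + 1 + s₀.reg regS ≤ V →
    2 ≤ G.P.card →
    G.Table s₀ → G.Prevs s₀ → G.Reflexes l s₀ → Stamps s₀ → s₀.reg regK = G.K → Conn G.P →
    IsSimple G.P → s₀.reg regF = 0 →
    ((s₀.reg regB = 0 ∧ ∀ t, ¬ Bite G.P t) ∨ ∃ t, Bite G.P t ∧ s₀.reg regB = G.cd t) →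
    Run V choose s₀ (a * (G.P.card * (l.length * l.length + 1))) fun s =>
      s.reg regS ≤ s₀.reg regS + 3 * (l.length * l.length : ℕ) + 1 ∧ Stamps s ∧
      ((s.reg regF = 0 ∧ NoCut G.P) ∨ (s.reg regF = 1 ∧ Marked G s)) := by
  obtain ⟨a, ha⟩ := pairs_spec
  generalize hc : (Cmd.set regS (.reg regS + 1) ;; .put arrV (.reg regB) (.reg regS) ;;
    .set regF 1) = c
  refine ⟨(Term.reg regB).cost + 1 + c.time + a, ?_⟩
  intro V G s₀ l hG hN hm hcard hT hR hRef hSt hK hP hs hF hB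
  have h1 : Run V choose s₀ ((Term.reg regB).cost + 1 + max c.time
      (a * (G.P.card * (l.length * l.length + 1)))) fun s =>
      s.reg regS ≤ s₀.reg regS + 3 * (l.length * l.length : ℕ) + 1 ∧ Stamps s ∧
      ((s.reg regF = 0 ∧ NoCut G.P) ∨ (s.reg regF = 1 ∧ Marked G s)) := by
    rw [choose, hc]
    refine Run.ite (fun h => ?_) fun h => ?_
    · rcases hB with h' | ⟨t, ht, hBt⟩
      · exact absurd h'.1 h
      have hS0 := hSt.1
      have hSV : |s₀.reg regS + 1| ≤ V := by rw [abs_le]; omega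
      have hV1 : (1 : ℤ) ≤ V := by omega
      subst hc
      refine Run.of_eval ?_ ?_
      · simp [Cmd.safe, Cmd.eval, hSV, hV1]
      · refine ⟨?_, ⟨?_, ?_⟩, .inr ⟨?_, {t}, G.P.erase t, ht.hcut hP hcard, ?_⟩⟩
        · simp [Cmd.eval]; omega
        · simp [Cmd.eval]; omega
        · intro i hi
          have := hSt.2 i hi
          simp only [Cmd.eval, den_add, den_reg, den_ofNat, setR_A, setA_A, setA_reg, setR_reg]
          split_ifs <;> omega
        · simp [Cmd.eval]
        · intro p hp
          rw [Finset.mem_singleton]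
          by_cases hpt : p = t
          · subst hpt; simp [Cmd.eval, hBt]
          · have h4 : G.cd p ≠ G.cd t := fun h => hpt (G.cd_inj (G.near hp) (G.near ht.1) h)
            have := hSt.2 (G.cd p) (G.cd_pos hp).le
            simp [Cmd.eval, hBt, h4, hpt]
            omega
    · have hB' : ∀ t, ¬ Bite G.P t := by
        rcases hB with h' | ⟨t, ht, hBt⟩
        · exact h'.2
        · have := G.cd_pos ht.1
          rw [den_reg] at h
          omega
      refine (ha hG hN (by omega) (by omega) hT hR hRef hSt hK hP hs hF).mono le_rfl ?_
      rintro s ⟨h1, h2, h3⟩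
      exact ⟨by omega, h2, h3.imp (fun h => ⟨h.1, hB', h.2⟩) id⟩
  refine h1.mono ?_ fun _ h => h
  have h3 : 1 ≤ G.P.card * (l.length * l.length + 1) := Nat.mul_pos (by omega) (by omega)
  have h4 := Nat.le_mul_of_pos_right ((Term.reg regB).cost + 1 + c.time) h3
  rw [add_mul _ a]
  have := max_le_add_of_nonneg (a := c.time)
    (b := (a * (G.P.card * (l.length * l.length + 1)))) (by omega) (by omega)
  omega

theorem length_eq_numReflex {P : Finset (ℤ × ℤ)} {l : List (ℤ × ℤ)} (hl : l.Nodup)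
    (h : ∀ t, t ∈ l ↔ LocallyReflex P t) : l.length = numReflex P := by
  classical
  rw [← List.toFinset_card_of_nodup hl, numReflex]
  congr 1
  ext t
  rw [List.mem_toFinset, h, Finset.mem_filter]
  exact ⟨fun h => ⟨h.1, h⟩, fun h => h.2⟩

/-- The direction `j + 1` works on the rotated polyomino in its own window of the tables. With at
most four directions, all cell numbers stay below `4 * (2 * E + 1) ^ 2`, and all stamps below four
times those of one direction. -/
theorem orient_spec : ∃ a : ℕ, ∀ {V : ℕ} {L : List (ℤ × ℤ)} {P : Finset (ℤ × ℤ)} {E : ℤ} {j : ℕ}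
    {s₀ : Store}, L.Nodup → L.toFinset = P → Conn P → IsSimple P → 2 ≤ P.card → 2 ≤ E →
    (∀ p ∈ P, |p.1| + 2 ≤ E ∧ |p.2| + 2 ≤ E) → (P.card : ℤ) < V →
    4 * (2 * E + 1) * (2 * E + 1) ≤ V → 4 * (3 * (numReflex P * numReflex P : ℕ) + 1) ≤ (V : ℤ) →
    j < 4 → Outer L E (numReflex P) j s₀ → s₀.reg regF = 0 →
    Run V orient s₀ (a * (P.card * (numReflex P * numReflex P + 1))) fun s =>
      Outer L E (numReflex P) (j + 1) s ∧
      ((s.reg regF = 0 ∧ NoCut (timage (rot (isUnitVec_dir (j + 1))) P)) ∨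
        (s.reg regF = 1 ∧ Found V P s)) := by
  obtain ⟨a1, h1⟩ := build_spec
  obtain ⟨a2, h2⟩ := sweep_spec
  obtain ⟨a3, h3⟩ := scan_spec
  obtain ⟨a4, h4⟩ := choose_spec
  refine ⟨turn.time + (a1 + (a2 + (a3 + a4))), ?_⟩
  intro V L P E j s₀ hnd hLP hP hs hcard hE2 hb hN hKV hrV hj hO hF
  obtain ⟨hu, hhu⟩ : ∃ hu, hu = isUnitVec_dir (j + 1) := ⟨_, rfl⟩
  rw [← hhu]
  have hjE : (j : ℤ) * (2 * E + 1) ≤ 3 * (2 * E + 1) := by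
    have : (j : ℤ) ≤ 3 := by omega
    exact mul_le_mul_of_nonneg_right this (by omega)
  have hjE0 : 0 ≤ (j : ℤ) * (2 * E + 1) := by positivity
  obtain ⟨G, hGP, hGE, hGX⟩ : ∃ G : Geo, G.P = timage (rot hu) P ∧ G.E = E ∧
      G.X = E + j * (2 * E + 1) :=
    ⟨⟨timage (rot hu) P, E, E + j * (2 * E + 1), hE2, by omega, bound_rot hb hu⟩, rfl, rfl, rfl⟩
  have hGK : G.K = 2 * E + 1 := by rw [Geo.K, hGE]
  have hcardG : G.P.card = P.card := by rw [hGP, card_timage]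
  have hPG : Conn G.P := by rw [hGP]; exact (isSymmetry_rot hu).conn hP
  have hsG : IsSimple G.P := by rw [hGP]; exact (isSymmetry_rot hu).isSimple hs
  have htop : G.top ≤ V := by
    refine le_trans ?_ hKV
    rw [Geo.top, hGK, hGX, hGE]
    have : E + j * (2 * E + 1) + E + 1 ≤ 4 * (2 * E + 1) := by omega
    have := mul_le_mul_of_nonneg_left this (show 0 ≤ 2 * E + 1 by omega)
    linarith
  have hXV : G.X + G.E + 1 ≤ V := by
    refine le_trans ?_ htop
    have := G.K_pos; have := G.le; have := G.two_le
    unfold Geo.top; nlinarith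
  have hunit := isUnitVec_dir j
  -- rotation
  have t1 : Run V turn s₀ turn.time fun s => (s.reg regP = (dir (j + 1)).1 ∧
      s.reg regQ = (dir (j + 1)).2 ∧ s.reg regX = G.X) ∧ Agree turn s₀ s := by
    refine Run.frame ?_
    have hXe : E + ((j : ℤ) - 1) * (2 * E + 1) + (2 * E + 1) = E + j * (2 * E + 1) := by ring
    refine Run.of_eval ?_ ?_
    · simp only [turn, Cmd.safe, Cmd.eval, den_sub, den_reg, den_add, den_ofNat, setR_reg]
      simp [hO.dir_fst, hO.dir_snd, hO.offset, hO.height, hXe]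
      rw [hGX, hGE] at hXV
      have hV1 : (1 : ℤ) ≤ V := by omega
      refine ⟨?_, ?_, ?_, abs_le.2 ⟨by omega, by omega⟩⟩ <;>
      rcases hunit with ⟨h1, h2⟩ | ⟨h1, h2⟩ | ⟨h1, h2⟩ | ⟨h1, h2⟩ <;> simp [h1, h2] <;> omega
    · simp only [turn, Cmd.eval, den_sub, den_reg, den_add, den_ofNat, setR_reg]
      simp [hO.dir_fst, hO.dir_snd, hO.offset, hO.height, hXe, hGX, dir]
  have hr : numReflex G.P = numReflex P := by rw [hGP, numReflex_rot]
  have key : Run V orient s₀ (turn.time + (a1 * G.P.card + (a2 * G.P.card + (a3 * G.P.card +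
      a4 * (G.P.card * (numReflex P * numReflex P + 1)))))) fun s =>
      Outer L E (numReflex P) (j + 1) s ∧
      ((s.reg regF = 0 ∧ NoCut (timage (rot hu) P)) ∨ (s.reg regF = 1 ∧ Found V P s)) := by
    rw [orient]
    refine Run.seq (t1.mono le_rfl ?_)
    rintro s1 ⟨⟨p1, p2, p3⟩, ag1⟩
    have hpar1 : G.Params s1 := by
      refine ⟨?_, ?_, ?_, p3⟩
      · rw [ag1.reg _ (by decide), hO.card, ← List.toFinset_card_of_nodup hnd, hLP, hcardG]
      · rw [ag1.reg _ (by decide), hO.bd, hGE]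
      · rw [ag1.reg _ (by decide), hO.height, hGK]
    have hts1 : G.Tiles (L.map (rot hu)) s1 := by
      refine ⟨hnd.map (rot hu).injective, ?_, ?_, ?_⟩
      · intro t
        rw [hGP, mem_timage, ← hLP, List.mem_toFinset, List.mem_map]
        constructor
        · rintro ⟨u, hu', rfl⟩
          rwa [AddEquiv.symm_apply_apply]
        · intro h
          exact ⟨_, h, AddEquiv.apply_symm_apply _ _⟩
      all_goals
        intro i t ht
        rw [List.getElem?_map, Option.map_eq_some_iff] at ht
        obtain ⟨u, hu', rfl⟩ := ht
        rw [ag1.arr _ (by decide), ag1.arr _ (by decide), hO.fst i u hu', hO.snd i u hu', p1, p2]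
        rfl
    have hfr1 : Fresh G.E G.X s1 := by
      rw [hGE, hGX]
      exact ⟨fun c hc => by rw [ag1.arr _ (by decide)]; exact hO.fresh.table c hc,
        fun c hc => by rw [ag1.arr _ (by decide)]; exact hO.fresh.col c hc,
        fun c hc => by rw [ag1.arr _ (by decide)]; exact hO.fresh.row c hc⟩
    have hNG : (G.P.card : ℤ) < V := by rw [hcardG]; exact hN
    refine Run.seq ((h1 htop hNG (by omega) hpar1 hts1 hfr1).frame.mono le_rfl ?_)
    rintro s2 ⟨hB2, ag2⟩
    have hpar2 : G.Params s2 :=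
      ⟨by rw [ag2.reg _ (by decide)]; exact hpar1.card,
        by rw [ag2.reg _ (by decide)]; exact hpar1.bd,
        by rw [ag2.reg _ (by decide)]; exact hpar1.height,
        by rw [ag2.reg _ (by decide)]; exact hpar1.offset⟩
    refine Run.seq ((h2 htop hNG (by omega) hPG hpar2 hts1.mem hB2 (fun c hc => by
      rw [ag2.arr _ (by decide)]; exact hfr1.row c hc)).frame.mono le_rfl ?_)
    rintro s3 ⟨⟨hR3, hT3⟩, ag3⟩
    have hpar3 : G.Params s3 :=
      ⟨by rw [ag3.reg _ (by decide)]; exact hpar2.card,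
        by rw [ag3.reg _ (by decide)]; exact hpar2.bd,
        by rw [ag3.reg _ (by decide)]; exact hpar2.height,
        by rw [ag3.reg _ (by decide)]; exact hpar2.offset⟩
    have hTab2 : G.Table s2 := hB2.isTable hts1
    have hTab3 : G.Table s3 := fun z hz => by rw [ag3.arr _ (by decide)]; exact hTab2 z hz
    have hC2 : ∀ (i : ℕ) t, (L.map (rot hu))[i]? = some t → s2.A arrC i = G.cd t := fun i t ht =>
      hB2.cells i t (List.getElem?_eq_some_iff.1 ht).1 ht
    refine Run.seq ((h3 htop hNG (by omega) hpar3 hts1.length hts1.nodup hts1.mem (fun i t ht => by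
      rw [ag3.arr _ (by decide)]; exact hC2 i t ht) hTab3 hR3).frame.mono le_rfl ?_)
    rintro s4 ⟨⟨l, hl, hRef, hBite⟩, ag4⟩
    have hlr : l.length = numReflex P := by rw [length_eq_numReflex hl hRef.2.2, hr]
    have hS4 : s4.reg regS = s₀.reg regS := by
      rw [ag4.reg _ (by decide), ag3.reg _ (by decide), ag2.reg _ (by decide),
        ag1.reg _ (by decide)]
    have hSt4 : Stamps s4 := by
      refine ⟨by rw [hS4]; exact hO.stamps.1, fun i hi => ?_⟩
      rw [hS4, ag4.arr _ (by decide), ag3.arr _ (by decide), ag2.arr _ (by decide),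
        ag1.arr _ (by decide)]
      exact hO.stamps.2 i hi
    have hTab4 : G.Table s4 := fun z hz => by rw [ag4.arr _ (by decide)]; exact hTab3 z hz
    have hstle := hO.stamp_le
    have hsj : ((j : ℤ) + 1) * (3 * (numReflex P * numReflex P : ℕ) + 1) ≤
        4 * (3 * (numReflex P * numReflex P : ℕ) + 1) := by
      have : (j : ℤ) + 1 ≤ 4 := by omega
      exact mul_le_mul_of_nonneg_right this (by positivity)
    rw [add_mul, one_mul] at hsj
    have h5 := h4 (l := l) (s₀ := s4) htop hNG (by rw [hlr, hS4]; omega) (by omega) hTab4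
      (fun u hu => by rw [ag4.arr _ (by decide)]; exact hR3 u hu) hRef hSt4
      (by rw [ag4.reg _ (by decide)]; exact hpar3.height) hPG hsG
      (by rw [ag4.reg _ (by decide), ag3.reg _ (by decide), ag2.reg _ (by decide),
        ag1.reg _ (by decide)]; exact hF) hBite
    rw [hlr, hS4] at h5
    refine h5.frame.mono le_rfl ?_
    rintro s5 ⟨⟨k1, k2, k3⟩, ag5⟩
    refine ⟨⟨?_, ?_, ?_, ?_, ?_, ?_, ?_, ?_, k2, ?_, ?_⟩, ?_⟩
    · rw [ag5.reg _ (by decide), ag4.reg _ (by decide), ag3.reg _ (by decide),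
        ag2.reg _ (by decide), ag1.reg _ (by decide)]; exact hO.card
    · rw [ag5.reg _ (by decide), ag4.reg _ (by decide), ag3.reg _ (by decide),
        ag2.reg _ (by decide), ag1.reg _ (by decide)]; exact hO.bd
    · rw [ag5.reg _ (by decide), ag4.reg _ (by decide), ag3.reg _ (by decide),
        ag2.reg _ (by decide), ag1.reg _ (by decide)]; exact hO.height
    · rw [ag5.reg _ (by decide), ag4.reg _ (by decide), ag3.reg _ (by decide),
        ag2.reg _ (by decide), p3, hGX]; push_cast; ring
    · rw [ag5.reg _ (by decide), ag4.reg _ (by decide), ag3.reg _ (by decide),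
        ag2.reg _ (by decide), p1]
    · rw [ag5.reg _ (by decide), ag4.reg _ (by decide), ag3.reg _ (by decide),
        ag2.reg _ (by decide), p2]
    · intro i t ht
      rw [ag5.arr _ (by decide), ag4.arr _ (by decide), ag3.arr _ (by decide),
        ag2.arr _ (by decide), ag1.arr _ (by decide)]
      exact hO.fst i t ht
    · intro i t ht
      rw [ag5.arr _ (by decide), ag4.arr _ (by decide), ag3.arr _ (by decide),
        ag2.arr _ (by decide), ag1.arr _ (by decide)]
      exact hO.snd i t ht
    · push_cast at k1 hstle ⊢
      linarith
    · refine ⟨fun c hc => ?_, fun c hc => ?_, fun c hc => ?_⟩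
      · rw [ag5.arr _ (by decide), ag4.arr _ (by decide), ag3.arr _ (by decide)]
        -- The window of the next direction starts exactly at `top`, where the table built for this
        -- direction is still empty.
        have hc' : G.top ≤ c := by
          refine le_trans (le_of_eq ?_) hc
          rw [Geo.top, hGK, hGX, hGE]; push_cast; ring
        have : G.K * (G.X - G.E) ≤ G.top := by
          have := G.K_pos; have := G.two_le
          unfold Geo.top; nlinarith
        rw [hB2.table c (this.trans hc') False, if_neg not_false]
        refine ⟨False.elim, ?_⟩
        rintro ⟨t, ht, rfl⟩
        have := G.cd_lt (G.near ((hts1.mem t).1 ht))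
        omega
      · rw [ag5.arr _ (by decide), ag4.arr _ (by decide), ag3.arr _ (by decide)]
        refine hB2.col c ?_
        rw [hGX, hGE]
        push_cast at hc
        linarith
      · rw [ag5.arr _ (by decide), ag4.arr _ (by decide)]
        refine hT3 c ?_
        rw [hGX, hGE]
        push_cast at hc
        linarith
    · rw [hGP] at k3
      refine k3.imp id fun h => ⟨h.1, _, _, hu, G, L.map (rot hu), hGP, htop, ?_, ?_, ?_, ?_,
        hts1.length, hts1.mem, ?_, h.2⟩
      · rw [ag5.reg _ (by decide), ag4.reg _ (by decide), ag3.reg _ (by decide),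
          ag2.reg _ (by decide), p1]
      · rw [ag5.reg _ (by decide), ag4.reg _ (by decide), ag3.reg _ (by decide),
          ag2.reg _ (by decide), p2]
      · exact ⟨by rw [ag5.reg _ (by decide), ag4.reg _ (by decide)]; exact hpar3.card,
          by rw [ag5.reg _ (by decide), ag4.reg _ (by decide)]; exact hpar3.bd,
          by rw [ag5.reg _ (by decide), ag4.reg _ (by decide)]; exact hpar3.height,
          by rw [ag5.reg _ (by decide), ag4.reg _ (by decide)]; exact hpar3.offset⟩
      · exact fun z hz => by rw [ag5.arr _ (by decide)]; exact hTab4 z hz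
      · exact fun i t ht => by
          rw [ag5.arr _ (by decide), ag4.arr _ (by decide), ag3.arr _ (by decide)]
          exact hC2 i t ht
  refine key.mono ?_ fun _ h => h
  rw [hcardG]
  have h6 : P.card ≤ P.card * (numReflex P * numReflex P + 1) := Nat.le_mul_of_pos_right _
      (by omega)
  have h7 : 1 ≤ P.card * (numReflex P * numReflex P + 1) := by omega
  have e1 := Nat.le_mul_of_pos_right turn.time h7
  have e2 := Nat.mul_le_mul_left a1 h6
  have e3 := Nat.mul_le_mul_left a2 h6
  have e4 := Nat.mul_le_mul_left a3 h6
  rw [add_mul, add_mul, add_mul, add_mul]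
  omega

end WordRAM


namespace WordRAM

open Polyomino

/-! ### Reading the input -/

/-- Copy of one tile. -/
def copyTile : Cmd :=
  .put arrX (.reg regI) (.load (2 * .reg regI)) ;;
  .put arrY (.reg regI) (.load (2 * .reg regI + 1)) ;;
  .set regE (.reg regE + (arr arrX (.reg regI) * arr arrX (.reg regI) +
    arr arrY (.reg regI) * arr arrY (.reg regI))) ;;
  .set regI (.reg regI + 1)

/-- Copy of the input, and computation of a bound for the coordinates. -/
def copyTiles : Cmd :=
  (.set regI 0 ;; .set regE 2) ;; .loop (ltT (.reg regI) (.reg regN)) copyTile ;;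
  (.set regK (2 * .reg regE + 1) ;; .set regX (.reg regE - .reg regK) ;; .set regP 0 ;;
    .set regQ (.const (-1)))

/-- The bound for the coordinates. -/
def extent (L : List (ℤ × ℤ)) : ℤ := 2 + (L.map fun t => t.1 * t.1 + t.2 * t.2).sum

theorem extent_append (L L' : List (ℤ × ℤ)) :
    extent (L ++ L') = extent L + (L'.map fun t => t.1 * t.1 + t.2 * t.2).sum := by
  simp [extent, add_assoc]

theorem sum_sq_nonneg (L : List (ℤ × ℤ)) : 0 ≤ (L.map fun t => t.1 * t.1 + t.2 * t.2).sum := by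
  refine List.sum_nonneg fun x hx => ?_
  obtain ⟨t, -, rfl⟩ := List.mem_map.1 hx
  exact add_nonneg (mul_self_nonneg _) (mul_self_nonneg _)

theorem two_le_extent (L : List (ℤ × ℤ)) : 2 ≤ extent L := by
  have := sum_sq_nonneg L
  unfold extent; omega

theorem extent_take_le (L : List (ℤ × ℤ)) (i : ℕ) : extent (L.take i) ≤ extent L := by
  conv_rhs => rw [← List.take_append_drop i L, extent_append]
  have := sum_sq_nonneg (L.drop i)
  omega

/-- The reason for summing squares in `extent`: one addition per tile gives a bound for all
coordinates, without absolute values or maxima. -/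
theorem abs_le_mul_self (x : ℤ) : |x| ≤ x * x := by
  rw [← abs_mul_abs_self x]
  rcases eq_or_ne x 0 with rfl | h
  · simp
  · have := Int.one_le_abs h
    nlinarith

theorem le_extent {L : List (ℤ × ℤ)} {t : ℤ × ℤ} (ht : t ∈ L) :
    |t.1| + 2 ≤ extent L ∧ |t.2| + 2 ≤ extent L := by
  have h1 : t.1 * t.1 + t.2 * t.2 ≤ (L.map fun t => t.1 * t.1 + t.2 * t.2).sum := by
    refine List.single_le_sum (fun x hx => ?_) _ (List.mem_map.2 ⟨t, ht, rfl⟩)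
    obtain ⟨u, -, rfl⟩ := List.mem_map.1 hx
    exact add_nonneg (mul_self_nonneg _) (mul_self_nonneg _)
  have h2 := abs_le_mul_self t.1
  have h3 := abs_le_mul_self t.2
  have h4 := mul_self_nonneg t.1
  have h5 := mul_self_nonneg t.2
  unfold extent
  omega

/-- A crude bound suffices, as long as it is polynomial in `N + M`: addresses then fit into words,
and unused memory costs no time. -/
theorem extent_le {L : List (ℤ × ℤ)} {M : ℕ} (h : ∀ t ∈ L, |t.1| ≤ (M : ℤ) ∧ |t.2| ≤ (M : ℤ)) :
    extent L ≤ 2 + L.length * (2 * (M * M)) := by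
  have h1 := List.sum_le_card_nsmul (L.map fun t => t.1 * t.1 + t.2 * t.2) (2 * ((M : ℤ) * M)) ?_
  · rw [List.length_map, nsmul_eq_mul] at h1
    unfold extent
    linarith
  · intro x hx
    obtain ⟨t, ht, rfl⟩ := List.mem_map.1 hx
    obtain ⟨h1, h2⟩ := h t ht
    have h3 := mul_le_mul h1 h1 (abs_nonneg _) (by positivity)
    have h4 := mul_le_mul h2 h2 (abs_nonneg _) (by positivity)
    rw [abs_mul_abs_self] at h3 h4
    linarith

theorem input_fst {L : List (ℤ × ℤ)} {i : ℕ} {t : ℤ × ℤ} (h : L[i]? = some t) :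
    (input L).mem (2 * i) = t.1 := by
  have h1 : (2 * (i : ℤ)).toNat = 2 * i := by omega
  simp [input, h1, h]

theorem input_snd {L : List (ℤ × ℤ)} {i : ℕ} {t : ℤ × ℤ} (h : L[i]? = some t) :
    (input L).mem (2 * i + 1) = t.2 := by
  have h1 : (2 * (i : ℤ) + 1).toNat = 2 * i + 1 := by omega
  have h2 : (2 * i + 1) / 2 = i := by omega
  have h3 : (0 : ℤ) ≤ 2 * i + 1 := by omega
  simp [input, h1, h, h2, h3]

theorem input_A (L : List (ℤ × ℤ)) (k : Fin 32) {i : ℤ} (hi : 0 ≤ i) : (input L).A k i = 0 := by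
  simp only [Store.A, input]
  rw [if_neg (by omega)]

theorem setA_mem_of_nonneg (s : Store) (k : Fin 32) {i a : ℤ} (z : ℤ) (hi : 0 ≤ i) (ha : 0 ≤ a) :
    (s.setA k i z).mem a = s.mem a := by
  simp only [Store.setA, Store.setM]
  rw [Function.update_of_ne (by omega)]

/-- The arrays occupy negative addresses, so the input is intact while it is copied. The offset
starts at `E - K`, so that the first turn brings it to `E`. -/
theorem copyTiles_spec : ∃ a : ℕ, ∀ {V : ℕ} {L : List (ℤ × ℤ)} {r : ℕ}, 1 ≤ L.length →
    (L.length : ℤ) < V → 2 * extent L + 1 ≤ V →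
    Run V copyTiles (input L) (a * L.length) fun s => Outer L (extent L) r 0 s ∧
      s.reg regF = 0 := by
  generalize hini : (Cmd.set regI 0 ;; .set regE 2) = ini
  generalize hfin : (Cmd.set regK (2 * .reg regE + 1) ;; .set regX (.reg regE - .reg regK) ;;
    .set regP 0 ;; .set regQ (.const (-1))) = fin
  refine ⟨ini.time + (copyTile.time + (ltT (.reg regI) (.reg regN)).cost + 1) +
    ((ltT (.reg regI) (.reg regN)).cost + 1) + fin.time, ?_⟩
  intro V L r hlen hNV hEV
  have hE2 := two_le_extent L
  have h1 : Run V ini (input L) ini.time fun s => (s.reg regI = 0 ∧ s.reg regE = 2 ∧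
      s.mem = (input L).mem) ∧ Agree ini (input L) s := by
    refine Run.frame ?_
    subst hini
    have hV : (2 : ℤ) ≤ V := by omega
    refine Run.of_eval ?_ ?_
    · simp [Cmd.safe, Cmd.eval, hV]
    · simp [Cmd.eval]
  have h2 : ∀ s, ((s.reg regI = 0 ∧ s.reg regE = 2 ∧ s.mem = (input L).mem) ∧
      Agree ini (input L) s) → Run V (.loop (ltT (.reg regI) (.reg regN)) copyTile) s
      (L.length * (copyTile.time + (ltT (.reg regI) (.reg regN)).cost + 1) +
        ((ltT (.reg regI) (.reg regN)).cost + 1)) fun s => s.reg regE = extent L ∧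
      (∀ (i : ℕ) t, L[i]? = some t → s.A arrX i = t.1 ∧ s.A arrY i = t.2) ∧
      (∀ k, copyTile.wr k = false → ini.wr k = false → s.reg k = (input L).reg k) ∧
      ∀ k, copyTile.wa k = false → ∀ i, s.A k i = (input L).A k i := by
    rintro s1 ⟨⟨g1, g2, g3⟩, g4⟩
    have hA : ∀ k i, s1.A k i = (input L).A k i := fun k i => by simp only [Store.A, g3]
    refine (Run.loopA (I := fun n s => ∃ i : ℕ, n + i = L.length ∧ s.reg regI = i ∧
      s.reg regE = extent (L.take i) ∧ (∀ a, 0 ≤ a → s.mem a = (input L).mem a) ∧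
      (∀ (j : ℕ) t, j < i → L[j]? = some t → s.A arrX j = t.1 ∧ s.A arrY j = t.2)) ?_ ?_).mono
      le_rfl ?_
    · exact ⟨0, by simp, by simpa using g1, by simpa [extent] using g2, fun a _ => by rw [g3],
        by simp⟩
    · rintro n s ⟨i, hn, hi, hE, hm, hXY⟩ hag he
      have hN : s.reg regN = L.length := by
        rw [hag.reg _ (by decide), g4.reg _ (by subst hini; decide)]; rfl
      have hilt : i < L.length := by
        by_contra hcon
        apply he
        simp only [den_ltT, den_reg, hi, hN]
        rw [if_neg (by omega)]
      obtain ⟨t, ht⟩ : ∃ t, L[i]? = some t := ⟨_, List.getElem?_eq_getElem hilt⟩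
      have htake : L.take (i + 1) = L.take i ++ [t] := by
        rw [List.take_add_one, ht]; rfl
      have hm1 : s.mem (2 * (i : ℤ)) = t.1 := by rw [hm _ (by omega), input_fst ht]
      have hm2 : ∀ z, (s.setA arrX i z).mem (2 * (i : ℤ) + 1) = t.2 := fun z => by
        rw [setA_mem_of_nonneg _ _ _ (by omega) (by omega), hm _ (by omega), input_snd ht]
      have hEi : extent (L.take i) + (t.1 * t.1 + t.2 * t.2) = extent (L.take (i + 1)) := by
        rw [htake, extent_append]; simp
      have hle := extent_take_le L (i + 1)
      have h2le := two_le_extent (L.take (i + 1))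
      obtain ⟨b1, b2⟩ := le_extent (List.mem_of_getElem? ht)
      have hV1 : |t.1| ≤ V := by omega
      have hV2 : |t.2| ≤ V := by omega
      have hV3 : |extent (L.take (i + 1))| ≤ V := by rw [abs_le]; omega
      have hV4 : |(i : ℤ) + 1| ≤ V := by rw [abs_le]; omega
      refine Run.of_eval ?_ ?_
      · simp [copyTile, Cmd.safe, Cmd.eval, hi, hm1, hm2, hE, hEi, hV1, hV2, hV3, hV4]
      · refine ⟨n - 1, by omega, i + 1, by omega, ?_, ?_, ?_, ?_⟩
        · simp [copyTile, Cmd.eval, hi]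
        · simp [copyTile, Cmd.eval, hi, hm1, hm2, hE, hEi]
        · intro a ha
          simp only [copyTile, Cmd.eval, setR_mem, den_reg, hi, setA_reg]
          rw [setA_mem_of_nonneg _ _ _ (by omega) ha, setA_mem_of_nonneg _ _ _ (by omega) ha,
              hm a ha]
        · intro j u hj hu
          simp only [copyTile, Cmd.eval, setR_A, setA_A, den_reg, hi, setA_reg, den_load, den_mul,
            den_ofNat, den_add, Nat.cast_ofNat, Nat.cast_one, hm1, hm2]
          rcases Nat.lt_succ_iff_lt_or_eq.1 hj with h | rfl
          · obtain ⟨h3, h4⟩ := hXY j u h hu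
            have : (j : ℤ) ≠ i := by omega
            simp [this, h3, h4]
          · rw [ht, Option.some.injEq] at hu
            subst hu
            simp
    · rintro s ⟨he, hag, n, i, hn, hi, hE, hm, hXY⟩
      have hN : s.reg regN = L.length := by
        rw [hag.reg _ (by decide), g4.reg _ (by subst hini; decide)]; rfl
      have hge : L.length ≤ i := by
        by_contra hcon
        simp only [den_ltT, den_reg, hi, hN] at he
        rw [if_pos (by omega)] at he
        omega
      refine ⟨by rw [hE, List.take_of_length_le hge], fun j t ht => hXY j t ?_ ht,
        fun k h h' => by rw [hag.reg k h, g4.reg k h'], fun k h i => by rw [hag.arr k h, hA]⟩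
      have := (List.getElem?_eq_some_iff.1 ht).1
      omega
  have h3 : ∀ s, (s.reg regE = extent L ∧
      (∀ (i : ℕ) t, L[i]? = some t → s.A arrX i = t.1 ∧ s.A arrY i = t.2) ∧
      (∀ k, copyTile.wr k = false → ini.wr k = false → s.reg k = (input L).reg k) ∧
      ∀ k, copyTile.wa k = false → ∀ i, s.A k i = (input L).A k i) →
      Run V fin s fin.time fun s => Outer L (extent L) r 0 s ∧ s.reg regF = 0 := by
    rintro s ⟨g1, g2, g3, g4⟩
    have hS : s.reg regS = 0 := by rw [g3 _ (by decide) (by subst hini; decide)]; rfl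
    have hF : s.reg regF = 0 := by rw [g3 _ (by decide) (by subst hini; decide)]; rfl
    have hN : s.reg regN = L.length := by rw [g3 _ (by decide) (by subst hini; decide)]; rfl
    have e1 : extent L - (2 * extent L + 1) = - extent L - 1 := by ring
    have hVa : |2 * extent L + 1| ≤ V := by rw [abs_le]; omega
    have hVb : |-extent L - 1| ≤ V := by rw [abs_le]; omega
    have hV1 : (1 : ℤ) ≤ V := by omega
    have hz : ∀ k, copyTile.wa k = false → ∀ c, 0 ≤ c → s.A k c = 0 := fun k hk c hc => by
      rw [g4 k hk, input_A L k hc]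
    subst hfin
    refine Run.of_eval ?_ ?_
    · simp [Cmd.safe, Cmd.eval, g1, hVa, e1, hVb, hV1]
    · refine ⟨⟨?_, ?_, ?_, ?_, ?_, ?_, ?_, ?_, ⟨?_, ?_⟩, ?_, ⟨?_, ?_, ?_⟩⟩, ?_⟩
      · simp [Cmd.eval, hN]
      · simp [Cmd.eval, g1]
      · simp [Cmd.eval, g1]
      · simp [Cmd.eval, g1]; ring
      · simp [Cmd.eval, dir]
      · simp [Cmd.eval, dir]
      · exact fun i t ht => (g2 i t ht).1
      · exact fun i t ht => (g2 i t ht).2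
      · simp [Cmd.eval, hS]
      · intro i hi
        simp only [Cmd.eval, setR_A, setR_reg]
        rw [hz _ (by decide) i hi]
        simp [hS]
      · simp [Cmd.eval, hS]
      · intro c hc
        refine hz _ (by decide) c ?_
        simpa using hc
      · intro c hc
        refine hz _ (by decide) c ?_
        simpa using hc
      · intro c hc
        refine hz _ (by decide) c ?_
        simp at hc
        omega
      · simp [Cmd.eval, hF]
  rw [copyTiles, hini, hfin]
  refine (Run.seq (h1.mono le_rfl fun s hs => Run.seq ((h2 s hs).mono le_rfl h3))).mono ?_
    fun _ h => h
  nlinarith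

/-! ### The loop over the directions -/

/-- Search for a cut in all directions. -/
def orients : Cmd := .loop (1 - .reg regF) orient

/-- The loop tests only the flag. It stops after at most four directions, since four failures would
contradict `exists_not_noCut`. -/
theorem orients_spec : ∃ a : ℕ, ∀ {V : ℕ} {L : List (ℤ × ℤ)} {P : Finset (ℤ × ℤ)} {E : ℤ}
    {s₀ : Store}, L.Nodup → L.toFinset = P → Conn P → IsSimple P → ¬ IsConvex P → TwoCuttable P →
    2 ≤ P.card → 2 ≤ E → (∀ p ∈ P, |p.1| + 2 ≤ E ∧ |p.2| + 2 ≤ E) → (P.card : ℤ) < V →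
    4 * (2 * E + 1) * (2 * E + 1) ≤ V → 4 * (3 * (numReflex P * numReflex P : ℕ) + 1) ≤ (V : ℤ) →
    Outer L E (numReflex P) 0 s₀ → s₀.reg regF = 0 →
    Run V orients s₀ (a * (P.card * (numReflex P * numReflex P + 1))) (Found V P) := by
  obtain ⟨a, ha⟩ := orient_spec
  refine ⟨4 * (a + (1 - Term.reg regF).cost + 1) + ((1 - Term.reg regF).cost + 1), ?_⟩
  intro V L P E s₀ hnd hLP hP hs hnc htc hcard hE2 hb hN hKV hrV hO hF
  have h : Run V orients s₀ (4 * (a * (P.card * (numReflex P * numReflex P + 1)) +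
      (1 - Term.reg regF).cost + 1) + ((1 - Term.reg regF).cost + 1)) (Found V P) := by
    refine (Run.loop (I := fun n s => ∃ j : ℕ, n + j = 4 ∧ Outer L E (numReflex P) j s ∧
      ((s.reg regF = 0 ∧ ∀ i, 0 < i → i ≤ j → NoCut (timage (rot (isUnitVec_dir i)) P)) ∨
        (s.reg regF = 1 ∧ Found V P s))) ?_ 4 s₀ ⟨0, rfl, hO, .inl ⟨hF, by omega⟩⟩).mono le_rfl ?_
    · rintro n s ⟨j, hn, hOj, hor⟩ he
      rcases hor with ⟨hF0, hno⟩ | ⟨hF1, -⟩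
      swap
      · exact absurd (by simp [hF1]) he
      have hj : j < 4 := by
        by_contra hcon
        obtain ⟨p, q, hu, hnot⟩ := exists_not_noCut hP hs hnc htc
        have hd : ∃ i, 0 < i ∧ i ≤ 4 ∧ dir i = (p, q) := by
          rcases hu with ⟨rfl, rfl⟩ | ⟨rfl, rfl⟩ | ⟨rfl, rfl⟩ | ⟨rfl, rfl⟩
          · exact ⟨1, by decide, by decide, by decide⟩
          · exact ⟨2, by decide, by decide, by decide⟩
          · exact ⟨3, by decide, by decide, by decide⟩
          · exact ⟨4, by decide, by decide, by decide⟩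
        obtain ⟨i, h1, h2, h3⟩ := hd
        have h4 := hno i h1 (by omega)
        have h5 : (dir i).1 = p ∧ (dir i).2 = q := by rw [h3]; exact ⟨rfl, rfl⟩
        obtain ⟨rfl, rfl⟩ := h5
        exact hnot h4
      refine (ha hnd hLP hP hs hcard hE2 hb hN hKV hrV hj hOj hF0).mono le_rfl ?_
      rintro s' ⟨h1, h2⟩
      refine ⟨n - 1, by omega, j + 1, by omega, h1, h2.imp (fun h => ⟨h.1, fun i hi hij => ?_⟩) id⟩
      rcases Nat.lt_or_ge i (j + 1) with h' | h'
      · exact hno i hi (by omega)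
      · obtain rfl : i = j + 1 := by omega
        exact h.2
    · rintro s ⟨he, n, j, hn, hOj, ⟨hF0, -⟩ | ⟨-, h⟩⟩
      · simp [hF0] at he
      · exact h
  refine h.mono ?_ fun _ h => h
  have h3 : 1 ≤ P.card * (numReflex P * numReflex P + 1) := Nat.mul_pos (by omega) (by omega)
  nlinarith

end WordRAM


namespace WordRAM

open Polyomino

/-! ### The start of the curve -/

/-- Corners all of whose cells have a proper number. -/
def Geo.NearCorner (G : Geo) (c : ℤ × ℤ) : Prop :=
  -G.E < c.1 ∧ c.1 ≤ G.E ∧ -G.E < c.2 ∧ c.2 ≤ G.E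

theorem Geo.NearCorner.near {G : Geo} {c : ℤ × ℤ} (h : G.NearCorner c) : G.Near c :=
  ⟨h.1.le, h.2.1, h.2.2.1.le, h.2.2.2⟩

theorem Geo.NearCorner.cd_pos {G : Geo} {c : ℤ × ℤ} (h : G.NearCorner c) : 0 < G.cd c := by
  have := G.K_pos
  have := G.le
  obtain ⟨h1, h2, h3, h4⟩ := h
  unfold Geo.cd
  nlinarith

theorem Geo.NearCorner.abs_cd_le {G : Geo} {V : ℕ} (hG : G.top ≤ V) {c : ℤ × ℤ}
    (h : G.NearCorner c) : |G.cd c| ≤ V := by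
  rw [abs_of_pos h.cd_pos]
  have := G.cd_lt h.near
  omega

/-- Test for corners in the interior. -/
def interiorT (a : Term) : Term :=
  arr arrP a * arr arrP (a - .reg regK) * arr arrP (a - 1) * arr arrP (a - .reg regK - 1)

theorem interiorT_spec {G : Geo} {s : Store} (hT : G.Table s) (hK : s.reg regK = G.K) {a : Term}
    {c : ℤ × ℤ} (hc : G.NearCorner c) (ha : a.den s = G.cd c) :
    (interiorT a).den s = @ite ℤ (NonInterior G.P c) (Classical.dec _) 0 1 := by
  obtain ⟨x, y⟩ := c
  obtain ⟨h1, h2, h3, h4⟩ := hc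
  simp only at h1 h2 h3 h4
  rw [show (NonInterior G.P (x, y)) = _ from propext nonInterior_iff]
  simp only [interiorT, den_mul, den_arr, den_sub, den_reg, den_ofNat, ha, hK, Nat.cast_one]
  rw [hT.get (x := x) (y := y) (by simp only [Geo.Near]; omega) rfl,
    hT.get (x := x - 1) (y := y) (by simp only [Geo.Near]; omega) (by simp only [Geo.cd]; ring),
    hT.get (x := x) (y := y - 1) (by simp only [Geo.Near]; omega) (by simp only [Geo.cd]; ring),
    hT.get (x := x - 1) (y := y - 1) (by simp only [Geo.Near]; omega)
      (by simp only [Geo.cd]; ring)]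
  by_cases k1 : (x, y) ∈ G.P
  swap
  · simp [k1]
  by_cases k2 : (x - 1, y) ∈ G.P
  swap
  · simp [k2]
  by_cases k3 : (x, y - 1) ∈ G.P
  swap
  · simp [k3]
  by_cases k4 : (x - 1, y - 1) ∈ G.P <;> simp [k1, k2, k3, k4]

/-- Test of one side of a tile; the other cell is `v`, the ends of the side are `a` and `b`. -/
def side (v a b : Term) : Cmd :=
  .ite (arr arrP v * (1 - eqT (arr arrV v) (.reg regS)) * (1 - interiorT a))
    (.set regY a ;; .set regZ b) .skip

/-- Test of the sides of a tile. -/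
def startTile : Cmd :=
  .ite (eqT (arr arrV (.reg regU)) (.reg regS))
    (side (.reg regU + .reg regK) (.reg regU + .reg regK) (.reg regU + .reg regK + 1) ;;
      side (.reg regU - 1) (.reg regU) (.reg regU + .reg regK) ;;
      side (.reg regU + 1) (.reg regU + .reg regK + 1) (.reg regU + 1)) .skip ;;
  .set regI (.reg regI + 1)

/-- Search for the first side of the curve. -/
def findStart : Cmd :=
  (.set regI 0 ;; .set regY 0) ;;
  .loop (ltT (.reg regI) (.reg regN)) (.set regU (arr arrC (.reg regI)) ;; startTile)

/-- The registers `Y` and `Z` hold the first side of the curve. -/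
def Geo.Started (G : Geo) (L : Finset (ℤ × ℤ)) (s : Store) : Prop :=
  ∃ p u u', IsSide G.P L p u u' ∧ NonInterior G.P u ∧ s.reg regY = G.cd u ∧ s.reg regZ = G.cd u'

theorem nearCorner_of_mem {G : Geo} {t : ℤ × ℤ} (ht : t ∈ G.P) {dx dy : ℤ} (h1 : -1 ≤ dx)
    (h2 : dx ≤ 1) (h3 : -1 ≤ dy) (h4 : dy ≤ 1) : G.NearCorner (t.1 + dx, t.2 + dy) := by
  have := G.near_of_mem ht
  simp only [Geo.NearCorner]
  omega

/-- Everything that the search for the start uses. -/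
structure Geo.Marks (G : Geo) (L : Finset (ℤ × ℤ)) (s : Store) : Prop where
  table : G.Table s
  height : s.reg regK = G.K
  marks : ∀ p ∈ G.P, s.A arrV (G.cd p) = s.reg regS ↔ p ∈ L

/-- `regY = 0` encodes that no start has been found; near corners have positive numbers. The
condition on `b` allows any value of `regY`, because `b` is evaluated after that register has been
overwritten. -/
theorem side_spec {V : ℕ} {G : Geo} (hG : G.top ≤ V) {L : Finset (ℤ × ℤ)} {s : Store}
    (hM : G.Marks L s) {v a b : Term} {w t u u' : ℤ × ℤ} (hw : G.Near w) (hu : G.NearCorner u)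
    (hu' : G.NearCorner u') (hv : v.den s = G.cd w) (ha : a.den s = G.cd u)
    (hb : ∀ z, b.den (s.setR regY z) = G.cd u')
    (hside : w ∈ G.P → w ∉ L → IsSide G.P L t u u') (hs : s.reg regY = 0 ∨ G.Started L s) :
    Run V (side v a b) s (side v a b).time fun s' => (s'.reg regY = 0 ∨ G.Started L s') ∧
      (s.reg regY ≠ 0 → s'.reg regY ≠ 0) ∧
      (w ∈ G.P → w ∉ L → NonInterior G.P u → s'.reg regY ≠ 0) := by
  classical
  have hden : (arr arrP v * (1 - eqT (arr arrV v) (.reg regS)) * (1 - interiorT a) : Term).den s =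
      if w ∈ G.P ∧ w ∉ L ∧ NonInterior G.P u then 1 else 0 := by
    simp only [den_mul, den_sub, den_eqT, den_arr, den_reg, den_ofNat, hv, hM.table w hw,
      interiorT_spec hM.table hM.height hu ha]
    by_cases h1 : w ∈ G.P
    · have h4 := hM.marks w h1
      by_cases h2 : w ∈ L <;> by_cases h3 : NonInterior G.P u <;> simp [h1, h2, h3, h4]
    · simp [h1]
  by_cases h : w ∈ G.P ∧ w ∉ L ∧ NonInterior G.P u
  · rw [if_pos h] at hden
    refine Run.of_eval ?_ ?_
    · simp [side, Cmd.safe, Cmd.eval, hden, ha, hb, hu.abs_cd_le hG, hu'.abs_cd_le hG]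
    · have hY : ((side v a b).eval s).reg regY = G.cd u := by simp [side, Cmd.eval, hden, ha]
      have hZ : ((side v a b).eval s).reg regZ = G.cd u' := by simp [side, Cmd.eval, hden, hb]
      have h0 : ((side v a b).eval s).reg regY ≠ 0 := by rw [hY]; exact hu.cd_pos.ne'
      exact ⟨.inr ⟨t, u, u', hside h.1 h.2.1, h.2.2, hY, hZ⟩, fun _ => h0, fun _ _ _ => h0⟩
  · rw [if_neg h] at hden
    refine Run.of_eval ?_ ?_
    · simp [side, Cmd.safe, hden]
    · have : (side v a b).eval s = s := by simp [side, Cmd.eval, hden]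
      rw [this]
      exact ⟨hs, id, fun h1 h2 h3 => absurd ⟨h1, h2, h3⟩ h⟩

theorem startTile_spec {V : ℕ} {G : Geo} (hG : G.top ≤ V) {L : Finset (ℤ × ℤ)} {s : Store}
    (hM : G.Marks L s) {t : ℤ × ℤ} (ht : t ∈ G.P) (hU : s.reg regU = G.cd t)
    (hI : |s.reg regI + 1| ≤ V) (hs : s.reg regY = 0 ∨ G.Started L s) :
    Run V startTile s startTile.time fun s' => (s'.reg regY = 0 ∨ G.Started L s') ∧
      (s.reg regY ≠ 0 → s'.reg regY ≠ 0) ∧ s'.reg regI = s.reg regI + 1 ∧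
      ∀ u u', IsSide G.P L t u u' → NonInterior G.P u → s'.reg regY ≠ 0 := by
  have hn : ∀ {dx dy : ℤ}, -1 ≤ dx → dx ≤ 1 → -1 ≤ dy → dy ≤ 1 →
      G.NearCorner (t.1 + dx, t.2 + dy) := fun h1 h2 h3 h4 => nearCorner_of_mem ht h1 h2 h3 h4
  have n1 : G.NearCorner (t.1 + 1, t.2) := by
    simpa using hn (dx := 1) (dy := 0) (by decide) (by decide) (by decide) (by decide)
  have n2 : G.NearCorner (t.1 + 1, t.2 + 1) :=
    hn (dx := 1) (dy := 1) (by decide) (by decide) (by decide) (by decide)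
  have n3 : G.NearCorner (t.1, t.2 - 1) := by
    simpa [← sub_eq_add_neg] using hn (dx := 0) (dy := -1) (by decide) (by decide) (by decide)
        (by decide)
  have n4 : G.NearCorner (t.1, t.2 + 1) := by
    simpa using hn (dx := 0) (dy := 1) (by decide) (by decide) (by decide) (by decide)
  have n5 : G.NearCorner t := by
    simpa using hn (dx := 0) (dy := 0) (by decide) (by decide) (by decide) (by decide)
  have c1 : G.cd t + G.K = G.cd (t.1 + 1, t.2) := by simp only [Geo.cd]; ring
  have c2 : G.cd t + G.K + 1 = G.cd (t.1 + 1, t.2 + 1) := by simp only [Geo.cd]; ring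
  have c3 : G.cd t - 1 = G.cd (t.1, t.2 - 1) := by simp only [Geo.cd]; ring
  have c4 : G.cd t + 1 = G.cd (t.1, t.2 + 1) := by simp only [Geo.cd]; ring
  have hlast : ∀ s' : Store, s'.reg regI = s.reg regI → Run V (.set regI (.reg regI + 1)) s'
      (Cmd.time (.set regI (.reg regI + 1))) fun s'' => s'' = s'.setR regI (s.reg regI + 1) := by
    intro s' h
    refine Run.of_eval ?_ ?_
    · simpa [Cmd.safe, h] using hI
    · simp [Cmd.eval, h]
  have hset : ∀ s' : Store, ∀ z, G.Started L s' → G.Started L (s'.setR regI z) := by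
    rintro s' z ⟨p, u, u', h1, h2, h3, h4⟩
    exact ⟨p, u, u', h1, h2, by simpa using h3, by simpa using h4⟩
  rw [startTile]
  refine Run.seq (T₁ := (eqT (arr arrV (.reg regU)) (.reg regS)).cost + 1 + max _ _) ?_
  refine Run.ite (fun h => ?_) fun h => ?_
  · have htL : t ∈ L := by
      rw [← hM.marks t ht]
      by_contra h'
      exact h (by simp [hU, h'])
    refine Run.seq ((side_spec hG hM (w := (t.1 + 1, t.2)) (t := t) (u := (t.1 + 1, t.2))
      (u' := (t.1 + 1, t.2 + 1)) n1.near n1 n2 (by simp [hU, hM.height, c1])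
      (by simp [hU, hM.height, c1]) (by simp [hU, hM.height, c2])
      (fun h1 h2 => ⟨htL, .inl ⟨h1, h2, rfl, rfl⟩⟩) hs).frame.mono le_rfl ?_)
    rintro s1 ⟨⟨f1, f2, f3⟩, ag1⟩
    have hM1 : G.Marks L s1 := ⟨fun z hz => by rw [ag1.arr _ rfl]; exact hM.table z hz,
      by rw [ag1.reg _ rfl]; exact hM.height,
      fun p hp => by rw [ag1.arr _ rfl, ag1.reg _ rfl]; exact hM.marks p hp⟩
    have hU1 : s1.reg regU = G.cd t := by rw [ag1.reg _ rfl]; exact hU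
    refine Run.seq ((side_spec hG hM1 (w := (t.1, t.2 - 1)) (t := t) (u := t)
      (u' := (t.1 + 1, t.2)) n3.near n5 n1 (by simp [hU1, c3])
      (by simp [hU1]) (by simp [hU1, hM1.height, c1])
      (fun h1 h2 => ⟨htL, .inr (.inl ⟨h1, h2, rfl, rfl⟩)⟩) f1).frame.mono le_rfl ?_)
    rintro s2 ⟨⟨g1, g2, g3⟩, ag2⟩
    have hM2 : G.Marks L s2 := ⟨fun z hz => by rw [ag2.arr _ rfl]; exact hM1.table z hz,
      by rw [ag2.reg _ rfl]; exact hM1.height,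
      fun p hp => by rw [ag2.arr _ rfl, ag2.reg _ rfl]; exact hM1.marks p hp⟩
    have hU2 : s2.reg regU = G.cd t := by rw [ag2.reg _ rfl]; exact hU1
    refine (side_spec hG hM2 (w := (t.1, t.2 + 1)) (t := t) (u := (t.1 + 1, t.2 + 1))
      (u' := (t.1, t.2 + 1)) n4.near n2 n4 (by simp [hU2, c4])
      (by simp [hU2, hM2.height, c2]) (by simp [hU2, c4])
      (fun h1 h2 => ⟨htL, .inr (.inr ⟨h1, h2, rfl, rfl⟩)⟩) g1).frame.mono le_rfl ?_
    rintro s3 ⟨⟨k1, k2, k3⟩, ag3⟩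
    refine (hlast s3 (by rw [ag3.reg _ rfl, ag2.reg _ rfl, ag1.reg _ rfl])).mono le_rfl ?_
    rintro _ rfl
    refine ⟨k1.imp (fun h => by simpa using h) (hset _ _), fun h => by
      simpa using k2 (g2 (f2 h)), by simp, ?_⟩
    rintro u u' ⟨-, h⟩ hnon
    rcases h with ⟨h1, h2, rfl, rfl⟩ | ⟨h1, h2, rfl, rfl⟩ | ⟨h1, h2, rfl, rfl⟩
    · simpa using k2 (g2 (f3 h1 h2 hnon))
    · simpa using k2 (g3 h1 h2 hnon)
    · simpa using k3 h1 h2 hnon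
  · have htL : t ∉ L := by
      rw [← hM.marks t ht]
      intro h'
      simp [hU, h'] at h
    refine Run.of_eval (by simp [Cmd.safe]) ?_
    refine (hlast s rfl).mono le_rfl ?_
    rintro _ rfl
    refine ⟨hs.imp (fun h => by simpa using h) (hset _ _), fun h => by simpa using h, by simp, ?_⟩
    rintro u u' ⟨h, -⟩
    exact absurd h htL

/-- Some tile of `L` has a suitable side by `exists_first_side`. Later finds overwrite earlier ones,
which is harmless: any side that starts at a non-interior corner yields the cut. -/
theorem findStart_spec : ∃ a : ℕ, ∀ {V : ℕ} {G : Geo} {s₀ : Store} {ts : List (ℤ × ℤ)}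
    {L R : Finset (ℤ × ℤ)},
    G.top ≤ V → (G.P.card : ℤ) < V → 1 ≤ G.P.card → Conn G.P → G.Params s₀ →
    ts.length = G.P.card → (∀ t, t ∈ ts ↔ t ∈ G.P) →
    (∀ (i : ℕ) t, ts[i]? = some t → s₀.A arrC i = G.cd t) → G.Marks L s₀ → HCut G.P L R →
    Run V findStart s₀ (a * G.P.card) (G.Started L) := by
  generalize hini : (Cmd.set regI 0 ;; .set regY 0) = ini
  refine ⟨ini.time + (Cmd.time (.set regU (arr arrC (.reg regI))) + startTile.time +
    (ltT (.reg regI) (.reg regN)).cost + 1) + ((ltT (.reg regI) (.reg regN)).cost + 1), ?_⟩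
  intro V G s₀ ts L R hG hN hcard hP hpar hlen hts hC hM hLR
  have h1 : Run V ini s₀ ini.time fun s => (s.reg regI = 0 ∧ s.reg regY = 0) ∧
      Agree ini s₀ s := by
    refine Run.frame ?_
    subst hini
    refine Run.of_eval ?_ ?_
    · simp [Cmd.safe, Cmd.eval]
    · simp [Cmd.eval]
  have h2 : ∀ s, ((s.reg regI = 0 ∧ s.reg regY = 0) ∧ Agree ini s₀ s) →
      Run V (.loop (ltT (.reg regI) (.reg regN))
        (.set regU (arr arrC (.reg regI)) ;; startTile)) s
      (G.P.card * (Cmd.time (.set regU (arr arrC (.reg regI))) + startTile.time +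
      (ltT (.reg regI) (.reg regN)).cost + 1) + ((ltT (.reg regI) (.reg regN)).cost + 1))
      (G.Started L) := by
    rintro s1 ⟨⟨g1, g2⟩, g3⟩
    refine (Run.loopA (I := fun n s => ∃ i : ℕ, n + i = G.P.card ∧ s.reg regI = i ∧
      (s.reg regY = 0 ∨ G.Started L s) ∧ ∀ t ∈ ts.take i, ∀ u u', IsSide G.P L t u u' →
        NonInterior G.P u → s.reg regY ≠ 0) ?_ ?_).mono le_rfl ?_
    · exact ⟨0, by simp, by simpa using g1, .inl g2, by simp⟩
    · rintro n s ⟨i, hn, hi, hst, hall⟩ hag he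
      have hreg : ∀ k, (Cmd.set regU (arr arrC (.reg regI)) ;; startTile).wr k = false →
          ini.wr k = false → s.reg k = s₀.reg k := fun k h h' => by rw [hag.reg k h, g3.reg k h']
      have harr : ∀ k, (Cmd.set regU (arr arrC (.reg regI)) ;; startTile).wa k = false →
          ini.wa k = false → ∀ i, s.A k i = s₀.A k i := fun k h h' i => by
        rw [hag.arr k h, g3.arr k h']
      have hilt : i < G.P.card := by
        by_contra hcon
        apply he
        simp only [den_ltT, den_reg, hi, hreg 0 (by decide) (by subst hini; decide), hpar.card]
        rw [if_neg (by omega)]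
      obtain ⟨t, ht⟩ : ∃ t, ts[i]? = some t := ⟨_, List.getElem?_eq_getElem (by omega)⟩
      have htP : t ∈ G.P := (hts t).1 (List.mem_of_getElem? ht)
      have htake : ts.take (i + 1) = ts.take i ++ [t] := by
        rw [List.take_add_one, ht]; rfl
      have hCt : s.A arrC i = G.cd t := by
        rw [harr _ (by decide) (by subst hini; decide)]; exact hC i t ht
      have hU : Run V (.set regU (arr arrC (.reg regI))) s
          (Cmd.time (.set regU (arr arrC (.reg regI)))) fun s' => s' = s.setR regU (G.cd t) := by
        refine Run.of_eval ?_ ?_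
        · simp [Cmd.safe, hi, hCt, G.abs_cd_le hG htP]
        · simp [Cmd.eval, hi, hCt]
      refine Run.seq (hU.mono le_rfl ?_)
      rintro _ rfl
      have hM' : G.Marks L (s.setR regU (G.cd t)) := by
        refine ⟨fun z hz => ?_, ?_, fun p hp => ?_⟩
        · rw [setR_A, harr _ (by decide) (by subst hini; decide)]; exact hM.table z hz
        · rw [setR_reg, if_neg (by decide), hreg _ (by decide) (by subst hini; decide)]
          exact hM.height
        · rw [setR_A, setR_reg, if_neg (by decide), harr _ (by decide) (by subst hini; decide),
            hreg _ (by decide) (by subst hini; decide)]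
          exact hM.marks p hp
      have hV1 : |(i : ℤ) + 1| ≤ V := by rw [abs_le]; omega
      have hst' : (s.setR regU (G.cd t)).reg regY = 0 ∨ G.Started L (s.setR regU (G.cd t)) := by
        refine hst.imp (fun h => by simpa using h) ?_
        rintro ⟨p, u, u', h1, h2, h3, h4⟩
        exact ⟨p, u, u', h1, h2, by simpa using h3, by simpa using h4⟩
      refine (startTile_spec hG hM' htP (by simp) (by simpa [hi] using hV1) hst').mono le_rfl ?_
      rintro s' ⟨k1, k2, k3, k4⟩
      refine ⟨n - 1, by omega, i + 1, by omega, by simpa [hi] using k3, k1, ?_⟩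
      intro w hw u u' hs hnon
      rw [htake] at hw
      rcases List.mem_append.1 hw with h | h
      · exact k2 (by simpa using hall w h u u' hs hnon)
      · rw [List.mem_singleton.1 h] at hs
        exact k4 u u' hs hnon
    · rintro s ⟨he, hag, n, i, hn, hi, hst, hall⟩
      have hge : ts.length ≤ i := by
        by_contra hcon
        have : s.reg regN = G.P.card := by
          rw [hag.reg _ (by decide), g3.reg _ (by subst hini; decide)]; exact hpar.card
        simp only [den_ltT, den_reg, hi, this] at he
        rw [if_pos (by omega)] at he
        omega
      rw [List.take_of_length_le hge] at hall
      obtain ⟨θ, hθ⟩ := hLR.exists_threshold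
      obtain ⟨p, u, u', k1, k2⟩ := exists_first_side hLR hθ hP
      exact hst.resolve_left (hall p ((hts p).2 (hLR.left_subset k1.1)) u u' k1 k2)
  rw [findStart, hini]
  refine (Run.seq (h1.mono le_rfl h2)).mono ?_ fun _ h => h
  nlinarith

end WordRAM


namespace WordRAM

open Polyomino

/-! ### The curve -/

/-- Output of the corner in the register `r`, rotated back. -/
def emit (r : ℕ) : Cmd :=
  .set regA (.reg r / .reg regK - .reg regX) ;;
  .set regD (.reg r - .reg regK * (.reg r / .reg regK) - .reg regE) ;;
  .raw (2 * .reg regM)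
    (.reg regP * .reg regA + .reg regQ * .reg regD + (1 - .reg regP - .reg regQ) / 2) ;;
  .raw (2 * .reg regM + 1)
    (.reg regP * .reg regD - .reg regQ * .reg regA + (1 - .reg regP + .reg regQ) / 2) ;;
  .set regM (.reg regM + 1)

/-- One step along the curve. -/
def stepCorner : Cmd :=
  .ite (eqT (arr arrV (.reg regZ)) (.reg regS)) (.set regZ (.reg regZ + .reg regK))
    (.ite (eqT (arr arrV (.reg regZ - .reg regK)) (.reg regS)) (.set regZ (.reg regZ + 1))
      (.set regZ (.reg regZ - .reg regK)))

/-- Output of the first two corners of the curve. -/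
def firstCorners : Cmd := .set regM 0 ;; emit regY ;; emit regZ

/-- Output of the curve. -/
def traceCut : Cmd :=
  firstCorners ;; .loop (interiorT (.reg regZ)) (stepCorner ;; emit regZ)

/-- The parameters of the output. -/
structure Geo.Emits (G : Geo) (p q : ℤ) (s : Store) : Prop where
  height : s.reg regK = G.K
  offset : s.reg regX = G.X
  bd : s.reg regE = G.E
  dir_fst : s.reg regP = p
  dir_snd : s.reg regQ = q

/-- The store `s'` arises from `s` by writing the corner `z` as entry `m` of the output. -/
structure Emitted (m : ℕ) (z : ℤ × ℤ) (s s' : Store) : Prop where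
  count : s'.reg regM = m + 1
  fst : s'.mem (2 * m) = z.1
  snd : s'.mem (2 * m + 1) = z.2
  other : ∀ b : ℤ, b ≠ 2 * m → b ≠ 2 * m + 1 → s'.mem b = s.mem b

theorem Emitted.A {m : ℕ} {z : ℤ × ℤ} {s s' : Store} (h : Emitted m z s s') (k : Fin 32) {i : ℤ}
    (hi : 0 ≤ i) : s'.A k i = s.A k i :=
  h.other _ (by omega) (by omega)

/-- Quotient and remainder by `K` recover the corner, which is then rotated back. The output
overwrites the input from address `0` on and leaves the arrays alone. The register `r` is read again
after `regA` has changed, hence `r ≠ regA`. -/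
theorem emit_spec {V : ℕ} {G : Geo} {s : Store} {p q : ℤ} (hu : IsUnitVec p q) (hG : G.top ≤ V)
    (hs : G.Emits p q s) {c : ℤ × ℤ} (hc : G.NearCorner c) {r : ℕ} (hr : r ≠ regA)
    (hrc : s.reg r = G.cd c) {m : ℕ} (hm : s.reg regM = m) (hmV : (m : ℤ) + 1 ≤ V) :
    Run V (emit r) s (emit r).time (Emitted m ((crot hu).symm c) s) := by
  have hdiv := G.cd_div hc.near
  have hmod : G.cd c - G.K * (c.1 + G.X) - G.E = c.2 := by simp only [Geo.cd]; ring
  have hV : G.E + 1 ≤ V := by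
    have := G.two_le
    have := G.le
    have : G.E + 1 ≤ G.top := by
      unfold Geo.top Geo.K
      nlinarith
    omega
  obtain ⟨h1, h2, h3, h4⟩ := hc
  have b1 : |c.1| ≤ V := by rw [abs_le]; omega
  have b2 : |c.2| ≤ V := by rw [abs_le]; omega
  have b3 : |p * c.1 + q * c.2 + (1 - p - q) / 2| ≤ V := by
    rw [abs_le]
    rcases hu with ⟨rfl, rfl⟩ | ⟨rfl, rfl⟩ | ⟨rfl, rfl⟩ | ⟨rfl, rfl⟩ <;> omega
  have b4 : |p * c.2 - q * c.1 + (1 - p + q) / 2| ≤ V := by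
    rw [abs_le]
    rcases hu with ⟨rfl, rfl⟩ | ⟨rfl, rfl⟩ | ⟨rfl, rfl⟩ | ⟨rfl, rfl⟩ <;> omega
  have b5 : |(m : ℤ) + 1| ≤ V := by rw [abs_le]; omega
  have hset : ∀ (s : Store) (a z b : ℤ), (s.setM a z).mem b = if b = a then z else s.mem b := by
    intro s a z b
    simp [Store.setM, Function.update_apply]
  refine Run.of_eval ?_ ?_
  · simp [emit, Cmd.safe, Cmd.eval, hr, hrc, hs.height, hs.offset, hs.bd, hs.dir_fst, hs.dir_snd,
      hm, hdiv, hmod, b1, b2, b3, b4, b5]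
  · refine ⟨?_, ?_, ?_, fun b hb1 hb2 => ?_⟩
    · simp [emit, Cmd.eval, hm]
    · simp [emit, Cmd.eval, hr, hrc, hs.height, hs.offset, hs.bd, hs.dir_fst, hs.dir_snd, hm, hdiv,
        hmod, hset, crot_symm_apply]
    · simp [emit, Cmd.eval, hr, hrc, hs.height, hs.offset, hs.bd, hs.dir_fst, hs.dir_snd, hm, hdiv,
        hmod, hset, crot_symm_apply]
    · simp [emit, Cmd.eval, hm, hset, hb1, hb2]

theorem nearCorner_of_isStart {G : Geo} {θ : ℤ → ℤ} {c : ℤ × ℤ} (h : IsStart G.P θ c) :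
    G.NearCorner c ∧ G.NearCorner (next θ c) := by
  have := G.near_of_mem h.left_mem
  simp only [leftTile, next, Geo.NearCorner] at this ⊢
  split_ifs at this ⊢ <;> dsimp only at this ⊢ <;> omega

/-- At an interior corner `(x, y)` the tiles `(x, y)` and `(x - 1, y)` are in `P`, and their stamps
decide whether `x < θ y` and whether `θ y < x`. So the thresholds never have to be computed. -/
theorem stepCorner_spec {V : ℕ} {G : Geo} (hG : G.top ≤ V) {L : Finset (ℤ × ℤ)} {s : Store}
    (hM : G.Marks L s) {θ : ℤ → ℤ} (hθ : ∀ x y : ℤ, (x, y) ∈ G.P → ((x, y) ∈ L ↔ x < θ y))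
    {c : ℤ × ℤ} (hc : ¬ NonInterior G.P c) (hn : G.NearCorner (next θ c))
    (hZ : s.reg regZ = G.cd c) :
    Run V stepCorner s stepCorner.time fun s' => s' = s.setR regZ (G.cd (next θ c)) := by
  obtain ⟨x, y⟩ := c
  rw [nonInterior_iff] at hc
  push Not at hc
  have h1 := (hM.marks _ hc.1).trans (hθ _ _ hc.1)
  have h2 := (hM.marks _ hc.2.1).trans (hθ _ _ hc.2.1)
  rw [G.cd_left] at h2
  have hb := hn.abs_cd_le hG
  simp only [next] at hb ⊢
  by_cases k1 : x < θ y
  · rw [if_pos k1, G.cd_right] at hb ⊢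
    refine Run.of_eval ?_ ?_ <;>
      simp [stepCorner, Cmd.safe, Cmd.eval, hZ, h1.2 k1, hM.height, hb]
  · rw [if_neg k1] at hb ⊢
    have k1' := mt h1.1 k1
    by_cases k2 : θ y < x
    · have k2' := mt h2.1 (by omega)
      rw [if_pos k2, G.cd_left] at hb ⊢
      refine Run.of_eval ?_ ?_ <;>
        simp [stepCorner, Cmd.safe, Cmd.eval, hZ, k1', k2', hM.height, hb]
    · have k2' := h2.2 (by omega)
      rw [if_neg k2, G.cd_up] at hb ⊢
      refine Run.of_eval ?_ ?_ <;>
        simp [stepCorner, Cmd.safe, Cmd.eval, hZ, k1', k2', hM.height, hb]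

/-- The curve has been followed for `m` steps, and written to the memory. -/
structure Traced (G : Geo) (θ : ℤ → ℤ) (g : ℤ × ℤ → ℤ × ℤ) (c : ℤ × ℤ) (s₀ : Store) (m : ℕ)
    (s : Store) : Prop where
  pos : 0 < m
  interior : ∀ k, 0 < k → k < m → ¬ NonInterior G.P ((next θ)^[k] c)
  cur : s.reg regZ = G.cd ((next θ)^[m] c)
  count : s.reg regM = m + 1
  out : ∀ k ≤ m, s.mem (2 * k) = (g ((next θ)^[k] c)).1 ∧
    s.mem (2 * k + 1) = (g ((next θ)^[k] c)).2
  arr : ∀ k i, 0 ≤ i → s.A k i = s₀.A k i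

theorem Geo.Marks.congr {G : Geo} {L : Finset (ℤ × ℤ)} {s s' : Store} (h : G.Marks L s)
    (hA : ∀ k i, 0 ≤ i → s'.A k i = s.A k i) (hK : s'.reg regK = s.reg regK)
    (hS : s'.reg regS = s.reg regS) : G.Marks L s' := by
  have hpos : ∀ z, G.Near z → 0 ≤ G.cd z := by
    rintro z ⟨h1, h2, h3, h4⟩
    have := G.K_pos
    have := G.le
    unfold Geo.cd
    nlinarith
  refine ⟨fun z hz => ?_, hK.trans h.height, fun p hp => ?_⟩
  · rw [hA _ _ (hpos z hz)]
    exact h.table z hz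
  · rw [hA _ _ (hpos p (G.near hp)), hS]
    exact h.marks p hp

theorem Geo.Emits.congr {G : Geo} {p q : ℤ} {s s' : Store} (h : G.Emits p q s)
    (h' : ∀ r, r < 7 → s'.reg r = s.reg r) : G.Emits p q s' :=
  ⟨(h' _ (by decide)).trans h.height, (h' _ (by decide)).trans h.offset,
    (h' _ (by decide)).trans h.bd, (h' _ (by decide)).trans h.dir_fst,
    (h' _ (by decide)).trans h.dir_snd⟩

/-- Each interior corner is the lower left corner of a tile of `P`, and the curve visits no corner
twice. -/
theorem le_card_of_interior {P : Finset (ℤ × ℤ)} {θ : ℤ → ℤ} {c : ℤ × ℤ} {m : ℕ}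
    (h : ∀ k, 0 < k → k ≤ m → ¬ NonInterior P ((next θ)^[k] c)) : m ≤ P.card := by
  have hinj := iterate_next_injective θ c
  have hsub : (Finset.Icc 1 m).image (fun k => (next θ)^[k] c) ⊆ P := by
    intro z hz
    obtain ⟨k, hk, rfl⟩ := Finset.mem_image.1 hz
    rw [Finset.mem_Icc] at hk
    by_contra hcon
    exact h k hk.1 hk.2 ⟨_, hcon, .inl rfl, .inl rfl⟩
  have := Finset.card_le_card hsub
  rwa [Finset.card_image_of_injective _ hinj, Nat.card_Icc, Nat.add_sub_cancel] at this

theorem lt_seven_cases {C : ℕ → Prop} (h0 : C 0) (h1 : C 1) (h2 : C 2) (h3 : C 3) (h4 : C 4)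
    (h5 : C 5) (h6 : C 6) : ∀ r, r < 7 → C r := by
  intro r hr
  interval_cases r <;> assumption

/-- At the non-interior first corner, stamps need not determine the next step, so both ends of the
first side are taken from the search for the start. -/
theorem firstCorners_spec {V : ℕ} {G : Geo} {s₀ : Store} {θ : ℤ → ℤ} {c : ℤ × ℤ} {p q : ℤ}
    (hu : IsUnitVec p q) (hG : G.top ≤ V) (hs : G.Emits p q s₀) (hV : 2 ≤ V)
    (hst : IsStart G.P θ c) (hY : s₀.reg regY = G.cd c) (hZ : s₀.reg regZ = G.cd (next θ c)) :
    Run V firstCorners s₀ firstCorners.time (Traced G θ (crot hu).symm c s₀ 1) := by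
  obtain ⟨hn0, hn1⟩ := nearCorner_of_isStart hst
  have h1 : Run V (.set regM 0) s₀ (Cmd.time (.set regM 0)) fun s => s = s₀.setR regM 0 :=
    Run.of_eval (by simp [Cmd.safe]) (by simp [Cmd.eval])
  refine Run.seq (h1.mono le_rfl ?_)
  rintro _ rfl
  have hs1 : G.Emits p q (s₀.setR regM 0) := hs.congr fun r hr => by
    rw [setR_reg, if_neg (by omega)]
  refine Run.seq ((emit_spec hu hG hs1 hn0 (r := regY) (by decide) (by simpa using hY) (m := 0)
    (by simp) (by push_cast; omega)).frame.mono le_rfl ?_)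
  rintro s2 ⟨he2, ag2⟩
  have hs2 : G.Emits p q s2 := hs1.congr (lt_seven_cases (ag2.reg _ rfl) (ag2.reg _ rfl)
    (ag2.reg _ rfl) (ag2.reg _ rfl) (ag2.reg _ rfl) (ag2.reg _ rfl) (ag2.reg _ rfl))
  have hZ2 : s2.reg regZ = G.cd (next θ c) := by
    rw [ag2.reg _ rfl]; simpa using hZ
  refine (emit_spec hu hG hs2 hn1 (r := regZ) (by decide) hZ2 (m := 1)
    (by simpa using he2.count) (by push_cast; omega)).frame.mono le_rfl ?_
  rintro s3 ⟨he3, ag3⟩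
  refine ⟨by decide, fun k h1 h2 => by omega, ?_, he3.count, ?_, fun k i hi => ?_⟩
  · rw [ag3.reg _ rfl, hZ2]; rfl
  · intro k hk
    rcases Nat.le_one_iff_eq_zero_or_eq_one.1 hk with rfl | rfl
    · rw [he3.other _ (by omega) (by omega), he3.other _ (by omega) (by omega)]
      exact ⟨he2.fst, he2.snd⟩
    · exact ⟨he3.fst, he3.snd⟩
  · rw [he3.A k hi, he2.A k hi, setR_A]

/-- The loop stops at the first non-interior corner after the start, and `le_card_of_interior`
bounds the number of steps by `N + 1`. -/
theorem traceCut_spec : ∃ a : ℕ, ∀ {V : ℕ} {G : Geo} {s₀ : Store} {L : Finset (ℤ × ℤ)}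
    {θ : ℤ → ℤ} {c : ℤ × ℤ} {p q : ℤ} (hu : IsUnitVec p q),
    G.top ≤ V → (G.P.card : ℤ) + 2 ≤ V → 1 ≤ G.P.card → G.Emits p q s₀ → G.Marks L s₀ →
    (∀ x y : ℤ, (x, y) ∈ G.P → ((x, y) ∈ L ↔ x < θ y)) → IsStart G.P θ c →
    s₀.reg regY = G.cd c → s₀.reg regZ = G.cd (next θ c) →
    Run V traceCut s₀ (a * G.P.card) fun s => ∃ m, m ≤ G.P.card + 1 ∧
      Traced G θ (crot hu).symm c s₀ m s ∧ NonInterior G.P ((next θ)^[m] c) := by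
  refine ⟨firstCorners.time + ((stepCorner ;; emit regZ).time + (interiorT (.reg regZ)).cost + 1) +
    ((interiorT (.reg regZ)).cost + 1), ?_⟩
  intro V G s₀ L θ c p q hu hG hN hcard hs hM hθ hst hY hZ
  have h2 : ∀ s, Traced G θ (crot hu).symm c s₀ 1 s ∧ Agree firstCorners s₀ s →
      Run V (.loop (interiorT (.reg regZ)) (stepCorner ;; emit regZ)) s
      (G.P.card * ((stepCorner ;; emit regZ).time + (interiorT (.reg regZ)).cost + 1) +
        ((interiorT (.reg regZ)).cost + 1))
      fun s => ∃ m, m ≤ G.P.card + 1 ∧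
        Traced G θ (crot hu).symm c s₀ m s ∧ NonInterior G.P ((next θ)^[m] c) := by
    rintro s1 ⟨ht1, ag1⟩
    have hmarks : ∀ s m, Traced G θ (crot hu).symm c s₀ m s →
        Agree (stepCorner ;; emit regZ) s1 s → G.Marks L s := fun s m ht ag =>
      hM.congr ht.arr (by rw [ag.reg _ rfl, ag1.reg _ rfl]) (by rw [ag.reg _ rfl, ag1.reg _ rfl])
    have hnear : ∀ s m, Traced G θ (crot hu).symm c s₀ m s →
        G.NearCorner ((next θ)^[m] c) := by
      intro s m ht
      obtain ⟨m, rfl⟩ := Nat.exists_eq_succ_of_ne_zero ht.pos.ne'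
      rw [Function.iterate_succ_apply']
      exact (nearCorner_of_isStart (isStart_iterate hst ht.interior (Nat.lt_succ_self m))).2
    refine (Run.loopA (I := fun n s => ∃ m, n + m = G.P.card + 1 ∧
      Traced G θ (crot hu).symm c s₀ m s) ⟨1, rfl, ht1⟩ ?_).mono le_rfl ?_
    · rintro n s ⟨m, hn, ht⟩ hag he
      have hMs := hmarks s m ht hag
      have hint : ¬ NonInterior G.P ((next θ)^[m] c) := by
        intro hcon
        rw [interiorT_spec hMs.table hMs.height (hnear s m ht) (by simpa using ht.cur),
          if_pos hcon] at he
        exact he rfl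
      have hint' : ∀ k, 0 < k → k < m + 1 → ¬ NonInterior G.P ((next θ)^[k] c) := by
        intro k hk1 hk2
        rcases Nat.lt_succ_iff_lt_or_eq.1 hk2 with h | rfl
        · exact ht.interior k hk1 h
        · exact hint
      have hm : m ≤ G.P.card := le_card_of_interior (θ := θ) (c := c) fun k h1 h2 =>
        hint' k h1 (by omega)
      have hnext : G.NearCorner (next θ ((next θ)^[m] c)) :=
        (nearCorner_of_isStart (isStart_iterate hst hint' (Nat.lt_succ_self m))).2
      refine Run.seq ((stepCorner_spec hG hMs hθ hint hnext ht.cur).mono le_rfl ?_)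
      rintro _ rfl
      have hs' : G.Emits p q (s.setR regZ (G.cd (next θ ((next θ)^[m] c)))) := by
        refine hs.congr fun r hr => ?_
        rw [setR_reg, if_neg (by omega)]
        revert r
        apply lt_seven_cases <;> rw [hag.reg _ rfl, ag1.reg _ rfl]
      refine (emit_spec hu hG hs' hnext (r := regZ) (by decide) (by simp) (m := m + 1)
        (by simpa using ht.count) (by push_cast; omega)).frame.mono le_rfl ?_
      rintro s' ⟨he', ag'⟩
      refine ⟨n - 1, by omega, m + 1, by omega, by omega, hint', ?_, he'.count, ?_, ?_⟩
      · rw [ag'.reg _ rfl, Function.iterate_succ_apply']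
        simp
      · intro k hk
        rcases Nat.le_succ_iff.1 hk with hk | rfl
        · rw [he'.other _ (by omega) (by omega), he'.other _ (by omega) (by omega)]
          exact ht.out k hk
        · rw [Function.iterate_succ_apply']
          exact ⟨he'.fst, he'.snd⟩
      · intro k i hi
        rw [he'.A k hi, setR_A, ht.arr k i hi]
    · rintro s ⟨he, hag, n, m, hn, ht⟩
      have hMs := hmarks s m ht hag
      refine ⟨m, by omega, ht, ?_⟩
      by_contra hcon
      rw [interiorT_spec hMs.table hMs.height (hnear s m ht) (by simpa using ht.cur),
        if_neg hcon] at he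
      exact one_ne_zero he
  have h1 := (firstCorners_spec hu hG hs (by omega) hst hY hZ).frame
  refine (Run.seq (h1.mono le_rfl h2)).mono ?_ fun _ h => h
  nlinarith

/-! ### The program -/

/-- The algorithm. -/
def findCut : Cmd :=
  copyTiles ;; orients ;; findStart ;; traceCut ;; .set regN (.reg regM)

/-- Only the pair search needs the factor `r ^ 2 + 1`; copying the input, finding the start and
tracing the curve are linear. -/
theorem findCut_spec : ∃ a : ℕ, ∀ {V : ℕ} {L : List (ℤ × ℤ)} {P : Finset (ℤ × ℤ)},
    L.Nodup → L.toFinset = P → Conn P → IsSimple P → ¬ IsConvex P → TwoCuttable P →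
    2 ≤ P.card → (P.card : ℤ) + 2 ≤ V →
    4 * (2 * extent L + 1) * (2 * extent L + 1) ≤ V →
    4 * (3 * (numReflex P * numReflex P : ℕ) + 1) ≤ (V : ℤ) →
    Run V findCut (input L) (a * (P.card * (numReflex P * numReflex P + 1))) fun s =>
      ∃ c A B, Outputs s c ∧ IsValidTwoCut P c A B := by
  obtain ⟨a₁, ha₁⟩ := copyTiles_spec
  obtain ⟨a₂, ha₂⟩ := orients_spec
  obtain ⟨a₃, ha₃⟩ := findStart_spec
  obtain ⟨a₄, ha₄⟩ := traceCut_spec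
  refine ⟨a₁ + a₂ + a₃ + a₄ + Cmd.time (.set regN (.reg regM)), ?_⟩
  intro V L P hnd hLP hP hs hnc htc hcard hN hE hr
  have hlen : L.length = P.card := by rw [← hLP, List.toFinset_card_of_nodup hnd]
  have hE2 := two_le_extent L
  have hbd : ∀ p ∈ P, |p.1| + 2 ≤ extent L ∧ |p.2| + 2 ≤ extent L := fun p hp =>
    le_extent (List.mem_toFinset.1 (hLP ▸ hp))
  have h1 := ha₁ (V := V) (L := L) (r := numReflex P) (by omega) (by omega) (by nlinarith)
  rw [hlen] at h1
  have hrun : Run V findCut (input L) (a₁ * P.card +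
      (a₂ * (P.card * (numReflex P * numReflex P + 1)) + (a₃ * P.card + (a₄ * P.card +
      Cmd.time (.set regN (.reg regM)))))) fun s =>
      -- Register `1`, the base address of the output, is never written and starts at `0`; this is
      -- supplied at the end from the frame of the whole program.
      ∃ c A B, (s.reg 1 = 0 → Outputs s c) ∧ IsValidTwoCut P c A B := by
    refine Run.seq (h1.mono le_rfl ?_)
    rintro s1 ⟨hO, hF⟩
    refine Run.seq ((ha₂ hnd hLP hP hs hnc htc hcard hE2 hbd (by omega) hE hr hO hF).mono
      le_rfl ?_)
    rintro s2 ⟨p, q, hu, G, ts, hGP, hG, hp, hq, hpar, hT, hts, hmem, hC, K, R, hcut, hmarks⟩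
    have hcardG : G.P.card = P.card := by rw [hGP, card_timage]
    have hM : G.Marks K s2 := ⟨hT, hpar.height, hmarks⟩
    have hPG : Conn G.P := hGP ▸ (isSymmetry_rot hu).conn hP
    have h3 := (ha₃ hG (by omega) (by omega) hPG hpar hts hmem hC hM hcut).frame
    rw [hcardG] at h3
    refine Run.seq (h3.mono le_rfl ?_)
    rintro s3 ⟨⟨t, u, u', hside, hnon, hY, hZ⟩, ag⟩
    obtain ⟨θ, hθ⟩ := hcut.exists_threshold
    obtain ⟨hst, rfl⟩ := hside.isStart hcut hθ
    have hM3 : G.Marks K s3 := hM.congr (fun k i _ => ag.arr k rfl i) (ag.reg _ rfl) (ag.reg _ rfl)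
    have hs3 : G.Emits p q s3 := ⟨(ag.reg _ rfl).trans hpar.height,
      (ag.reg _ rfl).trans hpar.offset, (ag.reg _ rfl).trans hpar.bd, (ag.reg _ rfl).trans hp,
      (ag.reg _ rfl).trans hq⟩
    have h4 := ha₄ hu hG (by omega) (by omega) hs3 hM3 hθ hst hY hZ
    rw [hcardG] at h4
    refine Run.seq (h4.mono le_rfl ?_)
    rintro s4 ⟨m, hm, ht, hend⟩
    refine Run.of_eval ?_ ?_
    · simp only [Cmd.safe, den_reg, ht.count]
      rw [abs_le]
      omega
    · have hcut2 : IsTwoCut (timage (rot hu) P) (trace θ u m) K R :=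
        hGP ▸ isTwoCut_trace hcut hθ (hGP ▸ (isSymmetry_rot hu).isSimple hs) hst ht.pos hnon hend
          ht.interior
      refine ⟨(trace θ u m).map (crot hu).symm, _, _, fun h1 => ⟨?_, ?_⟩,
        isValidTwoCut_of_rot hu hcut2 (pullApart_of_hcut hcut)⟩
      · simp [Cmd.eval, ht.count, trace]
      · intro i z hz
        rw [List.getElem?_map, trace_getElem?] at hz
        split_ifs at hz with hi
        · simp only [Option.map_some, Option.some.injEq] at hz
          rw [h1, ← hz]
          simpa [Cmd.eval] using ht.out i (by omega)
        · simp at hz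
  refine hrun.frame.mono ?_ ?_
  · have : 1 ≤ P.card := by omega
    have hx : P.card ≤ P.card * (numReflex P * numReflex P + 1) := Nat.le_mul_of_pos_right _
        (by omega)
    nlinarith [Nat.mul_le_mul_left a₁ hx, Nat.mul_le_mul_left a₃ hx, Nat.mul_le_mul_left a₄ hx,
      Nat.mul_le_mul_left (Cmd.time (.set regN (.reg regM))) (this.trans hx)]
  · rintro s ⟨⟨c, A, B, hc, h⟩, ag⟩
    exact ⟨c, A, B, hc ((ag.reg 1 (by decide)).trans rfl), h⟩

end WordRAM


/-! ### The word size and the conclusion. -/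

namespace WordRAM

open Polyomino

theorem input_bounded {L : List (ℤ × ℤ)} {M V : ℕ} (hL : ∀ p ∈ L, |p.1| ≤ (M : ℤ) ∧ |p.2| ≤ (M : ℤ))
    (hN : L.length ≤ V) (hM : M ≤ V) : (input L).Bounded V := by
  have hMV : (M : ℤ) ≤ V := by exact_mod_cast hM
  constructor
  · intro i
    simp only [input]
    split_ifs
    · rw [abs_of_nonneg (by omega)]; exact_mod_cast hN
    · simp
  · intro b
    simp only [input]
    split_ifs with h0 h1
    rotate_right
    · rw [abs_zero]; omega
    all_goals
      rcases lt_or_ge (b.toNat / 2) L.length with h | h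
      · rw [List.getD_eq_getElem _ _ h]
        have := hL _ (List.getElem_mem h)
        omega
      · rw [List.getD_eq_default _ _ h]
        simp

/-- `200` bounds the size of every expression in the program, and thereby the exponent by which
values may grow within an expression. -/
theorem findCut_ok : findCut.ok 200 := by decide

theorem two_le_card {P : Finset (ℤ × ℤ)} (h : 1 ≤ numReflex P) : 2 ≤ P.card := by
  classical
  obtain ⟨t, ht⟩ := Finset.card_pos.1 (Nat.lt_of_lt_of_le Nat.zero_lt_one h)
  obtain ⟨h1, dx, dy, hx, -, h2, -⟩ := (Finset.mem_filter.1 ht).2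
  refine Finset.one_lt_card.2 ⟨t, h1, _, h2, fun h => ?_⟩
  have := congrArg Prod.fst h
  dsimp only at this
  omega

theorem one_le_of_bound {P : Finset (ℤ × ℤ)} {M : ℕ} (hP : 2 ≤ P.card)
    (hM : ∀ p ∈ P, |p.1| ≤ (M : ℤ) ∧ |p.2| ≤ (M : ℤ)) : 1 ≤ M := by
  obtain ⟨a, ha, b, hb, hab⟩ := Finset.one_lt_card.1 hP
  by_contra h0
  obtain rfl : M = 0 := by omega
  have h1 := hM a ha
  have h2 := hM b hb
  simp only [Nat.cast_zero, abs_nonpos_iff] at h1 h2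
  exact hab (Prod.ext (h1.1.trans h2.1.symm) (h1.2.trans h2.2.symm))

/-- With `B = N + M ≥ 3`, the extent is of order `B ^ 3`, so `2 * E + 1 ≤ B ^ 5`; its square times
`4` stays below `B ^ 12`, as `4 ≤ B ^ 2`. -/
theorem word_bounds {N M r : ℕ} {E : ℤ} (hN : 2 ≤ N) (hM : 1 ≤ M) (hr : r ≤ N) (hE0 : 0 ≤ E)
    (hE : E ≤ 2 + N * (2 * (M * M))) : 64 ≤ (N + M) ^ 12 ∧ N + 2 ≤ (N + M) ^ 12 ∧
    4 * (2 * E + 1) * (2 * E + 1) ≤ ((N + M) ^ 12 : ℕ) ∧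
    4 * (3 * (r * r) + 1) ≤ (N + M) ^ 12 := by
  obtain ⟨B, hB⟩ : ∃ B, N + M = B := ⟨_, rfl⟩
  rw [hB]
  have h3 : 3 ≤ B := by omega
  have p1 : B ≤ B ^ 12 := Nat.le_self_pow (by decide) _
  have p4 : 3 ^ 4 ≤ B ^ 4 := Nat.pow_le_pow_left h3 4
  have p12 : B ^ 4 ≤ B ^ 12 := Nat.pow_le_pow_right (by omega) (by decide)
  have q2 : 3 * 3 ≤ B * B := Nat.mul_le_mul h3 h3
  have q4 : B ^ 4 = B * B * (B * B) := by ring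
  have hNM : N * (M * M) ≤ B ^ 3 :=
    (Nat.mul_le_mul (by omega : N ≤ B) (Nat.mul_le_mul (by omega : M ≤ B) (by omega : M ≤ B))).trans
      (by rw [pow_succ, pow_two, mul_assoc])
  refine ⟨by omega, ?_, ?_, ?_⟩
  · have : N + 2 ≤ B ^ 4 := by rw [q4]; nlinarith
    omega
  · have h5 : 2 * E + 1 ≤ (B : ℤ) ^ 5 := by
      have e1 : (N : ℤ) * (M * M) ≤ (B : ℤ) ^ 3 := by exact_mod_cast hNM
      have e2 : (9 : ℤ) ≤ (B : ℤ) * B := by exact_mod_cast q2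
      have e3 : (27 : ℤ) ≤ (B : ℤ) ^ 3 := by
        have := Nat.pow_le_pow_left h3 3
        exact_mod_cast this
      have e4 : (B : ℤ) ^ 5 = B * B * B ^ 3 := by ring
      nlinarith
    have h6 : (2 * E + 1) * (2 * E + 1) ≤ (B : ℤ) ^ 5 * (B : ℤ) ^ 5 :=
      mul_le_mul h5 h5 (by omega) (by positivity)
    have e2 : (9 : ℤ) ≤ (B : ℤ) * B := by exact_mod_cast q2
    have e5 : ((B ^ 12 : ℕ) : ℤ) = B * B * ((B : ℤ) ^ 5 * (B : ℤ) ^ 5) := by push_cast; ring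
    have e6 : (0 : ℤ) ≤ (B : ℤ) ^ 5 * (B : ℤ) ^ 5 := by positivity
    rw [e5]
    nlinarith
  · have h7 : r * r ≤ B * B := Nat.mul_le_mul (by omega) (by omega)
    have e1 : (B ^ 12) = B ^ 4 * B ^ 4 * (B ^ 4) := by ring
    have : 81 * B ^ 4 ≤ B ^ 12 := by
      rw [e1]
      have : 81 * 1 ≤ B ^ 4 * B ^ 4 := Nat.mul_le_mul p4 (Nat.one_le_pow _ _ (by omega))
      exact Nat.mul_le_mul_right _ this
    nlinarith

end WordRAM

theorem mainTheorem7 :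
    ∃ (prog : WordRAM.Prog) (k : ℕ) (C : ℝ),
      ∀ (P : Finset (ℤ × ℤ)) (L : List (ℤ × ℤ)) (M : ℕ),
        Polyomino.IsPolyomino P → Polyomino.IsSimple P → ¬ Polyomino.IsConvex P →
        Polyomino.TwoCuttable P →
        L.Nodup → L.toFinset = P → (∀ p ∈ P, |p.1| ≤ (M : ℤ) ∧ |p.2| ≤ (M : ℤ)) →
        ∃ (t : ℕ) (s : WordRAM.Store) (c : List (ℤ × ℤ)) (A B : Finset (ℤ × ℤ)),
          WordRAM.Exec ((P.card + M) ^ k) prog (WordRAM.input L) t s ∧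
          WordRAM.Outputs s c ∧
          Polyomino.IsValidTwoCut P c A B ∧
          (t : ℝ) ≤ C * (Polyomino.numReflex P : ℝ) ^ 2 * (P.card : ℝ) *
            Real.log (P.card : ℝ) := by
  classical
  obtain ⟨a, ha⟩ := WordRAM.findCut_spec
  -- Stored values are at most `(N + M) ^ 12`, and expressions of size at most `200` raise this to
  -- the power `200`. The factor `2` absorbs `r ^ 2 + 1 ≤ 2 * r ^ 2`, and `log 2` comes from `log N
  -- ≥ log 2`.
  refine ⟨WordRAM.findCut.prog, 12 * 200, 2 * a / Real.log 2, ?_⟩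
  intro P L M hpoly hs hnc htc hnd hLP hM
  have hP := (Polyomino.isPolyomino_iff.1 hpoly).2
  have hr := Polyomino.one_le_numReflex hP hnc
  have hcard := WordRAM.two_le_card hr
  have hM1 := WordRAM.one_le_of_bound hcard hM
  have hlen : L.length = P.card := by rw [← hLP, List.toFinset_card_of_nodup hnd]
  have hML : ∀ p ∈ L, |p.1| ≤ (M : ℤ) ∧ |p.2| ≤ (M : ℤ) := fun p hp =>
    hM p (hLP ▸ List.mem_toFinset.2 hp)
  have hE := WordRAM.extent_le hML
  rw [hlen] at hE
  have hrN : Polyomino.numReflex P ≤ P.card := Finset.card_filter_le _ _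
  have hE2 := WordRAM.two_le_extent L
  obtain ⟨v1, v2, v3, v4⟩ := WordRAM.word_bounds hcard hM1 hrN (by omega) hE
  obtain ⟨t, s, h1, h2, c, A, B, h3, h4⟩ := ha hnd hLP hP hs hnc htc hcard (by exact_mod_cast v2)
    v3 (by exact_mod_cast v4)
  have hMV : P.card + M ≤ (P.card + M) ^ 12 := Nat.le_self_pow (by decide) _
  refine ⟨t, s, c, A, B, (h1.exec v1 (by rw [← pow_mul]) WordRAM.findCut_ok
    (WordRAM.input_bounded hML (by omega) (by omega))).1, h3, h4, ?_⟩
  have hlog2 : 0 < Real.log 2 := Real.log_pos (by norm_num)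
  have hlog : 1 ≤ Real.log P.card / Real.log 2 := by
    rw [one_le_div hlog2]
    exact Real.log_le_log (by norm_num) (by exact_mod_cast hcard)
  have hT : t ≤ 2 * a * Polyomino.numReflex P ^ 2 * P.card := by
    refine h2.trans ?_
    have : Polyomino.numReflex P * Polyomino.numReflex P + 1 ≤ 2 * Polyomino.numReflex P ^ 2 := by
      nlinarith
    calc a * (P.card * (Polyomino.numReflex P * Polyomino.numReflex P + 1))
        ≤ a * (P.card * (2 * Polyomino.numReflex P ^ 2)) :=
          Nat.mul_le_mul_left _ (Nat.mul_le_mul_left _ this)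
      _ = _ := by ring
  have hT' : (t : ℝ) ≤ 2 * a * (Polyomino.numReflex P : ℝ) ^ 2 * P.card := by exact_mod_cast hT
  calc (t : ℝ) ≤ 2 * a * (Polyomino.numReflex P : ℝ) ^ 2 * P.card := hT'
    _ ≤ 2 * a * (Polyomino.numReflex P : ℝ) ^ 2 * P.card * (Real.log P.card / Real.log 2) :=
        le_mul_of_one_le_right (by positivity) hlog
    _ = _ := by ring
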